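/- **Conventions.** A seed (of geometric type) in a field $K$ consists of a quiver with mutable and frozen vertices (arrows between frozen vertices are ignored), encoded by a skew-symmetric integer matrix $(b_{vw})$, and an element $x_v\in K$ for each vertex $v$. Mutation at a mutable vertex $k$ is given by $x_kx_k'=\prod_{b_{kv}>0}x_v^{b_{kv}}+\prod_{b_{kv}<0}x_v^{-b_{kv}}$ and the usual matrix mutation. For $R\in\{\mathbb Z,\mathbb C\}$ the upper cluster algebra $\overline{\mathcal A}_R(\Sigma)\subset K$ is the intersection, over all seeds mutation equivalent to $\Sigma$, of the rings of Laurent polynomials in the mutable variables over the polynomial ring over $R$ in the frozen variables (frozen variables are not inverted). Let $1\le\alpha<\beta\le n-1$. For an $n\times n$ matrix $X$ put $f_{ij}=\det M_{ij}(X)$, where $M_{ij}(X)$ is the maximal contiguous square submatrix with upper left entry $x_{ij}$. Define $\varphi_{ij}(X)=f_{ij}(X)$ unless $i=n+j-\alpha$ or $j=n+i-\beta$. If $i=n+j-\alpha$ (so $1\le j\le\alpha$), $\varphi_{ij}$ is the determinant of the matrix glued from $A=X_{[i,n]}^{[j,\alpha+1]}$ and $B=X_{[1,n-\beta]}^{[\beta,n]}$: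 the rows of $B$ are placed below those of $A$, the columns $\beta,\beta+1$ of $B$ being in the same columns as $\alpha,\alpha+1$ of $A$, and all other entries are $0$. If $j=n+i-\beta$ (so $1\le i\le\beta$), $\varphi_{ij}$ is the determinant of the matrix glued from $A=X_{[i,\beta+1]}^{[j,n]}$ and $B=X_{[\alpha,n]}^{[1,n-\alpha]}$: the columns of $B$ are placed to the right of those of $A$, the rows $\alpha,\alpha+1$ of $B$ being in the same rows as $\beta,\beta+1$ of $A$, and all other entries are $0$. There are two exceptions, in which the gluing continues with a third block by the other rule. If $n=2\beta$, the matrices with $i=n+j-\alpha$ are glued from $X_{[i,n]}^{[j,\alpha+1]}$, $X_{[1,\beta+1]}^{[\beta,n]}$, $X_{[\alpha,n]}^{[1,n-\alpha]}$; if $n=2\alpha$, the matrices with $j=n+i-\beta$ are glued from $X_{[i,\beta+1]}^{[j,n]}$, $X_{[\alpha,n]}^{[1,\alpha+1]}$, $X_{[1,n-\beta]}^{[\beta,n]}$. Let $\Sigma_{\alpha\beta}(X)$ be the following seed on the vertex set $[n]\times[n]$, with variable $\varphi_{ij}(X)$ at $(i,j)$. The frozen vertices are those in the first row or column, except $(\alpha+1,1)$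 and $(1,\beta+1)$. There are arrows $(i,j)\to(i+1,j)$, $(i,j)\to(i,j+1)$, $(i,j)\to(i-1,j-1)$ whenever both ends are in the grid and not both are in the first row or column, and the additional arrows $(\alpha,1)\to(\alpha+1,1)$, $(1,\beta)\to(1,\beta+1)$, $(n,\alpha+1)\to(1,\beta+1)\to(n,\alpha)$, $(\beta+1,n)\to(\alpha+1,1)\to(\beta,n)$. The initial seed $\Sigma_{\alpha\beta}(n)$ on $SL_n$ has quiver $Q_{\alpha\beta}(n)$ and variables in $\mathbb C(SL_n)$; it is $\Sigma_{\alpha\beta}(X)$, for $X$ the matrix of coordinate functions of $SL_n$, with the vertex $(1,1)$ left out because $\varphi_{11}=\det X=1$. **The sequence $S=S_v\circ S_h$.** Every vertex stands on a position of the grid, at first on its own. For given $(r,c)$, a path of positions starts at a given position and runs up to the first position that is frozen in the above sense; the successor of $(i,j)$ is $(i-1,j-1)$, except that the successor of $(\alpha+1,1)$ is $(\beta,c)$ and that of $(1,\beta+1)$ is $(r,\alpha)$. Processing a path means: mutate, in the order of the path, at the vertices that stand on it, except at the last one; then shift every vertex on the path to the position of its successor (the vertex on the last position is dropped). $S_h$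 is the sequence of mutations obtained by processing, with $(r,c)=(n,n)$, the paths that start at $(n,n),(n,n-1),\dots,(n,2)$, in this order. $S_v$ is obtained by then processing, with $(r,c)=(n-1,n-1)$, the paths that start at $(n-1,n),(n-2,n),\dots,(2,n)$. **Proposition.** Let $1\le\alpha<\beta\le n-1$ and $\beta\ne n-1$. 1. All mutations of $S$ are at mutable vertices of $\Sigma_{\alpha\beta}(n)$. After applying $S$ to $\Sigma_{\alpha\beta}(n)$, freezing suitable mutable vertices and removing all isolated vertices, one obtains a seed that is isomorphic to $\Sigma_{\alpha\beta}(X')$, where $X'=X_{[1,n-1]}^{[1,n-1]}$: its vertices can be arranged on the $(n-1)\times(n-1)$ grid so that frozen vertices and arrows (other than those between frozen vertices) are those of $\Sigma_{\alpha\beta}(X')$ and the vertex $(i,j)$ carries the function $\varphi_{ij}$ of size $n-1$, evaluated at $X'$. In particular the vertices other than $(1,1)$ form a subquiver isomorphic to $Q_{\alpha\beta}(n-1)$. 2. Let $Y$ be the matrix of coordinate functions on $\mathrm{Mat}_{n-1}$. There is an embedding of fields $\theta:\mathbb C(\mathrm{Mat}_{n-1})\to\mathbb C(SL_n)$ over $\mathbb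 C$ with $\theta(y_{ij})=x_{ij}$ for $i,j\le n-1$, and $\theta\big(\overline{\mathcal A}_R(\Sigma_{\alpha\beta}(Y))\big)\subseteq\overline{\mathcal A}_R(\Sigma_{\alpha\beta}(n))$ for $R=\mathbb C$ and $R=\mathbb Z$. Likewise, with $Z$ the matrix of coordinate functions on $\mathrm{Mat}_n$, the embedding $\mathbb C(\mathrm{Mat}_{n-1})\to\mathbb C(\mathrm{Mat}_n)$, $y_{ij}\mapsto z_{ij}$, maps $\overline{\mathcal A}_R(\Sigma_{\alpha\beta}(Y))$ into $\overline{\mathcal A}_R(\Sigma_{\alpha\beta}(Z))$. -/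

import Mathlib

namespace ExoticCluster

/-! ## Seeds of geometric type, mutation, upper cluster algebras -/

/-- A seed of geometric type in the field `K`, with vertices taken from `V`: the finite set
`verts` of vertices of the quiver, the set `frozen` of frozen ones among them, the extended cluster
`var`, and the skew-symmetric integer matrix `b`, where `b v w > 0` means that there are `b v w`
arrows `v → w`. Arrows between two frozen vertices are irrelevant. The values of `var` and `b`
outside `verts` carry no information. -/
structure Seed (V K : Type*) where
  verts : Finset V
  frozen : Finset V
  var : V → K
  b : V → V → ℤ

namespace Seed

variable {V W K : Type*} [DecidableEq V] [DecidableEq W] [Field K]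

/-- The mutable vertices. -/
def exchangeable (s : Seed V K) : Finset V := s.verts \ s.frozen

/-- Seed mutation in direction `k`: exchange relation and matrix mutation. -/
def mutate (s : Seed V K) (k : V) : Seed V K where
  verts := s.verts
  frozen := s.frozen
  var := Function.update s.var k
    ((∏ v ∈ s.verts, s.var v ^ (s.b k v).toNat + ∏ v ∈ s.verts, s.var v ^ (-s.b k v).toNat)
      / s.var k)
  b := fun i j =>
    if i = k ∨ j = k then -s.b i j
    else s.b i j + (|s.b i k| * s.b k j + s.b i k * |s.b k j|) / 2

/-- Mutation along a list of vertices, the head of the list first. -/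
def mutateList (s : Seed V K) (l : List V) : Seed V K := l.foldl mutate s

/-- Seeds that are obtained from `s` by finitely many mutations at mutable vertices. -/
inductive MutEquiv (s : Seed V K) : Seed V K → Prop
  | refl : MutEquiv s s
  | step (t : Seed V K) (k : V) (ht : MutEquiv s t) (hk : k ∈ t.exchangeable) :
      MutEquiv s (t.mutate k)

/-- The ring of Laurent polynomials in the cluster variables of a seed over the ring of polynomials
(with coefficients in `R`) in its stable variables, as a subalgebra of `K`. -/
def laurent (R : Type*) [CommRing R] [Algebra R K] (s : Seed V K) : Subalgebra R K :=
  Algebra.adjoin R (s.var '' s.verts ∪ (fun v => (s.var v)⁻¹) '' s.exchangeable)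

/-- The upper cluster algebra with coefficients in `R`: the intersection of the rings of Laurent
polynomials over all mutation equivalent seeds. -/
def upper (R : Type*) [CommRing R] [Algebra R K] (s : Seed V K) : Subalgebra R K :=
  ⨅ (t : Seed V K) (_ : MutEquiv s t), t.laurent R

/-- Remove one vertex from the seed. -/
def remove (s : Seed V K) (v : V) : Seed V K where
  verts := s.verts.erase v
  frozen := s.frozen.erase v
  var := s.var
  b := s.b

/-- Freeze the vertices of `F`. -/
def freeze (s : Seed V K) (F : Finset V) : Seed V K where
  verts := s.verts
  frozen := s.frozen ∪ F
  var := s.var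
  b := s.b

/-- Remove all isolated vertices; arrows between two frozen vertices are ignored. -/
def removeIsolated (s : Seed V K) : Seed V K where
  verts := s.verts.filter fun v =>
    ∃ w ∈ s.verts, s.b v w ≠ 0 ∧ ¬(v ∈ s.frozen ∧ w ∈ s.frozen)
  frozen := s.frozen.filter fun v =>
    ∃ w ∈ s.verts, s.b v w ≠ 0 ∧ ¬(v ∈ s.frozen ∧ w ∈ s.frozen)
  var := s.var
  b := s.b

/-- `ι` is an isomorphism from the seed `t` to the seed `s`: a bijection of the vertices that
respects frozen vertices, the variables, and the arrows (those between two frozen vertices being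
ignored). -/
structure IsIso (ι : W → V) (t : Seed W K) (s : Seed V K) : Prop where
  bij : Set.BijOn ι t.verts s.verts
  frozen_iff : ∀ v ∈ t.verts, ι v ∈ s.frozen ↔ v ∈ t.frozen
  var_eq : ∀ v ∈ t.verts, s.var (ι v) = t.var v
  b_eq : ∀ v ∈ t.verts, ∀ w ∈ t.verts, ¬(v ∈ t.frozen ∧ w ∈ t.frozen) →
    s.b (ι v) (ι w) = t.b v w

end Seed

/-! ## The functions `φ_ij` -/

section Functions

variable {K : Type*} [Field K] {n : ℕ}

/-- The entry `x_ij` of `X`, rows and columns numbered from `1`. -/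
def entry (X : Matrix (Fin n) (Fin n) K) (i j : ℕ) : K :=
  if h : (1 ≤ i ∧ i ≤ n) ∧ (1 ≤ j ∧ j ≤ n) then
    X ⟨i - 1, by omega⟩ ⟨j - 1, by omega⟩
  else 0

/-- The `N × N` matrix whose only nonzero part is the block `X_{[i₁, i₂]}^{[j₁, j₂]}`
(rows `i₁, …, i₂` and columns `j₁, …, j₂` of `X`), which is placed below the first `r₀` rows and to
the right of the first `c₀` columns. -/
def block (N : ℕ) (X : Matrix (Fin n) (Fin n) K) (i₁ i₂ j₁ j₂ r₀ c₀ : ℕ) :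
    Matrix (Fin N) (Fin N) K :=
  Matrix.of fun r c =>
    if (r₀ ≤ (r : ℕ) ∧ i₁ + (r - r₀) ≤ i₂) ∧ (c₀ ≤ (c : ℕ) ∧ j₁ + (c - c₀) ≤ j₂) then
      entry X (i₁ + (r - r₀)) (j₁ + (c - c₀))
    else 0

/-- The function `f_ij`: the determinant of the maximal contiguous square submatrix of `X` with
upper left corner `x_ij`. -/
def f (X : Matrix (Fin n) (Fin n) K) (i j : ℕ) : K :=
  (block (n + 1 - max i j) X i n j n 0 0).det

/-- The function attached to `(i, j)` with `i = n + j - α`. In general the matrix is glued from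
`X_{[i,n]}^{[j,α+1]}` and `X_{[1,n-β]}^{[β,n]}`. If `n = 2β`, then the diagonal of `X` on which
the second block starts ends at `x_{βn}`, and the gluing continues with a third block. -/
def fCol (α β : ℕ) (X : Matrix (Fin n) (Fin n) K) (i j : ℕ) : K :=
  if n = 2 * β then
    let N := (n - i + 1) + (n - β) + (n - α)
    (block N X i n j (α + 1) 0 0 + block N X 1 (β + 1) β n (n - i + 1) (n - i)
      + block N X α n 1 (n - α) (n - i + β) ((n - i + 1) + (n - β))).det
  else
    let N := (n - i + 1) + (n - β)
    (block N X i n j (α + 1) 0 0 + block N X 1 (n - β) β n (n - i + 1) (n - i)).det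

/-- The function attached to `(i, j)` with `j = n + i - β`. In general the matrix is glued from
`X_{[i,β+1]}^{[j,n]}` and `X_{[α,n]}^{[1,n-α]}`. If `n = 2α`, then the diagonal of `X` on which
the second block starts ends at `x_{nα}`, and the gluing continues with a third block. -/
def fRow (α β : ℕ) (X : Matrix (Fin n) (Fin n) K) (i j : ℕ) : K :=
  if n = 2 * α then
    let N := (n - j + 1) + (n - α) + (n - β)
    (block N X i (β + 1) j n 0 0 + block N X α n 1 (α + 1) (n - j) (n - j + 1)
      + block N X 1 (n - β) β n ((n - j + 1) + (n - α)) (n - j + α)).det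
  else
    let N := (n - j + 1) + (n - α)
    (block N X i (β + 1) j n 0 0 + block N X α n 1 (n - α) (n - j) (n - j + 1)).det

/-- The function `φ_ij`, evaluated at the matrix `X`. -/
def phi (α β : ℕ) (X : Matrix (Fin n) (Fin n) K) (i j : ℕ) : K :=
  if i + α = n + j then fCol α β X i j
  else if j + β = n + i then fRow α β X i j
  else f X i j

end Functions

/-! ## The quiver `Q_{αβ}(n)` and the initial seed -/

/-- The `n × n` grid of vertices; rows and columns are numbered from `1`. -/
def grid (n : ℕ) : Finset (ℕ × ℕ) := Finset.Icc 1 n ×ˢ Finset.Icc 1 n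

/-- The vertices in the first row or column, except `(α + 1, 1)` and `(1, β + 1)`. -/
def IsStable (α β : ℕ) (p : ℕ × ℕ) : Prop :=
  (p.1 = 1 ∨ p.2 = 1) ∧ p ≠ (α + 1, 1) ∧ p ≠ (1, β + 1)

instance (α β : ℕ) : DecidablePred (IsStable α β) := fun p => by
  unfold IsStable; infer_instance

/-- There is an arrow `p → q` in the standard quiver on the `n × n` grid. There are no arrows
between the vertices of the first row and column, which are frozen in the standard quiver. -/
def StdArrow (n : ℕ) (p q : ℕ × ℕ) : Prop :=
  p ∈ grid n ∧ q ∈ grid n ∧ ¬((p.1 = 1 ∨ p.2 = 1) ∧ (q.1 = 1 ∨ q.2 = 1)) ∧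
    (q = (p.1 + 1, p.2) ∨ q = (p.1, p.2 + 1) ∨ p = (q.1 + 1, q.2 + 1))

instance (n : ℕ) (p q : ℕ × ℕ) : Decidable (StdArrow n p q) := by
  unfold StdArrow; infer_instance

/-- The arrows that are added to the standard quiver. -/
def addedArrows (n α β : ℕ) : List ((ℕ × ℕ) × (ℕ × ℕ)) :=
  [((α, 1), (α + 1, 1)), ((1, β), (1, β + 1)),
   ((n, α + 1), (1, β + 1)), ((1, β + 1), (n, α)),
   ((β + 1, n), (α + 1, 1)), ((α + 1, 1), (β, n))]

/-- The number of arrows `p → q`. -/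
def arrows (n α β : ℕ) (p q : ℕ × ℕ) : ℤ :=
  (if StdArrow n p q then 1 else 0) + (if (p, q) ∈ addedArrows n α β then 1 else 0)

/-- The seed given by the quiver on the full `n × n` grid and the functions `φ_ij`, evaluated at
`X`. The vertex `(1, 1)`, which carries `φ₁₁ = det X`, is present and frozen. -/
def matrixSeed {K : Type*} [Field K] {n : ℕ} (α β : ℕ) (X : Matrix (Fin n) (Fin n) K) :
    Seed (ℕ × ℕ) K where
  verts := grid n
  frozen := (grid n).filter (IsStable α β)
  var := fun p => phi α β X p.1 p.2
  b := fun p q => arrows n α β p q - arrows n α β q p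

/-! ## Rational functions on `Mat_n` and on `SL_n` -/

/-- The coordinate ring of `Mat_n` over `ℂ`. -/
abbrev MatRing (n : ℕ) : Type := MvPolynomial (Fin n × Fin n) ℂ

/-- The field of rational functions on `Mat_n`. -/
abbrev MatField (n : ℕ) : Type := FractionRing (MatRing n)

/-- The matrix of coordinate functions on `Mat_n`. -/
noncomputable def genericMat (n : ℕ) : Matrix (Fin n) (Fin n) (MatField n) :=
  (Matrix.mvPolynomialX (Fin n) (Fin n) ℂ).map (algebraMap (MatRing n) (MatField n))

/-- The ideal of `SL_n` in the coordinate ring of `Mat_n`. -/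
noncomputable def slIdeal (n : ℕ) : Ideal (MatRing n) :=
  Ideal.span {(Matrix.mvPolynomialX (Fin n) (Fin n) ℂ).det - 1}

/-- Dividing the first row by the determinant. -/
noncomputable def scaledMat (n : ℕ) : Matrix (Fin n) (Fin n) (MatField n) :=
  Matrix.of fun i j =>
    if (i : ℕ) = 0 then (genericMat n).det⁻¹ * genericMat n i j else genericMat n i j

theorem genericMat_det (n : ℕ) : (genericMat n).det =
    algebraMap (MatRing n) (MatField n) (Matrix.mvPolynomialX (Fin n) (Fin n) ℂ).det := by
  rw [RingHom.map_det]; rfl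

theorem genericMat_det_ne_zero (n : ℕ) : (genericMat n).det ≠ 0 := by
  rw [genericMat_det]
  intro h
  exact Matrix.det_mvPolynomialX_ne_zero (Fin n) ℂ
    ((IsFractionRing.injective (MatRing n) (MatField n)) (by rw [h, map_zero]))

theorem scaledMat_det (n : ℕ) : (scaledMat n).det = 1 := by
  rcases n with _ | n
  · simp
  · have h : scaledMat (n + 1) = (genericMat (n + 1)).updateRow 0
        ((genericMat (n + 1)).det⁻¹ • (genericMat (n + 1) 0)) := by
      ext i j
      by_cases hi : i = 0
      · subst hi; simp [scaledMat]
      · have : (i : ℕ) ≠ 0 := fun h => hi (Fin.ext h)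
        simp [scaledMat, hi]
    rw [h, Matrix.det_updateRow_smul, Matrix.updateRow_eq_self]
    exact inv_mul_cancel₀ (genericMat_det_ne_zero _)

noncomputable def scaleHom (n : ℕ) : MatRing n →ₐ[ℂ] MatField n :=
  MvPolynomial.aeval fun p => scaledMat n p.1 p.2

theorem scaleHom_clear (n : ℕ) (p : MatRing n) : ∃ (N : ℕ) (q : MatRing n),
    algebraMap (MatRing n) (MatField n) q = (genericMat n).det ^ N * scaleHom n p ∧
      q - p ∈ slIdeal n := by
  have hD : (Matrix.mvPolynomialX (Fin n) (Fin n) ℂ).det - 1 ∈ slIdeal n :=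
    Ideal.subset_span rfl
  have hpow : ∀ N : ℕ, (Matrix.mvPolynomialX (Fin n) (Fin n) ℂ).det ^ N - 1 ∈ slIdeal n := by
    intro N
    exact (slIdeal n).mem_of_dvd (sub_one_dvd_pow_sub_one _ N) hD
  induction p using MvPolynomial.induction_on with
  | C a =>
    refine ⟨0, MvPolynomial.C a, ?_, by simp⟩
    simp only [scaleHom, pow_zero, one_mul, MvPolynomial.aeval_C]
    exact (IsScalarTower.algebraMap_apply ℂ (MatRing n) (MatField n) a).symm
  | add p q hp hq =>
    obtain ⟨N, p', hp1, hp2⟩ := hp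
    obtain ⟨M, q', hq1, hq2⟩ := hq
    refine ⟨N + M, (Matrix.mvPolynomialX (Fin n) (Fin n) ℂ).det ^ M * p' +
      (Matrix.mvPolynomialX (Fin n) (Fin n) ℂ).det ^ N * q', ?_, ?_⟩
    · rw [map_add, map_mul, map_mul, map_pow, map_pow, ← genericMat_det, hp1, hq1, map_add]
      ring
    · have h := (slIdeal n).add_mem
        ((slIdeal n).add_mem (Ideal.mul_mem_right p' _ (hpow M)) hp2)
        ((slIdeal n).add_mem (Ideal.mul_mem_right q' _ (hpow N)) hq2)
      convert h using 1
      ring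
  | mul_X p v hp =>
    obtain ⟨N, p', hp1, hp2⟩ := hp
    have hX : ∀ w : Fin n × Fin n,
        algebraMap (MatRing n) (MatField n) (MvPolynomial.X w) = genericMat n w.1 w.2 := by
      intro w; simp [genericMat]
    by_cases hv : (v.1 : ℕ) = 0
    · refine ⟨N + 1, p' * MvPolynomial.X v, ?_, ?_⟩
      · rw [map_mul, map_mul, hp1, hX]
        have : scaleHom n (MvPolynomial.X v) = (genericMat n).det⁻¹ * genericMat n v.1 v.2 := by
          simp [scaleHom, scaledMat, hv]
        rw [this, pow_succ]
        have h0 := genericMat_det_ne_zero n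
        field_simp
      · have := Ideal.mul_mem_right (MvPolynomial.X v) _ hp2
        rwa [sub_mul] at this
    · refine ⟨N, p' * MvPolynomial.X v, ?_, ?_⟩
      · rw [map_mul, map_mul, hp1, hX]
        have : scaleHom n (MvPolynomial.X v) = genericMat n v.1 v.2 := by
          simp [scaleHom, scaledMat, hv]
        rw [this]
        ring
      · have := Ideal.mul_mem_right (MvPolynomial.X v) _ hp2
        rwa [sub_mul] at this

theorem slIdeal_eq_ker (n : ℕ) : slIdeal n = RingHom.ker (scaleHom n) := by
  apply le_antisymm
  · rw [slIdeal, Ideal.span_le, Set.singleton_subset_iff, SetLike.mem_coe, RingHom.mem_ker,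
      map_sub, map_one]
    have : scaleHom n (Matrix.mvPolynomialX (Fin n) (Fin n) ℂ).det = (scaledMat n).det := by
      rw [AlgHom.map_det]
      congr 1
      ext i j
      simp [scaleHom]
    rw [this, scaledMat_det, sub_self]
  · intro p hp
    obtain ⟨N, q, h1, h2⟩ := scaleHom_clear n p
    rw [RingHom.mem_ker] at hp
    rw [show scaleHom n p = 0 from hp, mul_zero] at h1
    have hq : q = 0 := (IsFractionRing.injective (MatRing n) (MatField n)) (by rw [h1, map_zero])
    rw [hq, zero_sub] at h2
    simpa using (slIdeal n).neg_mem h2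

instance (n : ℕ) : (slIdeal n).IsPrime := by
  rw [slIdeal_eq_ker]; exact RingHom.ker_isPrime _

/-- The coordinate ring of `SL_n` over `ℂ`. -/
abbrev SLRing (n : ℕ) : Type := MatRing n ⧸ slIdeal n

/-- The field of rational functions on `SL_n`. -/
abbrev SLField (n : ℕ) : Type := FractionRing (SLRing n)

/-- The matrix of coordinate functions on `SL_n`. -/
noncomputable def genericSL (n : ℕ) : Matrix (Fin n) (Fin n) (SLField n) :=
  (Matrix.mvPolynomialX (Fin n) (Fin n) ℂ).map
    fun p => algebraMap (SLRing n) (SLField n) (Ideal.Quotient.mk (slIdeal n) p)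

/-- The initial seed for `α ↦ β` on `SL_n`: the quiver `Q_{αβ}(n)` with the functions `φ_ij`, where
the vertex `(1, 1)` is left out because `φ₁₁ = det X = 1`. -/
noncomputable def initialSeed (n α β : ℕ) : Seed (ℕ × ℕ) (SLField n) :=
  (matrixSeed α β (genericSL n)).remove (1, 1)

/-- The submatrix of the first `n - 1` rows and columns. -/
def leading {K : Type*} {n : ℕ} (X : Matrix (Fin n) (Fin n) K) :
    Matrix (Fin (n - 1)) (Fin (n - 1)) K :=
  X.submatrix (Fin.castLE (Nat.sub_le n 1)) (Fin.castLE (Nat.sub_le n 1))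

/-! ## The mutation sequence `S = S_v ∘ S_h` -/

/-- The successor of a vertex on a path: `(i, j)` is followed by `(i - 1, j - 1)`, except that
`(α + 1, 1)` is followed by `(β, c)` and `(1, β + 1)` by `(r, α)`, where `r` and `c` are the
numbers of the last row and column that are in use. -/
def next (α β r c : ℕ) (p : ℕ × ℕ) : ℕ × ℕ :=
  if p = (α + 1, 1) then (β, c) else if p = (1, β + 1) then (r, α) else (p.1 - 1, p.2 - 1)

/-- The path from `p` up to the first frozen position, of at most the given number of steps. -/
def path (α β r c : ℕ) : ℕ → ℕ × ℕ → List (ℕ × ℕ)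
  | 0, p => [p]
  | m + 1, p => if IsStable α β p then [p] else p :: path α β r c m (next α β r c p)

/-- The paths that start at `(n, n), (n, n - 1), …, (n, 2)`, in this order. (A path visits each
position at most once, so `n * n` steps suffice.) -/
def hPaths (n α β : ℕ) : List (List (ℕ × ℕ)) :=
  (List.range (n - 1)).map fun k => path α β n n (n * n) (n, n - k)

/-- The paths that start at `(n - 1, n), (n - 2, n), …, (2, n)`, in this order; the positions in
row `n` are not in use any more, and those in column `n` are used only as starting part. -/
def vPaths (n α β : ℕ) : List (List (ℕ × ℕ)) :=
  (List.range (n - 2)).map fun k => path α β (n - 1) (n - 1) (n * n) (n - 1 - k, n)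

/-- `pos q` is the vertex that stands at the position `q` of the grid. Every vertex that stands on
the path is shifted to the position of its successor. -/
def shift (pos : ℕ × ℕ → ℕ × ℕ) : List (ℕ × ℕ) → ℕ × ℕ → ℕ × ℕ
  | p :: q :: l, x => if x = q then pos p else shift pos (q :: l) x
  | _, x => pos x

/-- The vertices at which one mutates, path by path: along each path one mutates at the vertices
that stand on it, except the last one, and then shifts the vertices. -/
def mutations : (ℕ × ℕ → ℕ × ℕ) → List (List (ℕ × ℕ)) → List (ℕ × ℕ)
  | _, [] => []
  | pos, p :: ps => p.dropLast.map pos ++ mutations (shift pos p) ps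

/-- The mutation sequence `S_h`. -/
def Sh (n α β : ℕ) : List (ℕ × ℕ) := mutations id (hPaths n α β)

/-- The mutation sequence `S_v`, which starts from the positions of the vertices after `S_h`. -/
def Sv (n α β : ℕ) : List (ℕ × ℕ) :=
  mutations ((hPaths n α β).foldl shift id) (vPaths n α β)

/-- The mutation sequence `S = S_v ∘ S_h`: first `S_h`, then `S_v`. -/
def S (n α β : ℕ) : List (ℕ × ℕ) := Sh n α β ++ Sv n α β

end ExoticCluster

set_option linter.unusedSectionVars false

/-! ### Mutation of seeds: involutivity, full rank, algebraic independence -/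

namespace ExoticCluster

/-! Processing one path shortens the minors carried by its vertices by one row (later by one column)
and moves the vertices one step along the path. The proof gives an explicit description of the whole
seed (`Stage`) that depends on the number `e` of entries left in the last row. It shows that
processing the path that starts at `(r, e)` turns the description for `e` into that for `e - 1`
(`Stage.step`). Since `S_v` is `S_h` for the transposed situation (`Stage.transpose`), only the
removal of rows has to be treated. The two alternatives in `Par` are the parameters of `S_h` and of
the transposed `S_v`.

Variables. A determinant glued from two blocks that overlap in two columns is a difference of two
products of minors (`mn_glue_cols`). Hence on the special diagonals `φ_ij` is an ordinary contiguous
minor of the matrix in which one column (or row) is replaced by a combination of itself and the next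
one, whose coefficients are again minors (`fCol_eq_mn`, `phi_eq_stageVar`). With this description
the exchange relations (`stageVar_path`) become determinantal identities. On the first diagonal of a
path they are the Desnanot–Jacobi identity. Behind `(a + 1, 1)` the old and the new variables are
minors with two different combinations of the same two rows, and a Plücker relation leaves the
determinant of the two coefficient vectors as a factor. This determinant is a product of variables
by a further identity (`rowCoeff_relation`, `colCoeff_relation`). All these identities are
specialisations of the three-term Plücker relation `mn_plucker`, obtained by inserting unit vectors
and using linearity.

Quivers. The effect of mutating along a chordless path is computed for general quivers in
`afterPath_mutateList`. For the paths at hand, the arrows after the shift of the vertices are again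
the expected ones, and a vertex that is dropped has no arrow to a mutable position still in use.
Therefore freezing the mutable vertices that do not stand on mutable positions isolates everything
outside the smaller grid, and the remaining seed is the one of the leading submatrix
(`Stage.isIso`).

Upper cluster algebras. A mutation sequence, an isomorphism of seeds and the removal of isolated
frozen vertices are harmless. The essential point is that freezing makes the upper cluster algebra
smaller (`upper_freeze_le`). This is not formal, since more mutations are allowed before freezing.
It rests on the theorem of Berenstein, Fomin and Zelevinsky that, for an exchange matrix of full
rank, an element that is Laurent in one seed and in its neighbours is Laurent in all seeds
(`UpperBound.mutate`). The proof reduces to the coprimality of exchange binomials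
(`isRelPrime_binom`), by comparing Laurent expansions in two adjacent directions.

Hypotheses of that theorem. Full rank of the initial seed follows by solving the kernel equations,
in which a mixed difference is constant along diagonals (`KernelEq.eq_zero`). Algebraic independence
follows from leading monomials for a suitable weight: each leading monomial is a coordinate function
times another leading monomial, or a coordinate function itself (`leadMon_succ`). On `SL_n` one uses
in addition that `x₁₁` occurs in the leading monomial of the determinant and in no other one
(`Lead.eq_zero_of_dvd`). The vertex `(1, 1)` carries the function `1` there and can be removed or
restored at any time (`keep_mutateList`). -/

theorem mutation_term (a c : ℤ) :
    (|a| * c + a * |c|) / 2 = max a 0 * max c 0 - max (-a) 0 * max (-c) 0 := by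
  rcases le_total 0 a with ha | ha <;> rcases le_total 0 c with hc | hc
  · rw [abs_of_nonneg ha, abs_of_nonneg hc, max_eq_left ha, max_eq_left hc,
      max_eq_right (by omega), max_eq_right (by omega), ← two_mul]
    simp
  · rw [abs_of_nonneg ha, abs_of_nonpos hc, max_eq_left ha, max_eq_right hc,
      max_eq_right (by omega : -a ≤ 0)]
    simp
  · rw [abs_of_nonpos ha, abs_of_nonneg hc, max_eq_right ha, max_eq_right (by omega : -c ≤ 0)]
    simp
  · rw [abs_of_nonpos ha, abs_of_nonpos hc, max_eq_right ha, max_eq_right hc,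
      max_eq_left (by omega), max_eq_left (by omega)]
    have : -a * c + a * -c = 2 * -(a * c) := by ring
    rw [this, Int.mul_ediv_cancel_left _ (by norm_num)]
    ring

namespace Seed

variable {V W K : Type*} [DecidableEq V] [DecidableEq W] [Field K]

/-- The right hand side of the exchange relation. -/
def exch (s : Seed V K) (k : V) : K :=
  ∏ v ∈ s.verts, s.var v ^ (s.b k v).toNat + ∏ v ∈ s.verts, s.var v ^ (-s.b k v).toNat

@[simp] theorem mutate_verts (s : Seed V K) (k : V) : (s.mutate k).verts = s.verts := rfl

@[simp] theorem mutate_exchangeable (s : Seed V K) (k : V) :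
    (s.mutate k).exchangeable = s.exchangeable := rfl

theorem mutate_var_self (s : Seed V K) (k : V) : (s.mutate k).var k = s.exch k / s.var k := by
  simp [mutate, exch]

theorem mutate_var_of_ne (s : Seed V K) {k v : V} (h : v ≠ k) :
    (s.mutate k).var v = s.var v := by
  simp [mutate, h]

theorem mutate_b_left (s : Seed V K) (k v : V) : (s.mutate k).b k v = -s.b k v := by
  simp [mutate]

theorem mutate_b_right (s : Seed V K) (k v : V) : (s.mutate k).b v k = -s.b v k := by
  simp [mutate]

theorem mutate_b_of_ne (s : Seed V K) {k i j : V} (hi : i ≠ k) (hj : j ≠ k) :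
    (s.mutate k).b i j = s.b i j +
      (max (s.b i k) 0 * max (s.b k j) 0 - max (-s.b i k) 0 * max (-s.b k j) 0) := by
  simp only [mutate, hi, hj, or_self, if_false, mutation_term]

/-- The matrix is skew-symmetric. -/
def Skew (s : Seed V K) : Prop := ∀ v w, s.b v w = -s.b w v

theorem Skew.self {s : Seed V K} (h : s.Skew) (v : V) : s.b v v = 0 := by
  have := h v v
  omega

theorem Skew.mutate {s : Seed V K} (h : s.Skew) (k : V) : (s.mutate k).Skew := by
  intro i j
  by_cases hi : i = k
  · subst hi
    rw [mutate_b_left, mutate_b_right, h i j]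
  by_cases hj : j = k
  · subst hj
    rw [mutate_b_left, mutate_b_right, h i j]
  rw [mutate_b_of_ne s hi hj, mutate_b_of_ne s hj hi, h j i, h i k, h k j]
  simp only [neg_neg]
  ring

/-- Row `k` changes its sign, so the two monomials are interchanged; the variable at `k` does not
occur in them because the diagonal entry is zero. -/
theorem exch_mutate {s : Seed V K} (h : s.Skew) (k : V) : (s.mutate k).exch k = s.exch k := by
  have key : ∀ e : ℤ → ℕ, e 0 = 0 → ∏ v ∈ s.verts, (s.mutate k).var v ^ e (s.b k v) =
      ∏ v ∈ s.verts, s.var v ^ e (s.b k v) := by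
    intro e he
    refine Finset.prod_congr rfl fun v _ => ?_
    by_cases hv : v = k
    · subst hv; rw [h.self, he, pow_zero, pow_zero]
    · rw [mutate_var_of_ne s hv]
  unfold exch
  simp only [mutate_verts, mutate_b_left, neg_neg]
  rw [key (fun z => (-z).toNat) rfl, key Int.toNat rfl, add_comm]

/-- The two nonvanishing hypotheses are there because the two mutations divide by `s.var k` and by
`s.exch k / s.var k`. -/
theorem mutate_mutate {s : Seed V K} (h : s.Skew) (k : V) (hk : s.var k ≠ 0)
    (hP : s.exch k ≠ 0) : (s.mutate k).mutate k = s := by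
  have hb : ((s.mutate k).mutate k).b = s.b := by
    funext i j
    by_cases hi : i = k
    · subst hi; rw [mutate_b_left, mutate_b_left, neg_neg]
    by_cases hj : j = k
    · subst hj; rw [mutate_b_right, mutate_b_right, neg_neg]
    rw [mutate_b_of_ne _ hi hj, mutate_b_of_ne _ hi hj, mutate_b_left, mutate_b_right]
    simp only [neg_neg]
    ring
  have hv : ((s.mutate k).mutate k).var = s.var := by
    funext v
    by_cases hv : v = k
    · subst hv
      rw [mutate_var_self, exch_mutate h, mutate_var_self]
      field_simp
    · rw [mutate_var_of_ne _ hv, mutate_var_of_ne _ hv]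
  calc (s.mutate k).mutate k = ⟨s.verts, s.frozen, ((s.mutate k).mutate k).var,
        ((s.mutate k).mutate k).b⟩ := rfl
    _ = s := by rw [hb, hv]

/-- The columns of the exchange matrix that belong to mutable vertices are linearly
independent. -/
def FullRank (s : Seed V K) : Prop :=
  ∀ c : V → ℤ, (∀ w ∈ s.verts, ∑ v ∈ s.exchangeable, s.b w v * c v = 0) →
    ∀ v ∈ s.exchangeable, c v = 0

theorem exchangeable_subset (s : Seed V K) : s.exchangeable ⊆ s.verts := Finset.sdiff_subset

/-- Matrix mutation is a base change of the columns up to row operations. Here it is made explicit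
on kernel vectors: a vector in the kernel of the mutated matrix becomes one in the kernel of the old
matrix when its entry at `k` is changed. -/
theorem FullRank.mutate {s : Seed V K} (hr : s.FullRank) (h : s.Skew) {k : V}
    (hk : k ∈ s.exchangeable) : (s.mutate k).FullRank := by
  intro c hc
  rw [mutate_verts, mutate_exchangeable] at *
  set σ := ∑ v ∈ s.exchangeable.erase k, max (s.b k v) 0 * c v with hσ
  have split : ∀ g : V → ℤ, ∑ v ∈ s.exchangeable, g v =
      g k + ∑ v ∈ s.exchangeable.erase k, g v := fun g =>
    (Finset.add_sum_erase _ g hk).symm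
  have hkv := s.exchangeable_subset hk
  have e1 : ∑ v ∈ s.exchangeable.erase k, s.b k v * c v = 0 := by
    have := hc k hkv
    rw [split, mutate_b_left, h.self] at this
    simp only [neg_zero, zero_mul, zero_add] at this
    rw [← neg_eq_zero, ← Finset.sum_neg_distrib, ← this]
    refine Finset.sum_congr rfl fun v _ => ?_
    rw [mutate_b_left]; ring
  -- The equation of row `k` says that the positive and the negative part of that row have the same
  -- sum `σ` against `c`. The correction terms of the mutation rule in row `w` then add up to `b w k
  -- * σ`, which is absorbed by the new entry `σ - c k`.
  have e2 : ∑ v ∈ s.exchangeable.erase k, max (-s.b k v) 0 * c v = σ := by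
    rw [eq_comm, ← sub_eq_zero, hσ, ← Finset.sum_sub_distrib]
    refine (Finset.sum_congr rfl fun v _ => ?_).trans e1
    have : max (s.b k v) 0 - max (-s.b k v) 0 = s.b k v := by omega
    linear_combination (c v) * this
  have key := hr (Function.update c k (σ - c k)) ?_
  · have hother : ∀ v ∈ s.exchangeable, v ≠ k → c v = 0 := by
      intro v hv hvk
      have := key v hv
      rwa [Function.update_of_ne hvk] at this
    intro v hv
    by_cases hvk : v = k
    · subst hvk
      have := key v hv
      rw [Function.update_self] at this
      have h0 : σ = 0 := by
        rw [hσ]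
        refine Finset.sum_eq_zero fun w hw => ?_
        rw [hother w (Finset.mem_of_mem_erase hw) (Finset.ne_of_mem_erase hw), mul_zero]
      omega
    · exact hother v hv hvk
  · intro w hw
    rw [split, Function.update_self]
    have hupd : ∑ v ∈ s.exchangeable.erase k, s.b w v * Function.update c k (σ - c k) v =
        ∑ v ∈ s.exchangeable.erase k, s.b w v * c v := by
      refine Finset.sum_congr rfl fun v hv => ?_
      rw [Function.update_of_ne (Finset.ne_of_mem_erase hv)]
    rw [hupd]
    by_cases hwk : w = k
    · subst hwk
      rw [e1, h.self]; ring
    · have := hc w hw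
      rw [split, mutate_b_right] at this
      have e3 : ∑ v ∈ s.exchangeable.erase k, (s.mutate k).b w v * c v =
          ∑ v ∈ s.exchangeable.erase k, s.b w v * c v +
            (max (s.b w k) 0 * σ - max (-s.b w k) 0 * σ) := by
        nth_rewrite 2 [← e2]
        rw [hσ, Finset.mul_sum, Finset.mul_sum, ← Finset.sum_sub_distrib,
          ← Finset.sum_add_distrib]
        refine Finset.sum_congr rfl fun v hv => ?_
        rw [mutate_b_of_ne s hwk (Finset.ne_of_mem_erase hv)]
        ring
      rw [e3] at this
      have h4 : max (s.b w k) 0 - max (-s.b w k) 0 = s.b w k := by omega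
      rw [← this]
      linear_combination (-σ) * h4

section Independence

variable (R : Type*) [CommRing R] [Algebra R K]

/-- The cluster variables are algebraically independent over `R`. -/
def Indep (s : Seed V K) : Prop := AlgebraicIndependent R fun v : s.verts => s.var v

variable {R}

theorem Indep.var_ne_zero [Nontrivial R] {s : Seed V K} (h : s.Indep R) {v : V}
    (hv : v ∈ s.verts) : s.var v ≠ 0 :=
  AlgebraicIndependent.ne_zero (x := fun i : s.verts => s.var i) h ⟨v, hv⟩

/-- At the point with all coordinates `1` the exchange binomial has the value `2`, so it is a
nonzero polynomial in independent elements. -/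
theorem Indep.exch_ne_zero [CharZero R] {s : Seed V K} (h : s.Indep R) (k : V) :
    s.exch k ≠ 0 := by
  set p : MvPolynomial s.verts R := ∏ v : s.verts, MvPolynomial.X v ^ (s.b k v).toNat +
    ∏ v : s.verts, MvPolynomial.X v ^ (-s.b k v).toNat with hp
  have hp0 : p ≠ 0 := by
    intro h0
    have := congrArg (MvPolynomial.eval fun _ => (1 : R)) h0
    simp only [hp, map_add, map_prod, map_pow, MvPolynomial.eval_X, one_pow,
      Finset.prod_const_one, map_zero] at this
    norm_num at this
  have he : MvPolynomial.aeval (fun v : s.verts => s.var v) p = s.exch k := by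
    simp only [hp, map_add, map_prod, map_pow, MvPolynomial.aeval_X, exch]
    rw [Finset.prod_coe_sort s.verts fun v => s.var v ^ (s.b k v).toNat,
      Finset.prod_coe_sort s.verts fun v => s.var v ^ (-s.b k v).toNat]
  rw [← he]
  exact fun h0 => hp0 (h.eq_zero_of_aeval_eq_zero p h0)

theorem exch_mem_adjoin {s : Seed V K} (h : s.Skew) (k : V) :
    s.exch k ∈ Algebra.adjoin R (s.var '' ((s.verts : Set V) \ {k})) := by
  have key : ∀ e : ℤ → ℕ, e 0 = 0 → ∏ v ∈ s.verts, s.var v ^ e (s.b k v) ∈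
      Algebra.adjoin R (s.var '' ((s.verts : Set V) \ {k})) := by
    intro e he
    refine Subalgebra.prod_mem _ fun v hv => ?_
    by_cases hvk : v = k
    · subst hvk; rw [h.self, he, pow_zero]; exact Subalgebra.one_mem _
    · exact Subalgebra.pow_mem _ (Algebra.subset_adjoin
        (Set.mem_image_of_mem _ (show v ∈ (s.verts : Set V) \ {k} from ⟨hv, hvk⟩))) _
  exact Subalgebra.add_mem _ (key Int.toNat rfl) (key (fun z => (-z).toNat) rfl)

/-- The old and the new variable have as product a polynomial in the other variables. If the new one
were algebraic over them, then so would be the old one. -/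
theorem Indep.mutate [IsDomain R] [FaithfulSMul R K] {s : Seed V K} (h : s.Indep R) {k : V}
    (hs : s.Skew) (hk : k ∈ s.verts) (hP : s.exch k ≠ 0) : (s.mutate k).Indep R := by
  have hins : (s.verts : Set V) = insert k ((s.verts : Set V) \ {k}) := by
    rw [Set.insert_sdiff_singleton, Set.insert_eq_of_mem (Finset.mem_coe.2 hk)]
  have hnot : k ∉ (s.verts : Set V) \ {k} := fun h => h.2 rfl
  have hcongr : Set.EqOn (s.mutate k).var s.var ((s.verts : Set V) \ {k}) :=
    fun v hv => mutate_var_of_ne s hv.2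
  change AlgebraicIndepOn R (s.mutate k).var (s.verts : Set V)
  replace h : AlgebraicIndepOn R s.var (s.verts : Set V) := h
  rw [hins, AlgebraicIndepOn.insert_iff hnot, hcongr.image_eq, mutate_var_self]
  rw [hins, AlgebraicIndepOn.insert_iff hnot] at h
  refine ⟨?_, fun halg => h.2 ?_⟩
  · have : (fun i : ((s.verts : Set V) \ {k} : Set V) => (s.mutate k).var i) =
        fun i : ((s.verts : Set V) \ {k} : Set V) => s.var i := by
      funext i; exact hcongr i.2
    unfold AlgebraicIndepOn at h ⊢
    rw [this]
    exact h.1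
  · have h1 : IsAlgebraic (Algebra.adjoin R (s.var '' ((s.verts : Set V) \ {k}))) (s.exch k) :=
      isAlgebraic_algebraMap (⟨s.exch k, exch_mem_adjoin hs k⟩ :
        Algebra.adjoin R (s.var '' ((s.verts : Set V) \ {k})))
    have h2 := h1.mul halg.inv
    rwa [inv_div, mul_div_cancel₀ _ hP] at h2

end Independence

end Seed

end ExoticCluster

/-! ### Coprimality of exchange binomials -/

namespace ExoticCluster

section Binomials

open MvPolynomial

variable {σ R : Type*} [Fintype σ] [DecidableEq σ] [CommRing R]

/-- The monomial with the given exponents. -/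
noncomputable def pmon (R : Type*) [CommRing R] (e : σ → ℕ) : MvPolynomial σ R := ∏ v, X v ^ e v

/-- The binomial that is attached to an integer vector. -/
noncomputable def binom (R : Type*) [CommRing R] (a : σ → ℤ) : MvPolynomial σ R :=
  pmon R (fun v => (a v).toNat) + pmon R (fun v => (-a v).toNat)

theorem binom_neg (a : σ → ℤ) : binom R (fun v => -a v) = binom R a := by
  unfold binom; simp only [neg_neg]; rw [add_comm]

theorem pmon_add (e f : σ → ℕ) : pmon R (fun v => e v + f v) = pmon R e * pmon R f := by
  simp only [pmon, pow_add, Finset.prod_mul_distrib]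

theorem pmon_mul (n : ℕ) (e : σ → ℕ) : pmon R (fun v => n * e v) = pmon R e ^ n := by
  simp only [pmon, ← Finset.prod_pow, ← pow_mul, mul_comm n]

theorem pmon_eq_mul (e : σ → ℕ) (i : σ) :
    pmon R e = X i ^ e i * pmon R (Function.update e i 0) := by
  unfold pmon
  rw [← Finset.mul_prod_erase _ _ (Finset.mem_univ i),
    ← Finset.mul_prod_erase Finset.univ (fun v => (X v : MvPolynomial σ R) ^ _)
      (Finset.mem_univ i), Function.update_self, pow_zero, one_mul]
  congr 1
  refine Finset.prod_congr rfl fun v hv => ?_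
  rw [Function.update_of_ne (Finset.ne_of_mem_erase hv)]

theorem eval_pmon_update (e : σ → ℕ) (i : σ) (r : R) :
    eval (Function.update (fun _ => (1 : R)) i r) (pmon R e) = r ^ e i := by
  simp only [pmon, map_prod, map_pow, eval_X]
  rw [Finset.prod_eq_single i]
  · simp
  · intro v _ hv; simp [hv]
  · simp

variable [IsDomain R]

theorem degreeOf_pmon (e : σ → ℕ) (i : σ) (h : e i = 0) : (pmon R e).degreeOf i = 0 := by
  have := degreeOf_prod_le i (Finset.univ) fun v => (X v : MvPolynomial σ R) ^ e v
  refine Nat.eq_zero_of_le_zero (this.trans (le_of_eq (Finset.sum_eq_zero fun v _ => ?_)))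
  by_cases hv : v = i
  · subst hv; rw [h, pow_zero, ← C_1, degreeOf_C]
  · refine Nat.eq_zero_of_le_zero ((degreeOf_pow_le _ _ _).trans ?_)
    rw [degreeOf_X, if_neg (fun h => hv h.symm), mul_zero]

variable [CharZero R]

/-- Setting `X i` to `0` and the other variables to `1` gives `1` or `2`, because at most one of the
two monomials contains `X i`. -/
theorem not_X_dvd_binom (a : σ → ℤ) (i : σ) : ¬(X i ∣ binom R a) := by
  rintro ⟨q, hq⟩
  have := congrArg (eval (Function.update (fun _ => (1 : R)) i 0)) hq
  rw [map_mul, eval_X, Function.update_self, zero_mul, binom, map_add, eval_pmon_update,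
    eval_pmon_update] at this
  rcases lt_trichotomy (a i) 0 with h | h | h
  · rw [show (a i).toNat = 0 by omega, zero_pow (show (-a i).toNat ≠ 0 by omega)] at this
    simp at this
  · rw [h] at this
    norm_num at this
  · rw [show (-a i).toNat = 0 by omega, zero_pow (show (a i).toNat ≠ 0 by omega)] at this
    simp at this

variable [UniqueFactorizationMonoid R]

theorem isRelPrime_pmon {d : MvPolynomial σ R} (h : ∀ i, ¬(X i ∣ d)) (e : σ → ℕ) :
    IsRelPrime d (pmon R e) := by
  refine IsRelPrime.prod_right fun v _ => IsRelPrime.pow_right ?_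
  exact ((X_prime (R := R) (i := v)).irreducible.isRelPrime_iff_not_dvd.2 (h v)).symm

theorem isUnit_of_dvd_binom_of_dvd_pmon {d : MvPolynomial σ R} {a : σ → ℤ} {e : σ → ℕ}
    (h : d ∣ binom R a) (h' : d ∣ pmon R e) : IsUnit d :=
  isRelPrime_pmon (fun i hi => not_X_dvd_binom a i hi) e h h'

/-- If a divisor of a binomial does not involve a variable that occurs in the binomial,
then it is a unit. -/
theorem isUnit_of_dvd_binom_of_degreeOf {d : MvPolynomial σ R} {a : σ → ℤ} {i : σ}
    (h : d ∣ binom R a) (ha : a i ≠ 0) (hd : d.degreeOf i = 0) : IsUnit d := by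
  have hi : i ∉ d.vars := by rw [mem_vars_iff_degreeOf_ne_zero]; simpa using hd
  -- The substitution of `0` for `X i` fixes `d` and leaves only one of the two monomials of the
  -- binomial. So `d` divides a monomial, whereas no variable divides it.
  set φ : MvPolynomial σ R →+* MvPolynomial σ R :=
    (aeval (Function.update (fun v => (X v : MvPolynomial σ R)) i 0)).toRingHom with hφ
  have hfix : φ d = d := by
    conv_rhs => rw [← RingHom.id_apply (α := MvPolynomial σ R) d]
    refine hom_congr_vars ?_ ?_ rfl
    · ext1 r; simp [hφ]
    · intro v hv _
      have : v ≠ i := by rintro rfl; exact hi hv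
      simp [hφ, this]
  have hX : φ (X i) = 0 := by simp [hφ]
  have hpm : ∀ e : σ → ℕ, e i = 0 → φ (pmon R e) = pmon R e := by
    intro e he
    simp only [pmon, map_prod, map_pow]
    refine Finset.prod_congr rfl fun v _ => ?_
    by_cases hv : v = i
    · subst hv; rw [he, pow_zero, pow_zero]
    · simp [hφ, hv]
  have hz : ∀ e : σ → ℕ, e i ≠ 0 → φ (pmon R e) = 0 := by
    intro e he
    rw [pmon_eq_mul e i, map_mul, map_pow, hX, zero_pow he, zero_mul]
  have h2 := map_dvd φ h
  rw [hfix] at h2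
  rcases lt_or_gt_of_ne ha with h0 | h0
  · rw [binom, map_add, hpm _ (show (a i).toNat = 0 by omega),
      hz _ (show (-a i).toNat ≠ 0 by omega), add_zero] at h2
    exact isUnit_of_dvd_binom_of_dvd_pmon h h2
  · rw [binom, map_add, hz _ (show (a i).toNat ≠ 0 by omega), zero_add,
      hpm _ (show (-a i).toNat = 0 by omega)] at h2
    exact isUnit_of_dvd_binom_of_dvd_pmon h h2

/-- Modulo a common divisor `d`, each of the two binomials says that its monomials are negatives of
each other. Raising these congruences to the powers `|c i|` and `|a i|` and multiplying them
eliminates `X i`, since the exponents of `X i` on both sides become equal. The resulting relation is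
nontrivial in `X j` because the exponent vectors are not parallel. Hence `d` divides a nonzero
polynomial without `X i`, does not involve `X i` itself, and is a unit by
`isUnit_of_dvd_binom_of_degreeOf`. -/
theorem isRelPrime_binom_aux {a c : σ → ℤ} {i j : σ} (hai : 0 ≤ a i) (hci : c i ≤ 0)
    (hne : a i ≠ 0 ∨ c i ≠ 0) (hij : c i * a j ≠ a i * c j) :
    IsRelPrime (binom R a) (binom R c) := by
  intro d hda hdc
  have hdX : ∀ v, ¬(X v ∣ d) := fun v hv => not_X_dvd_binom a v (hv.trans hda)
  set s := (c i).natAbs with hs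
  set t := (a i).natAbs with ht
  set M₁ := pmon R fun v => (a v).toNat
  set M₂ := pmon R fun v => (-a v).toNat
  set N₁ := pmon R fun v => (c v).toNat
  set N₂ := pmon R fun v => (-c v).toNat
  have h1 : d ∣ M₁ ^ s - (-M₂) ^ s :=
    hda.trans (by rw [binom, ← sub_neg_eq_add]; exact sub_dvd_pow_sub_pow _ _ s)
  have h2 : d ∣ N₁ ^ t - (-N₂) ^ t :=
    hdc.trans (by rw [binom, ← sub_neg_eq_add]; exact sub_dvd_pow_sub_pow _ _ t)
  set f : σ → ℕ := fun v => s * (a v).toNat + t * (c v).toNat with hf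
  set g : σ → ℕ := fun v => s * (-a v).toNat + t * (-c v).toNat with hg
  have h3 : d ∣ pmon R f - (-1) ^ (s + t) * pmon R g := by
    have e1 : pmon R f = M₁ ^ s * N₁ ^ t := by rw [hf, pmon_add, pmon_mul, pmon_mul]
    have e2 : pmon R g = M₂ ^ s * N₂ ^ t := by rw [hg, pmon_add, pmon_mul, pmon_mul]
    have e3 : pmon R f - (-1) ^ (s + t) * pmon R g =
        (M₁ ^ s - (-M₂) ^ s) * N₁ ^ t + (-M₂) ^ s * (N₁ ^ t - (-N₂) ^ t) := by
      rw [e1, e2, neg_pow M₂, neg_pow N₂, pow_add]; ring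
    rw [e3]
    exact dvd_add (h1.mul_right _) (h2.mul_left _)
  have hcast : ∀ v, (f v : ℤ) - g v = s * a v + t * c v := by
    intro v
    have e1 : ((a v).toNat : ℤ) - (-a v).toNat = a v := by omega
    have e2 : ((c v).toNat : ℤ) - (-c v).toNat = c v := by omega
    simp only [hf, hg]
    push_cast
    linear_combination (s : ℤ) * e1 + (t : ℤ) * e2
  have hsi : (s : ℤ) = -c i := by omega
  have hti : (t : ℤ) = a i := by omega
  have hfgi : f i = g i := by
    have := hcast i
    rw [hsi, hti] at this
    have h0 : -c i * a i + a i * c i = 0 := by ring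
    omega
  have hfgj : f j ≠ g j := by
    intro h
    have := hcast j
    rw [h, hsi, hti, sub_self] at this
    exact hij (by linear_combination this)
  set F := pmon R (Function.update f i 0) - (-1) ^ (s + t) * pmon R (Function.update g i 0)
    with hF
  have h4 : d ∣ F := by
    have : pmon R f - (-1) ^ (s + t) * pmon R g = X i ^ f i * F := by
      rw [hF, pmon_eq_mul f i, pmon_eq_mul g i, hfgi]; ring
    rw [this] at h3
    refine IsRelPrime.dvd_of_dvd_mul_left ?_ h3
    exact IsRelPrime.pow_right
      ((X_prime (R := R) (i := i)).irreducible.isRelPrime_iff_not_dvd.2 (hdX i)).symm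
  have hji : j ≠ i := by
    rintro rfl
    exact hij (by ring)
  -- With `X j = 2` and all other variables `1`, the vanishing of `F` would make two different
  -- powers of `2` agree up to sign.
  have hF0 : F ≠ 0 := by
    intro h0
    have := congrArg (eval (Function.update (fun _ => (1 : R)) j 2)) h0
    rw [hF, map_sub, map_mul, map_pow, map_neg, map_one, eval_pmon_update, eval_pmon_update,
      Function.update_of_ne hji, Function.update_of_ne hji, map_zero, sub_eq_zero] at this
    have h5 : (2 : ℤ) ^ f j = (-1) ^ (s + t) * 2 ^ g j := by exact_mod_cast this
    have h6 := congrArg Int.natAbs h5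
    rw [Int.natAbs_mul, Int.natAbs_pow, Int.natAbs_pow, Int.natAbs_pow] at h6
    simp only [Int.natAbs_neg, Int.natAbs_one, one_pow, one_mul] at h6
    exact hfgj (Nat.pow_right_injective (le_refl 2) h6)
  have hFdeg : F.degreeOf i = 0 := by
    have e1 : (pmon R (Function.update f i 0)).degreeOf i = 0 := degreeOf_pmon _ _ (by simp)
    have e2 : (pmon R (Function.update g i 0)).degreeOf i = 0 := degreeOf_pmon _ _ (by simp)
    have e3 : ((-1 : MvPolynomial σ R) ^ (s + t)).degreeOf i = 0 := by
      rw [show (-1 : MvPolynomial σ R) = C (-1) by simp, ← C_pow, degreeOf_C]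
    refine Nat.eq_zero_of_le_zero ((degreeOf_sub_le _ _ _).trans ?_)
    refine max_le e1.le ((degreeOf_mul_le _ _ _).trans ?_)
    rw [e2, e3]
  have hdeg : d.degreeOf i = 0 := by
    obtain ⟨q, hq⟩ := h4
    have hd0 : d ≠ 0 := by rintro rfl; exact hF0 (by rw [hq, zero_mul])
    have hq0 : q ≠ 0 := by rintro rfl; exact hF0 (by rw [hq, mul_zero])
    have := degreeOf_mul_eq (n := i) hd0 hq0
    rw [← hq, hFdeg] at this
    omega
  rcases hne with h | h
  · exact isUnit_of_dvd_binom_of_degreeOf hda h hdeg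
  · exact isUnit_of_dvd_binom_of_degreeOf hdc h hdeg

/-- Binomials with non-parallel exponent vectors are coprime. -/
theorem isRelPrime_binom {a c : σ → ℤ} {i j : σ} (hij : c i * a j ≠ a i * c j) :
    IsRelPrime (binom R a) (binom R c) := by
  have hne : a i ≠ 0 ∨ c i ≠ 0 := by
    by_contra! h
    rw [h.1, h.2, zero_mul, zero_mul] at hij
    exact hij rfl
  -- Negating an exponent vector does not change its binomial, so the signs at `i` may be chosen as
  -- in the auxiliary lemma.
  rcases le_total 0 (a i) with ha | ha <;> rcases le_total (c i) 0 with hc | hc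
  · exact isRelPrime_binom_aux ha hc hne hij
  · rw [← binom_neg c]
    exact isRelPrime_binom_aux (i := i) (j := j) ha (by omega) (by omega)
      (fun h => hij (by linear_combination -h))
  · rw [← binom_neg a]
    exact isRelPrime_binom_aux (i := i) (j := j) (by omega) hc (by omega)
      (fun h => hij (by linear_combination -h))
  · rw [← binom_neg a, ← binom_neg c]
    exact isRelPrime_binom_aux (i := i) (j := j) (by omega) (by omega) (by omega)
      (fun h => hij (by linear_combination h))

end Binomials

end ExoticCluster

/-! ### Laurent polynomials in both variables of one exchange relation -/

namespace ExoticCluster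

section Rank1

open Polynomial

variable {R K : Type*} [CommRing R] [Field K] [Algebra R K]

/-- An element that is a Laurent polynomial both in `x` and in `P / x` is a polynomial in `x` and
`P / x`. -/
theorem mem_of_laurent_of_laurent {A S : Subalgebra R K} {x P g : K} (hx : Transcendental A x)
    (hx0 : x ≠ 0) (hP : P ∈ A) (hP0 : P ≠ 0) (hAS : A ≤ S) (hxS : x ∈ S) (hxS' : P / x ∈ S)
    {N N' : ℕ} {p h : A[X]} (hg : x ^ N * g = aeval x p) (hg' : (P / x) ^ N' * g = aeval (P / x) h) :
    g ∈ S := by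
  set P' : A := ⟨P, hP⟩
  -- `H` will be `x ^ M * h (P / x)`, written as a polynomial in `x`. The bound by `N' + N`
  -- guarantees that none of the subtractions of indices below is truncated.
  set M := max h.natDegree (N' + N) with hM
  have hM1 : h.natDegree ≤ M := le_max_left _ _
  have hM2 : N' + N ≤ M := le_max_right _ _
  set H : A[X] := ∑ j ∈ Finset.range (M + 1), C (h.coeff j * P' ^ j) * X ^ (M - j) with hH
  have hcoeff : ∀ j ≤ M, H.coeff (M - j) = h.coeff j * P' ^ j := by
    intro j hj
    rw [hH, finsetSum_coeff, Finset.sum_eq_single j]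
    · rw [coeff_C_mul, coeff_X_pow, if_pos rfl, mul_one]
    · intro i hi hij
      rw [coeff_C_mul, coeff_X_pow, if_neg, mul_zero]
      have := Finset.mem_range.1 hi
      omega
    · intro hj'
      exact absurd (Finset.mem_range.2 (by omega)) hj'
  have hHx : aeval x H = x ^ M * aeval (P / x) h := by
    rw [aeval_eq_sum_range' (n := M + 1) (by omega) (P / x), Finset.mul_sum, hH, map_sum]
    refine Finset.sum_congr rfl fun j hj => ?_
    have hj' : j ≤ M := by have := Finset.mem_range.1 hj; omega
    rw [map_mul, aeval_C, map_pow, aeval_X, map_mul, map_pow, Algebra.smul_def, div_pow]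
    have : x ^ M = x ^ (M - j) * x ^ j := by rw [← pow_add]; congr 1; omega
    rw [this]
    have hPP : algebraMap A K P' = P := rfl
    rw [hPP]
    field_simp
  have hkey : C (P' ^ N') * X ^ (M - N') * p = X ^ N * H := by
    apply transcendental_iff_injective.1 hx
    rw [map_mul, map_mul, map_mul, aeval_C, map_pow, map_pow, map_pow, aeval_X, ← hg, hHx, ← hg',
      div_pow]
    have hPP : algebraMap A K P' = P := rfl
    have : x ^ M = x ^ (M - N') * x ^ N' := by rw [← pow_add]; congr 1; omega
    rw [hPP, this]
    field_simp
  have hP'0 : P' ≠ 0 := fun h0 => hP0 (congrArg Subtype.val h0)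
  -- The key divisibility: the coefficient of the negative power `x ^ (i - N)` contains the factor
  -- `P ^ (N - i)`, so that the term is a coefficient times a power of `P / x`.
  have hpi : ∀ i < N, p.coeff i = h.coeff (N' + N - i) * P' ^ (N - i) := by
    intro i hi
    have h1 := congrArg (fun q => q.coeff (i + (M - N'))) hkey
    rw [mul_right_comm, coeff_mul_X_pow, coeff_C_mul, mul_comm (X ^ N) H,
      show i + (M - N') = (M - (N' + N - i)) + N by omega, coeff_mul_X_pow,
      hcoeff _ (by omega), show N' + N - i = N' + (N - i) by omega, pow_add] at h1
    rw [show N' + N - i = N' + (N - i) by omega]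
    refine mul_left_cancel₀ (pow_ne_zero N' hP'0) ?_
    rw [h1]; ring
  have hxN : g = aeval x p / x ^ N := by
    rw [← hg]; field_simp
  rw [hxN, aeval_eq_sum_range, Finset.sum_div]
  refine Subalgebra.sum_mem _ fun i _ => ?_
  rw [Algebra.smul_def]
  rcases lt_or_ge i N with hi | hi
  · rw [hpi i hi, map_mul, map_pow]
    have hPP : algebraMap A K P' = P := rfl
    have : x ^ N = x ^ (N - i) * x ^ i := by rw [← pow_add]; congr 1; omega
    have e : algebraMap A K (h.coeff (N' + N - i)) * (algebraMap A K P') ^ (N - i) * x ^ i / x ^ N =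
        algebraMap A K (h.coeff (N' + N - i)) * (P / x) ^ (N - i) := by
      rw [this, hPP, div_pow]; field_simp
    rw [e]
    exact S.mul_mem (hAS (h.coeff _).2) (S.pow_mem hxS' _)
  · have : x ^ i = x ^ (i - N) * x ^ N := by rw [← pow_add]; congr 1; omega
    rw [this, ← mul_assoc, mul_div_cancel_right₀ _ (pow_ne_zero _ hx0)]
    exact S.mul_mem (hAS (p.coeff i).2) (S.pow_mem hxS _)

/-- Laurent polynomials in `x` have a common denominator that is a power of `x`. -/
theorem exists_pow_mul_eq_aeval {A : Subalgebra R K} {x : K} (hx0 : x ≠ 0) {G : Set K}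
    (hG : ∀ y ∈ G, y ∈ A ∨ y = x ∨ y = x⁻¹) {g : K} (hg : g ∈ Algebra.adjoin R G) :
    ∃ (N : ℕ) (p : A[X]), x ^ N * g = aeval x p := by
  have hA : ∀ a ∈ A, ∃ (N : ℕ) (p : A[X]), x ^ N * a = aeval x p := fun a ha =>
    ⟨0, C ⟨a, ha⟩, by rw [pow_zero, one_mul, aeval_C]; rfl⟩
  induction hg using Algebra.adjoin_induction with
  | mem y hy =>
    rcases hG y hy with h | rfl | rfl
    · exact hA y h
    · exact ⟨0, X, by simp⟩
    · exact ⟨1, 1, by simp [hx0]⟩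
  | algebraMap r => exact hA _ (A.algebraMap_mem r)
  | add y z _ _ hy hz =>
    obtain ⟨N, p, hp⟩ := hy
    obtain ⟨M, q, hq⟩ := hz
    refine ⟨N + M, X ^ M * p + X ^ N * q, ?_⟩
    rw [map_add, map_mul, map_mul, map_pow, map_pow, aeval_X, ← hp, ← hq]
    ring
  | mul y z _ _ hy hz =>
    obtain ⟨N, p, hp⟩ := hy
    obtain ⟨M, q, hq⟩ := hz
    refine ⟨N + M, p * q, ?_⟩
    rw [map_mul, ← hp, ← hq]
    ring

/-- If every generator is carried into `S` by a power of `P`, so is every element. -/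
theorem exists_pow_mul_mem {S : Subalgebra R K} {P : K} (hP : P ∈ S) {G : Set K}
    (hG : ∀ y ∈ G, ∃ N : ℕ, P ^ N * y ∈ S) {g : K} (hg : g ∈ Algebra.adjoin R G) :
    ∃ N : ℕ, P ^ N * g ∈ S := by
  induction hg using Algebra.adjoin_induction with
  | mem y hy => exact hG y hy
  | algebraMap r => exact ⟨0, by simp⟩
  | add y z _ _ hy hz =>
    obtain ⟨N, hp⟩ := hy
    obtain ⟨M, hq⟩ := hz
    refine ⟨N + M, ?_⟩
    have : P ^ (N + M) * (y + z) = P ^ M * (P ^ N * y) + P ^ N * (P ^ M * z) := by ring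
    rw [this]
    exact S.add_mem (S.mul_mem (S.pow_mem hP _) hp) (S.mul_mem (S.pow_mem hP _) hq)
  | mul y z _ _ hy hz =>
    obtain ⟨N, hp⟩ := hy
    obtain ⟨M, hq⟩ := hz
    refine ⟨N + M, ?_⟩
    have : P ^ (N + M) * (y * z) = (P ^ N * y) * (P ^ M * z) := by ring
    rw [this]
    exact S.mul_mem hp hq

/-- Stated for a ring homomorphism and not for an inclusion of subalgebras, because it is applied to
subalgebras over different base rings. -/
theorem isAlgebraic_of_injective {A B D : Type*} [CommRing A] [CommRing B] [CommRing D]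
    [Algebra A D] [Algebra B D] {f : A →+* B} (hf : Function.Injective f)
    (hc : ∀ a, algebraMap B D (f a) = algebraMap A D a) {x : D} (hx : IsAlgebraic A x) :
    IsAlgebraic B x := by
  obtain ⟨p, hp0, hp⟩ := hx
  refine ⟨p.map f, (Polynomial.map_ne_zero_iff hf).2 hp0, ?_⟩
  rw [aeval_def, eval₂_map, show (algebraMap B D).comp f = algebraMap A D from RingHom.ext hc]
  exact hp

end Rank1

namespace Seed

variable {V W K : Type*} [DecidableEq V] [DecidableEq W] [Field K]
variable (R : Type*) [CommRing R] [Algebra R K]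

/-- The ring of Laurent polynomials in the variables other than the one at `k`. -/
def coeffRing (s : Seed V K) (k : V) : Subalgebra R K :=
  Algebra.adjoin R (s.var '' ((s.verts : Set V) \ {k}) ∪
    (fun v => (s.var v)⁻¹) '' ((s.exchangeable : Set V) \ {k}))

/-- The ring that is generated over the coefficient ring by both variables of an exchange
relation. -/
def edgeRing (s : Seed V K) (k : V) : Subalgebra R K :=
  Algebra.adjoin R (s.var '' ((s.verts : Set V) \ {k}) ∪
    (fun v => (s.var v)⁻¹) '' ((s.exchangeable : Set V) \ {k}) ∪
      {s.var k, s.exch k / s.var k})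

variable {R}

theorem coeffRing_mutate (s : Seed V K) (k : V) :
    (s.mutate k).coeffRing R k = s.coeffRing R k := by
  unfold coeffRing
  congr 2
  · exact Set.image_congr fun v hv => mutate_var_of_ne s hv.2
  · exact Set.image_congr fun v hv => by rw [mutate_var_of_ne s hv.2]

theorem coeffRing_le_edgeRing (s : Seed V K) (k : V) : s.coeffRing R k ≤ s.edgeRing R k :=
  Algebra.adjoin_mono Set.subset_union_left

theorem adjoin_le_coeffRing (s : Seed V K) (k : V) :
    Algebra.adjoin R (s.var '' ((s.verts : Set V) \ {k})) ≤ s.coeffRing R k :=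
  Algebra.adjoin_mono Set.subset_union_left

/-- Adjoining inverses of variables is an algebraic extension of the polynomial ring in the other
variables, and transcendence is preserved by it. -/
theorem transcendental_coeffRing [IsDomain R] [FaithfulSMul R K] {s : Seed V K}
    (h : s.Indep R) {k : V} (hk : k ∈ s.verts) :
    Transcendental (s.coeffRing R k) (s.var k) := by
  have hins : (s.verts : Set V) = insert k ((s.verts : Set V) \ {k}) := by
    rw [Set.insert_sdiff_singleton, Set.insert_eq_of_mem (Finset.mem_coe.2 hk)]
  have hnot : k ∉ (s.verts : Set V) \ {k} := fun h => h.2 rfl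
  replace h : AlgebraicIndepOn R s.var (s.verts : Set V) := h
  rw [hins, AlgebraicIndepOn.insert_iff hnot] at h
  set B := Algebra.adjoin R (s.var '' ((s.verts : Set V) \ {k})) with hB
  set A' : Subalgebra B K := Algebra.adjoin B
    ((fun v => (s.var v)⁻¹) '' ((s.exchangeable : Set V) \ {k})) with hA'
  have halg : Algebra.IsAlgebraic B A' := by
    rw [← Subalgebra.isAlgebraic_iff, Algebra.isAlgebraic_adjoin_iff]
    rintro _ ⟨v, hv, rfl⟩
    have hvB : s.var v ∈ B := Algebra.subset_adjoin
      (Set.mem_image_of_mem _ ⟨s.exchangeable_subset hv.1, hv.2⟩)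
    exact (isAlgebraic_algebraMap (⟨s.var v, hvB⟩ : B)).inv
  have h1 : Transcendental A' (s.var k) := Transcendental.extendScalars _ h.2
  have hle : s.coeffRing R k ≤ A'.restrictScalars R := by
    refine Algebra.adjoin_le ?_
    rintro y (hy | hy)
    · have hyB : y ∈ B := Algebra.subset_adjoin hy
      exact (Subalgebra.mem_restrictScalars R).2 (A'.algebraMap_mem (⟨y, hyB⟩ : B))
    · have hyA : y ∈ A' := Algebra.subset_adjoin hy
      exact (Subalgebra.mem_restrictScalars R).2 hyA
  exact fun hal => h1 (isAlgebraic_of_injective (f := (Subalgebra.inclusion hle).toRingHom)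
    (Subalgebra.inclusion_injective hle) (fun _ => rfl) hal)

theorem laurent_le_of_gens {s : Seed V K} {S : Subalgebra R K} (h1 : ∀ v ∈ s.verts, s.var v ∈ S)
    (h2 : ∀ v ∈ s.exchangeable, (s.var v)⁻¹ ∈ S) : s.laurent R ≤ S := by
  refine Algebra.adjoin_le ?_
  rintro _ (⟨v, hv, rfl⟩ | ⟨v, hv, rfl⟩)
  · exact h1 v hv
  · exact h2 v hv

theorem var_mem_laurent {s : Seed V K} {v : V} (hv : v ∈ s.verts) : s.var v ∈ s.laurent R :=
  Algebra.subset_adjoin (Or.inl ⟨v, hv, rfl⟩)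

theorem inv_mem_laurent {s : Seed V K} {v : V} (hv : v ∈ s.exchangeable) :
    (s.var v)⁻¹ ∈ s.laurent R :=
  Algebra.subset_adjoin (Or.inr ⟨v, hv, rfl⟩)

theorem exch_mem_laurent (s : Seed V K) (k : V) : s.exch k ∈ s.laurent R :=
  Subalgebra.add_mem _
    (Subalgebra.prod_mem _ fun _ hv => Subalgebra.pow_mem _ (var_mem_laurent hv) _)
    (Subalgebra.prod_mem _ fun _ hv => Subalgebra.pow_mem _ (var_mem_laurent hv) _)

theorem edgeRing_le_laurent {s : Seed V K} {k : V} (hk : k ∈ s.exchangeable) :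
    s.edgeRing R k ≤ s.laurent R := by
  refine Algebra.adjoin_le ?_
  rintro _ ((⟨v, hv, rfl⟩ | ⟨v, hv, rfl⟩) | rfl | rfl)
  · exact var_mem_laurent hv.1
  · exact inv_mem_laurent hv.1
  · exact var_mem_laurent (s.exchangeable_subset hk)
  · rw [div_eq_mul_inv]
    exact Subalgebra.mul_mem _ (exch_mem_laurent s k) (inv_mem_laurent hk)

theorem edgeRing_mutate {s : Seed V K} (hs : s.Skew) {k : V} (hx : s.var k ≠ 0)
    (hP : s.exch k ≠ 0) : (s.mutate k).edgeRing R k = s.edgeRing R k := by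
  unfold edgeRing
  congr 2
  · congr 1
    · exact Set.image_congr fun v hv => mutate_var_of_ne s hv.2
    · exact Set.image_congr fun v hv => by rw [mutate_var_of_ne s hv.2]
  · rw [mutate_var_self, exch_mutate hs, Set.pair_comm]
    congr 1
    field_simp

/-- The case of a single exchange relation: being Laurent on both sides of an edge of the exchange
graph means being a polynomial in the two exchanged variables over the Laurent polynomials in the
others. No rank condition is needed for this. -/
theorem laurent_inf_laurent_mutate_le [IsDomain R] [CharZero R] [FaithfulSMul R K] {s : Seed V K}
    (hs : s.Skew) (h : s.Indep R) {k : V} (hk : k ∈ s.exchangeable) {g : K}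
    (hg : g ∈ s.laurent R) (hg' : g ∈ (s.mutate k).laurent R) : g ∈ s.edgeRing R k := by
  have hkv := s.exchangeable_subset hk
  have hx0 := h.var_ne_zero hkv
  have hP0 := h.exch_ne_zero k
  have gen : ∀ t : Seed V K, t.verts = s.verts → t.exchangeable = s.exchangeable →
      t.coeffRing R k = s.coeffRing R k →
      ∀ y ∈ t.var '' t.verts ∪ (fun v => (t.var v)⁻¹) '' t.exchangeable,
        y ∈ s.coeffRing R k ∨ y = t.var k ∨ y = (t.var k)⁻¹ := by
    intro t _ _ ht y hy
    rw [← ht]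
    rcases hy with ⟨v, hv, rfl⟩ | ⟨v, hv, rfl⟩
    · by_cases hvk : v = k
      · subst hvk; exact Or.inr (Or.inl rfl)
      · exact Or.inl (Algebra.subset_adjoin (Or.inl ⟨v, ⟨hv, hvk⟩, rfl⟩))
    · by_cases hvk : v = k
      · subst hvk; exact Or.inr (Or.inr rfl)
      · exact Or.inl (Algebra.subset_adjoin (Or.inr ⟨v, ⟨hv, hvk⟩, rfl⟩))
  have hx'0 : (s.mutate k).var k ≠ 0 := by
    rw [mutate_var_self]; exact div_ne_zero hP0 hx0
  obtain ⟨N, p, hp⟩ := exists_pow_mul_eq_aeval hx0 (gen s rfl rfl rfl) hg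
  obtain ⟨N', q, hq⟩ := exists_pow_mul_eq_aeval hx'0
    (gen (s.mutate k) rfl rfl (coeffRing_mutate s k)) hg'
  rw [mutate_var_self] at hq
  exact mem_of_laurent_of_laurent (transcendental_coeffRing h hkv) hx0
    (adjoin_le_coeffRing s k (exch_mem_adjoin hs k)) hP0 (coeffRing_le_edgeRing s k)
    (Algebra.subset_adjoin (by simp)) (Algebra.subset_adjoin (by simp)) hp hq

end Seed

end ExoticCluster

/-! ### The upper bound of a seed of full rank and its invariance under mutation -/

namespace ExoticCluster

namespace Seed

variable {V W K : Type*} [DecidableEq V] [DecidableEq W] [Field K]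

/-- The opposite seed: all arrows are reversed. -/
def op (s : Seed V K) : Seed V K where
  verts := s.verts
  frozen := s.frozen
  var := s.var
  b := fun v w => -s.b v w

theorem exch_op (s : Seed V K) (k : V) : s.op.exch k = s.exch k := by
  unfold exch op
  simp only [neg_neg]
  rw [add_comm]

theorem op_mutate (s : Seed V K) (k : V) : s.op.mutate k = (s.mutate k).op := by
  have hv : (s.op.mutate k).var = (s.mutate k).var := by
    funext v
    by_cases hv : v = k
    · subst hv; rw [mutate_var_self, mutate_var_self, exch_op]; rfl
    · rw [mutate_var_of_ne _ hv, mutate_var_of_ne _ hv]; rfl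
  have hb : (s.op.mutate k).b = fun i j => -(s.mutate k).b i j := by
    funext i j
    by_cases hi : i = k
    · subst hi; rw [mutate_b_left, mutate_b_left]; rfl
    by_cases hj : j = k
    · subst hj; rw [mutate_b_right, mutate_b_right]; rfl
    rw [mutate_b_of_ne _ hi hj, mutate_b_of_ne _ hi hj]
    simp only [op, neg_neg]
    ring
  calc s.op.mutate k = ⟨s.verts, s.frozen, (s.op.mutate k).var, (s.op.mutate k).b⟩ := rfl
    _ = (s.mutate k).op := by rw [hv, hb]; rfl

section

variable (R : Type*) [CommRing R] [Algebra R K]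

/-- Good seeds: skew-symmetric exchange matrix of full rank, and algebraically independent
variables. -/
structure Good (s : Seed V K) : Prop where
  skew : s.Skew
  indep : s.Indep R
  rank : s.FullRank

variable {R}

theorem Good.op {s : Seed V K} (h : s.Good R) : s.op.Good R where
  skew v w := by simp only [Seed.op]; rw [h.skew v w]
  indep := h.indep
  rank c hc := h.rank c fun w hw => by
    have := hc w hw
    rw [← neg_eq_zero, ← this, ← Finset.sum_neg_distrib]
    refine Finset.sum_congr rfl fun v _ => ?_
    simp only [Seed.op]; ring

variable [IsDomain R] [CharZero R] [FaithfulSMul R K]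

theorem Good.mutate {s : Seed V K} (h : s.Good R) {k : V} (hk : k ∈ s.exchangeable) :
    (s.mutate k).Good R where
  skew := h.skew.mutate k
  indep := h.indep.mutate h.skew (s.exchangeable_subset hk) (h.indep.exch_ne_zero k)
  rank := h.rank.mutate h.skew hk

/-- If all the 2 × 2 minors of the rows `k` and `l` vanish, then the combination of these two rows
with the entries in a column `j` as coefficients is zero. By skew-symmetry it is a relation between
columns. -/
theorem FullRank.not_parallel {s : Seed V K} (h : s.FullRank) (hs : s.Skew) {k l : V}
    (hk : k ∈ s.exchangeable) (hl : l ∈ s.exchangeable) (hkl : k ≠ l) :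
    ∃ i ∈ s.verts, ∃ j ∈ s.verts, s.b k i * s.b l j ≠ s.b l i * s.b k j := by
  by_contra! hpar
  have hne : ∃ j ∈ s.verts, s.b k j ≠ 0 := by
    by_contra! h0
    have := h (Pi.single k 1) (fun w hw => ?_) k hk
    · simp at this
    · refine Finset.sum_eq_zero fun v _ => ?_
      by_cases hv : v = k
      · subst hv; rw [hs w v, h0 w hw]; simp
      · simp [hv]
  obtain ⟨j, hj, hj0⟩ := hne
  have h1 := h (fun v => if v = k then s.b l j else if v = l then -s.b k j else 0)
    (fun w hw => ?_) l hl
  · simp only [hkl.symm, if_false, if_true] at h1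
    omega
  · rw [Finset.sum_eq_add_of_mem k l hk hl hkl]
    · simp only [if_true, hkl.symm, if_false]
      rw [hs w k, hs w l]
      linear_combination -(hpar w hw j hj)
    · intro v _ hv
      simp [hv.1, hv.2]

/-- The part of the exchange monomials that does not involve the vertices `k` and `l`. -/
def omon (s : Seed V K) (k l : V) (e : V → ℕ) : K :=
  ∏ v ∈ (s.verts.erase k).erase l, s.var v ^ e v

theorem prod_eq_omon (s : Seed V K) {k l : V} (hk : k ∈ s.verts) (hl : l ∈ s.verts)
    (hkl : k ≠ l) (e : V → ℕ) :
    ∏ v ∈ s.verts, s.var v ^ e v = s.var k ^ e k * (s.var l ^ e l * s.omon k l e) := by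
  unfold omon
  rw [← Finset.mul_prod_erase _ _ hk,
    ← Finset.mul_prod_erase _ _ (Finset.mem_erase.2 ⟨hkl.symm, hl⟩)]

theorem omon_mutate (s : Seed V K) {k l m : V} (hm : m = k ∨ m = l) (e : V → ℕ) :
    (s.mutate m).omon k l e = s.omon k l e := by
  refine Finset.prod_congr rfl fun v hv => ?_
  rw [Finset.mem_erase, Finset.mem_erase] at hv
  rw [mutate_var_of_ne]
  rintro rfl
  rcases hm with h | h
  · exact hv.2.1 h
  · exact hv.1 h

/-- The new variable at `l` can be exchanged before and after the mutation at `k`. -/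
theorem exists_exchange_eq {s : Seed V K} (hs : s.Skew) {k l : V} (hk : k ∈ s.verts)
    (hl : l ∈ s.verts) (hkl : k ≠ l) (hb : 0 ≤ s.b k l) (hx : s.var k ≠ 0)
    (hy : s.var l ≠ 0) (hP : s.exch k ≠ 0) : ∃ (e f g h : V → ℕ) (B : ℕ),
      s.exch k = s.var l ^ B * s.omon k l e + s.omon k l f ∧
      s.exch l / s.var l = ((s.mutate k).var k)⁻¹ ^ B * (s.omon k l g *
          ((s.mutate k).exch l / s.var l) + if B = 0 then 0 else
          s.omon k l h * s.omon k l e * s.var l ^ (B - 1) * ∑ i ∈ Finset.range B,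
            (s.var l ^ B * s.omon k l e + s.omon k l f) ^ i * s.omon k l f ^ (B - 1 - i)) ∧
      (B : ℤ) = s.b k l ∧ (e = fun v => (s.b k v).toNat) ∧ (f = fun v => (-s.b k v).toNat) := by
  obtain ⟨B, hB⟩ := Int.eq_ofNat_of_zero_le hb
  have hbl : s.b l k = -(B : ℤ) := by rw [hs l k, hB]
  have hkk := hs.self k
  have hll := hs.self l
  set e : V → ℕ := fun v => (s.b k v).toNat with he
  set f : V → ℕ := fun v => (-s.b k v).toNat with hf
  set p : V → ℕ := fun v => (s.b l v).toNat with hp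
  set h : V → ℕ := fun v => (-s.b l v).toNat with hh
  -- The mutation at `k` adds arrows at `l` that cancel against old ones. The exponents `g` describe
  -- the common monomial factor which is lost by this cancellation.
  set g : V → ℕ := fun v => min (p v) (h v + B * f v) with hg
  have h1 : s.exch k = s.var l ^ B * s.omon k l e + s.omon k l f := by
    rw [exch, prod_eq_omon s hk hl hkl, prod_eq_omon s hk hl hkl]
    simp [hkk, hB, he, hf]
  have h2 : s.exch l = s.omon k l p + s.var k ^ B * s.omon k l h := by
    rw [exch, prod_eq_omon s hk hl hkl, prod_eq_omon s hk hl hkl]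
    simp [hll, hbl, hp, hh]
  have hlk : (s.mutate k).b l k = B := by rw [mutate_b_right, hbl, neg_neg]
  have hll' : (s.mutate k).b l l = 0 := (hs.mutate k).self l
  have h3 : s.omon k l g * (s.mutate k).exch l = (s.mutate k).var k ^ B * s.omon k l p +
      s.omon k l h * s.omon k l f ^ B := by
    rw [exch, prod_eq_omon (s.mutate k) hk hl hkl, prod_eq_omon (s.mutate k) hk hl hkl,
      omon_mutate s (Or.inl rfl), omon_mutate s (Or.inl rfl), hlk, hll']
    simp only [Int.toNat_natCast, Int.toNat_zero, pow_zero, one_mul, neg_zero]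
    have hneg : (-(B : ℤ)).toNat = 0 := by omega
    rw [hneg, pow_zero, one_mul, mul_add, mul_left_comm]
    have hb' : ∀ v ∈ (s.verts.erase k).erase l, (s.mutate k).b l v =
        s.b l v - ((B * f v : ℕ) : ℤ) := by
      intro v hv
      rw [Finset.mem_erase, Finset.mem_erase] at hv
      rw [mutate_b_of_ne s hkl.symm hv.2.1, hbl]
      have e1 : max (-(B : ℤ)) 0 = 0 := by omega
      have e2 : max (- -(B : ℤ)) 0 = B := by omega
      have e3 : max (-s.b k v) 0 = (f v : ℤ) := by simp only [hf]; omega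
      rw [e1, e2, e3]; push_cast; ring
    have q1 : (s.omon k l g * s.omon k l fun v => ((s.mutate k).b l v).toNat) =
        s.omon k l p := by
      unfold omon
      rw [← Finset.prod_mul_distrib]
      refine Finset.prod_congr rfl fun v hv => ?_
      simp only []
      rw [← pow_add, hb' v hv]
      congr 1
      simp only [hg, hp, hh]
      generalize B * f v = z
      omega
    have q2 : (s.omon k l g * s.omon k l fun v => (-(s.mutate k).b l v).toNat) =
        s.omon k l h * s.omon k l f ^ B := by
      unfold omon
      rw [← Finset.prod_mul_distrib, ← Finset.prod_pow, ← Finset.prod_mul_distrib]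
      refine Finset.prod_congr rfl fun v hv => ?_
      simp only []
      rw [← pow_add, ← pow_mul, ← pow_add, hb' v hv, mul_comm (f v) B]
      congr 1
      simp only [hg, hp, hh]
      generalize B * f v = z
      omega
    rw [q1, q2]
  refine ⟨e, f, g, h, B, h1, ?_, hB.symm, rfl, rfl⟩
  have hx' : (s.mutate k).var k ≠ 0 := by rw [mutate_var_self]; exact div_ne_zero hP hx
  have h4 : s.var k * (s.mutate k).var k = s.var l ^ B * s.omon k l e + s.omon k l f := by
    rw [mutate_var_self, ← h1]; field_simp
  have h5 := (Commute.all (s.var l ^ B * s.omon k l e + s.omon k l f)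
    (s.omon k l f)).geom_sum₂_mul B
  set Q := ∑ i ∈ Finset.range B,
    (s.var l ^ B * s.omon k l e + s.omon k l f) ^ i * s.omon k l f ^ (B - 1 - i)
  rw [add_sub_cancel_right] at h5
  have hxB : (s.mutate k).var k ^ B * s.var k ^ B =
      (s.var l ^ B * s.omon k l e + s.omon k l f) ^ B := by
    rw [← h4, mul_pow, mul_comm]
  -- The difference between the exchange relations at `l` before and after the mutation at `k` is a
  -- multiple of `(x x') ^ B - F ^ B`, with `F` the monomial in `f`. Since `x x' = y ^ B * E + F`,
  -- it is divisible by `y ^ B`, hence by `y = s.var l` if `B > 0`.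
  have h6 : (s.mutate k).var k ^ B * s.exch l = s.omon k l g * (s.mutate k).exch l +
      s.omon k l h * (s.var l ^ B * s.omon k l e * Q) := by
    rw [h2, h3]
    linear_combination (s.omon k l h) * hxB - (s.omon k l h) * h5
  rw [inv_pow, eq_inv_mul_iff_mul_eq₀ (pow_ne_zero _ hx'), ← mul_div_assoc, h6, add_div,
    ← mul_div_assoc]
  congr 1
  split_ifs with hB0
  · rw [hB0] at h5 ⊢
    simp only [pow_zero, one_mul, sub_self] at h5 ⊢
    rw [mul_comm (s.omon k l e), h5]; simp
  · obtain ⟨C, rfl⟩ : ∃ C, B = C + 1 := ⟨B - 1, by omega⟩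
    rw [Nat.add_sub_cancel, pow_succ]
    field_simp

end

end Seed

namespace Seed

variable {V W K : Type*} [DecidableEq V] [DecidableEq W] [Field K]
variable {R : Type*} [CommRing R] [Algebra R K]

/-- The product of the mutable variables. -/
def mprod (s : Seed V K) : K := ∏ v ∈ s.exchangeable, s.var v

/-- One common denominator suffices. This moves questions about Laurent polynomials to the
polynomial ring, where unique factorisation is available. -/
theorem mem_laurent_iff [Nontrivial R] {s : Seed V K} (h : s.Indep R) {g : K} :
    g ∈ s.laurent R ↔ ∃ N : ℕ, s.mprod ^ N * g ∈ Algebra.adjoin R (s.var '' s.verts) := by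
  have hmem : ∀ v ∈ s.verts, s.var v ∈ Algebra.adjoin R (s.var '' s.verts) := fun v hv =>
    Algebra.subset_adjoin ⟨v, hv, rfl⟩
  have h0 : s.mprod ≠ 0 := Finset.prod_ne_zero_iff.2 fun v hv =>
    h.var_ne_zero (s.exchangeable_subset hv)
  constructor
  · refine exists_pow_mul_mem (Subalgebra.prod_mem _ fun v hv =>
      hmem v (s.exchangeable_subset hv)) ?_
    rintro _ (⟨v, hv, rfl⟩ | ⟨v, hv, rfl⟩)
    · exact ⟨0, by simpa using hmem v hv⟩
    · refine ⟨1, ?_⟩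
      have hv0 := h.var_ne_zero (s.exchangeable_subset hv)
      rw [pow_one]
      change (∏ v ∈ s.exchangeable, s.var v) * (s.var v)⁻¹ ∈ _
      rw [← Finset.prod_erase_mul _ _ hv, mul_assoc, mul_inv_cancel₀ hv0, mul_one]
      exact Subalgebra.prod_mem _ fun w hw =>
        hmem w (s.exchangeable_subset (Finset.mem_of_mem_erase hw))
  · rintro ⟨N, hN⟩
    have : g = (∏ v ∈ s.exchangeable, (s.var v)⁻¹) ^ N * (s.mprod ^ N * g) := by
      rw [Finset.prod_inv_distrib, ← mul_assoc, ← mul_pow]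
      change g = (s.mprod⁻¹ * s.mprod) ^ N * g
      rw [inv_mul_cancel₀ h0, one_pow, one_mul]
    rw [this]
    refine Subalgebra.mul_mem _ (Subalgebra.pow_mem _
      (Subalgebra.prod_mem _ fun v hv => inv_mem_laurent hv) _) ?_
    exact Algebra.adjoin_mono Set.subset_union_left hN

theorem adjoin_eq_range (s : Seed V K) : Algebra.adjoin R (s.var '' s.verts) =
    (MvPolynomial.aeval fun v : s.verts => s.var v : MvPolynomial s.verts R →ₐ[R] K).range := by
  rw [← Algebra.adjoin_range_eq_range_aeval]
  congr 1
  ext y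
  constructor
  · rintro ⟨v, hv, rfl⟩; exact ⟨⟨v, hv⟩, rfl⟩
  · rintro ⟨v, rfl⟩; exact ⟨v, v.2, rfl⟩

theorem aeval_pmon (s : Seed V K) (e : V → ℕ) :
    MvPolynomial.aeval (fun v : s.verts => s.var v) (pmon R fun v : s.verts => e v) =
      ∏ v ∈ s.verts, s.var v ^ e v := by
  simp only [pmon, map_prod, map_pow, MvPolynomial.aeval_X]
  exact Finset.prod_coe_sort s.verts fun v => s.var v ^ e v

theorem aeval_binom (s : Seed V K) (k : V) :
    MvPolynomial.aeval (fun v : s.verts => s.var v) (binom R fun v : s.verts => s.b k v) =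
      s.exch k := by
  rw [binom, map_add, aeval_pmon s fun v => (s.b k v).toNat,
    aeval_pmon s fun v => (-s.b k v).toNat]
  rfl

/-- After clearing denominators, comparing the two expressions for `P ^ N * Q ^ N' * g` shows by
coprimality that the factor `P ^ N` can be divided out. -/
theorem mem_of_mul_mem_of_mul_mem [IsDomain R] {s : Seed V K} (h : s.Indep R)
    {p q : MvPolynomial s.verts R} {P Q g : K}
    (hp : MvPolynomial.aeval (fun v : s.verts => s.var v) p = P)
    (hq : MvPolynomial.aeval (fun v : s.verts => s.var v) q = Q) (hP : P ≠ 0)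
    [UniqueFactorizationMonoid R] (hpq : IsRelPrime p q) {N N' : ℕ}
    (h1 : P ^ N * g ∈ s.laurent R) (h2 : Q ^ N' * g ∈ s.laurent R) : g ∈ s.laurent R := by
  rw [mem_laurent_iff h] at *
  set ψ := (MvPolynomial.aeval fun v : s.verts => s.var v : MvPolynomial s.verts R →ₐ[R] K)
  have hinj : Function.Injective ψ := h
  obtain ⟨a, ha⟩ := h1
  obtain ⟨c, hc⟩ := h2
  rw [adjoin_eq_range] at ha hc ⊢
  obtain ⟨U, hU⟩ := ha
  obtain ⟨T, hT⟩ := hc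
  have hm : s.mprod ∈ ψ.range := by
    rw [← adjoin_eq_range]
    exact Subalgebra.prod_mem _ fun v hv =>
      Algebra.subset_adjoin ⟨v, s.exchangeable_subset hv, rfl⟩
  obtain ⟨m, hm⟩ := hm
  have key : q ^ N' * (m ^ c * U) = p ^ N * (m ^ a * T) := by
    apply hinj
    change ψ m = _ at hm
    change ψ U = _ at hU
    change ψ T = _ at hT
    simp only [map_mul, map_pow, hp, hq, hm, hU, hT]
    ring
  have hdvd : p ^ N ∣ m ^ c * U :=
    IsRelPrime.dvd_of_dvd_mul_left (IsRelPrime.pow hpq) (Dvd.intro _ key.symm)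
  obtain ⟨Z, hZ⟩ := hdvd
  refine ⟨c + a, Z, ?_⟩
  have := congrArg ψ hZ
  change ψ m = _ at hm
  change ψ U = _ at hU
  simp only [map_mul, map_pow, hp, hm, hU] at this
  change ψ Z = _
  refine mul_left_cancel₀ (pow_ne_zero N hP) ?_
  rw [← this]
  ring

variable [IsDomain R] [CharZero R] [FaithfulSMul R K]

theorem edgeRing_le_laurent_mutate {s : Seed V K} (h : s.Good R) {k : V}
    (hk : k ∈ s.exchangeable) : s.edgeRing R k ≤ (s.mutate k).laurent R := by
  rw [← edgeRing_mutate h.skew (h.indep.var_ne_zero (s.exchangeable_subset hk))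
    (h.indep.exch_ne_zero k)]
  exact edgeRing_le_laurent (s := s.mutate k) hk

/-- Only the inverse of the variable at `k` is missing in the edge ring, and its product with
`s.exch k` is the new variable. -/
theorem exists_exch_pow_mul_mem {s : Seed V K} (h : s.Good R) {k : V} (hk : k ∈ s.exchangeable)
    {g : K} (hg : g ∈ s.laurent R) : ∃ N : ℕ, s.exch k ^ N * g ∈ s.edgeRing R k := by
  have hx0 := h.indep.var_ne_zero (s.exchangeable_subset hk)
  refine exists_pow_mul_mem (coeffRing_le_edgeRing s k
    (adjoin_le_coeffRing s k (exch_mem_adjoin h.skew k))) ?_ hg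
  rintro _ (⟨v, hv, rfl⟩ | ⟨v, hv, rfl⟩)
  · refine ⟨0, ?_⟩
    rw [pow_zero, one_mul]
    refine Algebra.subset_adjoin ?_
    by_cases hvk : v = k
    · subst hvk; simp
    · exact Or.inl (Or.inl ⟨v, ⟨hv, hvk⟩, rfl⟩)
  · by_cases hvk : v = k
    · subst hvk
      refine ⟨1, ?_⟩
      rw [pow_one, ← div_eq_mul_inv]
      exact Algebra.subset_adjoin (by simp)
    · refine ⟨0, ?_⟩
      rw [pow_zero, one_mul]
      exact Algebra.subset_adjoin (Or.inl (Or.inr ⟨v, ⟨hv, hvk⟩, rfl⟩))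

/-- Let `D` be the edge ring at `l` of the seed mutated at `k`; it is contained in the Laurent ring
of the last seed. Some power of the exchange polynomial of the mutated seed at `l` carries `g` into
`D`, because `g` is Laurent after the mutation at `k`. Some power of `s.exch k` carries `g` into
`D`, because `g` lies in the edge ring of `s` at `l`. The two exchange polynomials are coprime, up
to a Laurent monomial, so `g` itself is Laurent in the last seed. -/
theorem mem_laurent_mutate_mutate_of_nonneg [UniqueFactorizationMonoid R] {s : Seed V K}
    (h : s.Good R) {k l : V} (hk : k ∈ s.exchangeable) (hl : l ∈ s.exchangeable) (hkl : k ≠ l)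
    (hb : 0 ≤ s.b k l) {g : K} (hg : g ∈ s.laurent R) (hgk : g ∈ (s.mutate k).laurent R)
    (hgl : g ∈ (s.mutate l).laurent R) : g ∈ ((s.mutate k).mutate l).laurent R := by
  have hkv := s.exchangeable_subset hk
  have hlv := s.exchangeable_subset hl
  have hx := h.indep.var_ne_zero hkv
  have hy := h.indep.var_ne_zero hlv
  have hPk := h.indep.exch_ne_zero k
  have ht : (s.mutate k).Good R := h.mutate hk
  have hPl := ht.indep.exch_ne_zero l
  have ht2 : ((s.mutate k).mutate l).Good R := ht.mutate hl
  obtain ⟨e, f, c, d, B, e1, e2, hB, he, hf⟩ :=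
    exists_exchange_eq h.skew hkv hlv hkl hb hx hy hPk
  have hyl : (s.mutate k).var l = s.var l := mutate_var_of_ne s hkl.symm
  set t := s.mutate k with htdef
  set D := t.edgeRing R l with hD
  have hD1 : ∀ v ∈ s.verts, t.var v ∈ D := by
    intro v hv
    by_cases hvl : v = l
    · subst hvl; exact Algebra.subset_adjoin (by simp)
    · exact Algebra.subset_adjoin (Or.inl (Or.inl ⟨v, ⟨hv, hvl⟩, rfl⟩))
  have hD2 : ∀ v ∈ s.exchangeable, v ≠ l → (t.var v)⁻¹ ∈ D := fun v hv hvl =>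
    Algebra.subset_adjoin (Or.inl (Or.inr ⟨v, ⟨hv, hvl⟩, rfl⟩))
  have hD3 : t.exch l / s.var l ∈ D := by
    rw [← hyl]; exact Algebra.subset_adjoin (by simp)
  have hDl : s.var l ∈ D := hyl ▸ hD1 l hlv
  have hDo : ∀ e, s.omon k l e ∈ D := fun e => by
    refine Subalgebra.prod_mem _ fun v hv => Subalgebra.pow_mem _ ?_ _
    rw [Finset.mem_erase, Finset.mem_erase] at hv
    rw [← mutate_var_of_ne s hv.2.1]
    exact hD1 v hv.2.2
  have hDP : s.exch k ∈ D := by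
    rw [e1]
    exact D.add_mem (D.mul_mem (D.pow_mem hDl _) (hDo _)) (hDo _)
  have hDy : s.exch l / s.var l ∈ D := by
    rw [e2]
    refine D.mul_mem (D.pow_mem (hD2 k hk hkl) _) (D.add_mem (D.mul_mem (hDo _) hD3) ?_)
    split_ifs
    · exact D.zero_mem
    · refine D.mul_mem (D.mul_mem (D.mul_mem (hDo _) (hDo _)) (D.pow_mem hDl _))
        (D.sum_mem fun i _ => D.mul_mem (D.pow_mem ?_ _) (D.pow_mem (hDo _) _))
      rw [← e1]; exact hDP
  have hle : D ≤ (t.mutate l).laurent R := edgeRing_le_laurent_mutate ht hl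
  have hgE := laurent_inf_laurent_mutate_le h.skew h.indep hl hg hgl
  -- Generators of the edge ring of `s` at `l`: the variable at `k` is `s.exch k` divided by the new
  -- one, its inverse needs one factor `s.exch k`, and the new variable at `l` lies in `D` by
  -- `exists_exchange_eq`.
  obtain ⟨N₁, hN₁⟩ : ∃ N : ℕ, s.exch k ^ N * g ∈ D := by
    refine exists_pow_mul_mem hDP ?_ hgE
    rintro _ ((⟨v, hv, rfl⟩ | ⟨v, hv, rfl⟩) | rfl | rfl)
    · refine ⟨0, ?_⟩
      rw [pow_zero, one_mul]
      by_cases hvk : v = k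
      · subst hvk
        have : s.var v = s.exch v * (t.var v)⁻¹ := by
          rw [htdef, mutate_var_self]; field_simp
        rw [this]
        exact D.mul_mem hDP (hD2 v hk hkl)
      · rw [← mutate_var_of_ne s hvk]; exact hD1 v hv.1
    · by_cases hvk : v = k
      · subst hvk
        refine ⟨1, ?_⟩
        rw [pow_one, ← div_eq_mul_inv, ← mutate_var_self]
        exact hD1 v hkv
      · refine ⟨0, ?_⟩
        rw [pow_zero, one_mul]
        change (s.var v)⁻¹ ∈ D
        rw [← mutate_var_of_ne s hvk]
        exact hD2 v hv.1 hv.2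
    · exact ⟨0, by simpa using hDl⟩
    · exact ⟨0, by simpa using hDy⟩
  obtain ⟨N₂, hN₂⟩ := exists_exch_pow_mul_mem ht hl hgk
  -- the coprimality argument takes place in the polynomial ring of the last seed
  set u := t.mutate l with hu
  have hul : u.var l = t.exch l / s.var l := by rw [hu, mutate_var_self, hyl]
  have hul0 : u.var l ≠ 0 := by rw [hul]; exact div_ne_zero hPl hy
  set ψ := (MvPolynomial.aeval fun v : u.verts => u.var v : MvPolynomial u.verts R →ₐ[R] K)
    with hψ
  set p : MvPolynomial u.verts R := binom R fun v : u.verts => u.b l v with hp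
  set O : (V → ℕ) → MvPolynomial u.verts R := fun e =>
    pmon R fun v : u.verts => (fun w => if w = k ∨ w = l then 0 else e w) v with hO
  have hψO : ∀ e, ψ (O e) = s.omon k l e := by
    intro e
    rw [hψ, hO]
    simp only []
    rw [aeval_pmon u fun w => if w = k ∨ w = l then 0 else e w,
      prod_eq_omon u (k := k) (l := l) hkv hlv hkl]
    simp only [true_or, or_true, if_true, pow_zero, one_mul]
    rw [← omon_mutate s (m := k) (Or.inl rfl), ← omon_mutate (s.mutate k) (m := l) (Or.inr rfl)]
    refine Finset.prod_congr rfl fun v hv => ?_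
    rw [Finset.mem_erase, Finset.mem_erase] at hv
    simp only []
    rw [if_neg (by tauto)]
  -- In the last seed `s.exch k` contains the denominator `u.var l ^ B`; `q` is the polynomial
  -- obtained by clearing it.
  set q : MvPolynomial u.verts R := p ^ B * O e + MvPolynomial.X ⟨l, hlv⟩ ^ B * O f with hq
  have hψp : ψ p = t.exch l := by
    rw [hp, hψ, aeval_binom, hu, exch_mutate ht.skew]
  have hψq : ψ q = u.var l ^ B * s.exch k := by
    rw [hq, map_add, map_mul, map_mul, map_pow, map_pow, hψp, hψO, hψO, hψ,
      MvPolynomial.aeval_X, e1, hul]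
    have : (t.exch l / s.var l) ^ B * s.var l ^ B = t.exch l ^ B := by
      rw [← mul_pow]; field_simp
    linear_combination -(s.omon k l e) * this
  have hcop : IsRelPrime p q := by
    -- Without arrows between `k` and `l` both polynomials are the binomials of two rows of `s`,
    -- which are not parallel by full rank. Otherwise a common divisor of `p` and `q` divides the
    -- monomial term of `q`, and `p` is coprime to all monomials.
    rcases Nat.eq_zero_or_pos B with hB0 | hB0
    · have hqb : q = binom R fun v : u.verts => s.b k v := by
        rw [hq, hB0, pow_zero, pow_zero, one_mul, one_mul, binom]
        have hkl0 : s.b k l = 0 := by rw [← hB, hB0]; rfl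
        have hkk0 := h.skew.self k
        congr 1
        · rw [hO]; simp only []
          congr 1; funext v
          split_ifs with hv
          · rcases hv with hv | hv <;> rw [hv] <;> simp [hkl0, hkk0]
          · rw [he]
        · rw [hO]; simp only []
          congr 1; funext v
          split_ifs with hv
          · rcases hv with hv | hv <;> rw [hv] <;> simp [hkl0, hkk0]
          · rw [hf]
      have hpb : p = binom R fun v : u.verts => s.b l v := by
        rw [hp, ← binom_neg]
        congr 1; funext v
        have e0 : u.b l v = -t.b l v := mutate_b_left t l v
        rw [e0, neg_neg]
        have hlk0 : s.b l k = 0 := by rw [h.skew l k, ← hB, hB0]; rfl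
        by_cases hv : (v : V) = k
        · rw [hv, htdef, mutate_b_right, hlk0, neg_zero]
        · rw [htdef, mutate_b_of_ne s hkl.symm hv, hlk0]; simp
      obtain ⟨i, hi, j, hj, hij⟩ := h.rank.not_parallel h.skew hk hl hkl
      rw [hqb, hpb]
      exact isRelPrime_binom (i := ⟨i, hi⟩) (j := ⟨j, hj⟩) hij
    · intro z hzp hzq
      have h1 : z ∣ MvPolynomial.X ⟨l, hlv⟩ ^ B * O f := by
        rw [hq] at hzq
        exact (dvd_add_right ((dvd_pow hzp hB0.ne').mul_right _)).1 hzq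
      have hcop1 : IsRelPrime p (MvPolynomial.X ⟨l, hlv⟩ ^ B * O f) := by
        have hX : ∀ i, ¬(MvPolynomial.X i ∣ p) := fun i => not_X_dvd_binom _ i
        refine IsRelPrime.mul_right (IsRelPrime.pow_right ?_) (isRelPrime_pmon hX _)
        exact (MvPolynomial.X_prime.irreducible.isRelPrime_iff_not_dvd.2 (hX _)).symm
      exact hcop1 hzp h1
  refine mem_of_mul_mem_of_mul_mem (N := N₂) (N' := N₁) ht2.indep hψp hψq hPl hcop (hle hN₂) ?_
  rw [mul_pow, mul_assoc]
  exact Subalgebra.mul_mem _ (Subalgebra.pow_mem _ (Subalgebra.pow_mem _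
    (var_mem_laurent (s := u) hlv) _) _) (hle hN₁)

/-- Passing to the opposite seed changes the sign of `b k l` and neither the variables nor the
Laurent rings. -/
theorem mem_laurent_mutate_mutate [UniqueFactorizationMonoid R] {s : Seed V K} (h : s.Good R)
    {k l : V} (hk : k ∈ s.exchangeable) (hl : l ∈ s.exchangeable) (hkl : k ≠ l) {g : K}
    (hg : g ∈ s.laurent R) (hgk : g ∈ (s.mutate k).laurent R)
    (hgl : g ∈ (s.mutate l).laurent R) : g ∈ ((s.mutate k).mutate l).laurent R := by
  rcases le_total 0 (s.b k l) with hb | hb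
  · exact mem_laurent_mutate_mutate_of_nonneg h hk hl hkl hb hg hgk hgl
  · have hb' : 0 ≤ s.op.b k l := by simp only [op]; omega
    have := mem_laurent_mutate_mutate_of_nonneg h.op (k := k) (l := l) hk hl hkl hb' (g := g) hg
      (by rw [op_mutate]; exact hgk) (by rw [op_mutate]; exact hgl)
    rw [op_mutate, op_mutate] at this
    exact this

/-- The upper bound: Laurent polynomials in a seed and in all adjacent ones. -/
def UpperBound (R : Type*) [CommRing R] [Algebra R K] (s : Seed V K) (g : K) : Prop :=
  g ∈ s.laurent R ∧ ∀ k ∈ s.exchangeable, g ∈ (s.mutate k).laurent R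

/-- The neighbours of the mutated seed are the old seed, by involutivity, and the seeds obtained by
a mutation at `k` followed by one at some `l ≠ k`. The latter involve only three known Laurent
conditions. -/
theorem UpperBound.mutate [UniqueFactorizationMonoid R] {s : Seed V K} (h : s.Good R) {g : K}
    (hg : s.UpperBound R g) {k : V} (hk : k ∈ s.exchangeable) :
    (s.mutate k).UpperBound R g := by
  refine ⟨hg.2 k hk, fun l hl => ?_⟩
  by_cases hkl : k = l
  · subst hkl
    rw [mutate_mutate h.skew k (h.indep.var_ne_zero (s.exchangeable_subset hk))
      (h.indep.exch_ne_zero k)]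
    exact hg.1
  · exact mem_laurent_mutate_mutate h hk hl hkl hg.1 (hg.2 k hk) (hg.2 l hl)

theorem MutEquiv.good {s t : Seed V K} (h : s.Good R) (hst : MutEquiv s t) : t.Good R := by
  induction hst with
  | refl => exact h
  | step t k _ hk ih => exact ih.mutate hk

/-- The finitely many conditions of the upper bound propagate along mutations, so they replace the
infinitely many conditions that define the upper cluster algebra. -/
theorem UpperBound.mem_upper [UniqueFactorizationMonoid R] {s : Seed V K} (h : s.Good R) {g : K}
    (hg : s.UpperBound R g) : g ∈ s.upper R := by
  have key : ∀ t : Seed V K, MutEquiv s t → t.UpperBound R g := by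
    intro t ht
    induction ht with
    | refl => exact hg
    | step t k ht hk ih => exact ih.mutate (ht.good h) hk
  simp only [upper, Algebra.mem_iInf]
  exact fun t ht => (key t ht).1

theorem laurent_freeze_le (s : Seed V K) (F : Finset V) :
    (s.freeze F).laurent R ≤ s.laurent R := by
  refine Algebra.adjoin_mono (Set.union_subset_union_right _ (Set.image_mono ?_))
  exact Finset.coe_subset.2 (Finset.sdiff_subset_sdiff subset_rfl Finset.subset_union_left)

/-- The upper cluster algebra becomes smaller when vertices are frozen. -/
theorem upper_freeze_le [UniqueFactorizationMonoid R] {s : Seed V K} (h : s.Good R)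
    (F : Finset V) : (s.freeze F).upper R ≤ s.upper R := by
  intro g hg
  simp only [upper, Algebra.mem_iInf] at hg
  refine UpperBound.mem_upper h ⟨laurent_freeze_le s F (hg _ .refl), fun k hk => ?_⟩
  -- For a newly frozen `k` the mutation at `k` is not available, but Laurent polynomials of the
  -- frozen seed do not contain the inverse of the variable at `k`. So they lie in the edge ring,
  -- which is contained in both Laurent rings.
  by_cases hkF : k ∈ F
  · refine edgeRing_le_laurent_mutate h hk ?_
    have : (s.freeze F).laurent R ≤ s.edgeRing R k := by
      refine laurent_le_of_gens (fun v hv => ?_) fun v hv => ?_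
      · refine Algebra.subset_adjoin ?_
        by_cases hvk : v = k
        · subst hvk; exact Or.inr (Or.inl rfl)
        · exact Or.inl (Or.inl ⟨v, ⟨hv, hvk⟩, rfl⟩)
      · simp only [exchangeable, freeze, Finset.mem_sdiff, Finset.mem_union] at hv
        have hvk : v ≠ k := by rintro rfl; exact hv.2 (Or.inr hkF)
        refine Algebra.subset_adjoin (Or.inl (Or.inr ⟨v, ⟨?_, hvk⟩, rfl⟩))
        simp only [exchangeable, Finset.coe_sdiff, Set.mem_sdiff, Finset.mem_coe]
        exact ⟨hv.1, fun h => hv.2 (Or.inl h)⟩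
    exact this (hg _ .refl)
  · have hk' : k ∈ (s.freeze F).exchangeable := by
      simp only [exchangeable, freeze, Finset.mem_sdiff, Finset.mem_union] at hk ⊢
      exact ⟨hk.1, fun h => h.elim hk.2 hkF⟩
    exact laurent_freeze_le (s.mutate k) F (hg _ (.step _ k .refl hk'))

end Seed

/-! ### Upper cluster algebras under reversed mutations, removal of vertices, isomorphisms and field
maps -/

namespace Seed

variable {V W K L : Type*} [DecidableEq V] [DecidableEq W] [Field K] [Field L]

section Reverse

variable {R : Type*} [CommRing R] [Algebra R K]

theorem MutEquiv.trans {s t u : Seed V K} (h₁ : MutEquiv s t) (h₂ : MutEquiv t u) :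
    MutEquiv s u := by
  induction h₂ with
  | refl => exact h₁
  | step u k _ hk ih => exact .step u k ih hk

theorem MutEquiv.symm [IsDomain R] [CharZero R] [FaithfulSMul R K] {s t : Seed V K}
    (hs : s.Good R) (h : MutEquiv s t) : MutEquiv t s := by
  induction h with
  | refl => exact .refl
  | step t k ht hk ih =>
    have hg := ht.good hs
    have h1 : MutEquiv (t.mutate k) ((t.mutate k).mutate k) := .step _ k .refl hk
    rw [mutate_mutate hg.skew k (hg.indep.var_ne_zero (t.exchangeable_subset hk))
      (hg.indep.exch_ne_zero k)] at h1
    exact h1.trans ih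

theorem mutateList_verts (s : Seed V K) (l : List V) : (s.mutateList l).verts = s.verts := by
  induction l generalizing s with
  | nil => rfl
  | cons k l ih => exact ih (s.mutate k)

theorem mutateList_frozen (s : Seed V K) (l : List V) : (s.mutateList l).frozen = s.frozen := by
  induction l generalizing s with
  | nil => rfl
  | cons k l ih => exact ih (s.mutate k)

theorem mutateList_append (s : Seed V K) (l l' : List V) :
    s.mutateList (l ++ l') = (s.mutateList l).mutateList l' := List.foldl_append

theorem mutEquiv_mutateList (s : Seed V K) {l : List V} (hl : ∀ k ∈ l, k ∈ s.exchangeable) :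
    MutEquiv s (s.mutateList l) := by
  induction l generalizing s with
  | nil => exact .refl
  | cons k l ih =>
    have h1 : MutEquiv s (s.mutate k) := .step s k .refl (hl k (by simp))
    exact h1.trans (ih (s.mutate k) fun j hj => hl j (by simp [hj]))

theorem MutEquiv.upper_le [IsDomain R] [CharZero R] [FaithfulSMul R K] {s t : Seed V K}
    (hs : s.Good R) (h : MutEquiv s t) : t.upper R ≤ s.upper R := by
  intro g hg
  simp only [upper, Algebra.mem_iInf] at hg ⊢
  exact fun u hu => hg u ((h.symm hs).trans hu)

end Reverse

/-- The vertices with the property `p` are kept, the others are removed. -/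
def keep (s : Seed V K) (p : V → Prop) [DecidablePred p] : Seed V K where
  verts := s.verts.filter p
  frozen := s.frozen.filter p
  var := s.var
  b := s.b

theorem remove_eq_keep (s : Seed V K) (v : V) : s.remove v = s.keep (· ≠ v) := by
  unfold remove keep
  rw [Finset.filter_ne', Finset.filter_ne']

theorem exch_keep (s : Seed V K) (p : V → Prop) [DecidablePred p] {k : V}
    (h : ∀ v ∈ s.verts, ¬p v → s.var v = 1 ∨ s.b k v = 0) : (s.keep p).exch k = s.exch k := by
  have key : ∀ e : ℤ → ℕ, e 0 = 0 → ∏ v ∈ s.verts.filter p, s.var v ^ e (s.b k v) =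
      ∏ v ∈ s.verts, s.var v ^ e (s.b k v) := by
    intro e he
    refine Finset.prod_subset (Finset.filter_subset _ _) fun v hv hv' => ?_
    rcases h v hv fun hp => hv' (Finset.mem_filter.2 ⟨hv, hp⟩) with h1 | h1
    · rw [h1, one_pow]
    · rw [h1, he, pow_zero]
  unfold exch
  exact congrArg₂ (· + ·) (key Int.toNat rfl) (key (fun z => (-z).toNat) rfl)

theorem keep_mutate (s : Seed V K) (p : V → Prop) [DecidablePred p] {k : V}
    (h : ∀ v ∈ s.verts, ¬p v → s.var v = 1 ∨ s.b k v = 0) :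
    (s.keep p).mutate k = (s.mutate k).keep p := by
  have hv : ((s.keep p).mutate k).var = (s.mutate k).var := by
    funext v
    by_cases hv : v = k
    · subst hv; rw [mutate_var_self, mutate_var_self, exch_keep s p h]; rfl
    · rw [mutate_var_of_ne _ hv, mutate_var_of_ne _ hv]; rfl
  calc (s.keep p).mutate k = ⟨_, _, ((s.keep p).mutate k).var, ((s.keep p).mutate k).b⟩ := rfl
    _ = (s.mutate k).keep p := by rw [hv]; rfl

/-- A vertex with the variable `1` at which one never mutates does not contribute to any exchange
relation. This compares the seeds on `SL_n` with and without the vertex `(1, 1)`. -/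
theorem keep_mutateList (s : Seed V K) (p : V → Prop) [DecidablePred p] {l : List V}
    (hl : ∀ k ∈ l, p k) (h : ∀ v ∈ s.verts, ¬p v → s.var v = 1) :
    (s.keep p).mutateList l = (s.mutateList l).keep p := by
  induction l generalizing s with
  | nil => rfl
  | cons k l ih =>
    change ((s.keep p).mutate k).mutateList l = ((s.mutate k).mutateList l).keep p
    rw [keep_mutate s p fun v hv hp => Or.inl (h v hv hp)]
    refine ih (s.mutate k) (fun j hj => hl j (by simp [hj])) fun v hv hp => ?_
    rw [mutate_var_of_ne _ (fun hvk => hp (by rw [hvk]; exact hl k (by simp)))]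
    exact h v hv hp

theorem keep_laurent_le (R : Type*) [CommRing R] [Algebra R K] (s : Seed V K) (p : V → Prop)
    [DecidablePred p] : (s.keep p).laurent R ≤ s.laurent R := by
  refine laurent_le_of_gens (fun v hv => var_mem_laurent (Finset.filter_subset _ _ hv))
    fun v hv => inv_mem_laurent ?_
  simp only [exchangeable, keep, Finset.mem_sdiff, Finset.mem_filter] at hv ⊢
  exact ⟨hv.1.1, fun hf => hv.2 ⟨hf, hv.1.2⟩⟩

/-- A frozen vertex without arrows to mutable ones stays in this state under all mutations at
mutable vertices. Every seed of the large pattern therefore restricts to one of the small pattern,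
and the Laurent ring of the restriction is smaller. -/
theorem keep_upper_le (R : Type*) [CommRing R] [Algebra R K] (s : Seed V K) (p : V → Prop)
    [DecidablePred p]
    (h : ∀ v ∈ s.verts, ¬p v → v ∈ s.frozen ∧ ∀ k ∈ s.exchangeable, s.b k v = 0) :
    (s.keep p).upper R ≤ s.upper R := by
  intro g hg
  simp only [upper, Algebra.mem_iInf] at hg ⊢
  have key : ∀ t : Seed V K, MutEquiv s t → MutEquiv (s.keep p) (t.keep p) ∧
      ∀ v ∈ t.verts, ¬p v → v ∈ t.frozen ∧ ∀ k ∈ t.exchangeable, t.b k v = 0 := by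
    intro t ht
    induction ht with
    | refl => exact ⟨.refl, h⟩
    | step t k ht hk ih =>
      obtain ⟨ih1, ih2⟩ := ih
      constructor
      · rw [← keep_mutate t p fun v hv hp => Or.inr ((ih2 v hv hp).2 k hk)]
        refine .step _ k ih1 ?_
        have hpk : p k := by
          by_contra hp
          exact (Finset.mem_sdiff.1 hk).2 (ih2 k (t.exchangeable_subset hk) hp).1
        simp only [exchangeable, keep, Finset.mem_sdiff, Finset.mem_filter] at hk ⊢
        exact ⟨⟨hk.1, hpk⟩, fun hf => hk.2 hf.1⟩
      · intro v hv hp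
        have h1 := ih2 v hv hp
        refine ⟨h1.1, fun j hj => ?_⟩
        have hvk : v ≠ k := by
          rintro rfl; exact (Finset.mem_sdiff.1 hk).2 h1.1
        by_cases hjk : j = k
        · subst hjk; rw [mutate_b_left, h1.2 j hk, neg_zero]
        · rw [mutate_b_of_ne t hjk hvk, h1.2 j hj, h1.2 k hk]; simp
  exact fun t ht => keep_laurent_le R t p (hg _ (key t ht).1)

section Iso

variable {ι : W → V} {t : Seed W K} {s : Seed V K}

theorem IsIso.mem_exchangeable (h : IsIso ι t s) {v : W} (hv : v ∈ t.verts) :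
    ι v ∈ s.exchangeable ↔ v ∈ t.exchangeable := by
  simp only [exchangeable, Finset.mem_sdiff, h.frozen_iff v hv]
  exact ⟨fun h' => ⟨hv, h'.2⟩, fun h' => ⟨h.bij.mapsTo hv, h'.2⟩⟩

theorem IsIso.exch_eq (h : IsIso ι t s) {k : W} (hk : k ∈ t.exchangeable) :
    s.exch (ι k) = t.exch k := by
  have himg : s.verts = t.verts.image ι := by
    apply Finset.coe_injective
    rw [Finset.coe_image, h.bij.image_eq]
  have key : ∀ e : ℤ → ℕ, ∏ v ∈ s.verts, s.var v ^ e (s.b (ι k) v) =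
      ∏ v ∈ t.verts, t.var v ^ e (t.b k v) := by
    intro e
    rw [himg, Finset.prod_image h.bij.injOn]
    refine Finset.prod_congr rfl fun v hv => ?_
    rw [h.var_eq v hv, h.b_eq k (t.exchangeable_subset hk) v hv
      fun hf => (Finset.mem_sdiff.1 hk).2 hf.1]
  unfold exch
  rw [key Int.toNat, key fun z => (-z).toNat]

theorem IsIso.mutate (h : IsIso ι t s) {k : W} (hk : k ∈ t.exchangeable) :
    IsIso ι (t.mutate k) (s.mutate (ι k)) := by
  have hkv := t.exchangeable_subset hk
  have hkf := (Finset.mem_sdiff.1 hk).2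
  refine ⟨h.bij, h.frozen_iff, fun v hv => ?_, fun v hv w hw hvw => ?_⟩
  · by_cases hvk : v = k
    · subst hvk
      rw [mutate_var_self, mutate_var_self, h.exch_eq hk, h.var_eq v hv]
    · rw [mutate_var_of_ne _ hvk, mutate_var_of_ne _ fun h' => hvk (h.bij.injOn hv hkv h'),
        h.var_eq v hv]
  · by_cases hvk : v = k
    · subst hvk
      rw [mutate_b_left, mutate_b_left, h.b_eq v hv w hw hvw]
    by_cases hwk : w = k
    · subst hwk
      rw [mutate_b_right, mutate_b_right, h.b_eq v hv w hw hvw]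
    rw [mutate_b_of_ne _ hvk hwk, mutate_b_of_ne _ (fun h' => hvk (h.bij.injOn hv hkv h'))
      fun h' => hwk (h.bij.injOn hw hkv h'), h.b_eq v hv w hw hvw,
      h.b_eq v hv k hkv fun hf => hkf hf.2, h.b_eq k hkv w hw fun hf => hkf hf.1]

theorem IsIso.laurent_le (R : Type*) [CommRing R] [Algebra R K] (h : IsIso ι t s) :
    t.laurent R ≤ s.laurent R := by
  refine laurent_le_of_gens (fun v hv => ?_) fun v hv => ?_
  · rw [← h.var_eq v hv]; exact var_mem_laurent (h.bij.mapsTo hv)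
  · have hv' := t.exchangeable_subset hv
    rw [← h.var_eq v hv']
    exact inv_mem_laurent ((h.mem_exchangeable hv').2 hv)

/-- Arrows between two frozen vertices never enter an exchange relation or an arrow at a mutable
vertex, so an isomorphism that ignores them is still compatible with all mutations. -/
theorem IsIso.upper_le (R : Type*) [CommRing R] [Algebra R K] (h : IsIso ι t s) :
    t.upper R ≤ s.upper R := by
  intro g hg
  simp only [upper, Algebra.mem_iInf] at hg ⊢
  intro s' hs'
  have key : ∃ t', MutEquiv t t' ∧ IsIso ι t' s' := by
    induction hs' with
    | refl => exact ⟨t, .refl, h⟩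
    | step s' k _ hk ih =>
      obtain ⟨t', ht', hi⟩ := ih
      obtain ⟨v, hv, rfl⟩ := hi.bij.surjOn (s'.exchangeable_subset hk)
      have hv' := (hi.mem_exchangeable hv).1 hk
      exact ⟨t'.mutate v, .step t' v ht' hv', hi.mutate hv'⟩
  obtain ⟨t', ht', hi⟩ := key
  exact hi.laurent_le R (hg t' ht')

end Iso

/-- The image of a seed under a field homomorphism. -/
def map (θ : K →+* L) (s : Seed V K) : Seed V L where
  verts := s.verts
  frozen := s.frozen
  var := fun v => θ (s.var v)
  b := s.b

theorem map_mutate (θ : K →+* L) (s : Seed V K) (k : V) :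
    (s.mutate k).map θ = (s.map θ).mutate k := by
  have hP : (s.map θ).exch k = θ (s.exch k) := by
    simp only [exch, map, map_add, map_prod, map_pow]
  have hv : ((s.map θ).mutate k).var = fun v => θ ((s.mutate k).var v) := by
    funext v
    by_cases hv : v = k
    · subst hv; rw [mutate_var_self, mutate_var_self, hP, map_div₀]; rfl
    · rw [mutate_var_of_ne _ hv, mutate_var_of_ne _ hv]; rfl
  symm
  calc (s.map θ).mutate k = ⟨_, _, ((s.map θ).mutate k).var, ((s.map θ).mutate k).b⟩ := rfl
    _ = (s.mutate k).map θ := by rw [hv]; rfl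

/-- Mutation is given by rational expressions and commutes with homomorphisms of fields, so all
seeds of the image pattern are images of seeds. -/
theorem map_mem_upper {R : Type*} [CommRing R] [Algebra R K] [Algebra R L] (θ : K →ₐ[R] L)
    (s : Seed V K) {g : K} (hg : g ∈ s.upper R) : θ g ∈ (s.map (θ : K →+* L)).upper R := by
  simp only [upper, Algebra.mem_iInf] at hg ⊢
  intro t ht
  have key : ∃ t', MutEquiv s t' ∧ t = t'.map (θ : K →+* L) := by
    induction ht with
    | refl => exact ⟨s, .refl, rfl⟩
    | step t k _ hk ih =>
      obtain ⟨t', ht', rfl⟩ := ih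
      exact ⟨t'.mutate k, .step t' k ht' hk, (map_mutate _ _ _).symm⟩
  obtain ⟨t', ht', rfl⟩ := key
  have hle : t'.laurent R ≤ ((t'.map (θ : K →+* L)).laurent R).comap θ := by
    refine laurent_le_of_gens (fun v hv => ?_) fun v hv => ?_
    · exact var_mem_laurent (s := t'.map (θ : K →+* L)) hv
    · rw [Subalgebra.mem_comap, map_inv₀]
      exact inv_mem_laurent (s := t'.map (θ : K →+* L)) hv
  exact hle (hg t' ht')

end Seed

/-! ### Mutation along a path in a quiver -/

namespace Seed

variable {V K : Type*} [DecidableEq V] [Field K]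

/-- The vertices that are not on the path `v 0, …, v m`. -/
def offPath (s : Seed V K) (v : ℕ → V) (m : ℕ) : Finset V :=
  s.verts.filter fun u => ∀ a ≤ m, u ≠ v a

/-- A path `v 0 → v 1 → … → v m` in the quiver without further arrows between its vertices. The
function `I a` describes the arrows from vertices off the path to `v a` after the mutations at
`v 0, …, v (a - 1)`, and `Z` those from `v 0` to vertices off the path. -/
structure IsPath (s : Seed V K) (v : ℕ → V) (m : ℕ) (I : ℕ → V → ℤ) (Z : V → ℤ) : Prop where
  mem : ∀ a ≤ m, v a ∈ s.verts
  inj : ∀ a ≤ m, ∀ b ≤ m, v a = v b → a = b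
  succ : ∀ a < m, s.b (v a) (v (a + 1)) = 1
  far : ∀ a b, a + 1 < b → b ≤ m → s.b (v a) (v b) = 0
  Z_nonneg : ∀ u ∈ s.offPath v m, 0 ≤ Z u
  I_nonneg : ∀ a < m, ∀ u ∈ s.offPath v m, 0 ≤ I a u
  I_mul_Z : ∀ u ∈ s.offPath v m, I 0 u * Z u = 0
  b_zero : ∀ u ∈ s.offPath v m, s.b (v 0) u = Z u - I 0 u
  I_succ : ∀ a, a + 1 < m → ∀ u ∈ s.offPath v m, I (a + 1) u = I a u - s.b (v (a + 1)) u

/-- The matrix after the mutations at the vertices `v 0, …, v j` of a path. -/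
structure AfterPath (s t : Seed V K) (v : ℕ → V) (m : ℕ) (I : ℕ → V → ℤ) (Z : V → ℤ) (j : ℕ) :
    Prop where
  off : ∀ u ∈ s.offPath v m, ∀ w ∈ s.offPath v m,
    t.b u w = s.b u w + I 0 u * Z w - Z u * I 0 w
  lt : ∀ a < j, ∀ u ∈ s.offPath v m,
    t.b (v a) u = I a u - I (a + 1) u - if a = 0 then Z u else 0
  last : ∀ u ∈ s.offPath v m, t.b (v j) u = I j u - if j = 0 then Z u else 0
  cur : ∀ u ∈ s.offPath v m, t.b (v (j + 1)) u = s.b (v (j + 1)) u - I j u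
  gt : ∀ a, j + 1 < a → a ≤ m → ∀ u ∈ s.offPath v m, t.b (v a) u = s.b (v a) u
  on : ∀ a b, a < b → b ≤ m →
    t.b (v a) (v b) = if b = a + 1 then (if a = j then -1 else 1) else 0

section Path

variable {s : Seed V K} {v : ℕ → V} {m : ℕ} {I : ℕ → V → ℤ} {Z : V → ℤ}

theorem offPath_ne {u : V} (hu : u ∈ s.offPath v m) {a : ℕ} (ha : a ≤ m) : u ≠ v a :=
  (Finset.mem_filter.1 hu).2 a ha

theorem offPath_mem {u : V} (hu : u ∈ s.offPath v m) : u ∈ s.verts :=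
  (Finset.mem_filter.1 hu).1

theorem mutateList_path_succ (s : Seed V K) (v : ℕ → V) (j : ℕ) :
    s.mutateList ((List.range (j + 1)).map v) =
      (s.mutateList ((List.range j).map v)).mutate (v j) := by
  rw [List.range_succ, List.map_append, mutateList_append]
  rfl

theorem Skew.mutateList {s : Seed V K} (h : s.Skew) (l : List V) : (s.mutateList l).Skew := by
  induction l generalizing s with
  | nil => exact h
  | cons k l ih => exact ih (h.mutate k)

theorem IsPath.ne (h : s.IsPath v m I Z) {a b : ℕ} (ha : a ≤ m) (hb : b ≤ m) (hab : a ≠ b) :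
    v a ≠ v b := fun e => hab (h.inj a ha b hb e)

/-- The first mutation is special: only here may arrows lead from the mutated vertex to vertices off
the path. So it is the only one that creates arrows between two vertices off the path. -/
theorem IsPath.afterPath_zero (h : s.IsPath v m I Z) (hs : s.Skew) (hm : 0 < m) :
    AfterPath s (s.mutate (v 0)) v m I Z 0 := by
  have b10 : s.b (v 1) (v 0) = -1 := by rw [hs, h.succ 0 hm]
  refine ⟨?_, fun a ha => absurd ha (Nat.not_lt_zero a), ?_, ?_, ?_, ?_⟩
  · intro u hu w hw
    rw [mutate_b_of_ne _ (offPath_ne hu hm.le) (offPath_ne hw hm.le), hs u (v 0), h.b_zero u hu,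
      h.b_zero w hw]
    -- `I 0` and `Z` are nonnegative with disjoint supports, hence they are the negative and the
    -- positive part of row `v 0`.
    have e1 : max (-(Z u - I 0 u)) 0 = I 0 u := by
      rcases mul_eq_zero.1 (h.I_mul_Z u hu) with e | e <;>
      have := h.Z_nonneg u hu <;> have := h.I_nonneg 0 hm u hu <;> omega
    have e2 : max (Z u - I 0 u) 0 = Z u := by
      rcases mul_eq_zero.1 (h.I_mul_Z u hu) with e | e <;>
      have := h.Z_nonneg u hu <;> have := h.I_nonneg 0 hm u hu <;> omega
    have e3 : max (-(Z w - I 0 w)) 0 = I 0 w := by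
      rcases mul_eq_zero.1 (h.I_mul_Z w hw) with e | e <;>
      have := h.Z_nonneg w hw <;> have := h.I_nonneg 0 hm w hw <;> omega
    have e4 : max (Z w - I 0 w) 0 = Z w := by
      rcases mul_eq_zero.1 (h.I_mul_Z w hw) with e | e <;>
      have := h.Z_nonneg w hw <;> have := h.I_nonneg 0 hm w hw <;> omega
    rw [neg_neg, e1, e2, e3, e4]
    ring
  · intro u hu
    rw [mutate_b_left, h.b_zero u hu, if_pos rfl]
    ring
  · intro u hu
    rw [mutate_b_of_ne _ (h.ne hm hm.le one_ne_zero) (offPath_ne hu hm.le), b10,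
      h.b_zero u hu]
    have e1 : max (-(Z u - I 0 u)) 0 = I 0 u := by
      rcases mul_eq_zero.1 (h.I_mul_Z u hu) with e | e <;>
      have := h.Z_nonneg u hu <;> have := h.I_nonneg 0 hm u hu <;> omega
    rw [e1]
    simp
    ring
  · intro a ha ham u hu
    rw [mutate_b_of_ne _ (h.ne ham hm.le (by omega)) (offPath_ne hu hm.le), hs (v a) (v 0),
      h.far 0 a ha ham]
    simp
  · intro a b hab hb
    by_cases ha : a = 0
    · subst ha
      rw [mutate_b_left, if_pos rfl]
      by_cases h1 : b = 0 + 1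
      · rw [if_pos h1, h1, h.succ 0 hm]
      · rw [if_neg h1, h.far 0 b (by omega) hb, neg_zero]
    · rw [mutate_b_of_ne _ (h.ne (by omega) hm.le ha) (h.ne hb hm.le (by omega)), if_neg ha,
        h.far 0 b (by omega) hb]
      by_cases h1 : b = a + 1
      · subst h1
        rw [if_pos rfl, h.succ a (by omega)]
        have : max (-s.b (v a) (v 0)) 0 * max (-(0 : ℤ)) 0 = 0 := by simp
        simp
      · rw [if_neg h1, h.far a b (by omega) hb]
        simp

/-- At the time of its mutation `v (j + 1)` has arrows to both of its neighbours on the path, and by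
`I_succ` all its arrows off the path are incoming, with multiplicities `I (j + 1)`. The mutation
thus creates arrows to the two neighbours only. The arrow between `v j` and `v (j + 1)` is restored,
and the next one is reversed. -/
theorem AfterPath.step {t : Seed V K} (h : s.IsPath v m I Z) (ht : t.Skew) {j : ℕ}
    (hj : j + 1 < m) (H : AfterPath s t v m I Z j) :
    AfterPath s (t.mutate (v (j + 1))) v m I Z (j + 1) := by
  have hc : ∀ u ∈ s.offPath v m, t.b (v (j + 1)) u = -I (j + 1) u := by
    intro u hu
    rw [H.cur u hu, h.I_succ j hj u hu]; ring
  have hl : t.b (v j) (v (j + 1)) = -1 := by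
    rw [H.on j (j + 1) (by omega) hj.le, if_pos rfl, if_pos rfl]
  have hr : t.b (v (j + 1)) (v (j + 2)) = 1 := by
    rw [H.on (j + 1) (j + 2) (by omega) hj, if_pos rfl, if_neg (by omega)]
  have hz : ∀ a < j, t.b (v a) (v (j + 1)) = 0 := by
    intro a ha
    rw [H.on a (j + 1) (by omega) hj.le, if_neg (by omega)]
  have hz' : ∀ a, j + 2 < a → a ≤ m → t.b (v (j + 1)) (v a) = 0 := by
    intro a ha ham
    rw [H.on (j + 1) a (by omega) ham, if_neg (by omega)]
  refine ⟨?_, ?_, ?_, ?_, ?_, ?_⟩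
  · intro u hu w hw
    have hu0 := h.I_nonneg _ hj u hu
    have hw0 := h.I_nonneg _ hj w hw
    rw [mutate_b_of_ne _ (offPath_ne hu hj.le) (offPath_ne hw hj.le), ht u (v (j + 1)), hc u hu, hc w hw,
      H.off u hu w hw]
    rw [max_eq_right (show -I (j + 1) w ≤ 0 by omega),
      max_eq_right (show -(- -I (j + 1) u) ≤ 0 by omega)]
    ring
  · intro a ha u hu
    have hu0 := h.I_nonneg _ hj u hu
    rw [mutate_b_of_ne _ (h.ne (by omega) hj.le (by omega)) (offPath_ne hu hj.le), hc u hu]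
    rcases Nat.lt_succ_iff_lt_or_eq.1 ha with ha | rfl
    · rw [hz a ha, H.lt a ha u hu]; simp
    · rw [hl, H.last u hu]
      rw [max_eq_left (show 0 ≤ - -I (a + 1) u by omega)]
      simp
      ring
  · intro u hu
    rw [mutate_b_left, hc u hu, if_neg (by omega)]
    ring
  · intro u hu
    have hu0 := h.I_nonneg _ hj u hu
    rw [mutate_b_of_ne _ (h.ne hj hj.le (by omega)) (offPath_ne hu hj.le), hc u hu,
      ht (v (j + 1 + 1)) (v (j + 1)), hr, H.gt (j + 1 + 1) (by omega) hj u hu,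
      max_eq_left (show 0 ≤ - -I (j + 1) u by omega)]
    simp
    ring
  · intro a ha ham u hu
    rw [mutate_b_of_ne _ (h.ne ham hj.le (by omega)) (offPath_ne hu hj.le),
      ht (v a) (v (j + 1)), hz' a (by omega) ham, H.gt a (by omega) ham u hu]
    simp
  · intro a b hab hb
    by_cases ha : a = j + 1
    · subst ha
      rw [mutate_b_left, H.on (j + 1) b hab hb, if_pos (rfl : j + 1 = j + 1),
        if_neg (show ¬ j + 1 = j by omega)]
      split_ifs <;> simp
    by_cases hbj : b = j + 1
    · subst hbj
      rw [mutate_b_right, H.on a (j + 1) hab hb, if_neg ha]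
      by_cases h1 : a = j
      · rw [if_pos (by omega), if_pos h1, if_pos (by omega), neg_neg]
      · rw [if_neg (by omega), if_neg (by omega), neg_zero]
    have hpos : ∀ c, j + 1 < c → c ≤ m → 0 ≤ t.b (v (j + 1)) (v c) := by
      intro c hc hcm
      rw [H.on (j + 1) c hc hcm, if_neg (show j + 1 ≠ j by omega)]
      split_ifs <;> simp
    rw [mutate_b_of_ne _ (h.ne (by omega) hj.le ha) (h.ne hb hj.le hbj)]
    have hprod : max (t.b (v a) (v (j + 1))) 0 * max (t.b (v (j + 1)) (v b)) 0 -
        max (-t.b (v a) (v (j + 1))) 0 * max (-t.b (v (j + 1)) (v b)) 0 = 0 := by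
      rcases lt_or_ge a j with h1 | h1
      · rw [hz a h1]; simp
      · have e1 : t.b (v a) (v (j + 1)) ≤ 0 := by
          rcases eq_or_ne a j with rfl | h2
          · rw [hl]; simp
          · rw [ht]
            have := hpos a (by omega) (by omega)
            omega
        have e2 := hpos b (by omega) hb
        rw [max_eq_right e1, max_eq_right (show -t.b (v (j + 1)) (v b) ≤ 0 by omega)]
        simp
    rw [hprod, add_zero, H.on a b hab hb, if_neg ha]
    by_cases h1 : a = j
    · rw [if_neg (by omega), if_neg (by omega)]
    · rw [if_neg h1]

/-- The mutated variables along a path: `T a` replaces the variable of `v a`. -/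
structure PathVars (s : Seed V K) (v : ℕ → V) (m : ℕ) (I : ℕ → V → ℤ) (Z : V → ℤ) (T : ℕ → K) :
    Prop where
  zero : s.var (v 0) * T 0 = ∏ u ∈ s.offPath v m, s.var u ^ (I 0 u).toNat +
    s.var (v 1) * ∏ u ∈ s.offPath v m, s.var u ^ (Z u).toNat
  succ : ∀ a, a + 1 < m → s.var (v (a + 1)) * T (a + 1) =
    ∏ u ∈ s.offPath v m, s.var u ^ (I (a + 1) u).toNat + s.var (v (a + 2)) * T a

theorem IsPath.prod_eq (h : s.IsPath v m I Z) (g : V → K) :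
    ∏ u ∈ s.verts, g u = (∏ u ∈ s.offPath v m, g u) * ∏ a ∈ Finset.range (m + 1), g (v a) := by
  rw [offPath, ← Finset.prod_filter_mul_prod_filter_not s.verts (fun u => ∀ a ≤ m, u ≠ v a)]
  congr 1
  symm
  refine Finset.prod_bij' (fun a _ => v a)
    (fun u _ => if hu : ∃ a, a ≤ m ∧ u = v a then hu.choose else 0) ?_ ?_ ?_ ?_ ?_
  · intro a ha
    have ha' : a ≤ m := by simpa [Nat.lt_succ_iff] using ha
    simp only [Finset.mem_filter, not_forall]
    exact ⟨h.mem a ha', a, ha', fun h => h rfl⟩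
  · intro u hu
    simp only [Finset.mem_filter, not_forall, not_not] at hu
    obtain ⟨_, a, ha, e⟩ := hu
    have hex : ∃ a, a ≤ m ∧ u = v a := ⟨a, ha, e⟩
    rw [dif_pos hex]
    exact Finset.mem_range.2 (Nat.lt_succ_of_le hex.choose_spec.1)
  · intro a ha
    have ha' : a ≤ m := by simpa [Nat.lt_succ_iff] using ha
    have hex : ∃ b, b ≤ m ∧ v a = v b := ⟨a, ha', rfl⟩
    rw [dif_pos hex]
    exact (h.inj _ ha' _ hex.choose_spec.1 hex.choose_spec.2).symm
  · intro u hu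
    simp only [Finset.mem_filter, not_forall, not_not] at hu
    obtain ⟨_, a, ha, e⟩ := hu
    have hex : ∃ a, a ≤ m ∧ u = v a := ⟨a, ha, e⟩
    rw [dif_pos hex]
    exact hex.choose_spec.2.symm
  · intros; rfl

/-- Since `f` and `g` have disjoint supports, the difference `g - f` determines both exponents
without cancellation. -/
theorem IsPath.exch_eq (h : s.IsPath v m I Z) {t : Seed V K} (hv : t.verts = s.verts) {k : V}
    {f g : V → ℤ} (hfg : ∀ u ∈ s.offPath v m, t.b k u = g u - f u)
    (hf : ∀ u ∈ s.offPath v m, 0 ≤ f u) (hg : ∀ u ∈ s.offPath v m, 0 ≤ g u)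
    (h0 : ∀ u ∈ s.offPath v m, f u * g u = 0) (hon : ∀ a ≤ m, 0 ≤ t.b k (v a)) :
    t.exch k = ∏ u ∈ s.offPath v m, t.var u ^ (f u).toNat +
      (∏ u ∈ s.offPath v m, t.var u ^ (g u).toNat) *
        ∏ a ∈ Finset.range (m + 1), t.var (v a) ^ (t.b k (v a)).toNat := by
  rw [exch, hv, h.prod_eq, h.prod_eq, add_comm]
  have e1 : ∏ a ∈ Finset.range (m + 1), t.var (v a) ^ (-t.b k (v a)).toNat = 1 := by
    refine Finset.prod_eq_one fun a ha => ?_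
    have := hon a (by simpa [Nat.lt_succ_iff] using ha)
    rw [Int.toNat_of_nonpos (by omega), pow_zero]
  rw [e1, mul_one]
  congr 1
  · refine Finset.prod_congr rfl fun u hu => ?_
    have := hfg u hu
    have := hf u hu
    have := hg u hu
    congr 1
    rcases mul_eq_zero.1 (h0 u hu) with e | e <;> omega
  · congr 1
    refine Finset.prod_congr rfl fun u hu => ?_
    have := hfg u hu
    have := hf u hu
    have := hg u hu
    congr 1
    rcases mul_eq_zero.1 (h0 u hu) with e | e <;> omega

/-- The form of the quiver before each mutation dictates the exchange relation listed in `PathVars`: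
one monomial is given by the incoming arrows, the other one is the product of the next variable on
the path and the preceding new one. Matrix and variables are followed together because the exchange
relation needs the current matrix. -/
theorem afterPath_mutateList (h : s.IsPath v m I Z) (hs : s.Skew) {T : ℕ → K}
    (hT : s.PathVars v m I Z T) (h0 : ∀ a < m, s.var (v a) ≠ 0) {j : ℕ} (hj : j < m) :
    AfterPath s (s.mutateList ((List.range (j + 1)).map v)) v m I Z j ∧
    (∀ u, (∀ a ≤ j, u ≠ v a) → (s.mutateList ((List.range (j + 1)).map v)).var u = s.var u) ∧
    ∀ a ≤ j, (s.mutateList ((List.range (j + 1)).map v)).var (v a) = T a := by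
  induction j with
  | zero =>
    have e : s.mutateList ((List.range (0 + 1)).map v) = s.mutate (v 0) := rfl
    rw [e]
    refine ⟨h.afterPath_zero hs hj, fun u hu => mutate_var_of_ne _ (hu 0 le_rfl), ?_⟩
    intro a ha
    obtain rfl : a = 0 := by omega
    have hon : ∀ a ≤ m, s.b (v 0) (v a) = if a = 1 then 1 else 0 := by
      intro a ha
      rcases Nat.eq_zero_or_pos a with rfl | h1
      · rw [hs.self, if_neg (by omega)]
      · split_ifs with h2
        · subst h2; exact h.succ 0 hj
        · exact h.far 0 a (by omega) ha
    rw [mutate_var_self, div_eq_iff (h0 0 hj), mul_comm (T 0), hT.zero,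
      h.exch_eq rfl h.b_zero (h.I_nonneg 0 hj) h.Z_nonneg h.I_mul_Z fun a ha => by
        rw [hon a ha]; split_ifs <;> simp]
    have e1 : ∏ a ∈ Finset.range (m + 1), s.var (v a) ^ (s.b (v 0) (v a)).toNat =
        s.var (v 1) := by
      rw [Finset.prod_eq_single 1]
      · rw [hon 1 hj, if_pos rfl]; simp
      · intro a ha h1
        rw [hon a (by simpa [Nat.lt_succ_iff] using ha), if_neg h1]; simp
      · intro h1; exact absurd (Finset.mem_range.2 (by omega)) h1
    rw [e1, mul_comm (s.var (v 1))]
  | succ j ih =>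
    obtain ⟨hA, hne, hT'⟩ := ih (by omega)
    rw [mutateList_path_succ]
    set t := s.mutateList ((List.range (j + 1)).map v) with ht
    have hts : t.Skew := hs.mutateList _
    have htv : t.verts = s.verts := mutateList_verts _ _
    refine ⟨hA.step h hts hj, ?_, ?_⟩
    · intro u hu
      rw [mutate_var_of_ne _ (hu (j + 1) le_rfl)]
      exact hne u fun a ha => hu a (by omega)
    · intro a ha
      rcases Nat.lt_or_ge a (j + 1) with h1 | h1
      · rw [mutate_var_of_ne _ (h.ne (by omega) hj.le (by omega))]
        exact hT' a (by omega)
      obtain rfl : a = j + 1 := by omega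
      have hvk : t.var (v (j + 1)) = s.var (v (j + 1)) :=
        hne _ fun a ha => h.ne hj.le (by omega) (by omega)
      have hon : ∀ a ≤ m, t.b (v (j + 1)) (v a) = if a = j ∨ a = j + 2 then 1 else 0 := by
        intro a ha
        rcases lt_trichotomy a (j + 1) with h1 | rfl | h1
        · rw [hts, hA.on a (j + 1) h1 hj.le]
          split_ifs <;> omega
        · rw [hts.self, if_neg (by omega)]
        · rw [hA.on (j + 1) a h1 ha]
          split_ifs <;> omega
      have hoff : ∀ u ∈ s.offPath v m, t.var u = s.var u := fun u hu =>
        hne u fun a ha => offPath_ne hu (by omega)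
      rw [mutate_var_self, div_eq_iff (by rw [hvk]; exact h0 _ hj), hvk, mul_comm (T (j + 1)),
        hT.succ j hj, h.exch_eq htv (f := I (j + 1)) (g := 0)
          (fun u hu => by rw [hA.cur u hu, h.I_succ j hj u hu, Pi.zero_apply]; ring)
          (h.I_nonneg _ hj) (fun _ _ => le_rfl) (fun _ _ => mul_zero _) fun a ha => by
          rw [hon a ha]; split_ifs <;> simp]
      have e1 : ∏ a ∈ Finset.range (m + 1), t.var (v a) ^ (t.b (v (j + 1)) (v a)).toNat =
          s.var (v (j + 2)) * T j := by
        rw [← Finset.prod_subset (s₁ := {j + 2, j})]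
        · rw [Finset.prod_pair (by omega), hon _ hj, hon j (by omega), if_pos (by omega),
            if_pos (by omega), hT' j le_rfl, hne (v (j + 2)) fun a ha => h.ne hj (by omega) (by omega)]
          simp
        · intro a ha
          simp only [Finset.mem_insert, Finset.mem_singleton] at ha
          exact Finset.mem_range.2 (by omega)
        · intro a ha h1
          simp only [Finset.mem_insert, Finset.mem_singleton] at h1
          rw [hon a (by simpa [Nat.lt_succ_iff] using ha), if_neg (by omega)]
          simp
      rw [e1]
      simp only [Pi.zero_apply, Int.toNat_zero, pow_zero, Finset.prod_const_one, one_mul]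
      congr 1
      exact Finset.prod_congr rfl fun u hu => by rw [hoff u hu]

end Path

end Seed

/-! ### Contiguous minors with replaced rows and columns -/

section Minors

variable {K : Type*} [CommRing K]

/-- The determinant of the contiguous `k × k` submatrix with upper left entry `x i j`. -/
def mn (x : ℕ → ℕ → K) (i j k : ℕ) : K :=
  (Matrix.of fun u v : Fin k => x (i + u) (j + v)).det

/-- Replace column `a` by `y`. -/
def updC (x : ℕ → ℕ → K) (a : ℕ) (y : ℕ → K) : ℕ → ℕ → K := fun i j => if j = a then y i else x i j

/-- Replace row `b` by `z`. -/
def updR (x : ℕ → ℕ → K) (b : ℕ) (z : ℕ → K) : ℕ → ℕ → K := fun i j => if i = b then z j else x i j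

theorem updC_self (x : ℕ → ℕ → K) (a : ℕ) (y : ℕ → K) (i : ℕ) : updC x a y i a = y i := if_pos rfl

theorem updC_of_ne (x : ℕ → ℕ → K) {a j : ℕ} (y : ℕ → K) (i : ℕ) (h : j ≠ a) :
    updC x a y i j = x i j := if_neg h

theorem updR_self (x : ℕ → ℕ → K) (a : ℕ) (y : ℕ → K) (j : ℕ) : updR x a y a j = y j := if_pos rfl

theorem updR_of_ne (x : ℕ → ℕ → K) {a i : ℕ} (y : ℕ → K) (j : ℕ) (h : i ≠ a) :
    updR x a y i j = x i j := if_neg h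

theorem mn_congr {x x' : ℕ → ℕ → K} {i j i' j' k : ℕ}
    (h : ∀ u < k, ∀ v < k, x (i + u) (j + v) = x' (i' + u) (j' + v)) :
    mn x i j k = mn x' i' j' k := by
  unfold mn
  congr 1
  ext u v
  exact h u u.2 v v.2

theorem mn_transpose (x : ℕ → ℕ → K) (i j k : ℕ) : mn (fun i j => x j i) j i k = mn x i j k := by
  unfold mn
  rw [← Matrix.det_transpose]
  rfl

@[simp] theorem mn_zero (x : ℕ → ℕ → K) (i j : ℕ) : mn x i j 0 = 1 := by simp [mn]

@[simp] theorem mn_one (x : ℕ → ℕ → K) (i j : ℕ) : mn x i j 1 = x i j := by simp [mn]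

theorem mn_updC_of_notMem (x : ℕ → ℕ → K) {a : ℕ} (y : ℕ → K) {i j k : ℕ}
    (h : a < j ∨ j + k ≤ a) : mn (updC x a y) i j k = mn x i j k :=
  mn_congr fun _ _ v hv => updC_of_ne _ _ _ (by omega)

theorem mn_updR_of_notMem (x : ℕ → ℕ → K) {b : ℕ} (z : ℕ → K) {i j k : ℕ}
    (h : b < i ∨ i + k ≤ b) : mn (updR x b z) i j k = mn x i j k :=
  mn_congr fun _ _ v hv => updR_of_ne _ _ _ (by omega)

theorem mn_updR_linear (x : ℕ → ℕ → K) {b i j k : ℕ} (h : i ≤ b ∧ b < i + k) (p q : K)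
    (z w : ℕ → K) : mn (updR x b fun j => p * z j + q * w j) i j k =
      p * mn (updR x b z) i j k + q * mn (updR x b w) i j k := by
  have e : ∀ y : ℕ → K, mn (updR x b y) i j k =
      ((Matrix.of fun u v : Fin k => x (i + u) (j + v)).updateRow ⟨b - i, by omega⟩
        fun v : Fin k => y (j + v)).det := by
    intro y
    unfold mn
    congr 1
    ext u v
    by_cases hu : (u : ℕ) = b - i
    · have hu' : u = ⟨b - i, by omega⟩ := Fin.ext hu
      rw [hu', Matrix.updateRow_self, Matrix.of_apply, updR, if_pos (by simp; omega)]
    · rw [Matrix.updateRow_ne fun h => hu (by rw [h]), Matrix.of_apply, Matrix.of_apply, updR,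
        if_neg (by omega)]
  rw [e, e, e, ← Matrix.det_updateRow_smul, ← Matrix.det_updateRow_smul,
    ← Matrix.det_updateRow_add]
  rfl

theorem mn_updR_eq_zero (x : ℕ → ℕ → K) {b c i j k : ℕ} (hb : i ≤ b ∧ b < i + k)
    (hc : i ≤ c ∧ c < i + k) (hbc : b ≠ c) : mn (updR x b (x c)) i j k = 0 := by
  unfold mn
  refine Matrix.det_zero_of_row_eq (i := ⟨b - i, by omega⟩) (j := ⟨c - i, by omega⟩) ?_ ?_
  · intro h
    have := congrArg Fin.val h
    simp at this
    omega
  · ext v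
    simp only [Matrix.of_apply, updR]
    rw [if_pos (by omega), if_neg (by omega)]
    congr 1
    omega

/-- Swapping two rows changes the sign of a minor. -/
theorem mn_swap_rows (x : ℕ → ℕ → K) {b c i j k : ℕ} (hb : i ≤ b ∧ b < i + k)
    (hc : i ≤ c ∧ c < i + k) (hbc : b ≠ c) (z w : ℕ → K) :
    mn (updR (updR x b z) c w) i j k = -mn (updR (updR x b w) c z) i j k := by
  have comm : ∀ u v : ℕ → K, updR (updR x b u) c v = updR (updR x c v) b u := by
    intro u v
    funext p q
    unfold updR
    split_ifs <;> first | rfl | omega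
  have lin1 : ∀ u u' v : ℕ → K, mn (updR (updR x b fun j => u j + u' j) c v) i j k =
      mn (updR (updR x b u) c v) i j k + mn (updR (updR x b u') c v) i j k := by
    intro u u' v
    simp only [comm]
    have := mn_updR_linear (updR x c v) (j := j) hb 1 1 u u'
    simpa using this
  have lin2 : ∀ u v v' : ℕ → K, mn (updR (updR x b u) c fun j => v j + v' j) i j k =
      mn (updR (updR x b u) c v) i j k + mn (updR (updR x b u) c v') i j k := by
    intro u v v'
    have := mn_updR_linear (updR x b u) (j := j) hc 1 1 v v'
    simpa using this
  have alt : ∀ u : ℕ → K, mn (updR (updR x b u) c u) i j k = 0 := by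
    intro u
    have := mn_updR_eq_zero (updR x b u) (j := j) hc hb hbc.symm
    convert this using 3
    funext q
    rw [updR_self]
  -- Polarisation: an alternating form that vanishes on equal arguments is skew.
  have := alt fun j => z j + w j
  rw [lin1, lin2, lin2, alt, alt] at this
  linear_combination this

/-- Expansion along a row with a single nonzero entry. -/
theorem mn_expand_row (x : ℕ → ℕ → K) {i j k p q : ℕ} (hp : p ≤ k) (hq : q ≤ k)
    (h1 : x (i + p) (j + q) = 1) (h0 : ∀ v ≤ k, v ≠ q → x (i + p) (j + v) = 0) :
    mn x i j (k + 1) = (-1) ^ (p + q) * mn (fun u v => x (if u < i + p then u else u + 1)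
      (if v < j + q then v else v + 1)) i j k := by
  unfold mn
  rw [Matrix.det_succ_row _ (⟨p, by omega⟩ : Fin (k + 1)),
    Finset.sum_eq_single (⟨q, by omega⟩ : Fin (k + 1))]
  · simp only [Matrix.of_apply, h1, mul_one]
    congr 2
    ext u v
    simp only [Matrix.submatrix_apply, Matrix.of_apply, Fin.succAbove, Fin.lt_def]
    congr 1
    · simp only [Fin.val_castSucc]
      by_cases hu : (u : ℕ) < p
      · rw [if_pos hu, if_pos (by omega)]; rfl
      · rw [if_neg hu, if_neg (by omega)]; simp [add_assoc]
    · simp only [Fin.val_castSucc]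
      by_cases hv : (v : ℕ) < q
      · rw [if_pos hv, if_pos (by omega)]; rfl
      · rw [if_neg hv, if_neg (by omega)]; simp [add_assoc]
  · intro v _ hv
    have : x (i + p) (j + v) = 0 := h0 v (by omega) fun h => hv (Fin.ext h)
    simp only [Matrix.of_apply, this]
    ring
  · intro h; exact absurd (Finset.mem_univ _) h

/-- This and the following expansions turn a minor with a unit vector as row into a smaller minor.
In this way identities between minors of different sizes become specialisations of one identity. -/
theorem mn_unit_first_first (x : ℕ → ℕ → K) {i j k : ℕ} (h1 : x i j = 1)
    (h0 : ∀ v ≤ k, v ≠ 0 → x i (j + v) = 0) : mn x i j (k + 1) = mn x (i + 1) (j + 1) k := by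
  rw [mn_expand_row x (p := 0) (q := 0) (Nat.zero_le _) (Nat.zero_le _) h1 h0]
  simp only [add_zero, pow_zero, one_mul]
  refine mn_congr fun u _ v _ => ?_
  rw [if_neg (by omega), if_neg (by omega)]
  congr 1 <;> omega

theorem mn_unit_last_last (x : ℕ → ℕ → K) {i j k : ℕ} (h1 : x (i + k) (j + k) = 1)
    (h0 : ∀ v < k, x (i + k) (j + v) = 0) : mn x i j (k + 1) = mn x i j k := by
  rw [mn_expand_row x (p := k) (q := k) le_rfl le_rfl h1 fun v hv hne => h0 v (by omega)]
  rw [← two_mul, pow_mul, neg_one_sq, one_pow, one_mul]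
  refine mn_congr fun u _ v _ => ?_
  rw [if_pos (by omega), if_pos (by omega)]

theorem mn_unit_last_first (x : ℕ → ℕ → K) {i j k : ℕ} (h1 : x (i + k) j = 1)
    (h0 : ∀ v ≤ k, v ≠ 0 → x (i + k) (j + v) = 0) :
    mn x i j (k + 1) = (-1) ^ k * mn x i (j + 1) k := by
  rw [mn_expand_row x (p := k) (q := 0) le_rfl (Nat.zero_le _) h1 h0]
  simp only [add_zero]
  congr 1
  refine mn_congr fun u _ v _ => ?_
  rw [if_pos (by omega), if_neg (by omega)]
  congr 1
  omega

theorem mn_unit_first_last (x : ℕ → ℕ → K) {i j k : ℕ} (h1 : x i (j + k) = 1)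
    (h0 : ∀ v < k, x i (j + v) = 0) :
    mn x i j (k + 1) = (-1) ^ k * mn x (i + 1) j k := by
  rw [mn_expand_row x (p := 0) (q := k) (Nat.zero_le _) le_rfl h1 fun v hv hne => h0 v (by omega)]
  simp only [add_zero, zero_add]
  congr 1
  refine mn_congr fun u _ v _ => ?_
  rw [if_neg (by omega), if_pos (by omega)]
  congr 1
  omega

/-- Deleting the second column leaves the first one next to the third one. This is expressed by a
column replacement, so that the remaining minor is still contiguous. -/
theorem mn_unit_first_second (x : ℕ → ℕ → K) {i j k : ℕ} (h1 : x i (j + 1) = 1)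
    (h0 : ∀ v ≤ k + 1, v ≠ 1 → x i (j + v) = 0) :
    mn x i j (k + 2) = -mn (updC x (j + 1) fun u => x u j) (i + 1) (j + 1) (k + 1) := by
  rw [mn_expand_row x (p := 0) (q := 1) (Nat.zero_le _) (by omega) h1 h0]
  simp only [add_zero, zero_add, pow_one, neg_one_mul, neg_inj]
  refine mn_congr fun u _ v _ => ?_
  rw [if_neg (by omega)]
  unfold updC
  by_cases hv : v = 0
  · subst hv
    rw [if_pos (by omega), if_pos (by omega)]
    congr 1
    omega
  · rw [if_neg (by omega), if_neg (by omega)]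
    congr 1 <;> omega

theorem mn_unit_last_second (x : ℕ → ℕ → K) {i j k : ℕ} (h1 : x (i + (k + 1)) (j + k) = 1)
    (h0 : ∀ v ≤ k + 1, v ≠ k → x (i + (k + 1)) (j + v) = 0) :
    mn x i j (k + 2) = -mn (updC x (j + k) fun u => x u (j + (k + 1))) i j (k + 1) := by
  rw [mn_expand_row x (p := k + 1) (q := k) le_rfl (by omega) h1 h0]
  have : (-1 : K) ^ (k + 1 + k) = -1 := by
    rw [show k + 1 + k = 2 * k + 1 by ring, pow_succ, pow_mul]; simp
  rw [this, neg_one_mul, neg_inj]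
  refine mn_congr fun u _ v _ => ?_
  rw [if_pos (by omega)]
  unfold updC
  by_cases hv : v = k
  · subst hv
    rw [if_neg (by omega), if_pos rfl]
    rfl
  · rw [if_pos (by omega), if_neg (by omega)]

/-- The three-term Plücker relation for an alternating bilinear form in which every vector is a
combination of two given ones. -/
theorem plucker_of_combination {E : Type*} (ω : E → E → K) (alt : ∀ u v, ω u v = -ω v u)
    {p q s : E} (t : E) (c d : K) (h : ∀ u, ω s u = c * ω p u + d * ω q u) (hp : ω p p = 0)
    (hq : ω q q = 0) : ω p q * ω s t = ω p s * ω q t - ω p t * ω q s := by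
  rw [alt p s, alt q s, h, h, h, hp, hq, alt q p]
  ring

end Minors

/-! ### The three-term Plücker relation -/

section Plucker

variable {K : Type*} [Field K]

/-- If the rows form a basis, `s` is a combination of them, with coefficients from the inverse
matrix. In a minor with `s` as first row the middle rows contribute nothing, since they occur twice;
only the first and the last row remain. -/
theorem mn_cramer (x : ℕ → ℕ → K) {i j k : ℕ} (h : mn x i j (k + 2) ≠ 0) (s : ℕ → K) :
    ∃ c d : K, ∀ u : ℕ → K, mn (updR (updR x i s) (i + (k + 1)) u) i j (k + 2) =
      c * mn (updR x (i + (k + 1)) u) i j (k + 2) +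
        d * mn (updR (updR x i (x (i + (k + 1)))) (i + (k + 1)) u) i j (k + 2) := by
  set A : Matrix (Fin (k + 2)) (Fin (k + 2)) K := Matrix.of fun u v => x (i + u) (j + v) with hA
  have hdet : A.det ≠ 0 := h
  set e : Fin (k + 2) → K := Matrix.vecMul (fun v : Fin (k + 2) => s (j + v)) A⁻¹ with he
  have hs : ∀ v : Fin (k + 2), s (j + v) = ∑ a, e a * x (i + a) (j + v) := by
    intro v
    have : Matrix.vecMul e A = fun v : Fin (k + 2) => s (j + v) := by
      rw [he, Matrix.vecMul_vecMul, Matrix.nonsing_inv_mul _ (Ne.isUnit hdet), Matrix.vecMul_one]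
    rw [← congrFun this v]
    rfl
  refine ⟨e 0, e (Fin.last _), fun u => ?_⟩
  have row : ∀ w : ℕ → K, mn (updR (updR x i w) (i + (k + 1)) u) i j (k + 2) =
      Matrix.detRowAlternating.toMultilinearMap.toLinearMap
        (A.updateRow (Fin.last _) fun v => u (j + v)) 0 (fun v => w (j + v)) := by
    intro w
    change mn _ _ _ _ = ((A.updateRow (Fin.last _) fun v => u (j + v)).updateRow 0 _).det
    unfold mn
    congr 1
    ext a b
    rcases Fin.eq_zero_or_eq_succ a with rfl | ⟨a, rfl⟩
    · rw [Matrix.updateRow_self]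
      simp [updR]
    · rw [Matrix.updateRow_ne (Fin.succ_ne_zero _)]
      by_cases ha : a = Fin.last k
      · subst ha
        rw [show (Fin.last k).succ = Fin.last (k + 1) from rfl, Matrix.updateRow_self]
        simp [updR]
      · have ha' : (a : ℕ) ≠ k := fun h => ha (Fin.ext h)
        rw [Matrix.updateRow_ne fun h => ha' (by simpa using congrArg Fin.val h)]
        simp [updR, hA, ha']
  have hlin : (fun v : Fin (k + 2) => s (j + v)) = ∑ a, e a • fun v : Fin (k + 2) =>
      x (i + a) (j + v) := by
    funext v
    rw [hs v, Finset.sum_apply]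
    rfl
  rw [row, hlin, map_sum, Fin.sum_univ_succ, Fin.sum_univ_castSucc]
  simp only [map_smul, smul_eq_mul, ← row]
  have hmid : ∑ a : Fin k, e a.castSucc.succ *
      mn (updR (updR x i (x (i + (a.castSucc.succ : Fin (k + 2))))) (i + (k + 1)) u) i j (k + 2) =
      0 := by
    refine Finset.sum_eq_zero fun a _ => ?_
    have hc : updR (updR x i (x (i + (a.castSucc.succ : Fin (k + 2))))) (i + (k + 1)) u =
        updR (updR x (i + (k + 1)) u) i
          ((updR x (i + (k + 1)) u) (i + (a.castSucc.succ : Fin (k + 2)))) := by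
      funext p q
      have := a.2
      simp only [updR, Fin.val_succ, Fin.val_castSucc]
      split_ifs <;> first | rfl | omega
    have := a.2
    rw [hc, mn_updR_eq_zero _ (by omega) (by simp) (by simp), mul_zero]
  simp only [Fin.val_zero, add_zero, Fin.succ_last] at hmid ⊢
  rw [hmid, zero_add]
  congr 3
  funext p q
  simp only [updR]
  split_ifs with h1 h2 <;> first | rfl | rw [h2]

/-- The three-term Plücker relation for the minors obtained by replacing the first and the last
row. -/
theorem mn_plucker (x : ℕ → ℕ → K) (i j k : ℕ) (p q s t : ℕ → K) :
    mn (updR (updR x i p) (i + (k + 1)) q) i j (k + 2) *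
        mn (updR (updR x i s) (i + (k + 1)) t) i j (k + 2) =
      mn (updR (updR x i p) (i + (k + 1)) s) i j (k + 2) *
          mn (updR (updR x i q) (i + (k + 1)) t) i j (k + 2) -
        mn (updR (updR x i p) (i + (k + 1)) t) i j (k + 2) *
          mn (updR (updR x i q) (i + (k + 1)) s) i j (k + 2) := by
  set ω : (ℕ → K) → (ℕ → K) → K := fun u v =>
    mn (updR (updR x i u) (i + (k + 1)) v) i j (k + 2) with hω
  have alt : ∀ u v, ω u v = -ω v u := fun u v =>
    mn_swap_rows x (by omega) (by omega) (by omega) u v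
  have self : ∀ u, ω u u = 0 := by
    intro u
    have := mn_updR_eq_zero (updR x i u) (b := i + (k + 1)) (c := i) (i := i) (j := j)
      (k := k + 2) (by omega) (by omega) (by omega)
    convert this using 3
    funext q
    rw [updR_self]
  have key : ∀ p q s t, ω p q ≠ 0 → ω p q * ω s t = ω p s * ω q t - ω p t * ω q s := by
    intro p q s t h
    obtain ⟨c, d, hcd⟩ := mn_cramer (updR (updR x i p) (i + (k + 1)) q) h s
    refine plucker_of_combination ω alt t c d (fun u => ?_) (self p) (self q)
    have := hcd u
    have e1 : ∀ w, updR (updR (updR (updR x i p) (i + (k + 1)) q) i w) (i + (k + 1)) u =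
        updR (updR x i w) (i + (k + 1)) u := by
      intro w
      funext a b
      unfold updR
      split_ifs <;> rfl
    have e2 : updR (updR (updR x i p) (i + (k + 1)) q) (i + (k + 1)) u =
        updR (updR x i p) (i + (k + 1)) u := by
      funext a b
      unfold updR
      split_ifs <;> rfl
    have e3 : updR (updR x i p) (i + (k + 1)) q (i + (k + 1)) = q := by
      funext b; rw [updR_self]
    rw [e1, e2, e3, e1] at this
    exact this
  change ω p q * ω s t = ω p s * ω q t - ω p t * ω q s
  -- The relation is symmetric under permutations of the vectors up to signs, so it suffices that
  -- one of the pairings of `p` with `q`, `s`, `t` is nonzero. If all three vanish, both sides are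
  -- zero.
  by_cases h1 : ω p q = 0
  · by_cases h2 : ω p s = 0
    · by_cases h3 : ω p t = 0
      · rw [h1, h2, h3]; ring
      · have := key p t q s h3
        linear_combination this + ω p q * alt s t - ω p s * alt q t
    · have := key p s q t h2
      linear_combination (-1) * this  + ω p t * alt s q
  · exact key p q s t h1

end Plucker

section Minors

variable {K : Type*} [CommRing K]

theorem updR_eq_self (x : ℕ → ℕ → K) (i : ℕ) : updR x i (x i) = x := by
  funext p q
  unfold updR
  split_ifs with h
  · rw [h]
  · rfl

/-- The Desnanot–Jacobi identity. -/
theorem mn_updC (x : ℕ → ℕ → K) (a : ℕ) (y : ℕ → K) (i j k : ℕ) :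
    mn (updC x a y) i j k = mn (updR (fun i j => x j i) a y) j i k :=
  (mn_transpose _ _ _ _).symm

theorem mn_updC_linear (x : ℕ → ℕ → K) {a i j k : ℕ} (h : j ≤ a ∧ a < j + k) (p q : K)
    (y w : ℕ → K) : mn (updC x a fun i => p * y i - q * w i) i j k =
      p * mn (updC x a y) i j k - q * mn (updC x a w) i j k := by
  have := mn_updR_linear (fun i j => x j i) (j := i) h p (-q) y w
  simp only [mn_updC, sub_eq_add_neg, ← neg_mul]
  exact this

theorem mn_updR_linear_sub (x : ℕ → ℕ → K) {b i j k : ℕ} (h : i ≤ b ∧ b < i + k) (p q : K)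
    (z w : ℕ → K) : mn (updR x b fun j => p * z j - q * w j) i j k =
      p * mn (updR x b z) i j k - q * mn (updR x b w) i j k := by
  have := mn_updR_linear x (j := j) h p (-q) z w
  simp only [sub_eq_add_neg, ← neg_mul]
  exact this

theorem mn_swap_cols_self (x : ℕ → ℕ → K) {a c i j k : ℕ} (ha : j ≤ a ∧ a < j + k)
    (hc : j ≤ c ∧ c < j + k) (hac : a ≠ c) :
    mn (updC (updC x a fun i => x i c) c fun i => x i a) i j k = -mn x i j k := by
  have := mn_swap_rows (fun i j => x j i) (j := i) ha hc hac (fun i => x i c) (fun i => x i a)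
  rw [updR_eq_self (fun i j => x j i) a, updR_eq_self (fun i j => x j i) c] at this
  rw [← mn_transpose x, ← this, mn_updC]
  rfl

theorem updC_eq_self (x : ℕ → ℕ → K) (a : ℕ) : (updC x a fun i => x i a) = x := by
  funext p q
  unfold updC
  split_ifs with h
  · rw [h]
  · rfl

/-- Given identities of the same form for `x` and for `x` with the columns `a` and `a + 1`
interchanged, one obtains by linearity the corresponding identity in which column `a` is replaced
by a linear combination of these columns. -/
theorem mn_updC_sub (x : ℕ → ℕ → K) {a i j k : ℕ} (h1 : j ≤ a) (h2 : a + 1 = j + k) (p q : K) :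
    mn (updC x a fun i => p * x i a - q * x i (a + 1)) i j k = p * mn x i j k -
      q * mn (updC (updC x a fun i => x i (a + 1)) (a + 1) fun i => x i a) i j k := by
  rw [mn_updC_linear x (by omega), updC_eq_self, mn_updC_of_notMem (updC x a _) _ (by omega)]

end Minors

/-! ### Determinantal identities behind the exchange relations -/

section Relations

variable {K : Type*} [Field K]

/-- The Plücker relation for the first row, the last row and the unit vectors of the first and of
the last column. Each unit vector cuts off a row and a column of the minor in which it is inserted.
-/
theorem mn_desnanot_jacobi (x : ℕ → ℕ → K) (i j k : ℕ) :
    mn x (i + 1) (j + 1) (k + 1) * mn x i j (k + 1) =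
      mn x i (j + 1) (k + 1) * mn x (i + 1) j (k + 1) +
        mn x i j (k + 2) * mn x (i + 1) (j + 1) k := by
  set e : ℕ → ℕ → K := fun j v => if v = j then 1 else 0 with he
  have e1 : ∀ j, e j j = 1 := fun j => if_pos rfl
  have e0 : ∀ j v, v ≠ j → e j v = 0 := fun j v h => if_neg h
  have key := mn_plucker x i j k (x i) (x (i + (k + 1))) (e j) (e (j + (k + 1)))
  rw [mn_swap_rows x (by omega) (by omega) (by omega) (x (i + (k + 1))) (e j),
    mn_swap_rows x (by omega) (by omega) (by omega) (x (i + (k + 1))) (e (j + (k + 1)))] at key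
  simp only [updR_eq_self] at key
  have h0 : ∀ w u : ℕ → K, ∀ v, updR (updR x i w) (i + (k + 1)) u i v = w v := fun w u v => by
    rw [updR_of_ne _ _ _ (by omega), updR_self]
  have hc : ∀ w u : ℕ → K, ∀ j' k', k' ≤ k + 1 →
      mn (updR (updR x i w) (i + (k + 1)) u) (i + 1) j' k' =
      mn (updR x (i + (k + 1)) u) (i + 1) j' k' := fun w u j' k' _ => by
    refine mn_congr fun p _ q _ => ?_
    unfold updR
    split_ifs <;> first | rfl | omega
  have a1 : updR x (i + (k + 1)) (x (i + (k + 1))) = x := updR_eq_self _ _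
  rw [mn_unit_first_first (updR (updR x i (e j)) (i + (k + 1)) (e (j + (k + 1))))
      (by rw [h0, e1]) (fun v _ hv => by rw [h0, e0 _ _ (by omega)]),
    hc _ _ _ _ le_rfl, mn_unit_last_last (updR x (i + (k + 1)) (e (j + (k + 1))))
      (by rw [show i + 1 + k = i + (k + 1) by ring, updR_self,
        show j + 1 + k = j + (k + 1) by ring, e1])
      (fun v hv => by rw [show i + 1 + k = i + (k + 1) by ring, updR_self, e0 _ _ (by omega)]),
    mn_updR_of_notMem x _ (by omega),
    mn_unit_last_first (updR x (i + (k + 1)) (e j)) (by rw [updR_self, e1])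
      (fun v _ hv => by rw [updR_self, e0 _ _ (by omega)]),
    mn_updR_of_notMem x _ (by omega),
    mn_unit_first_last (updR (updR x i (e (j + (k + 1)))) (i + (k + 1)) (x (i + (k + 1))))
      (by rw [h0, e1]) (fun v hv => by rw [h0, e0 _ _ (by omega)]), hc _ _ _ _ le_rfl, a1,
    mn_unit_last_last (updR x (i + (k + 1)) (e (j + (k + 1)))) (by rw [updR_self, e1])
      (fun v hv => by rw [updR_self, e0 _ _ (by omega)]),
    mn_updR_of_notMem x _ (by omega),
    mn_unit_first_first (updR (updR x i (e j)) (i + (k + 1)) (x (i + (k + 1))))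
      (by rw [h0, e1]) (fun v _ hv => by rw [h0, e0 _ _ (by omega)]), hc _ _ _ _ le_rfl, a1]
    at key
  have hsq : ((-1 : K) ^ (k + 1)) * (-1) ^ (k + 1) = 1 := by
    rw [← mul_pow]; simp
  linear_combination (-1 : K) * key + mn x i (j + 1) (k + 1) * mn x (i + 1) j (k + 1) * hsq

/-- The identity is linear in the replaced column. For the column itself it is the ordinary
identity, and for the next column it is the ordinary identity for the matrix with these two columns
interchanged, in which the minors containing both columns change sign. -/
theorem mn_desnanot_jacobi_updC (x : ℕ → ℕ → K) (i j k : ℕ) (p q : K) {y : ℕ → K}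
    (hy : ∀ i, y i = p * x i (j + (k + 1)) - q * x i (j + (k + 1) + 1)) :
    mn x (i + 1) (j + 1) (k + 2) * mn (updC x (j + (k + 1)) y) i j (k + 2) =
      mn x i (j + 1) (k + 2) * mn (updC x (j + (k + 1)) y) (i + 1) j (k + 2) +
        mn x i j (k + 3) * mn (updC x (j + (k + 1)) y) (i + 1) (j + 1) (k + 1) := by
  obtain rfl : y = fun i => p * x i (j + (k + 1)) - q * x i (j + (k + 1) + 1) := funext hy
  rw [mn_updC_sub x (by omega) (by omega), mn_updC_sub x (by omega) (by omega),
    mn_updC_sub x (by omega) (by omega)]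
  have h1 := mn_desnanot_jacobi x i j (k + 1)
  have h2 := mn_desnanot_jacobi (updC (updC x (j + (k + 1)) fun i => x i (j + (k + 1) + 1))
    (j + (k + 1) + 1) fun i => x i (j + (k + 1))) i j (k + 1)
  rw [mn_swap_cols_self x (i := i + 1) (j := j + 1) (k := k + 1 + 1) (by omega) (by omega)
    (by omega), mn_swap_cols_self x (i := i) (j := j + 1) (k := k + 1 + 1) (by omega) (by omega)
    (by omega), mn_swap_cols_self x (i := i) (j := j) (k := k + 1 + 2) (by omega) (by omega)
    (by omega)] at h2
  linear_combination p * h1 + q * h2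

theorem mn_desnanot_jacobi_updC_one (x : ℕ → ℕ → K) (i j : ℕ) (p q : K) {y : ℕ → K}
    (hy : ∀ i, y i = p * x i j - q * x i (j + 1)) :
    x (i + 1) (j + 1) * y i = x i (j + 1) * y (i + 1) + mn x i j 2 * p := by
  rw [hy, hy, mn, Matrix.det_fin_two]
  simp
  ring

/-- The unit vector with a one at `j`. -/
def unitVec (K : Type*) [Field K] (j : ℕ) : ℕ → K := fun v => if v = j then 1 else 0

theorem unitVec_self (j : ℕ) : unitVec K j j = 1 := if_pos rfl

theorem unitVec_of_ne {j v : ℕ} (h : v ≠ j) : unitVec K j v = 0 := if_neg h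

/-- The Desnanot–Jacobi identity for the matrix whose row `i` is the unit vector at column `j + 1`.
The minors that start at `(i, j)` turn into minors with column `j` in place of column `j + 1`. -/
theorem minor_relation_cols (x : ℕ → ℕ → K) (i j k : ℕ) :
    mn (updC x (j + 1) fun u => x u j) (i + 1) (j + 1) (k + 2) * mn x (i + 1) (j + 1) (k + 1) -
      mn x (i + 1) (j + 1) (k + 2) * mn (updC x (j + 1) fun u => x u j) (i + 1) (j + 1) (k + 1) =
    mn x (i + 1) j (k + 2) * mn x (i + 1) (j + 2) (k + 1) := by
  set x' := updR x i (unitVec K (j + 1)) with hx'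
  have h := mn_desnanot_jacobi x' i j (k + 1)
  have hc : ∀ l, mn (updC x' (j + 1) fun u => x' u j) (i + 1) (j + 1) l =
      mn (updC x (j + 1) fun u => x u j) (i + 1) (j + 1) l := fun l =>
    mn_congr fun u _ v _ => by
      simp only [updC]
      split_ifs <;> rw [hx', updR_of_ne _ _ _ (by omega)]
  have u1 : ∀ l, mn x' i j (l + 2) =
      -mn (updC x (j + 1) fun u => x u j) (i + 1) (j + 1) (l + 1) := fun l => by
    rw [mn_unit_first_second x' (by rw [hx', updR_self, unitVec_self])
      (fun v _ hv => by rw [hx', updR_self, unitVec_of_ne (by omega)]), hc]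
  have u2 : mn x' i (j + 1) (k + 2) = mn x (i + 1) (j + 2) (k + 1) := by
    rw [mn_unit_first_first x' (by rw [hx', updR_self, unitVec_self])
      (fun v _ hv => by rw [hx', updR_self, unitVec_of_ne (by omega)]), hx',
      mn_updR_of_notMem x _ (by omega)]
  have u3 : ∀ j' l, mn x' (i + 1) j' l = mn x (i + 1) j' l := fun j' l =>
    mn_updR_of_notMem x _ (by omega)
  rw [show k + 1 + 1 = k + 2 from rfl, show k + 1 + 2 = (k + 1) + 2 from rfl, u1, u1, u2, u3, u3,
    u3] at h
  linear_combination h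

theorem minor_relation_rows (x : ℕ → ℕ → K) (i j k : ℕ) :
    mn (updR x (i + 1) (x i)) (i + 1) (j + 1) (k + 2) * mn x (i + 1) (j + 1) (k + 1) -
      mn x (i + 1) (j + 1) (k + 2) * mn (updR x (i + 1) (x i)) (i + 1) (j + 1) (k + 1) =
    mn x i (j + 1) (k + 2) * mn x (i + 2) (j + 1) (k + 1) := by
  have h := minor_relation_cols (fun i j => x j i) j i k
  simp only [mn_updC, mn_transpose] at h
  exact h

/-- Again by linearity in the last column, from `minor_relation_rows` for `x` and for `x` with two
columns interchanged. The larger minors contain both columns, the smaller ones only the first of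
them. -/
theorem minor_relation_rows_updC (x : ℕ → ℕ → K) (i j k : ℕ) (p q : K) {y : ℕ → K}
    (hy : ∀ i, y i = p * x i (j + (k + 1)) - q * x i (j + (k + 1) + 1)) {xy : ℕ → ℕ → K}
    (hxy : xy = updC x (j + (k + 1)) y) :
    mn (updR x (i + 1) (x i)) (i + 1) (j + 1) (k + 2) * mn xy (i + 1) (j + 1) (k + 1) -
      mn x (i + 1) (j + 1) (k + 2) * mn (updR xy (i + 1) (xy i)) (i + 1) (j + 1) (k + 1) =
    mn x i (j + 1) (k + 2) * mn xy (i + 2) (j + 1) (k + 1) := by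
  subst hxy
  obtain rfl : y = fun i => p * x i (j + (k + 1)) - q * x i (j + (k + 1) + 1) := funext hy
  set a := j + (k + 1) with ha
  set xs := updC (updC x a fun i => x i (a + 1)) (a + 1) fun i => x i a with hxs
  have hcomm : ∀ y : ℕ → K, updR (updC x a y) (i + 1) ((updC x a y) i) =
      updC (updR x (i + 1) (x i)) a (fun u => if u = i + 1 then y i else y u) := by
    intro y
    funext u v
    simp only [updR, updC]
    split_ifs <;> rfl
  have e1 : updR (updC x a fun i => p * x i a - q * x i (a + 1)) (i + 1)
      ((updC x a fun i => p * x i a - q * x i (a + 1)) i) = updC (updR x (i + 1) (x i)) a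
      fun u => p * updR x (i + 1) (x i) u a - q * updR x (i + 1) (x i) u (a + 1) := by
    rw [hcomm]
    congr 1
    funext u
    simp only [updR]
    split_ifs <;> rfl
  have e2 : updC (updC (updR x (i + 1) (x i)) a fun u => updR x (i + 1) (x i) u (a + 1)) (a + 1)
      (fun u => updR x (i + 1) (x i) u a) = updR xs (i + 1) (xs i) := by
    funext u v
    rw [hxs]
    simp only [updR, updC]
    split_ifs <;> rfl
  rw [e1, mn_updC_sub x (by omega) (by omega), mn_updC_sub x (by omega) (by omega),
    mn_updC_sub (updR x (i + 1) (x i)) (by omega) (by omega), e2, ← hxs]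
  have h1 := minor_relation_rows x i j k
  have h2 := minor_relation_rows xs i j k
  rw [← e2, mn_swap_cols_self (updR x (i + 1) (x i)) (k := k + 2) (by omega) (by omega) (by omega),
    e2, hxs, mn_swap_cols_self x (i := i + 1) (k := k + 2) (by omega) (by omega) (by omega),
    mn_swap_cols_self x (i := i) (k := k + 2) (by omega) (by omega) (by omega), ← hxs] at h2
  linear_combination p * h1 + q * h2

/-- The Desnanot–Jacobi identity for the matrix whose column `j + k + 2` is a unit vector. The
minors that end there lose row `i + k + 1`, so that row `i + k + 2` takes its place. -/
theorem plucker_rows (x : ℕ → ℕ → K) (i j k : ℕ) :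
    mn x (i + 1) (j + 1) (k + 1) * mn (updR x (i + (k + 1)) (x (i + (k + 2)))) i j (k + 2) -
      mn x i j (k + 2) * mn (updR x (i + (k + 1)) (x (i + (k + 2)))) (i + 1) (j + 1) (k + 1) =
    mn x i (j + 1) (k + 1) * mn x (i + 1) j (k + 2) := by
  set x' := updC x (j + (k + 2)) (unitVec K (i + (k + 1))) with hx'
  have h := mn_desnanot_jacobi x' i j (k + 1)
  have u1 : mn x' i j (k + 3) = -mn (updR x (i + (k + 1)) (x (i + (k + 2)))) i j (k + 2) := by
    rw [← mn_transpose x', mn_unit_last_second (fun i j => x' j i)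
      (by rw [hx', updC_self, unitVec_self])
      (fun v _ hv => by rw [hx', updC_self, unitVec_of_ne (by omega)]), mn_updC]
    congr 1
    refine mn_congr fun u _ v _ => ?_
    simp only [updR]
    split_ifs <;> rw [hx', updC_of_ne _ _ _ (by omega)]
  have u2 : mn x' (i + 1) (j + 1) (k + 2) =
      -mn (updR x (i + (k + 1)) (x (i + (k + 2)))) (i + 1) (j + 1) (k + 1) := by
    rw [← mn_transpose x', mn_unit_last_second (fun i j => x' j i)
      (by rw [hx', show j + 1 + (k + 1) = j + (k + 2) by ring, updC_self,
        show i + 1 + k = i + (k + 1) by ring, unitVec_self])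
      (fun v _ hv => by
        rw [hx', show j + 1 + (k + 1) = j + (k + 2) by ring, updC_self,
          unitVec_of_ne (by omega)]), mn_updC]
    congr 1
    refine mn_congr fun u _ v _ => ?_
    rw [show i + 1 + k = i + (k + 1) by ring, show i + 1 + (k + 1) = i + (k + 2) by ring]
    simp only [updR]
    split_ifs <;> rw [hx', updC_of_ne _ _ _ (by omega)]
  have u3 : mn x' i (j + 1) (k + 2) = mn x i (j + 1) (k + 1) := by
    rw [← mn_transpose x', mn_unit_last_last (fun i j => x' j i)
      (by rw [hx', show j + 1 + (k + 1) = j + (k + 2) by ring, updC_self, unitVec_self])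
      (fun v _ => by
        rw [hx', show j + 1 + (k + 1) = j + (k + 2) by ring, updC_self,
          unitVec_of_ne (by omega)]), mn_transpose, hx', mn_updC_of_notMem x _ (by omega)]
  have u4 : ∀ i' j' k', j' + k' ≤ j + (k + 2) → mn x' i' j' k' = mn x i' j' k' :=
    fun i' j' k' h => mn_updC_of_notMem x _ (by omega)
  rw [show k + 1 + 1 = k + 2 from rfl, show k + 1 + 2 = k + 3 from rfl, u1, u2, u3,
    u4 i j _ (by omega), u4 (i + 1) j _ (by omega), u4 (i + 1) (j + 1) _ (by omega)] at h
  linear_combination h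

/-- Both products are bilinear in the coefficient vectors `(p, q)` and `(p', q')`. In their
difference only the determinant of these vectors survives, multiplied by the expression in
`plucker_rows`. -/
theorem plucker_updR (x : ℕ → ℕ → K) (i j k : ℕ) (p q p' q' : K) {z z' : ℕ → K}
    (hz : ∀ j, z j = p * x (i + (k + 1)) j - q * x (i + (k + 2)) j)
    (hz' : ∀ j, z' j = p' * x (i + (k + 1)) j - q' * x (i + (k + 2)) j) :
    mn (updR x (i + (k + 1)) z) (i + 1) (j + 1) (k + 1) *
        mn (updR x (i + (k + 1)) z') i j (k + 2) =
      mn (updR x (i + (k + 1)) z) i j (k + 2) *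
          mn (updR x (i + (k + 1)) z') (i + 1) (j + 1) (k + 1) +
        (q * p' - p * q') * (mn x i (j + 1) (k + 1) * mn x (i + 1) j (k + 2)) := by
  obtain rfl := funext hz
  obtain rfl := funext hz'
  have h := plucker_rows x i j k
  simp only [mn_updR_linear_sub x (b := i + (k + 1)) (i := i + 1) (k := k + 1) (by omega),
    mn_updR_linear_sub x (b := i + (k + 1)) (i := i) (k := k + 2) (by omega), updR_eq_self]
  linear_combination (q * p' - p * q') * h

theorem plucker_updC (x : ℕ → ℕ → K) (i j k : ℕ) (p q p' q' : K) {y y' : ℕ → K}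
    (hy : ∀ i, y i = p * x i (j + (k + 1)) - q * x i (j + (k + 2)))
    (hy' : ∀ i, y' i = p' * x i (j + (k + 1)) - q' * x i (j + (k + 2))) :
    mn (updC x (j + (k + 1)) y) (i + 1) (j + 1) (k + 1) *
        mn (updC x (j + (k + 1)) y') i j (k + 2) =
      mn (updC x (j + (k + 1)) y) i j (k + 2) *
          mn (updC x (j + (k + 1)) y') (i + 1) (j + 1) (k + 1) +
        (q * p' - p * q') * (mn x (i + 1) j (k + 1) * mn x i (j + 1) (k + 2)) := by
  have h := plucker_updR (fun i j => x j i) j i k p q p' q' hy hy'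
  simp only [mn_transpose] at h
  simp only [mn_updC]
  exact h

/-- `plucker_updR` for the matrix with a unit vector as first row, which relates minors with column
`j` to those with column `j + 1`. -/
theorem minor_relation_updR (x : ℕ → ℕ → K) (i j k : ℕ) (p q p' q' : K) {z z' : ℕ → K}
    (hz : ∀ j, z j = p * x (i + (k + 1)) j - q * x (i + (k + 2)) j)
    (hz' : ∀ j, z' j = p' * x (i + (k + 1)) j - q' * x (i + (k + 2)) j)
    {xz xz' : ℕ → ℕ → K} (hx : xz = updR x (i + (k + 1)) z) (hx' : xz' = updR x (i + (k + 1)) z') :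
    mn (updC xz (j + 1) fun u => xz u j) (i + 1) (j + 1) (k + 1) *
        mn xz' (i + 1) (j + 1) (k + 1) -
      mn xz (i + 1) (j + 1) (k + 1) *
        mn (updC xz' (j + 1) fun u => xz' u j) (i + 1) (j + 1) (k + 1) =
    (q * p' - p * q') * (mn x (i + 1) j (k + 2) * mn x (i + 1) (j + 2) k) := by
  set x' := updR x i (unitVec K (j + 1)) with hxd
  have h := plucker_updR x' i j k p q p' q' (z := z) (z' := z')
    (fun v => by rw [hz, hxd, updR_of_ne _ _ _ (by omega), updR_of_ne _ _ _ (by omega)])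
    (fun v => by rw [hz', hxd, updR_of_ne _ _ _ (by omega), updR_of_ne _ _ _ (by omega)])
  have h0 : ∀ w : ℕ → K, ∀ v, updR x' (i + (k + 1)) w i v = unitVec K (j + 1) v := fun w v => by
    rw [updR_of_ne _ _ _ (by omega), hxd, updR_self]
  have u1 : ∀ w : ℕ → K, mn (updR x' (i + (k + 1)) w) i j (k + 2) =
      -mn (updC (updR x (i + (k + 1)) w) (j + 1) fun u => updR x (i + (k + 1)) w u j)
        (i + 1) (j + 1) (k + 1) := fun w => by
    rw [mn_unit_first_second _ (by rw [h0, unitVec_self])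
      fun v _ hv => by rw [h0, unitVec_of_ne (by omega)]]
    congr 1
    refine mn_congr fun u _ v _ => ?_
    have : ∀ c, updR x' (i + (k + 1)) w (i + 1 + u) c = updR x (i + (k + 1)) w (i + 1 + u) c := by
      intro c
      unfold updR
      split_ifs
      · rfl
      · rw [hxd, updR_of_ne _ _ _ (by omega)]
    unfold updC
    split_ifs <;> exact this _
  have u2 : ∀ w : ℕ → K, mn (updR x' (i + (k + 1)) w) (i + 1) (j + 1) (k + 1) =
      mn (updR x (i + (k + 1)) w) (i + 1) (j + 1) (k + 1) := fun w => by
    refine mn_congr fun u _ v _ => ?_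
    unfold updR
    split_ifs
    · rfl
    · rw [hxd, updR_of_ne _ _ _ (by omega)]
  have u3 : mn x' i (j + 1) (k + 1) = mn x (i + 1) (j + 2) k := by
    rw [mn_unit_first_first _ (by rw [hxd, updR_self, unitVec_self])
      fun v _ hv => by rw [hxd, updR_self, unitVec_of_ne (by omega)], hxd,
      mn_updR_of_notMem x _ (by omega)]
  have u4 : mn x' (i + 1) j (k + 2) = mn x (i + 1) j (k + 2) := mn_updR_of_notMem x _ (by omega)
  rw [u1, u1, u2, u2, u3, u4, ← hx, ← hx'] at h
  linear_combination h

end Relations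

/-! ### The quivers in the course of the removal of a row -/

/-- The conditions on the parameters under which the last one of `r` rows is removed. -/
structure Par (r c a b : ℕ) : Prop where
  ha : 1 ≤ a
  hb : 1 ≤ b
  har : a + 2 ≤ r
  hac : a + 1 ≤ c
  hbc : b + 2 ≤ c
  h : (r = c ∧ a < b) ∨ (r = c + 1 ∧ b < a)

/-- The positions in use when `e` entries of the last row are left. -/
def Act (r c e : ℕ) (p : ℕ × ℕ) : Prop :=
  1 ≤ p.1 ∧ p.1 ≤ r ∧ 1 ≤ p.2 ∧ p.2 ≤ c ∧ (p.1 < r ∨ p.2 ≤ e)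

/-- The last complete row up to column `a + 1`. -/
def lastRow (r a e : ℕ) : ℕ := if a + 1 ≤ e then r else r - 1

/-- The arrows when `e` entries of the last row are left. -/
def Arr (r c a b e : ℕ) (p q : ℕ × ℕ) : Prop :=
  (¬((p.1 = 1 ∨ p.2 = 1) ∧ (q.1 = 1 ∨ q.2 = 1)) ∧
    ((q.1 = p.1 + 1 ∧ q.2 = p.2) ∨ (q.1 = p.1 ∧ q.2 = p.2 + 1) ∨
      (p.1 = q.1 + 1 ∧ p.2 = q.2 + 1))) ∨
  (p.1 = a ∧ p.2 = 1 ∧ q.1 = a + 1 ∧ q.2 = 1) ∨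
  (p.1 = 1 ∧ p.2 = b ∧ q.1 = 1 ∧ q.2 = b + 1) ∨
  (p.1 = lastRow r a e ∧ p.2 = a + 1 ∧ q.1 = 1 ∧ q.2 = b + 1) ∨
  (p.1 = 1 ∧ p.2 = b + 1 ∧ q.1 = lastRow r a e ∧ q.2 = a) ∨
  (p.1 = b + 1 ∧ p.2 = c ∧ q.1 = a + 1 ∧ q.2 = 1) ∨
  (p.1 = a + 1 ∧ p.2 = 1 ∧ q.1 = b ∧ q.2 = c)

instance (r c a b e : ℕ) (p q : ℕ × ℕ) : Decidable (Arr r c a b e p q) := by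
  unfold Arr; infer_instance

/-- The signed number of arrows from `p` to `q`. -/
def arrB (r c a b e : ℕ) (p q : ℕ × ℕ) : ℤ :=
  (if Arr r c a b e p q then 1 else 0) - (if Arr r c a b e q p then 1 else 0)

/-- The indicator function of a position. -/
def ind (x q : ℕ × ℕ) : ℤ := if q = x then 1 else 0

section

variable {r c a b e : ℕ}

theorem lastRow_spec (r a e : ℕ) :
    (a + 1 ≤ e ∧ lastRow r a e = r) ∨ (e < a + 1 ∧ lastRow r a e = r - 1) := by
  unfold lastRow
  split_ifs with h
  · exact .inl ⟨h, rfl⟩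
  · exact .inr ⟨by omega, rfl⟩

theorem ind_three {x y z q : ℕ × ℕ} (hxy : x ≠ y) (hxz : x ≠ z) (hyz : y ≠ z) {A : Prop}
    [Decidable A] (h : A ↔ q = x ∨ q = y ∨ q = z) :
    (if A then 1 else 0 : ℤ) = ind x q + ind y q + ind z q := by
  unfold ind
  by_cases h1 : q = x
  · subst h1
    rw [if_pos (h.2 (.inl rfl)), if_pos rfl, if_neg hxy, if_neg hxz]; rfl
  by_cases h2 : q = y
  · subst h2
    rw [if_pos (h.2 (.inr (.inl rfl))), if_pos rfl, if_neg h1, if_neg hyz]; rfl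
  by_cases h3 : q = z
  · subst h3
    rw [if_pos (h.2 (.inr (.inr rfl))), if_pos rfl, if_neg h1, if_neg h2]; rfl
  rw [if_neg (by tauto), if_neg h1, if_neg h2, if_neg h3]; rfl

theorem ind_two {x y q : ℕ × ℕ} (hxy : x ≠ y) {A : Prop} [Decidable A] (h : A ↔ q = x ∨ q = y) :
    (if A then 1 else 0 : ℤ) = ind x q + ind y q := by
  unfold ind
  by_cases h1 : q = x
  · subst h1
    rw [if_pos (h.2 (.inl rfl)), if_pos rfl, if_neg hxy]; rfl
  by_cases h2 : q = y
  · subst h2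
    rw [if_pos (h.2 (.inr rfl)), if_pos rfl, if_neg h1]; rfl
  rw [if_neg (by tauto), if_neg h1, if_neg h2]; rfl

/-- The excluded positions are the ends of the additional arrows in the last row and in the last
column. -/
theorem arrB_interior {i j : ℕ} (hi : 1 ≤ i) (hj : 1 ≤ j)
    (hij : ¬ (i + 1 = lastRow r a e ∧ (j = a ∨ j + 1 = a)))
    (hij' : ¬ (j + 1 = c ∧ (i = b ∨ i + 1 = b))) (q : ℕ × ℕ) :
    arrB r c a b e (i + 1, j + 1) q = ind (i + 2, j + 1) q + ind (i + 1, j + 2) q + ind (i, j) q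
      - (ind (i, j + 1) q + ind (i + 1, j) q + ind (i + 2, j + 2) q) := by
  obtain ⟨q1, q2⟩ := q
  unfold arrB
  rw [ind_three (x := (i + 2, j + 1)) (y := (i + 1, j + 2)) (z := (i, j)) (by simp) (by simp)
    (by simp), ind_three (x := (i, j + 1)) (y := (i + 1, j)) (z := (i + 2, j + 2)) (by simp)
    (by simp) (by simp)]
  all_goals
    simp only [Arr, Prod.mk.injEq]
    constructor
    · rintro (⟨_, h⟩ | h | h | h | h | h | h) <;> omega
    · intro h
      left
      omega

theorem ind_one {x q : ℕ × ℕ} {A : Prop} [Decidable A] (h : A ↔ q = x) :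
    (if A then 1 else 0 : ℤ) = ind x q := by
  unfold ind
  simp only [h]

theorem arrB_start (hP : Par r c a b) (he2 : 2 ≤ e) {q : ℕ × ℕ}
    (hq : Act r c e q) : arrB r c a b e (r, e) q = (if e = a + 1 then ind (1, b + 1) q else 0) +
      ind (r - 1, e - 1) q - (ind (r - 1, e) q + ind (r, e - 1) q) := by
  obtain ⟨q1, q2⟩ := q
  obtain ⟨ha, hb, har, hac, hbc, hh⟩ := hP
  have hρ := lastRow_spec r a e
  simp only [Act] at hq
  have h2 : Arr r c a b e (q1, q2) (r, e) ↔
      (q1, q2) = (r - 1, e) ∨ (q1, q2) = (r, e - 1) := by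
    simp only [Prod.mk.injEq]
    unfold Arr
    generalize lastRow r a e = ρ at hρ ⊢
    constructor
    · rintro (⟨_, h⟩ | h | h | h | h | h | h) <;> omega
    · intro h; left; omega
  rw [arrB, ind_two (by rw [Ne, Prod.mk.injEq]; omega) h2]
  congr 1
  by_cases h1 : e = a + 1
  · rw [if_pos h1]
    refine ind_two (by rw [Ne, Prod.mk.injEq]; omega) ?_
    simp only [Prod.mk.injEq]
    unfold Arr
    generalize lastRow r a e = ρ at hρ ⊢
    constructor
    · rintro (⟨_, h⟩ | h | h | h | h | h | h) <;> omega
    · rintro (h | h)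
      · right; right; right; left; omega
      · left; omega
  · rw [if_neg h1, zero_add]
    refine ind_one ?_
    simp only [Prod.mk.injEq]
    unfold Arr
    generalize lastRow r a e = ρ at hρ ⊢
    constructor
    · rintro (⟨_, h⟩ | h | h | h | h | h | h) <;> omega
    · intro h; left; omega

theorem arrB_firstCol (hP : Par r c a b)  {q : ℕ × ℕ}
    (hq : Act r c e q) : arrB r c a b e (a + 1, 1) q = ind (a + 1, 2) q + ind (b, c) q -
      (ind (a + 2, 2) q + ind (a, 1) q + ind (b + 1, c) q) := by
  obtain ⟨q1, q2⟩ := q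
  obtain ⟨ha, hb, har, hac, hbc, hh⟩ := hP
  have hρ := lastRow_spec r a e
  simp only [Act] at hq
  have h1 : Arr r c a b e (a + 1, 1) (q1, q2) ↔ (q1, q2) = (a + 1, 2) ∨ (q1, q2) = (b, c) := by
    simp only [Prod.mk.injEq]
    unfold Arr
    generalize lastRow r a e = ρ at hρ ⊢
    constructor
    · rintro (⟨_, h⟩ | h | h | h | h | h | h) <;> omega
    · rintro (h | h)
      · left; omega
      · right; right; right; right; right; right; omega
  have h2 : Arr r c a b e (q1, q2) (a + 1, 1) ↔ (q1, q2) = (a + 2, 2) ∨ (q1, q2) = (a, 1) ∨ (q1, q2) = (b + 1, c) := by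
    simp only [Prod.mk.injEq]
    unfold Arr
    generalize lastRow r a e = ρ at hρ ⊢
    constructor
    · rintro (⟨_, h⟩ | h | h | h | h | h | h) <;> omega
    · rintro (h | h | h)
      · left; omega
      · right; left; omega
      · right; right; right; right; right; left; omega
  rw [arrB, ind_two (by rw [Ne, Prod.mk.injEq]; omega) h1,
    ind_three (by rw [Ne, Prod.mk.injEq]; omega) (by rw [Ne, Prod.mk.injEq]; omega) (by rw [Ne, Prod.mk.injEq]; omega) h2]

theorem arrB_firstRow (hP : Par r c a b)  {q : ℕ × ℕ}
    (hq : Act r c e q) : arrB r c a b e (1, b + 1) q = ind (2, b + 1) q + ind (lastRow r a e, a) q -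
      (ind (2, b + 2) q + ind (1, b) q + ind (lastRow r a e, a + 1) q) := by
  obtain ⟨q1, q2⟩ := q
  obtain ⟨ha, hb, har, hac, hbc, hh⟩ := hP
  have hρ := lastRow_spec r a e
  simp only [Act] at hq
  have h1 : Arr r c a b e (1, b + 1) (q1, q2) ↔ (q1, q2) = (2, b + 1) ∨ (q1, q2) = (lastRow r a e, a) := by
    simp only [Prod.mk.injEq]
    unfold Arr
    generalize lastRow r a e = ρ at hρ ⊢
    constructor
    · rintro (⟨_, h⟩ | h | h | h | h | h | h) <;> omega
    · rintro (h | h)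
      · left; omega
      · right; right; right; right; left; omega
  have h2 : Arr r c a b e (q1, q2) (1, b + 1) ↔ (q1, q2) = (2, b + 2) ∨ (q1, q2) = (1, b) ∨ (q1, q2) = (lastRow r a e, a + 1) := by
    simp only [Prod.mk.injEq]
    unfold Arr
    generalize lastRow r a e = ρ at hρ ⊢
    constructor
    · rintro (⟨_, h⟩ | h | h | h | h | h | h) <;> omega
    · rintro (h | h | h)
      · left; omega
      · right; right; left; omega
      · right; right; right; left; omega
  rw [arrB, ind_two (by rw [Ne, Prod.mk.injEq]; omega) h1,
    ind_three (by rw [Ne, Prod.mk.injEq]; omega) (by rw [Ne, Prod.mk.injEq]; omega) (by rw [Ne, Prod.mk.injEq]; omega) h2]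

theorem arrB_lastCol (hP : Par r c a b) (hb2 : 2 ≤ b) {q : ℕ × ℕ}
    (hq : Act r c e q) : arrB r c a b e (b, c) q = ind (b + 1, c) q + ind (b - 1, c - 1) q -
      (ind (b - 1, c) q + ind (b, c - 1) q + ind (a + 1, 1) q) := by
  obtain ⟨q1, q2⟩ := q
  obtain ⟨ha, hb, har, hac, hbc, hh⟩ := hP
  have hρ := lastRow_spec r a e
  simp only [Act] at hq
  have h1 : Arr r c a b e (b, c) (q1, q2) ↔ (q1, q2) = (b + 1, c) ∨ (q1, q2) = (b - 1, c - 1) := by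
    simp only [Prod.mk.injEq]
    unfold Arr
    generalize lastRow r a e = ρ at hρ ⊢
    constructor
    · rintro (⟨_, h⟩ | h | h | h | h | h | h) <;> omega
    · rintro (h | h)
      · left; omega
      · left; omega
  have h2 : Arr r c a b e (q1, q2) (b, c) ↔ (q1, q2) = (b - 1, c) ∨ (q1, q2) = (b, c - 1) ∨ (q1, q2) = (a + 1, 1) := by
    simp only [Prod.mk.injEq]
    unfold Arr
    generalize lastRow r a e = ρ at hρ ⊢
    constructor
    · rintro (⟨_, h⟩ | h | h | h | h | h | h) <;> omega
    · rintro (h | h | h)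
      · left; omega
      · left; omega
      · right; right; right; right; right; right; omega
  rw [arrB, ind_two (by rw [Ne, Prod.mk.injEq]; omega) h1,
    ind_three (by rw [Ne, Prod.mk.injEq]; omega) (by rw [Ne, Prod.mk.injEq]; omega) (by rw [Ne, Prod.mk.injEq]; omega) h2]

/-- Under `e + a = r` and `c = 2 * b` both alternatives of `Par` give `lastRow r a e = c`: either `r
= c` and the last row still reaches column `a + 1`, or `r = c + 1` and it does not. -/
theorem arrB_lastRow (hP : Par r c a b) (he : e + a = r) (hcb : c = 2 * b) (ha2 : 2 ≤ a) {q : ℕ × ℕ}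
    (hq : Act r c e q) : arrB r c a b e (c, a) q = ind (c, a + 1) q + ind (c - 1, a - 1) q -
      (ind (c - 1, a) q + ind (c, a - 1) q + ind (1, b + 1) q) := by
  obtain ⟨q1, q2⟩ := q
  obtain ⟨ha, hb, har, hac, hbc, hh⟩ := hP
  have hρ := lastRow_spec r a e
  simp only [Act] at hq
  have h1 : Arr r c a b e (c, a) (q1, q2) ↔ (q1, q2) = (c, a + 1) ∨ (q1, q2) = (c - 1, a - 1) := by
    simp only [Prod.mk.injEq]
    unfold Arr
    generalize lastRow r a e = ρ at hρ ⊢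
    constructor
    · rintro (⟨_, h⟩ | h | h | h | h | h | h) <;> omega
    · rintro (h | h)
      · left; omega
      · left; omega
  have h2 : Arr r c a b e (q1, q2) (c, a) ↔ (q1, q2) = (c - 1, a) ∨ (q1, q2) = (c, a - 1) ∨ (q1, q2) = (1, b + 1) := by
    simp only [Prod.mk.injEq]
    unfold Arr
    generalize lastRow r a e = ρ at hρ ⊢
    constructor
    · rintro (⟨_, h⟩ | h | h | h | h | h | h) <;> omega
    · rintro (h | h | h)
      · left; omega
      · left; omega
      · right; right; right; right; left; omega
  rw [arrB, ind_two (by rw [Ne, Prod.mk.injEq]; omega) h1,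
    ind_three (by rw [Ne, Prod.mk.injEq]; omega) (by rw [Ne, Prod.mk.injEq]; omega) (by rw [Ne, Prod.mk.injEq]; omega) h2]

end

/-! ### The paths: positions, lengths and neighbouring arrows -/

/-- The path that starts at `(r, e)`. -/
def pathPos (r c a b e k : ℕ) : ℕ × ℕ :=
  if k < e then (r - k, e - k)
  else if k < e + b then (b - (k - e), c - (k - e))
  else (c - (k - e - b), a - (k - e - b))

/-- The number of mutations along the path that starts at `(r, e)`. -/
def pathLen (r c a b e : ℕ) : ℕ :=
  if e + a = r then (if c = 2 * b then e + b + a - 1 else e + b - 1) else e - 1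

/-- The positions off the path with an arrow to the `k`-th position of the path, when the preceding
vertices have been mutated. -/
def pathIn (r c a b e k : ℕ) : List (ℕ × ℕ) :=
  if k < e then
    if e + a = r ∧ k + 1 = e then [(a, 1), (a + 2, 1), (b + 1, c)]
    else [(r - k - 1, e - k), (r - k, e - k - 1)]
  else if k < e + b then
    if c = 2 * b ∧ k + 1 = e + b then [(1, b), (1, b + 2), (c, a + 1), (a, 1), (a + 2, 1)]
    else [(b - (k - e) - 1, c - (k - e)), (b - (k - e), c - (k - e) - 1), (a, 1), (a + 2, 1)]
  else [(c - (k - e - b) - 1, a - (k - e - b)), (c - (k - e - b), a - (k - e - b) - 1),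
    (a, 1), (a + 2, 1), (1, b), (1, b + 2)]

/-- The number of occurrences of `q` in a list of positions. -/
def cnt (l : List (ℕ × ℕ)) (q : ℕ × ℕ) : ℤ := (l.map fun x => ind x q).sum

section

variable {r c a b e : ℕ}

theorem pathPos_seg1 {k : ℕ} (h : k < e) : pathPos r c a b e k = (r - k, e - k) := if_pos h

theorem pathPos_seg2 {k : ℕ} (h : k < b) : pathPos r c a b e (e + k) = (b - k, c - k) := by
  rw [pathPos, if_neg (by omega), if_pos (by omega)]
  simp

theorem pathPos_seg3 (k : ℕ) : pathPos r c a b e (e + b + k) = (c - k, a - k) := by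
  rw [pathPos, if_neg (by omega), if_neg (by omega), show e + b + k - e - b = k by omega]

theorem pathIn_seg1 {k : ℕ} (h : k < e) (h' : e + a ≠ r ∨ k + 1 ≠ e) :
    pathIn r c a b e k = [(r - k - 1, e - k), (r - k, e - k - 1)] := by
  rw [pathIn, if_pos h, if_neg (by omega)]

theorem pathIn_firstCol {k : ℕ} (h : k + 1 = e) (h' : e + a = r) :
    pathIn r c a b e k = [(a, 1), (a + 2, 1), (b + 1, c)] := by
  rw [pathIn, if_pos (by omega), if_pos (by omega)]

theorem pathIn_seg2 {k : ℕ} (h : k < b) (h' : c ≠ 2 * b ∨ k + 1 ≠ b) :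
    pathIn r c a b e (e + k) = [(b - k - 1, c - k), (b - k, c - k - 1), (a, 1), (a + 2, 1)] := by
  rw [pathIn, if_neg (by omega), if_pos (by omega), if_neg (by omega)]
  simp

theorem pathIn_firstRow {k : ℕ} (h : k + 1 = e + b) (hb : 1 ≤ b) (h' : c = 2 * b) :
    pathIn r c a b e k = [(1, b), (1, b + 2), (c, a + 1), (a, 1), (a + 2, 1)] := by
  rw [pathIn, if_neg (by omega), if_pos (by omega), if_pos (by omega)]

theorem pathIn_seg3 (k : ℕ) : pathIn r c a b e (e + b + k) =
    [(c - k - 1, a - k), (c - k, a - k - 1), (a, 1), (a + 2, 1), (1, b), (1, b + 2)] := by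
  rw [pathIn, if_neg (by omega), if_neg (by omega), show e + b + k - e - b = k by omega]

/-- A case distinction for the steps of the path. -/
theorem path_cases (hP : Par r c a b) (he : 2 ≤ e) (_hec : e ≤ c) {k : ℕ}
    (hk : k < pathLen r c a b e) :
    (k + 1 < e) ∨ (k + 1 = e ∧ e + a = r) ∨ (∃ s, k = e + s ∧ s + 1 < b ∧ e + a = r) ∨
    (k + 1 = e + b ∧ e + a = r ∧ c = 2 * b) ∨
    (∃ s, k = e + b + s ∧ s + 1 < a ∧ e + a = r ∧ c = 2 * b) := by
  obtain ⟨ha, hb, har, hac, hbc, hh⟩ := hP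
  unfold pathLen at hk
  by_cases h1 : k + 1 < e
  · exact .inl h1
  by_cases h2 : k + 1 = e
  · right; left; refine ⟨h2, ?_⟩; split_ifs at hk <;> omega
  by_cases h3 : k + 1 < e + b
  · right; right; left; refine ⟨k - e, by omega, by omega, ?_⟩; split_ifs at hk <;> omega
  by_cases h4 : k + 1 = e + b
  · right; right; right; left; refine ⟨h4, ?_⟩; split_ifs at hk <;> omega
  · right; right; right; right; refine ⟨k - e - b, by omega, ?_⟩; split_ifs at hk <;> omega

theorem pathLen_pos (hP : Par r c a b) (he : 2 ≤ e) : 1 ≤ pathLen r c a b e := by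
  obtain ⟨ha, hb, har, hac, hbc, hh⟩ := hP
  unfold pathLen
  split_ifs <;> omega

theorem pathLen_le : pathLen r c a b e ≤ e + b + a := by
  unfold pathLen
  split_ifs <;> omega

theorem act_pathPos (hP : Par r c a b) (he : 2 ≤ e) (hec : e ≤ c) {k : ℕ}
    (hk : k ≤ pathLen r c a b e) : Act r c e (pathPos r c a b e k) := by
  obtain ⟨ha, hb, har, hac, hbc, hh⟩ := hP
  unfold pathLen at hk
  unfold pathPos Act
  split_ifs at * <;> dsimp only <;> omega

/-- Only the first position of the path is not in use any more afterwards. -/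
theorem act_pathPos_succ (hP : Par r c a b) (he : 2 ≤ e) (hec : e ≤ c) {k : ℕ} (hk1 : 1 ≤ k)
    (hk : k ≤ pathLen r c a b e) : Act r c (e - 1) (pathPos r c a b e k) := by
  obtain ⟨ha, hb, har, hac, hbc, hh⟩ := hP
  unfold pathLen at hk
  unfold pathPos Act
  split_ifs at * <;> dsimp only <;> omega

theorem pathPos_zero (he : 2 ≤ e) : pathPos r c a b e 0 = (r, e) := by
  rw [pathPos_seg1 (by omega)]; simp

theorem pathPos_inj (hP : Par r c a b) (he : 2 ≤ e) (hec : e ≤ c) {k l : ℕ}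
    (hk : k ≤ pathLen r c a b e) (hl : l ≤ pathLen r c a b e)
    (h : pathPos r c a b e k = pathPos r c a b e l) : k = l := by
  obtain ⟨ha, hb, har, hac, hbc, hh⟩ := hP
  unfold pathLen at hk hl
  unfold pathPos at h
  by_contra hne
  split_ifs at * <;> rw [Prod.mk.injEq] at h <;> omega

theorem not_isStable_pathPos (hP : Par r c a b) (he : 2 ≤ e) (hec : e ≤ c) {k : ℕ}
    (hk : k < pathLen r c a b e) : ¬ IsStable a b (pathPos r c a b e k) := by
  unfold IsStable
  simp only [Ne, Prod.ext_iff, not_and]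
  rcases path_cases hP he hec hk with h | ⟨h, h'⟩ | ⟨s, rfl, h, h'⟩ | ⟨h, h', h''⟩ |
    ⟨s, rfl, h, h', h''⟩
  all_goals obtain ⟨ha, hb, har, hac, hbc, hh⟩ := hP
  · rw [pathPos_seg1 (by omega)]; dsimp only; omega
  · rw [pathPos_seg1 (by omega)]; dsimp only; omega
  · rw [pathPos_seg2 (by omega)]; dsimp only; omega
  · obtain rfl : k = e + (b - 1) := by omega
    rw [pathPos_seg2 (by omega)]; dsimp only; omega
  · rw [pathPos_seg3]; dsimp only; omega

theorem isStable_pathPos_last (hP : Par r c a b) (he : 2 ≤ e) (hec : e ≤ c) :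
    IsStable a b (pathPos r c a b e (pathLen r c a b e)) := by
  obtain ⟨ha, hb, har, hac, hbc, hh⟩ := hP
  unfold IsStable pathPos pathLen
  simp only [Ne, Prod.ext_iff]
  split_ifs <;> dsimp only <;> omega

theorem next_pathPos (hP : Par r c a b) (he : 2 ≤ e) (hec : e ≤ c) {k : ℕ}
    (hk : k < pathLen r c a b e) :
    next a b c c (pathPos r c a b e k) = pathPos r c a b e (k + 1) := by
  rcases path_cases hP he hec hk with h | ⟨h, h'⟩ | ⟨s, rfl, h, h'⟩ | ⟨h, h', h''⟩ |
    ⟨s, rfl, h, h', h''⟩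
  all_goals obtain ⟨ha, hb, har, hac, hbc, hh⟩ := hP
  · rw [pathPos_seg1 (by omega), pathPos_seg1 (by omega), next,
      if_neg (by rw [Prod.mk.injEq]; omega), if_neg (by rw [Prod.mk.injEq]; omega)]
    rfl
  · subst h
    rw [pathPos_seg1 (by omega), show k + 1 = k + 1 + 0 by rfl, pathPos_seg2 (by omega), next,
      if_pos (by rw [Prod.mk.injEq]; omega)]
    rfl
  · rw [pathPos_seg2 (by omega), add_assoc, pathPos_seg2 (by omega), next,
      if_neg (by rw [Prod.mk.injEq]; omega), if_neg (by rw [Prod.mk.injEq]; omega)]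
    rfl
  · rw [h, show e + b = e + b + 0 by rfl, pathPos_seg3, show k = e + (b - 1) by omega,
      pathPos_seg2 (by omega), next, if_neg (by rw [Prod.mk.injEq]; omega),
      if_pos (by rw [Prod.mk.injEq]; omega)]
    rfl
  · rw [pathPos_seg3, add_assoc, pathPos_seg3, next,
      if_neg (by rw [Prod.mk.injEq]; omega), if_neg (by rw [Prod.mk.injEq]; omega)]
    rfl

/-- The recursive path with a bounded number of steps is identified with a closed formula for its
positions; any bound not smaller than the length will do. -/
theorem path_eq_map {P : ℕ → ℕ × ℕ} {α β r c m N : ℕ} (hN : m ≤ N)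
    (h1 : ∀ k < m, ¬ IsStable α β (P k)) (h2 : ∀ k < m, next α β r c (P k) = P (k + 1))
    (h3 : IsStable α β (P m)) : path α β r c N (P 0) = (List.range (m + 1)).map P := by
  induction m generalizing P N with
  | zero =>
    cases N with
    | zero => rfl
    | succ N => rw [path, if_pos h3]; rfl
  | succ m ih =>
    obtain ⟨N, rfl⟩ : ∃ M, N = M + 1 := ⟨N - 1, by omega⟩
    rw [path, if_neg (h1 0 (Nat.succ_pos _)), h2 0 (Nat.succ_pos _),
      ih (P := fun k => P (k + 1)) (by omega) (fun k hk => h1 (k + 1) (by omega))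
        (fun k hk => h2 (k + 1) (by omega)) h3, List.range_succ_eq_map (n := m + 1)]
    simp [List.map_map, Function.comp_def]

theorem path_eq_pathPos (hP : Par r c a b) (he : 2 ≤ e) (hec : e ≤ c) {N : ℕ}
    (hN : e + b + a ≤ N) : path a b c c N (r, e) =
      (List.range (pathLen r c a b e + 1)).map (pathPos r c a b e) := by
  rw [← pathPos_zero (r := r) (c := c) (a := a) (b := b) he]
  exact path_eq_map (pathLen_le.trans hN) (fun k hk => not_isStable_pathPos hP he hec hk)
    (fun k hk => next_pathPos hP he hec hk) (isStable_pathPos_last hP he hec)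

end

section

variable {r c a b e : ℕ}

theorem ind_of_ne {x q : ℕ × ℕ} (h : q ≠ x) : ind x q = 0 := if_neg h

/-- The arrows at the first position of the path. -/
theorem arrB_path_zero (hP : Par r c a b) (he : 2 ≤ e) {q : ℕ × ℕ}
    (hq : Act r c e q) (hoff : ∀ k ≤ pathLen r c a b e, q ≠ pathPos r c a b e k) :
    arrB r c a b e (r, e) q = (if e = a + 1 then ind (1, b + 1) q else 0) -
      cnt (pathIn r c a b e 0) q := by
  have h1 := hoff 1 (pathLen_pos hP he)
  rw [pathPos_seg1 (by omega)] at h1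
  rw [arrB_start hP he hq, ind_of_ne h1, pathIn_seg1 (by omega) (by omega)]
  simp [cnt]

/-- The recursion for the arrows into the positions of the path. -/
theorem cnt_pathIn_succ (hP : Par r c a b) (he : 2 ≤ e) (hec : e ≤ c) {k : ℕ}
    (hk : k + 1 < pathLen r c a b e) {q : ℕ × ℕ} (hq : Act r c e q)
    (hoff : ∀ k ≤ pathLen r c a b e, q ≠ pathPos r c a b e k) :
    cnt (pathIn r c a b e (k + 1)) q =
      cnt (pathIn r c a b e k) q - arrB r c a b e (pathPos r c a b e (k + 1)) q := by
  have hρ := lastRow_spec r a e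
  -- Of the neighbours of position `k + 1`, those on the path itself do not matter for `q`. The
  -- outgoing arrows that remain lead to in-neighbours of the preceding step and cancel them; the
  -- incoming ones are new in-neighbours. The frozen positions that are not cancelled, such as `(a,
  -- 1)` and `(a + 2, 1)`, stay in the list from then on.
  have o0 := ind_of_ne (hoff k (by omega))
  have o1 := ind_of_ne (hoff (k + 1) (by omega))
  have o2 := ind_of_ne (hoff (k + 2) (by omega))
  rcases path_cases hP he hec hk with h | ⟨h, h'⟩ | ⟨s, hs, h, h'⟩ | ⟨h, h', h''⟩ |
    ⟨s, hs, h, h', h''⟩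
  all_goals have ⟨ha, hb, har, hac, hbc, hh⟩ := hP
  · rw [pathIn_seg1 (by omega) (by omega), pathIn_seg1 (by omega) (by omega),
      pathPos_seg1 (by omega)]
    rw [pathPos_seg1 (by omega)] at o0 o2
    obtain ⟨i, hi⟩ : ∃ i, r - k = i + 2 := ⟨r - k - 2, by omega⟩
    obtain ⟨j, hj⟩ : ∃ j, e - k = j + 2 := ⟨e - k - 2, by omega⟩
    rw [hi, hj] at o0
    rw [show r - (k + 2) = i by omega, show e - (k + 2) = j by omega] at o2
    rw [show r - (k + 1) = i + 1 by omega, show e - (k + 1) = j + 1 by omega, hi, hj,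
      arrB_interior (by omega) (by omega) (by omega) (by omega), o0, o2]
    simp [cnt]
    ring
  · rw [pathIn_firstCol h h', pathIn_seg1 (by omega) (by omega), pathPos_seg1 (by omega)]
    rw [pathPos_seg1 (by omega)] at o0
    rw [show k + 2 = e + 0 by omega, pathPos_seg2 (by omega)] at o2
    rw [show r - (k + 1) = a + 1 by omega, show e - (k + 1) = 1 by omega, arrB_firstCol hP hq,
      show r - k = a + 2 by omega, show e - k = 2 by omega]
    rw [show r - k = a + 2 by omega, show e - k = 2 by omega] at o0
    simp only [Nat.sub_zero] at o2
    rw [o0, o2]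
    simp [cnt]
    ring
  · rcases Nat.eq_zero_or_pos s with rfl | hs0
    · obtain rfl : e = k + 1 := by omega
      have e1 := pathIn_seg2 (r := r) (c := c) (a := a) (b := b) (e := k + 1) (k := 0) (by omega)
        (by omega)
      have e2 := pathPos_seg2 (r := r) (c := c) (a := a) (b := b) (e := k + 1) (k := 0) (by omega)
      simp only [Nat.add_zero, Nat.sub_zero] at e1 e2
      rw [e1, e2, pathIn_firstCol (by omega) h']
      rw [pathPos_seg1 (by omega), show r - k = a + 1 by omega, show k + 1 - k = 1 by omega] at o0
      rw [show k + 2 = k + 1 + 1 by rfl, pathPos_seg2 (by omega)] at o2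
      rw [arrB_lastCol hP (by omega) hq, o0, o2]
      simp [cnt]
      ring
    · obtain ⟨s, rfl⟩ : ∃ t, s = t + 1 := ⟨s - 1, by omega⟩
      obtain rfl : k = e + s := by omega
      rw [pathIn_seg2 (by omega) (by omega), add_assoc, pathIn_seg2 (by omega) (by omega),
        pathPos_seg2 (by omega)]
      rw [pathPos_seg2 (by omega)] at o0
      rw [add_assoc, pathPos_seg2 (by omega)] at o2
      obtain ⟨i, hi⟩ : ∃ i, b - s = i + 2 := ⟨b - s - 2, by omega⟩
      obtain ⟨j, hj⟩ : ∃ j, c - s = j + 2 := ⟨c - s - 2, by omega⟩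
      rw [hi, hj] at o0
      rw [show b - (s + 2) = i by omega, show c - (s + 2) = j by omega] at o2
      rw [show b - (s + 1) = i + 1 by omega, show c - (s + 1) = j + 1 by omega, hi, hj,
        arrB_interior (by omega) (by omega) (by omega) (by omega), o0, o2]
      simp [cnt]
      ring
  · rcases Nat.lt_or_ge 1 b with hb1 | hb1
    · rw [pathIn_firstRow (by omega) hb h'', show k = e + (b - 2) by omega,
        pathIn_seg2 (by omega) (by omega), add_assoc, pathPos_seg2 (by omega)]
      rw [show k = e + (b - 2) by omega, pathPos_seg2 (by omega)] at o0
      rw [show k + 2 = e + b + 0 by omega, pathPos_seg3] at o2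
      rw [show b - (b - 2) = 2 by omega, show c - (b - 2) = b + 2 by omega] at o0
      rw [show b - (b - 2) = 2 by omega, show c - (b - 2) = b + 2 by omega,
        show b - (b - 2 + 1) = 1 by omega, show c - (b - 2 + 1) = b + 1 by omega,
        arrB_firstRow hP hq, o0, show lastRow r a e = c by omega]
      simp only [Nat.sub_zero] at o2
      rw [o2]
      simp [cnt]
      ring
    · omega
  · rcases Nat.eq_zero_or_pos s with rfl | hs0
    · rw [hs, pathIn_seg3, pathPos_seg3, pathIn_firstRow (k := k) (by omega) hb h'']
      rw [show k = e + (b - 1) by omega, pathPos_seg2 (by omega)] at o0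
      rw [show b - (b - 1) = 1 by omega, show c - (b - 1) = b + 1 by omega] at o0
      rw [show k + 2 = e + b + 1 by omega, pathPos_seg3] at o2
      simp only [Nat.sub_zero]
      rw [arrB_lastRow hP h' h'' (by omega) hq, o0, o2]
      simp [cnt]
      ring
    · obtain ⟨s, rfl⟩ : ∃ t, s = t + 1 := ⟨s - 1, by omega⟩
      obtain rfl : k = e + b + s := by omega
      rw [pathIn_seg3, add_assoc, pathIn_seg3, pathPos_seg3]
      rw [pathPos_seg3] at o0
      rw [add_assoc, pathPos_seg3] at o2
      obtain ⟨i, hi⟩ : ∃ i, c - s = i + 2 := ⟨c - s - 2, by omega⟩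
      obtain ⟨j, hj⟩ : ∃ j, a - s = j + 2 := ⟨a - s - 2, by omega⟩
      rw [hi, hj] at o0
      rw [show c - (s + 2) = i by omega, show a - (s + 2) = j by omega] at o2
      rw [show c - (s + 1) = i + 1 by omega, show a - (s + 1) = j + 1 by omega, hi, hj,
        arrB_interior (by omega) (by omega) (by omega) (by omega), o0, o2]
      simp [cnt]
      ring

end

section

variable {r c a b e : ℕ}

theorem arr_path_succ (hP : Par r c a b) (he : 2 ≤ e) (hec : e ≤ c) {k : ℕ}
    (hk : k < pathLen r c a b e) :
    Arr r c a b e (pathPos r c a b e k) (pathPos r c a b e (k + 1)) := by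
  have hρ := lastRow_spec r a e
  rcases path_cases hP he hec hk with h | ⟨h, h'⟩ | ⟨s, rfl, h, h'⟩ | ⟨h, h', h''⟩ |
    ⟨s, rfl, h, h', h''⟩
  all_goals obtain ⟨ha, hb, har, hac, hbc, hh⟩ := hP
  · rw [pathPos_seg1 (by omega), pathPos_seg1 (by omega)]
    left; dsimp only; omega
  · subst h
    rw [pathPos_seg1 (by omega), show k + 1 = k + 1 + 0 by rfl, pathPos_seg2 (by omega)]
    right; right; right; right; right; right; dsimp only; omega
  · rw [pathPos_seg2 (by omega), add_assoc, pathPos_seg2 (by omega)]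
    left; dsimp only; omega
  · rw [h, show e + b = e + b + 0 by rfl, pathPos_seg3, show k = e + (b - 1) by omega,
      pathPos_seg2 (by omega)]
    right; right; right; right; left; dsimp only; omega
  · rw [pathPos_seg3, add_assoc, pathPos_seg3]
    left; dsimp only; omega

theorem arr_path (hP : Par r c a b) (he : 2 ≤ e) (hec : e ≤ c) {k l : ℕ}
    (hk : k ≤ pathLen r c a b e) (hl : l ≤ pathLen r c a b e)
    (h : Arr r c a b e (pathPos r c a b e k) (pathPos r c a b e l)) : l = k + 1 := by
  have hρ := lastRow_spec r a e
  obtain ⟨ha, hb, har, hac, hbc, hh⟩ := hP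
  unfold pathLen at hk hl
  unfold pathPos Arr at h
  generalize lastRow r a e = ρ at hρ h
  split_ifs at hk hl with h1 h2
  · split_ifs at h <;> dsimp only at h <;> rcases h with ⟨_, h⟩ | h | h | h | h | h | h <;> omega
  · split_ifs at h <;> dsimp only at h <;> rcases h with ⟨_, h⟩ | h | h | h | h | h | h <;> omega
  · rw [if_pos (by omega), if_pos (by omega)] at h
    dsimp only at h
    rcases h with ⟨_, h⟩ | h | h | h | h | h | h <;> omega

theorem arrB_path (hP : Par r c a b) (he : 2 ≤ e) (hec : e ≤ c) {k l : ℕ} (hkl : k < l)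
    (hl : l ≤ pathLen r c a b e) : arrB r c a b e (pathPos r c a b e k) (pathPos r c a b e l) =
      if l = k + 1 then 1 else 0 := by
  unfold arrB
  rw [if_neg (c := Arr r c a b e (pathPos r c a b e l) (pathPos r c a b e k))
    fun h => by have := arr_path hP he hec hl (by omega) h; omega]
  by_cases h : l = k + 1
  · subst h
    rw [if_pos (arr_path_succ hP he hec hl), if_pos rfl]; rfl
  · rw [if_neg fun h' => h (arr_path hP he hec (by omega) hl h'), if_neg h]; rfl

/-- The arrows at the last position of the path. -/
theorem arrB_path_last (hP : Par r c a b) (he : 2 ≤ e) (hec : e ≤ c) {q : ℕ × ℕ}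
    (hq : Act r c (e - 1) q) (hst : ¬ IsStable a b q)
    (hoff : ∀ k ≤ pathLen r c a b e, q ≠ pathPos r c a b e k) :
    arrB r c a b e (pathPos r c a b e (pathLen r c a b e)) q =
      cnt (pathIn r c a b e (pathLen r c a b e - 1)) q := by
  have hρ := lastRow_spec r a e
  have o1 := hoff (pathLen r c a b e - 1) (by omega)
  obtain ⟨q1, q2⟩ := q
  obtain ⟨ha, hb, har, hac, hbc, hh⟩ := hP
  simp only [IsStable, Act, Ne, Prod.mk.injEq] at hst hq
  have conclude : ∀ (p : ℕ × ℕ) (l : List (ℕ × ℕ)), ¬ Arr r c a b e (q1, q2) p →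
      ((if Arr r c a b e p (q1, q2) then 1 else 0 : ℤ) = cnt l (q1, q2)) →
      arrB r c a b e p (q1, q2) = cnt l (q1, q2) := by
    intro p l h1 h2
    rw [arrB, if_neg h1, h2, sub_zero]
  -- The path ends at `(c - a + 1, 1)`, `(1, c - b + 1)` or `(r - e + 1, 1)`, according to the
  -- number of diagonals it runs through. The entries `(a, 1)`, `(a + 2, 1)`, `(1, b)`, `(1, b + 2)`
  -- of the list are frozen and therefore not equal to the mutable position in question.
  by_cases h1 : e + a = r
  · by_cases h2 : c = 2 * b
    · have hm : pathLen r c a b e = e + b + (a - 1) := by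
        unfold pathLen; rw [if_pos h1, if_pos h2]; omega
      have hP1 : pathPos r c a b e (pathLen r c a b e) = (c - a + 1, 1) := by
        rw [hm, pathPos_seg3, Prod.mk.injEq]; omega
      rw [hP1]
      rcases Nat.lt_or_ge 1 a with h3 | h3
      · rw [hm, show e + b + (a - 1) - 1 = e + b + (a - 2) by omega, pathPos_seg3, Ne,
          Prod.mk.injEq] at o1
        rw [hm, show e + b + (a - 1) - 1 = e + b + (a - 2) by omega, pathIn_seg3]
        refine conclude _ _ ?_ ?_
        · unfold Arr
          rintro (⟨_, h⟩ | h | h | h | h | h | h) <;> dsimp only at * <;> omega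
        · rw [ind_two (q := (q1, q2)) (x := (c - a + 1, 2)) (y := (c - a + 2, 1))
            (by rw [Ne, Prod.mk.injEq]; omega)]
          · simp only [cnt, List.map_cons, List.map_nil, List.sum_cons, List.sum_nil]
            rw [ind_of_ne (x := (a, 1)) (by rw [Ne, Prod.mk.injEq]; omega),
              ind_of_ne (x := (a + 2, 1)) (by rw [Ne, Prod.mk.injEq]; omega),
              ind_of_ne (x := (1, b)) (by rw [Ne, Prod.mk.injEq]; omega),
              ind_of_ne (x := (1, b + 2)) (by rw [Ne, Prod.mk.injEq]; omega)]
            rw [show c - (a - 2) - 1 = c - a + 1 by omega, show a - (a - 2) = 2 by omega,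
              show c - (a - 2) = c - a + 2 by omega]
            simp
          · simp only [Prod.mk.injEq]
            unfold Arr
            constructor
            · rintro (⟨_, h⟩ | h | h | h | h | h | h) <;> dsimp only at * <;> omega
            · rintro (h | h)
              · left; dsimp only; omega
              · right; left; dsimp only; omega
      · rw [hm, show e + b + (a - 1) - 1 = e + (b - 1) by omega, pathPos_seg2 (by omega), Ne,
          Prod.mk.injEq] at o1
        rw [hm, pathIn_firstRow (by omega) hb h2]
        refine conclude _ _ ?_ ?_
        · unfold Arr
          rintro (⟨_, h⟩ | h | h | h | h | h | h) <;> dsimp only at * <;> omega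
        · rw [ind_one (q := (q1, q2)) (x := (c, a + 1))]
          · simp only [cnt, List.map_cons, List.map_nil, List.sum_cons, List.sum_nil]
            rw [ind_of_ne (x := (a, 1)) (by rw [Ne, Prod.mk.injEq]; omega),
              ind_of_ne (x := (a + 2, 1)) (by rw [Ne, Prod.mk.injEq]; omega),
              ind_of_ne (x := (1, b)) (by rw [Ne, Prod.mk.injEq]; omega),
              ind_of_ne (x := (1, b + 2)) (by rw [Ne, Prod.mk.injEq]; omega)]
            simp
          · simp only [Prod.mk.injEq]
            unfold Arr
            constructor
            · rintro (⟨_, h⟩ | h | h | h | h | h | h) <;> dsimp only at * <;> omega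
            · intro h; left; dsimp only; omega
    · have hm : pathLen r c a b e = e + (b - 1) := by
        unfold pathLen; rw [if_pos h1, if_neg h2]; omega
      have hP1 : pathPos r c a b e (pathLen r c a b e) = (1, c - b + 1) := by
        rw [hm, pathPos_seg2 (by omega), Prod.mk.injEq]; omega
      rw [hP1]
      rcases Nat.lt_or_ge 1 b with h3 | h3
      · rw [hm, show e + (b - 1) - 1 = e + (b - 2) by omega, pathPos_seg2 (by omega), Ne,
          Prod.mk.injEq] at o1
        rw [hm, show e + (b - 1) - 1 = e + (b - 2) by omega, pathIn_seg2 (by omega) (by omega)]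
        refine conclude _ _ ?_ ?_
        · unfold Arr
          rintro (⟨_, h⟩ | h | h | h | h | h | h) <;> dsimp only at * <;> omega
        · rw [ind_two (q := (q1, q2)) (x := (1, c - b + 2)) (y := (2, c - b + 1))
            (by rw [Ne, Prod.mk.injEq]; omega)]
          · simp only [cnt, List.map_cons, List.map_nil, List.sum_cons, List.sum_nil]
            rw [ind_of_ne (x := (a, 1)) (by rw [Ne, Prod.mk.injEq]; omega),
              ind_of_ne (x := (a + 2, 1)) (by rw [Ne, Prod.mk.injEq]; omega)]
            rw [show b - (b - 2) - 1 = 1 by omega, show b - (b - 2) = 2 by omega,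
              show c - (b - 2) - 1 = c - b + 1 by omega, show c - (b - 2) = c - b + 2 by omega]
            simp
          · simp only [Prod.mk.injEq]
            unfold Arr
            constructor
            · rintro (⟨_, h⟩ | h | h | h | h | h | h) <;> dsimp only at * <;> omega
            · rintro (h | h)
              · right; right; left; dsimp only; omega
              · left; dsimp only; omega
      · rw [hm, show e + (b - 1) - 1 = e - 1 by omega, pathPos_seg1 (by omega), Ne,
          Prod.mk.injEq] at o1
        rw [hm, pathIn_firstCol (by omega) h1]
        refine conclude _ _ ?_ ?_
        · unfold Arr
          rintro (⟨_, h⟩ | h | h | h | h | h | h) <;> dsimp only at * <;> omega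
        · rw [ind_one (q := (q1, q2)) (x := (b + 1, c))]
          · simp only [cnt, List.map_cons, List.map_nil, List.sum_cons, List.sum_nil]
            rw [ind_of_ne (x := (a, 1)) (by rw [Ne, Prod.mk.injEq]; omega),
              ind_of_ne (x := (a + 2, 1)) (by rw [Ne, Prod.mk.injEq]; omega)]
            simp
          · simp only [Prod.mk.injEq]
            unfold Arr
            constructor
            · rintro (⟨_, h⟩ | h | h | h | h | h | h) <;> dsimp only at * <;> omega
            · intro h; left; dsimp only; omega
  · have hm : pathLen r c a b e = e - 1 := by
      unfold pathLen; rw [if_neg h1]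
    have hP1 : pathPos r c a b e (pathLen r c a b e) = (r - e + 1, 1) := by
      rw [hm, pathPos_seg1 (by omega), Prod.mk.injEq]; omega
    rw [hP1]
    rw [hm, pathPos_seg1 (by omega), Ne, Prod.mk.injEq] at o1
    rw [hm, pathIn_seg1 (by omega) (by omega)]
    refine conclude _ _ ?_ ?_
    · unfold Arr
      rintro (⟨_, h⟩ | h | h | h | h | h | h) <;> dsimp only at * <;> omega
    · rw [ind_two (q := (q1, q2)) (x := (r - e + 1, 2)) (y := (r - e + 2, 1))
        (by rw [Ne, Prod.mk.injEq]; omega)]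
      · simp only [cnt, List.map_cons, List.map_nil, List.sum_cons, List.sum_nil]
        rw [show r - (e - 1 - 1) - 1 = r - e + 1 by omega, show e - (e - 1 - 1) = 2 by omega,
          show r - (e - 1 - 1) = r - e + 2 by omega]
        simp
      · simp only [Prod.mk.injEq]
        unfold Arr
        constructor
        · rintro (⟨_, h⟩ | h | h | h | h | h | h) <;> dsimp only at * <;> omega
        · rintro (h | h)
          · left; dsimp only; omega
          · right; left; dsimp only; omega

theorem arrB_skew (p q : ℕ × ℕ) : arrB r c a b e p q = -arrB r c a b e q p := by
  unfold arrB; ring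

/-- The arrows that do not depend on the length of the last row. -/
def Arr0 (c a b : ℕ) (p q : ℕ × ℕ) : Prop :=
  (¬((p.1 = 1 ∨ p.2 = 1) ∧ (q.1 = 1 ∨ q.2 = 1)) ∧
    ((q.1 = p.1 + 1 ∧ q.2 = p.2) ∨ (q.1 = p.1 ∧ q.2 = p.2 + 1) ∨
      (p.1 = q.1 + 1 ∧ p.2 = q.2 + 1))) ∨
  (p.1 = a ∧ p.2 = 1 ∧ q.1 = a + 1 ∧ q.2 = 1) ∨
  (p.1 = 1 ∧ p.2 = b ∧ q.1 = 1 ∧ q.2 = b + 1) ∨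
  (p.1 = b + 1 ∧ p.2 = c ∧ q.1 = a + 1 ∧ q.2 = 1) ∨
  (p.1 = a + 1 ∧ p.2 = 1 ∧ q.1 = b ∧ q.2 = c)

instance (c a b : ℕ) (p q : ℕ × ℕ) : Decidable (Arr0 c a b p q) := by
  unfold Arr0; infer_instance

theorem arr_iff (p q : ℕ × ℕ) : Arr r c a b e p q ↔ Arr0 c a b p q ∨
    (p = (lastRow r a e, a + 1) ∧ q = (1, b + 1)) ∨ (p = (1, b + 1) ∧ q = (lastRow r a e, a)) := by
  unfold Arr Arr0
  simp only [Prod.ext_iff]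
  constructor
  · rintro (h | h | h | h | h | h | h)
    · exact .inl (.inl h)
    · exact .inl (.inr (.inl h))
    · exact .inl (.inr (.inr (.inl h)))
    · exact .inr (.inl ⟨⟨h.1, h.2.1⟩, h.2.2⟩)
    · exact .inr (.inr ⟨⟨h.1, h.2.1⟩, h.2.2⟩)
    · exact .inl (.inr (.inr (.inr (.inl h))))
    · exact .inl (.inr (.inr (.inr (.inr h))))
  · rintro ((h | h | h | h | h) | h | h)
    · exact .inl h
    · exact .inr (.inl h)
    · exact .inr (.inr (.inl h))
    · exact .inr (.inr (.inr (.inr (.inr (.inl h)))))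
    · exact .inr (.inr (.inr (.inr (.inr (.inr h)))))
    · exact .inr (.inr (.inr (.inl ⟨h.1.1, h.1.2, h.2⟩)))
    · exact .inr (.inr (.inr (.inr (.inl ⟨h.1.1, h.1.2, h.2⟩))))

theorem ind_arr (hP : Par r c a b) (p q : ℕ × ℕ) :
    (if Arr r c a b e p q then 1 else 0 : ℤ) = (if Arr0 c a b p q then 1 else 0) +
      ind (lastRow r a e, a + 1) p * ind (1, b + 1) q +
        ind (1, b + 1) p * ind (lastRow r a e, a) q := by
  have hρ : 3 ≤ lastRow r a e := by
    have := lastRow_spec r a e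
    obtain ⟨ha, hb, har, hac, hbc, hh⟩ := hP
    omega
  have hc := hP.hbc
  have hac := hP.hac
  have ha := hP.ha
  have hb := hP.hb
  simp only [arr_iff]
  generalize lastRow r a e = ρ at hρ
  unfold ind
  by_cases h1 : p = (ρ, a + 1) ∧ q = (1, b + 1)
  · obtain ⟨rfl, rfl⟩ := h1
    rw [if_pos (.inr (.inl ⟨rfl, rfl⟩)), if_neg, if_pos rfl, if_pos rfl, if_neg]
    · simp
    · rw [Prod.mk.injEq]; omega
    · rintro (⟨_, h⟩ | h | h | h | h) <;> dsimp only at h <;> omega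
  by_cases h2 : p = (1, b + 1) ∧ q = (ρ, a)
  · obtain ⟨rfl, rfl⟩ := h2
    rw [if_pos (.inr (.inr ⟨rfl, rfl⟩)), if_neg, if_neg, if_pos rfl, if_pos rfl]
    · simp
    · rw [Prod.mk.injEq]; omega
    · rintro (⟨_, h⟩ | h | h | h | h) <;> dsimp only at h <;> omega
  have e1 : (if p = (ρ, a + 1) then 1 else 0 : ℤ) * (if q = (1, b + 1) then 1 else 0) = 0 := by
    by_cases h3 : p = (ρ, a + 1)
    · rw [if_neg (fun h4 => h1 ⟨h3, h4⟩), mul_zero]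
    · rw [if_neg h3, zero_mul]
  have e2 : (if p = (1, b + 1) then 1 else 0 : ℤ) * (if q = (ρ, a) then 1 else 0) = 0 := by
    by_cases h3 : p = (1, b + 1)
    · rw [if_neg (fun h4 => h2 ⟨h3, h4⟩), mul_zero]
    · rw [if_neg h3, zero_mul]
  rw [e1, e2, add_zero, add_zero]
  simp only [h1, h2, or_false]

/-- The change of the arrows when the path that starts at `(r, e)` is processed. -/
theorem arrB_pred (hP : Par r c a b) (he : 2 ≤ e) {p q : ℕ × ℕ}
    (hp : Act r c (e - 1) p) (hq : Act r c (e - 1) q) :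
    arrB r c a b (e - 1) p q = arrB r c a b e p q + (if e = a + 1 then
      (cnt (pathIn r c a b e 0) p - ind (r - 1, a) p) * ind (1, b + 1) q -
        ind (1, b + 1) p * (cnt (pathIn r c a b e 0) q - ind (r - 1, a) q) else 0) := by
  -- The additional arrows at `(1, b + 1)` move from row `r` to row `r - 1` exactly when the entry
  -- in column `a + 1` of the last row disappears.
  by_cases h : e = a + 1
  · have har := hP.har
    subst h
    rw [if_pos rfl, pathIn_seg1 (by omega) (by have := hP.h; omega)]
    have l1 : lastRow r a (a + 1) = r := by unfold lastRow; rw [if_pos le_rfl]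
    have l2 : lastRow r a (a + 1 - 1) = r - 1 := by unfold lastRow; rw [if_neg (by omega)]
    have h0 : ∀ p : ℕ × ℕ, Act r c (a + 1 - 1) p → ind (r, a + 1) p = 0 := by
      rintro ⟨p1, p2⟩ hp
      unfold Act at hp
      exact ind_of_ne (by rw [Ne, Prod.mk.injEq]; omega)
    unfold arrB
    rw [ind_arr hP, ind_arr hP, ind_arr hP, ind_arr hP, l1, l2, h0 p hp, h0 q hq]
    simp [cnt]
    ring
  · rw [if_neg h, add_zero]
    have : lastRow r a (e - 1) = lastRow r a e := by
      unfold lastRow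
      by_cases h1 : a + 1 ≤ e
      · rw [if_pos h1, if_pos (by omega)]
      · rw [if_neg h1, if_neg (by omega)]
    unfold arrB
    rw [ind_arr hP, ind_arr hP, ind_arr hP, ind_arr hP, this]

end

/-! ### The variables at the intermediate stages -/

section

variable {K : Type*} [CommRing K]

/-- The minor with the entries `(a + 1, 1)` and `(r, r - a)` in its corners. -/
def rowCoeff (X : ℕ → ℕ → K) (r a : ℕ) : K := mn X (a + 1) 1 (r - a)

/-- The same minor with row `a + 1` replaced by row `a`. -/
def rowCoeff' (X : ℕ → ℕ → K) (r a : ℕ) : K := mn (updR X (a + 1) (X a)) (a + 1) 1 (r - a)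

/-- The minor with the entries `(1, b + 1)` and `(c - b, c)` in its corners. -/
def colCoeff (X : ℕ → ℕ → K) (c b : ℕ) : K := mn X 1 (b + 1) (c - b)

/-- The same minor with column `b + 1` replaced by column `b`. -/
def colCoeff' (X : ℕ → ℕ → K) (c b : ℕ) : K :=
  mn (updC X (b + 1) fun u => X u b) 1 (b + 1) (c - b)

/-- A combination of the rows `b` and `b + 1` of `x`. -/
def vrow (x X : ℕ → ℕ → K) (r a b : ℕ) : ℕ → K := fun j =>
  rowCoeff X r a * x b j - rowCoeff' X r a * x (b + 1) j

/-- A combination of the columns `a` and `a + 1` of `x`. -/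
def vcol (x X : ℕ → ℕ → K) (c a b : ℕ) : ℕ → K := fun i =>
  colCoeff X c b * x i a - colCoeff' X c b * x i (a + 1)

/-- The matrix that determines the coefficients of `zrow`. -/
def rowBase (x : ℕ → ℕ → K) (r c a b : ℕ) : ℕ → ℕ → K :=
  if r = 2 * a then updC x a (vcol x x c a b) else x

/-- The matrix that determines the coefficients of `ycol`. -/
def colBase (x : ℕ → ℕ → K) (r c a b : ℕ) : ℕ → ℕ → K :=
  if c = 2 * b then updR x b (vrow x x r a b) else x

/-- The row by which row `b` is replaced in the minors on one diagonal. -/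
def zrow (x : ℕ → ℕ → K) (r c a b : ℕ) : ℕ → K := vrow x (rowBase x r c a b) r a b

/-- The column by which column `a` is replaced in the minors on one diagonal. -/
def ycol (x : ℕ → ℕ → K) (r c a b : ℕ) : ℕ → K := vcol x (colBase x r c a b) c a b

/-- The number of rows on which the coefficients depend when `e` entries of the last row are
left. -/
def effRow (r a e : ℕ) : ℕ := if e + a < r then r - 1 else r

/-- The variable at the position `p` when `e` entries of the last row are left. -/
def stageVar (x : ℕ → ℕ → K) (r c a b e : ℕ) (p : ℕ × ℕ) : K :=
  if p.2 + r ≤ e + p.1 then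
    mn (if p.2 + r = a + p.1 then updC x a (ycol x (effRow r a e) c a b) else x) p.1 p.2
      (r + 1 - p.1)
  else if p.2 + r ≤ c + p.1 then
    mn (if p.2 + r = a + 1 + p.1 then updC x a (ycol x (effRow r a e) c a b) else x) p.1 p.2
      (r - p.1)
  else
    mn (if p.2 + b = c + p.1 then updR x b (zrow x (effRow r a e) c a b) else x) p.1 p.2
      (c + 1 - p.2)

theorem rowCoeff_transpose (X : ℕ → ℕ → K) (r a : ℕ) :
    rowCoeff (fun i j => X j i) r a = colCoeff X r a := mn_transpose _ _ _ _

theorem rowCoeff'_transpose (X : ℕ → ℕ → K) (r a : ℕ) :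
    rowCoeff' (fun i j => X j i) r a = colCoeff' X r a := by
  unfold rowCoeff' colCoeff'
  rw [← mn_transpose]
  rfl

theorem vrow_transpose (x X : ℕ → ℕ → K) (r a b : ℕ) :
    vrow (fun i j => x j i) (fun i j => X j i) r a b = vcol x X r b a := by
  funext j
  unfold vrow vcol
  rw [rowCoeff_transpose, rowCoeff'_transpose]

theorem rowBase_transpose (x : ℕ → ℕ → K) (r c a b : ℕ) :
    rowBase (fun i j => x j i) r c a b = fun i j => colBase x c r b a j i := by
  unfold rowBase colBase
  split_ifs
  · rw [← vrow_transpose (fun i j => x j i) (fun i j => x j i)]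
    rfl
  · rfl

theorem zrow_transpose (x : ℕ → ℕ → K) (r c a b : ℕ) :
    zrow (fun i j => x j i) r c a b = ycol x c r b a := by
  unfold zrow ycol
  rw [rowBase_transpose, vrow_transpose]

theorem ycol_transpose (x : ℕ → ℕ → K) (r c a b : ℕ) :
    ycol (fun i j => x j i) r c a b = zrow x c r b a :=
  (zrow_transpose (fun i j => x j i) c r b a).symm

end

section

variable {K : Type*} [Field K] {x : ℕ → ℕ → K} {r c a b e i j k : ℕ}

theorem stageVar_lo (h : j + r ≤ e + i) (hk : r + 1 - i = k) (h' : j + r ≠ a + i) :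
    stageVar x r c a b e (i, j) = mn x i j k := by
  rw [stageVar, if_pos h, if_neg h', hk]

theorem stageVar_lo_y (h : j + r = a + i) (hk : r + 1 - i = k) (h' : a ≤ e) :
    stageVar x r c a b e (i, j) = mn (updC x a (ycol x (effRow r a e) c a b)) i j k := by
  rw [stageVar, if_pos (by dsimp only; omega), if_pos h, hk]

theorem stageVar_mid (h : e + i < j + r) (h2 : j + r ≤ c + i) (hk : r - i = k)
    (h' : j + r ≠ a + 1 + i) : stageVar x r c a b e (i, j) = mn x i j k := by
  rw [stageVar, if_neg (by dsimp only; omega), if_pos h2, if_neg h', hk]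

theorem stageVar_mid_y (h : j + r = a + 1 + i) (hk : r - i = k) (h1 : e ≤ a) (h2 : a + 1 ≤ c) :
    stageVar x r c a b e (i, j) = mn (updC x a (ycol x (effRow r a e) c a b)) i j k := by
  rw [stageVar, if_neg (by dsimp only; omega), if_pos (by dsimp only; omega), if_pos h, hk]

theorem stageVar_hi (h : c + i < j + r) (he : e ≤ c) (hk : c + 1 - j = k) (h' : j + b ≠ c + i) :
    stageVar x r c a b e (i, j) = mn x i j k := by
  rw [stageVar, if_neg (by dsimp only; omega), if_neg (by dsimp only; omega), if_neg h', hk]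

theorem stageVar_hi_z (h : c + i < j + r) (he : e ≤ c) (hk : c + 1 - j = k) (h' : j + b = c + i) :
    stageVar x r c a b e (i, j) = mn (updR x b (zrow x (effRow r a e) c a b)) i j k := by
  rw [stageVar, if_neg (by dsimp only; omega), if_neg (by dsimp only; omega), if_pos h', hk]

theorem effRow_spec (r a e : ℕ) :
    (e + a < r ∧ effRow r a e = r - 1) ∨ (r ≤ e + a ∧ effRow r a e = r) := by
  unfold effRow
  split_ifs with h
  · exact .inl ⟨h, rfl⟩
  · exact .inr ⟨by omega, rfl⟩

/-- Since `a ≠ b`, also after a row has been removed, a third block never occurs in both gluings at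
the same time. -/
theorem effRow_ne (hP : Par r c a b) (h : c = 2 * b) (e : ℕ) : effRow r a e ≠ 2 * a := by
  have := effRow_spec r a e
  obtain ⟨ha, hb, har, hac, hbc, hh⟩ := hP
  omega

/-- The number of rows enters the replaced column only through the third block of the gluing, which
is present for `c = 2 * b`. -/
theorem ycol_congr (h : c ≠ 2 * b ∨ r = k) : ycol x r c a b = ycol x k c a b := by
  rcases h with h | rfl
  · unfold ycol colBase
    rw [if_neg h, if_neg h]
  · rfl

/-- The relation behind the passage of the path through the first column. -/
theorem rowCoeff_relation (hP : Par r c a b) (he : 2 ≤ e) (hec : e ≤ c) (h : e + a = r) :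
    rowCoeff' (rowBase x r c a b) r a * rowCoeff (rowBase x (r - 1) c a b) (r - 1) a -
      rowCoeff (rowBase x r c a b) r a * rowCoeff' (rowBase x (r - 1) c a b) (r - 1) a =
    stageVar x r c a b e (a, 1) * stageVar x r c a b e (a + 2, 1) := by
  obtain ⟨ha, hb, har, hac, hbc, hh⟩ := hP
  obtain ⟨k, hk⟩ : ∃ k, r - a = k + 2 := ⟨r - a - 2, by omega⟩
  have hk' : r - 1 - a = k + 1 := by omega
  have heff : effRow r a e = r := by
    have := effRow_spec r a e
    omega
  unfold rowCoeff rowCoeff'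
  rw [hk, hk']
  -- A third block is involved either in the old coefficients (`r = 2 * a`), or in the new ones (`r
  -- - 1 = 2 * a`), or in none of them. In the first case everything takes place in the matrix with
  -- column `a` replaced; in the second case only the smaller minors contain the replaced column as
  -- their last one.
  by_cases h1 : r = 2 * a
  · have hy : ycol x r c a b = vcol x x c a b := by
      unfold ycol colBase
      rw [if_neg (by omega)]
    rw [stageVar_mid_y (k := k + 2) (by omega) (by omega) (by omega) (by omega),
      stageVar_lo (k := k + 1) (by omega) (by omega) (by omega), heff, hy]
    unfold rowBase
    rw [if_pos h1, if_neg (by omega)]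
    set xy := updC x a (vcol x x c a b) with hxy
    have e1 : ∀ i, mn x i 1 (k + 1) = mn xy i 1 (k + 1) := fun i => by
      rw [hxy, mn_updC_of_notMem x _ (by omega)]
    have e2 : mn (updR x (a + 1) (x a)) (a + 1) 1 (k + 1) =
        mn (updR xy (a + 1) (xy a)) (a + 1) 1 (k + 1) :=
      mn_congr fun u _ v _ => by
        unfold updR
        split_ifs <;> rw [hxy, updC_of_ne _ _ _ (by omega)]
    rw [e1, e1, e2]
    exact minor_relation_rows xy a 0 k
  · by_cases h2 : r = 2 * a + 1
    · have hy : ycol x r c a b = vcol x x c a b := by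
        unfold ycol colBase
        rw [if_neg (by omega)]
      rw [stageVar_mid (k := k + 2) (by omega) (by omega) (by omega) (by omega),
        stageVar_lo_y (k := k + 1) (by omega) (by omega) (by omega), heff, hy]
      unfold rowBase
      rw [if_neg h1, if_pos (by omega)]
      refine minor_relation_rows_updC x a 0 k (colCoeff x c b) (colCoeff' x c b) ?_ ?_
        (y := vcol x x c a b)
      · intro i
        rw [show 0 + (k + 1) = a by omega]; rfl
      · rw [show 0 + (k + 1) = a by omega]
    · rw [stageVar_mid (k := k + 2) (by omega) (by omega) (by omega) (by omega),
        stageVar_lo (k := k + 1) (by omega) (by omega) (by omega)]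
      unfold rowBase
      rw [if_neg h1, if_neg (by omega)]
      exact minor_relation_rows x a 0 k

/-- The relation behind the passage of the path through the first row. -/
theorem colCoeff_relation (hP : Par r c a b) (he : 2 ≤ e) (hec : e ≤ c) (h : e + a = r)
    (hcb : c = 2 * b) :
    colCoeff' (colBase x r c a b) c b * colCoeff (colBase x (r - 1) c a b) c b -
      colCoeff (colBase x r c a b) c b * colCoeff' (colBase x (r - 1) c a b) c b =
    (stageVar x r c a b e (a, 1) * stageVar x r c a b e (a + 2, 1)) *
      (stageVar x r c a b e (1, b) * stageVar x r c a b e (1, b + 2)) := by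
  -- The first two factors are the determinant of the coefficient vectors by which row `b` is
  -- replaced before and after. With this determinant as factor the claim is an instance of
  -- `minor_relation_updR`.
  rw [← rowCoeff_relation hP he hec h]
  obtain ⟨ha, hb, har, hac, hbc, hh⟩ := hP
  have e1 : stageVar x r c a b e (1, b) = mn x 1 b (b + 1) :=
    stageVar_hi (by omega) hec (by omega) (by omega)
  have e2 : stageVar x r c a b e (1, b + 2) = mn x 1 (b + 2) (b - 1) :=
    stageVar_hi (by omega) hec (by omega) (by omega)
  rw [e1, e2]
  unfold rowBase colBase colCoeff colCoeff'
  rw [if_pos hcb, if_pos hcb, if_neg (by omega), if_neg (by omega), show c - b = b - 1 + 1 by omega,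
    show b + 1 = b - 1 + 2 by omega]
  have hb' : 0 + (b - 1 + 1) = b := by omega
  have hb'' : 0 + (b - 1 + 2) = b + 1 := by omega
  have := minor_relation_updR x 0 b (b - 1) (rowCoeff x r a) (rowCoeff' x r a)
    (rowCoeff x (r - 1) a) (rowCoeff' x (r - 1) a) (z := vrow x x r a b)
    (z' := vrow x x (r - 1) a b) (fun j => by rw [hb', hb'']; rfl)
    (fun j => by rw [hb', hb'']; rfl) rfl rfl
  rw [hb'] at this
  rw [show b - 1 + 2 = b + 1 by omega] at this ⊢
  exact this

end

section

variable {K : Type*} [Field K] {x : ℕ → ℕ → K} {r c a b e : ℕ}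

theorem stageVar_firstCol (hP : Par r c a b) (h : e + a = r) :
    stageVar x r c a b e (a + 1, 1) = rowCoeff (rowBase x r c a b) r a := by
  have hy := ycol_congr (x := x) (r := r) (c := c) (a := a) (b := b) (k := r) (.inr rfl)
  have heff : effRow r a e = r := by
    have := effRow_spec r a e
    omega
  obtain ⟨ha, hb, har, hac, hbc, hh⟩ := hP
  unfold rowCoeff rowBase
  split_ifs with h1
  · rw [stageVar_lo_y (k := r - a) (by omega) (by omega) (by omega), heff]
    unfold ycol colBase
    rw [if_neg (by omega)]
  · rw [stageVar_lo (k := r - a) (by omega) (by omega) (by omega)]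

theorem stageVar_pred_firstCol (hP : Par r c a b) (hec : e ≤ c) (he : 2 ≤ e) (h : e + a = r) :
    stageVar x r c a b (e - 1) (a + 1, 1) =
      rowCoeff (rowBase x (r - 1) c a b) (r - 1) a := by
  have heff : effRow r a (e - 1) = r - 1 := by
    have := effRow_spec r a (e - 1)
    omega
  obtain ⟨ha, hb, har, hac, hbc, hh⟩ := hP
  unfold rowCoeff rowBase
  split_ifs with h1
  · rw [stageVar_mid_y (k := r - 1 - a) (by omega) (by omega) (by omega) (by omega), heff]
    unfold ycol colBase
    rw [if_neg (by omega)]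
  · rw [stageVar_mid (k := r - 1 - a) (by omega) (by omega) (by omega) (by omega)]

theorem stageVar_firstRow (hP : Par r c a b) (hec : e ≤ c) :
    stageVar x r c a b e (1, b + 1) = colCoeff (colBase x (effRow r a e) c a b) c b := by
  have hr := effRow_ne hP (e := e)
  obtain ⟨ha, hb, har, hac, hbc, hh⟩ := hP
  unfold colCoeff colBase
  split_ifs with h1
  · rw [stageVar_hi_z (k := c - b) (by omega) (by omega) (by omega) (by omega)]
    unfold zrow rowBase
    rw [if_neg (hr h1)]
  · rw [stageVar_hi (k := c - b) (by omega) (by omega) (by omega) (by omega)]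

/-- Along the diagonal through `(c, a)`, the variables are minors of `updC x a y`. -/
theorem stageVar_lastRow (hP : Par r c a b) (hcb : c = 2 * b) {e' : ℕ} (h : e + a = r)
    (he' : e' = e ∨ e' + 1 = e) {s : ℕ} (hs : s < a) :
    stageVar x r c a b e' (c - s, a - s) =
      mn (updC x a (ycol x (effRow r a e') c a b)) (c - s) (a - s) (s + 1) := by
  obtain ⟨ha, hb, har, hac, hbc, hh⟩ := hP
  rcases hh with hh | hh
  · rw [stageVar_lo_y (k := s + 1) (by omega) (by omega) (by omega)]
  · rw [stageVar_mid_y (k := s + 1) (by omega) (by omega) (by omega) (by omega)]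

theorem stageVar_above_lastRow (hP : Par r c a b) (hcb : c = 2 * b) (h : e + a = r)
    {s : ℕ} (hs : s ≤ a) : stageVar x r c a b e (c - s, a + 1 - s) =
      mn x (c - s) (a + 1 - s) (s + 1) := by
  obtain ⟨ha, hb, har, hac, hbc, hh⟩ := hP
  rcases hh with hh | hh
  · rw [stageVar_lo (k := s + 1) (by omega) (by omega) (by omega)]
  · by_cases h1 : a + 2 ≤ c
    · rw [stageVar_mid (k := s + 1) (by omega) (by omega) (by omega) (by omega)]
    · rw [stageVar_hi (k := s + 1) (by omega) (by omega) (by omega) (by omega)]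

theorem stageVar_below_lastRow (hP : Par r c a b) (hcb : c = 2 * b) (h : e + a = r)
    {s : ℕ} (hs : s + 1 < a) : stageVar x r c a b e (c - s, a - s - 1) =
      mn x (c - s) (a - s - 1) (s + 1) := by
  obtain ⟨ha, hb, har, hac, hbc, hh⟩ := hP
  rcases hh with hh | hh
  · rw [stageVar_lo (k := s + 1) (by omega) (by omega) (by omega)]
  · rw [stageVar_mid (k := s + 1) (by omega) (by omega) (by omega) (by omega)]

/-- On the first diagonal of the path the minors lose the last row, and the exchange relation is the
Desnanot–Jacobi identity. Only the diagonals that start in the columns `a` and `a + 1` are affected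
by the replaced column. -/
theorem stageVar_path_seg1 (hP : Par r c a b) (hec : e ≤ c) {k : ℕ} (hk : k + 1 < e) :
    stageVar x r c a b e (r - k, e - k) * stageVar x r c a b (e - 1) (r - k - 1, e - k - 1) =
      stageVar x r c a b e (r - k - 1, e - k) * stageVar x r c a b e (r - k, e - k - 1) +
      stageVar x r c a b e (r - k - 1, e - k - 1) *
        (if k = 0 then (if e = a + 1 then stageVar x r c a b e (1, b + 1) else 1)
          else stageVar x r c a b (e - 1) (r - k, e - k)) := by
  have hfr := stageVar_firstRow (x := x) hP hec
  have hρ := effRow_spec r a e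
  have hρ' := effRow_spec r a (e - 1)
  obtain ⟨ha, hb, har, hac, hbc, hh⟩ := hP
  obtain ⟨i, hi⟩ : ∃ i, r = i + k + 1 := ⟨r - k - 1, by omega⟩
  obtain ⟨j, hj⟩ : ∃ j, e = j + k + 1 := ⟨e - k - 1, by omega⟩
  rw [show r - k = i + 1 by omega, show e - k = j + 1 by omega, Nat.add_sub_cancel,
    Nat.add_sub_cancel]
  -- The variables on the path end in the replaced column `a`. All the minors of the relation may be
  -- read in the matrix with this column replaced, since the others do not reach it.
  by_cases h1 : e = a
  · rw [stageVar_lo_y (i := i + 1) (k := k + 1) (by omega) (by omega) (by omega),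
      stageVar_mid (e := e - 1) (i := i) (k := k + 1) (by omega) (by omega) (by omega) (by omega),
      stageVar_mid_y (i := i) (j := j + 1) (k := k + 1) (by omega) (by omega) (by omega) (by omega),
      stageVar_lo (e := e) (i := i + 1) (j := j) (k := k + 1) (by omega) (by omega) (by omega),
      stageVar_lo_y (e := e) (i := i) (j := j) (k := k + 2) (by omega) (by omega) (by omega),
      stageVar_mid (e := e - 1) (i := i + 1) (k := k) (by omega) (by omega) (by omega) (by omega),
      if_neg (by omega : ¬ e = a + 1)]
    set A := updC x a (ycol x (effRow r a e) c a b) with hA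
    have e1 : ∀ i, mn x i j (k + 1) = mn A i j (k + 1) := fun i => by
      rw [hA, mn_updC_of_notMem x _ (by omega)]
    have e2 : (if k = 0 then (1 : K) else mn x (i + 1) (j + 1) k) = mn A (i + 1) (j + 1) k := by
      rw [hA, mn_updC_of_notMem x _ (by omega)]
      split_ifs with h
      · rw [h, mn_zero]
      · rfl
    rw [e1, e1, e2]
    exact mn_desnanot_jacobi A i j k
  have q1 : stageVar x r c a b e (i, j + 1) = mn x i (j + 1) (k + 1) := by
    by_cases h2 : e = c
    · exact stageVar_hi (by omega) (by omega) (by omega) (by omega)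
    · exact stageVar_mid (by omega) (by omega) (by omega) (by omega)
  rw [stageVar_lo (i := i + 1) (j := j + 1) (k := k + 1) (by omega) (by omega) (by omega), q1,
    stageVar_lo (e := e) (i := i) (j := j) (k := k + 2) (by omega) (by omega) (by omega)]
  -- The variables on the path are ordinary minors that contain both columns `a` and `a + 1`,
  -- whereas the new variables end in the replaced column. At the first step no preceding new
  -- variable is available; its place is taken by the coefficient of column `a`, which is the
  -- variable at `(1, b + 1)`. This is the arrow recorded by `pathZ`.
  by_cases h2 : e = a + 1
  · have hy : ycol x (effRow r a (e - 1)) c a b = ycol x (effRow r a e) c a b :=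
      ycol_congr (by omega)
    rw [stageVar_mid_y (e := e - 1) (i := i) (k := k + 1) (by omega) (by omega) (by omega)
        (by omega), stageVar_lo_y (i := i + 1) (j := j) (k := k + 1) (by omega) (by omega)
        (by omega), if_pos h2, hy,
        stageVar_mid_y (e := e - 1) (i := i + 1) (k := k) (by omega) (by omega) (by omega)
        (by omega), hfr, hy]
    obtain h0 | ⟨k, rfl⟩ : k = 0 ∨ ∃ l, k = l + 1 := by
      cases k
      · exact .inl rfl
      · exact .inr ⟨_, rfl⟩
    · subst h0
      rw [if_pos rfl]
      simp only [zero_add, mn_one]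
      obtain rfl : j = a := by omega
      rw [updC_self, updC_self]
      exact mn_desnanot_jacobi_updC_one x i j _ _ fun i => rfl
    · rw [if_neg (by omega)]
      obtain rfl : a = j + (k + 1) := by omega
      exact mn_desnanot_jacobi_updC x i j k _ _ fun i => rfl
  · rw [stageVar_mid (e := e - 1) (i := i) (k := k + 1) (by omega) (by omega) (by omega)
        (by omega), stageVar_lo (i := i + 1) (j := j) (k := k + 1) (by omega) (by omega)
        (by omega), if_neg h2,
        stageVar_mid (e := e - 1) (i := i + 1) (k := k) (by omega) (by omega) (by omega)
        (by omega)]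
    have e2 : (if k = 0 then (1 : K) else mn x (i + 1) (j + 1) k) = mn x (i + 1) (j + 1) k := by
      split_ifs with h
      · rw [h, mn_zero]
      · rfl
    rw [e2]
    exact mn_desnanot_jacobi x i j k

/-- The exchange relations along the path. -/
theorem stageVar_path (hP : Par r c a b) (he : 2 ≤ e) (hec : e ≤ c) {k : ℕ}
    (hk : k < pathLen r c a b e) :
    stageVar x r c a b e (pathPos r c a b e k) *
        stageVar x r c a b (e - 1) (pathPos r c a b e (k + 1)) =
      ((pathIn r c a b e k).map (stageVar x r c a b e)).prod +
      stageVar x r c a b e (pathPos r c a b e (k + 1)) *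
        (if k = 0 then (if e = a + 1 then stageVar x r c a b e (1, b + 1) else 1)
          else stageVar x r c a b (e - 1) (pathPos r c a b e k)) := by
  rcases path_cases hP he hec hk with h | ⟨h, h'⟩ | ⟨s, rfl, h, h'⟩ | ⟨h, h', h''⟩ |
    ⟨s, rfl, h, h', h''⟩
  · rw [pathPos_seg1 (by omega), pathPos_seg1 (by omega), pathIn_seg1 (by omega) (by omega)]
    have := stageVar_path_seg1 (x := x) hP hec h
    simp only [List.map_cons, List.map_nil, List.prod_cons, List.prod_nil, mul_one]
    exact this
  all_goals
    have hW := rowCoeff_relation (x := x) hP he hec h'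
    have hf := stageVar_firstCol (x := x) hP h'
    have hf' := stageVar_pred_firstCol (x := x) hP hec he h'
    have heff : effRow r a e = r := by
      have := effRow_spec r a e
      omega
    have heff' : effRow r a (e - 1) = r - 1 := by
      have := effRow_spec r a (e - 1)
      omega
    rw [if_neg (by omega : ¬ _ = 0)]
  -- The passage from `(a + 1, 1)` to `(b, c)`. The variables at `(b, c)` are entries of the
  -- replaced rows, that is, combinations of `x b c` and `x (b + 1) c`; the term with `x b c`
  -- cancels and the other one is governed by `rowCoeff_relation`.
  · subst h
    rw [pathIn_firstCol rfl h', pathPos_seg1 (by omega), show k + 1 = k + 1 + 0 by rfl,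
      pathPos_seg2 (by have := hP.hb; omega)]
    obtain ⟨ha, hb, har, hac, hbc, hh⟩ := hP
    rw [show r - k = a + 1 by omega, show k + 1 + 0 - k = 1 by omega]
    simp only [List.map_cons, List.map_nil, List.prod_cons, List.prod_nil, mul_one, add_zero,
      Nat.sub_zero]
    rw [hf, hf', stageVar_hi_z (e := k + 1 - 1) (i := b) (j := c) (k := 1) (by omega) (by omega) (by omega)
      (by omega), stageVar_hi_z (e := k + 1) (i := b) (j := c) (k := 1) (by omega) (by omega) (by omega)
      (by omega), stageVar_hi (i := b + 1) (j := c) (k := 1) (by omega) (by omega) (by omega)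
      (by omega), mn_one, mn_one, mn_one, updR_self, updR_self, heff, heff']
    unfold zrow vrow
    linear_combination x (b + 1) c * hW
  -- On the second diagonal the old and the new variables are minors with two combinations of the
  -- rows `b` and `b + 1`. The Plücker relation produces the determinant of their coefficients,
  -- which is the product of the variables at `(a, 1)` and `(a + 2, 1)`.
  · have hb := hP.hb
    have hb2 := hP.hbc
    have ht := hP.h
    rw [pathIn_seg2 (by omega) (by omega), pathPos_seg2 (by omega), add_assoc,
      pathPos_seg2 (by omega)]
    simp only [List.map_cons, List.map_nil, List.prod_cons, List.prod_nil, mul_one]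
    obtain ⟨i, hi⟩ : ∃ i, b = i + (s + 1) := ⟨b - s - 1, by omega⟩
    obtain ⟨j, hj⟩ : ∃ j, c = j + (s + 1) := ⟨c - s - 1, by omega⟩
    rw [show b - (s + 1) = i by omega, show c - (s + 1) = j by omega, show b - s = i + 1 by omega,
      show c - s = j + 1 by omega, Nat.add_sub_cancel, Nat.add_sub_cancel,
      stageVar_hi_z (e := e) (i := i + 1) (j := j + 1) (k := s + 1) (by omega) (by omega)
        (by omega) (by omega),
      stageVar_hi_z (e := e - 1) (i := i + 1) (j := j + 1) (k := s + 1) (by omega) (by omega)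
        (by omega) (by omega),
      stageVar_hi_z (e := e) (i := i) (j := j) (k := s + 2) (by omega) (by omega) (by omega)
        (by omega),
      stageVar_hi_z (e := e - 1) (i := i) (j := j) (k := s + 2) (by omega) (by omega) (by omega)
        (by omega),
      stageVar_hi (e := e) (i := i) (j := j + 1) (k := s + 1) (by omega) (by omega) (by omega)
        (by omega),
      stageVar_hi (e := e) (i := i + 1) (j := j) (k := s + 2) (by omega) (by omega) (by omega)
        (by omega), heff, heff']
    have := plucker_updR x i j s (rowCoeff (rowBase x r c a b) r a)
      (rowCoeff' (rowBase x r c a b) r a) (rowCoeff (rowBase x (r - 1) c a b) (r - 1) a)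
      (rowCoeff' (rowBase x (r - 1) c a b) (r - 1) a) (z := zrow x r c a b)
      (z' := zrow x (r - 1) c a b) (fun j => by rw [← hi]; rw [show i + (s + 2) = b + 1 by omega]; rfl)
      (fun j => by rw [← hi]; rw [show i + (s + 2) = b + 1 by omega]; rfl)
    rw [← hi] at this
    rw [this, hW]
    ring
  all_goals
    have hV := colCoeff_relation (x := x) hP he hec h' h''
    have hg := stageVar_firstRow (x := x) hP hec
    have hg' := stageVar_firstRow (x := x) (e := e - 1) hP (by omega)
    rw [heff] at hg
    rw [heff'] at hg'
  · have hb := hP.hb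
    have ha := hP.ha
    have y1 := stageVar_lastRow (x := x) hP h'' (e' := e) h' (.inl rfl) (s := 0) (by omega)
    have y2 := stageVar_lastRow (x := x) hP h'' (e' := e - 1) h' (.inr (by omega)) (s := 0)
      (by omega)
    have y3 := stageVar_above_lastRow (x := x) hP h'' h' (s := 0) (by omega)
    rw [heff] at y1
    rw [heff'] at y2
    simp only [Nat.sub_zero, zero_add, mn_one, updC_self] at y1 y2 y3
    rw [pathIn_firstRow h hb h'', h, show e + b = e + b + 0 by rfl, pathPos_seg3,
      show k = e + (b - 1) by omega, pathPos_seg2 (by omega), show b - (b - 1) = 1 by omega,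
      show c - (b - 1) = b + 1 by omega]
    simp only [List.map_cons, List.map_nil, List.prod_cons, List.prod_nil, mul_one, Nat.sub_zero]
    rw [y1, y2, y3, hg, hg']
    unfold ycol vcol
    linear_combination x c (a + 1) * hV
  -- The third diagonal is like the second one, with columns in place of rows; the determinant of
  -- the coefficients now consists of four frozen variables.
  · have ht := hP.h
    have hb2 := hP.hbc
    have y1 := stageVar_lastRow (x := x) hP h'' (e' := e) h' (.inl rfl) (s := s) (by omega)
    have y2 := stageVar_lastRow (x := x) hP h'' (e' := e - 1) h' (.inr (by omega)) (s := s)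
      (by omega)
    have y1' := stageVar_lastRow (x := x) hP h'' (e' := e) h' (.inl rfl) (s := s + 1) (by omega)
    have y2' := stageVar_lastRow (x := x) hP h'' (e' := e - 1) h' (.inr (by omega)) (s := s + 1)
      (by omega)
    have y3 := stageVar_above_lastRow (x := x) hP h'' h' (s := s + 1) (by omega)
    have y4 := stageVar_below_lastRow (x := x) hP h'' h' (s := s) (by omega)
    rw [heff] at y1 y1'
    rw [heff'] at y2 y2'
    rw [pathIn_seg3, pathPos_seg3, add_assoc, pathPos_seg3]
    simp only [List.map_cons, List.map_nil, List.prod_cons, List.prod_nil, mul_one]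
    obtain ⟨i, hi⟩ : ∃ i, c = i + (s + 1) := ⟨c - s - 1, by omega⟩
    obtain ⟨j, hj⟩ : ∃ j, a = j + (s + 1) := ⟨a - s - 1, by omega⟩
    rw [show c - s = i + 1 by omega, show a - s = j + 1 by omega] at *
    rw [show c - (s + 1) = i by omega] at *
    rw [show a - (s + 1) = j by omega] at *
    rw [show a + 1 - (s + 1) = j + 1 by omega] at y3
    rw [Nat.add_sub_cancel] at y4
    rw [Nat.add_sub_cancel, Nat.add_sub_cancel, y1, y2, y1', y2', y3, y4]
    have := plucker_updC x i j s (colCoeff (colBase x r c a b) c b)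
      (colCoeff' (colBase x r c a b) c b) (colCoeff (colBase x (r - 1) c a b) c b)
      (colCoeff' (colBase x (r - 1) c a b) c b) (y := ycol x r c a b)
      (y' := ycol x (r - 1) c a b)
      (fun i => by rw [← hj]; rw [show j + (s + 2) = a + 1 by omega]; rfl)
      (fun i => by rw [← hj]; rw [show j + (s + 2) = a + 1 by omega]; rfl)
    rw [← hj] at this
    rw [this, hV]
    ring

end

section

variable {r c a b e : ℕ}

theorem act_of_mem_pathIn (hP : Par r c a b) (he : 2 ≤ e) (hec : e ≤ c) {k : ℕ}
    (hk : k < pathLen r c a b e) {q : ℕ × ℕ} (hq : q ∈ pathIn r c a b e k) : Act r c e q := by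
  rcases path_cases hP he hec hk with h | ⟨h, h'⟩ | ⟨s, rfl, h, h'⟩ | ⟨h, h', h''⟩ |
    ⟨s, rfl, h, h', h''⟩
  all_goals obtain ⟨ha, hb, har, hac, hbc, hh⟩ := hP
  · rw [pathIn_seg1 (by omega) (by omega)] at hq
    simp only [List.mem_cons, List.not_mem_nil, or_false] at hq
    rcases hq with rfl | rfl <;> unfold Act <;> dsimp only <;> omega
  · rw [pathIn_firstCol (by omega) (by omega)] at hq
    simp only [List.mem_cons, List.not_mem_nil, or_false] at hq
    rcases hq with rfl | rfl | rfl <;> unfold Act <;> dsimp only <;> omega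
  · rw [pathIn_seg2 (by omega) (by omega)] at hq
    simp only [List.mem_cons, List.not_mem_nil, or_false] at hq
    rcases hq with rfl | rfl | rfl | rfl <;> unfold Act <;> dsimp only <;> omega
  · rw [pathIn_firstRow (by omega) (by omega) (by omega)] at hq
    simp only [List.mem_cons, List.not_mem_nil, or_false] at hq
    rcases hq with rfl | rfl | rfl | rfl | rfl <;> unfold Act <;> dsimp only <;> omega
  · rw [pathIn_seg3] at hq
    simp only [List.mem_cons, List.not_mem_nil, or_false] at hq
    rcases hq with rfl | rfl | rfl | rfl | rfl | rfl <;> unfold Act <;> dsimp only <;> omega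

theorem ne_pathPos_of_mem_pathIn (hP : Par r c a b) (he : 2 ≤ e) (hec : e ≤ c) {k l : ℕ}
    (hk : k < pathLen r c a b e) (hl : l ≤ pathLen r c a b e) {q : ℕ × ℕ}
    (hq : q ∈ pathIn r c a b e k) : q ≠ pathPos r c a b e l := by
  have key : ∀ q1 q2 : ℕ, (q1, q2) = pathPos r c a b e l → (q1 + e = q2 + r ∧ q1 ≤ r) ∨
      (e + a = r ∧ q1 + c = q2 + b ∧ q1 ≤ b) ∨
      (e + a = r ∧ c = 2 * b ∧ q1 + a = q2 + c ∧ q1 ≤ c) := by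
    intro q1 q2 h
    obtain ⟨ha, hb, har, hac, hbc, hh⟩ := hP
    unfold pathLen at hl
    unfold pathPos at h
    split_ifs at h hl <;> rw [Prod.mk.injEq] at h <;> omega
  rcases path_cases hP he hec hk with h | ⟨h, h'⟩ | ⟨s, rfl, h, h'⟩ | ⟨h, h', h''⟩ |
    ⟨s, rfl, h, h', h''⟩
  all_goals obtain ⟨ha, hb, har, hac, hbc, hh⟩ := hP
  · rw [pathIn_seg1 (by omega) (by omega)] at hq
    simp only [List.mem_cons, List.not_mem_nil, or_false] at hq
    rcases hq with rfl | rfl <;> intro hc <;> have := key _ _ hc <;> omega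
  · rw [pathIn_firstCol (by omega) (by omega)] at hq
    simp only [List.mem_cons, List.not_mem_nil, or_false] at hq
    rcases hq with rfl | rfl | rfl <;> intro hc <;> have := key _ _ hc <;> omega
  · rw [pathIn_seg2 (by omega) (by omega)] at hq
    simp only [List.mem_cons, List.not_mem_nil, or_false] at hq
    rcases hq with rfl | rfl | rfl | rfl <;> intro hc <;> have := key _ _ hc <;> omega
  · rw [pathIn_firstRow (by omega) (by omega) (by omega)] at hq
    simp only [List.mem_cons, List.not_mem_nil, or_false] at hq
    rcases hq with rfl | rfl | rfl | rfl | rfl <;> intro hc <;> have := key _ _ hc <;> omega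
  · rw [pathIn_seg3] at hq
    simp only [List.mem_cons, List.not_mem_nil, or_false] at hq
    rcases hq with rfl | rfl | rfl | rfl | rfl | rfl <;> intro hc <;> have := key _ _ hc <;> omega

/-- The description of the positions of the path by the diagonals on which they lie. -/
theorem mem_path_of_diag (hP : Par r c a b) (he : 2 ≤ e) (hec : e ≤ c) {q : ℕ × ℕ}
    (hq : Act r c e q) (h : (q.1 + e = q.2 + r) ∨ (e + a = r ∧ q.1 + c = q.2 + b) ∨
      (e + a = r ∧ c = 2 * b ∧ q.1 + a = q.2 + c)) :
    ∃ k ≤ pathLen r c a b e, q = pathPos r c a b e k := by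
  obtain ⟨q1, q2⟩ := q
  obtain ⟨ha, hb, har, hac, hbc, hh⟩ := hP
  unfold Act at hq
  dsimp only at hq h
  rcases h with h | ⟨h1, h⟩ | ⟨h1, h2, h⟩
  · refine ⟨r - q1, ?_, ?_⟩
    · unfold pathLen; split_ifs <;> omega
    · rw [pathPos_seg1 (by omega), Prod.mk.injEq]; omega
  · refine ⟨e + (b - q1), ?_, ?_⟩
    · unfold pathLen; split_ifs <;> omega
    · rw [pathPos_seg2 (by omega), Prod.mk.injEq]; omega
  · refine ⟨e + b + (c - q1), ?_, ?_⟩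
    · unfold pathLen; split_ifs; omega
    · rw [pathPos_seg3, Prod.mk.injEq]; omega

/-- Lowering `e` moves only the diagonal that starts at `(r, e)` to the next region, and it changes
the coefficients of the replaced row or column only for `e + a = r`. In that case the diagonals on
which these coefficients matter belong to the path. -/
theorem stageVar_pred {K : Type*} [Field K] {x : ℕ → ℕ → K} (hP : Par r c a b) (he : 2 ≤ e)
    (hec : e ≤ c) {q : ℕ × ℕ} (hq : Act r c (e - 1) q)
    (hoff : ∀ k ≤ pathLen r c a b e, q ≠ pathPos r c a b e k) :
    stageVar x r c a b (e - 1) q = stageVar x r c a b e q := by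
  have hq' : Act r c e q := by unfold Act at hq ⊢; omega
  have hd := mt (mem_path_of_diag hP he hec hq')
    (fun ⟨k, hk, h⟩ => hoff k hk h)
  obtain ⟨q1, q2⟩ := q
  have hρ := effRow_spec r a e
  have hρ' := effRow_spec r a (e - 1)
  have heff : e + a ≠ r → effRow r a (e - 1) = effRow r a e := by omega
  obtain ⟨ha, hb, har, hac, hbc, hh⟩ := hP
  unfold Act at hq
  unfold stageVar
  dsimp only at hq hd ⊢
  by_cases h1 : q2 + r ≤ e - 1 + q1
  · rw [if_pos h1, if_pos (show q2 + r ≤ e + q1 by omega)]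
    by_cases h2 : q2 + r = a + q1
    · rw [if_pos h2, if_pos h2]
      by_cases h3 : e + a = r ∧ c = 2 * b
      · omega
      · by_cases h4 : e + a = r
        · rw [ycol_congr (k := effRow r a e) (by omega)]
        · rw [heff h4]
    · rw [if_neg h2, if_neg h2]
  rw [if_neg h1, if_neg (show ¬ q2 + r ≤ e + q1 by omega)]
  by_cases h2 : q2 + r ≤ c + q1
  · rw [if_pos h2, if_pos h2]
    by_cases h3 : q2 + r = a + 1 + q1
    · rw [if_pos h3, if_pos h3]
      by_cases h4 : e + a = r
      · rw [ycol_congr (k := effRow r a e) (by omega)]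
      · rw [heff h4]
    · rw [if_neg h3, if_neg h3]
  · rw [if_neg h2, if_neg h2]
    by_cases h3 : q2 + b = c + q1
    · rw [heff (by omega)]
    · rw [if_neg h3, if_neg h3]

end

/-! ### Processing a single path -/

section Shift

theorem shift_eq_of_notMem {pos : ℕ × ℕ → ℕ × ℕ} {l : List (ℕ × ℕ)} {x : ℕ × ℕ}
    (h : x ∉ l.tail) : shift pos l x = pos x := by
  induction l with
  | nil => rfl
  | cons p l ih =>
    cases l with
    | nil => rfl
    | cons q l =>
      rw [List.tail_cons, List.mem_cons, not_or] at h
      rw [shift, if_neg h.1]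
      exact ih h.2

theorem shift_map_range {pos : ℕ × ℕ → ℕ × ℕ} {P : ℕ → ℕ × ℕ} {m : ℕ}
    (hP : ∀ a ≤ m, ∀ b ≤ m, P a = P b → a = b) {k : ℕ} (hk : k < m) :
    shift pos ((List.range (m + 1)).map P) (P (k + 1)) = pos (P k) := by
  induction k generalizing P m with
  | zero =>
    obtain ⟨m, rfl⟩ : ∃ l, m = l + 1 := ⟨m - 1, by omega⟩
    rw [List.range_succ_eq_map, List.range_succ_eq_map]
    simp [shift]
  | succ k ih =>
    obtain ⟨m, rfl⟩ : ∃ l, m = l + 1 := ⟨m - 1, by omega⟩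
    have := ih (P := fun a => P (a + 1)) (m := m)
      (fun a ha b hb h => by have := hP _ (by omega) _ (by omega) h; omega) (by omega)
    rw [List.range_succ_eq_map, List.map_cons, List.map_map]
    obtain ⟨m, rfl⟩ : ∃ l, m = l + 1 := ⟨m - 1, by omega⟩
    rw [List.range_succ_eq_map, List.map_cons, shift, if_neg]
    · rw [← this]
      rw [List.range_succ_eq_map (n := m + 1)]
      rfl
    · intro h
      have := hP _ (by omega) _ (by omega) h
      simp at this

end Shift

section Count

variable {V K : Type*} [DecidableEq V] [Field K]

theorem prod_pow_count {S : Finset V} (f : V → K) {L : List V} (hL : ∀ u ∈ L, u ∈ S) :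
    ∏ u ∈ S, f u ^ (L.count u) = (L.map f).prod := by
  rw [Finset.prod_list_map_count]
  symm
  refine Finset.prod_subset (fun u hu => hL u (List.mem_toFinset.1 hu)) fun u _ hu => ?_
  rw [List.count_eq_zero_of_not_mem (fun h => hu (List.mem_toFinset.2 h)), pow_zero]

theorem cnt_eq_count (L : List (ℕ × ℕ)) (q : ℕ × ℕ) : cnt L q = (L.count q : ℤ) := by
  induction L with
  | nil => rfl
  | cons p L ih =>
    rw [List.count_cons, Nat.cast_add, ← ih]
    simp only [cnt, List.map_cons, List.sum_cons, ind, beq_iff_eq, eq_comm (a := q)]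
    split_ifs <;> simp [add_comm]

theorem count_map_of_injOn {pos : ℕ × ℕ → V} {A : ℕ × ℕ → Prop}
    (inj : ∀ q q', A q → A q' → pos q = pos q' → q = q') {L : List (ℕ × ℕ)} (hL : ∀ q ∈ L, A q)
    {q : ℕ × ℕ} (hq : A q) : (L.map pos).count (pos q) = L.count q := by
  induction L with
  | nil => rfl
  | cons p L ih =>
    have : p = q ↔ pos p = pos q := ⟨congrArg pos, inj _ _ (hL p (by simp)) hq⟩
    rw [List.map_cons, List.count_cons, List.count_cons, ih fun q hq => hL q (by simp [hq])]
    simp [this]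

end Count

section

variable {V K : Type*} [DecidableEq V] [Field K]

/-- No variable of a seed obtained by mutations at mutable vertices vanishes. -/
def Seed.NonVanishing (s : Seed V K) : Prop :=
  ∀ l : List V, (∀ v ∈ l, v ∈ s.exchangeable) → ∀ v ∈ s.verts, (s.mutateList l).var v ≠ 0

theorem Seed.NonVanishing.mutateList {s : Seed V K} (h : s.NonVanishing) {l : List V}
    (hl : ∀ v ∈ l, v ∈ s.exchangeable) : (s.mutateList l).NonVanishing := by
  intro l' hl' v hv
  rw [← Seed.mutateList_append]
  simp only [Seed.exchangeable, Seed.mutateList_verts, Seed.mutateList_frozen] at hl' hv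
  refine h _ (fun w hw => ?_) v hv
  rcases List.mem_append.1 hw with hw | hw
  · exact hl w hw
  · exact hl' w hw

/-- The seed `s`, whose vertices stand at the positions `q ↦ pos q`, has the variables and arrows
which are expected when `e` entries of the last row are left. -/
structure Stage (s : Seed V K) (pos : ℕ × ℕ → V) (x : ℕ → ℕ → K) (r c a b e : ℕ) : Prop where
  skew : s.Skew
  nz : s.NonVanishing
  mem : ∀ q, Act r c e q → pos q ∈ s.verts
  exch : ∀ q, Act r c e q → ¬IsStable a b q → pos q ∈ s.exchangeable
  inj : ∀ q q', Act r c e q → Act r c e q' → pos q = pos q' → q = q'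
  var : ∀ q, Act r c e q → s.var (pos q) = stageVar x r c a b e q
  arr : ∀ q q', Act r c e q → Act r c e q' → ¬IsStable a b q →
    s.b (pos q) (pos q') = arrB r c a b e q q'
  out : ∀ u ∈ s.verts, (∀ q, Act r c e q → u ≠ pos q) → ∀ q, Act r c e q → ¬IsStable a b q →
    s.b u (pos q) = 0

theorem Stage.arr' {s : Seed V K} {pos : ℕ × ℕ → V} {x : ℕ → ℕ → K} {r c a b e : ℕ}
    (h : Stage s pos x r c a b e) (q q' : ℕ × ℕ) (hq : Act r c e q) (hq' : Act r c e q')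
    (hst : ¬IsStable a b q') : s.b (pos q) (pos q') = arrB r c a b e q q' := by
  rw [h.skew, h.arr q' q hq' hq hst, ← arrB_skew]

theorem arrB_pathPos_far {r c a b e : ℕ} (hP : Par r c a b) (he : 2 ≤ e) (hec : e ≤ c) {k l : ℕ}
    (hkl : k + 1 < l) (hl : l ≤ pathLen r c a b e) :
    arrB r c a b e (pathPos r c a b e k) (pathPos r c a b e l) = 0 := by
  rw [arrB_path hP he hec (by omega) hl, if_neg (by omega)]

variable {s : Seed V K} {pos : ℕ × ℕ → V} {x : ℕ → ℕ → K} {r c a b e : ℕ}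

/-- The exponents of the exchange relations along the path. -/
def pathI (pos : ℕ × ℕ → V) (r c a b e k : ℕ) (u : V) : ℤ :=
  (((pathIn r c a b e k).map pos).count u : ℤ)

/-- The outgoing arrows of the first vertex of the path. -/
def pathZ (pos : ℕ × ℕ → V) (a b e : ℕ) (u : V) : ℤ :=
  if e = a + 1 ∧ u = pos (1, b + 1) then 1 else 0

theorem act_pathStart (hP : Par r c a b) : Act r c e (1, b + 1) := by
  obtain ⟨ha, hb, har, hac, hbc, hh⟩ := hP
  unfold Act; dsimp only; omega

theorem firstRow_off_path (hP : Par r c a b) (he : e = a + 1) {k : ℕ}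
    (hk : k ≤ pathLen r c a b e) : (1, b + 1) ≠ pathPos r c a b e k := by
  obtain ⟨ha, hb, har, hac, hbc, hh⟩ := hP
  unfold pathLen at hk
  unfold pathPos
  rw [Ne]
  split_ifs at hk ⊢ <;> rw [Prod.mk.injEq] <;> omega

theorem firstRow_notMem_pathIn_zero (hP : Par r c a b) (he : e = a + 1) :
    (1, b + 1) ∉ pathIn r c a b e 0 := by
  obtain ⟨ha, hb, har, hac, hbc, hh⟩ := hP
  rw [pathIn_seg1 (by omega) (by omega)]
  simp only [List.mem_cons, List.not_mem_nil, or_false, Prod.mk.injEq]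
  omega

theorem Stage.pathI_pos (hS : Stage s pos x r c a b e) (hP : Par r c a b) (he : 2 ≤ e)
    (hec : e ≤ c) {k : ℕ} (hk : k < pathLen r c a b e) {q : ℕ × ℕ} (hq : Act r c e q) :
    pathI pos r c a b e k (pos q) = cnt (pathIn r c a b e k) q := by
  rw [pathI, count_map_of_injOn hS.inj (fun q hq => act_of_mem_pathIn hP he hec hk hq) hq,
    cnt_eq_count]

theorem Stage.pathI_out (hP : Par r c a b) (he : 2 ≤ e)
    (hec : e ≤ c) {k : ℕ} (hk : k < pathLen r c a b e) {u : V}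
    (hu : ∀ q, Act r c e q → u ≠ pos q) : pathI pos r c a b e k u = 0 := by
  rw [pathI, List.count_eq_zero_of_not_mem, Nat.cast_zero]
  intro h
  obtain ⟨q, hq, rfl⟩ := List.mem_map.1 h
  exact hu q (act_of_mem_pathIn hP he hec hk hq) rfl

theorem Stage.pathZ_pos (hS : Stage s pos x r c a b e) (hP : Par r c a b) {q : ℕ × ℕ}
    (hq : Act r c e q) : pathZ pos a b e (pos q) = if e = a + 1 then ind (1, b + 1) q else 0 := by
  unfold pathZ ind
  by_cases h : e = a + 1
  · have : pos q = pos (1, b + 1) ↔ q = (1, b + 1) :=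
      ⟨hS.inj _ _ hq (act_pathStart hP), congrArg pos⟩
    simp only [h, true_and, this, if_true]
  · rw [if_neg (fun h' => h h'.1), if_neg h]

theorem Stage.pathZ_out (hP : Par r c a b) {u : V}
    (hu : ∀ q, Act r c e q → u ≠ pos q) : pathZ pos a b e u = 0 :=
  if_neg fun h => hu _ (act_pathStart hP) h.2

/-- A vertex off the path stands at a position off the path, or it is not in use. -/
theorem Stage.off_cases (he : 2 ≤ e) {u : V}
    (hu : u ∈ s.offPath (fun k => pos (pathPos r c a b e k)) (pathLen r c a b e)) :
    (∃ q, u = pos q ∧ Act r c e q ∧ Act r c (e - 1) q ∧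
      ∀ k ≤ pathLen r c a b e, q ≠ pathPos r c a b e k) ∨ (∀ q, Act r c e q → u ≠ pos q) := by
  by_cases h : ∃ q, Act r c e q ∧ u = pos q
  · obtain ⟨q, hq, rfl⟩ := h
    have hoff : ∀ k ≤ pathLen r c a b e, q ≠ pathPos r c a b e k := fun k hk h =>
      Seed.offPath_ne hu hk (congrArg pos h)
    refine .inl ⟨q, rfl, hq, ?_, hoff⟩
    have h0 := hoff 0 (Nat.zero_le _)
    rw [pathPos_zero he, Ne, Prod.ext_iff] at h0
    unfold Act at hq ⊢
    dsimp only at h0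
    omega
  · right
    intro q hq h'
    exact h ⟨q, hq, h'⟩

/-- For vertices standing on positions in use, the conditions are the statements on `arrB` and
`pathIn` above. For vertices no longer in use they hold because such vertices have no arrows to the
mutable vertices of the path. -/
theorem Stage.isPath (hS : Stage s pos x r c a b e) (hP : Par r c a b) (he : 2 ≤ e)
    (hec : e ≤ c) : s.IsPath (fun k => pos (pathPos r c a b e k)) (pathLen r c a b e)
      (pathI pos r c a b e) (pathZ pos a b e) := by
  have hm := pathLen_pos (r := r) (c := c) (a := a) (b := b) hP he
  refine ⟨fun k hk => hS.mem _ (act_pathPos hP he hec hk), ?_, ?_, ?_, ?_, ?_, ?_, ?_, ?_⟩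
  · intro k hk l hl h
    exact pathPos_inj hP he hec hk hl (hS.inj _ _ (act_pathPos hP he hec hk)
      (act_pathPos hP he hec hl) h)
  · intro k hk
    rw [hS.arr _ _ (act_pathPos hP he hec hk.le) (act_pathPos hP he hec hk)
      (not_isStable_pathPos hP he hec hk), arrB_path hP he hec (by omega) hk, if_pos rfl]
  · intro k l hkl hl
    rw [hS.arr _ _ (act_pathPos hP he hec (by omega)) (act_pathPos hP he hec hl)
      (not_isStable_pathPos hP he hec (by omega)), arrB_pathPos_far hP he hec hkl hl]
  · intro u _
    unfold pathZ
    split_ifs <;> simp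
  · intro k _ u _
    exact Int.natCast_nonneg _
  · intro u hu
    unfold pathZ
    split_ifs with h
    · rw [h.2, hS.pathI_pos hP he hec hm (act_pathStart hP), cnt_eq_count,
        List.count_eq_zero_of_not_mem (firstRow_notMem_pathIn_zero hP h.1)]
      simp
    · rw [mul_zero]
  · intro u hu
    rcases Stage.off_cases he hu with ⟨q, rfl, hq, -, hoff⟩ | h
    · rw [hS.arr _ _ (act_pathPos hP he hec (Nat.zero_le _)) hq
        (not_isStable_pathPos hP he hec hm), hS.pathI_pos hP he hec hm hq, hS.pathZ_pos hP hq,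
        pathPos_zero he, arrB_path_zero hP he hq hoff]
    · rw [hS.skew, hS.out u (Seed.offPath_mem hu) h _ (act_pathPos hP he hec (Nat.zero_le _))
        (not_isStable_pathPos hP he hec hm), Stage.pathI_out hP he hec hm h, Stage.pathZ_out hP h]
      rfl
  · intro k hk u hu
    rcases Stage.off_cases he hu with ⟨q, rfl, hq, -, hoff⟩ | h
    · rw [hS.arr _ _ (act_pathPos hP he hec hk.le) hq
        (not_isStable_pathPos hP he hec hk), hS.pathI_pos hP he hec hk hq,
        hS.pathI_pos hP he hec (by omega) hq, cnt_pathIn_succ hP he hec hk hq hoff]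
    · rw [hS.skew, hS.out u (Seed.offPath_mem hu) h _ (act_pathPos hP he hec hk.le)
        (not_isStable_pathPos hP he hec hk), Stage.pathI_out hP he hec hk h,
        Stage.pathI_out hP he hec (by omega) h]
      rfl

theorem Stage.prod_pathI (hS : Stage s pos x r c a b e) (hP : Par r c a b) (he : 2 ≤ e)
    (hec : e ≤ c) {k : ℕ} (hk : k < pathLen r c a b e) :
    ∏ u ∈ s.offPath (fun k => pos (pathPos r c a b e k)) (pathLen r c a b e),
      s.var u ^ (pathI pos r c a b e k u).toNat =
    ((pathIn r c a b e k).map (stageVar x r c a b e)).prod := by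
  simp only [pathI, Int.toNat_natCast]
  rw [prod_pow_count, List.map_map]
  · congr 1
    exact List.map_congr_left fun q hq => hS.var q (act_of_mem_pathIn hP he hec hk hq)
  · intro u hu
    obtain ⟨q, hq, rfl⟩ := List.mem_map.1 hu
    have hq' := act_of_mem_pathIn hP he hec hk hq
    refine Finset.mem_filter.2 ⟨hS.mem q hq', fun l hl h => ?_⟩
    exact ne_pathPos_of_mem_pathIn hP he hec hk hl hq
      (hS.inj _ _ hq' (act_pathPos hP he hec hl) h)

theorem Stage.pathVars (hS : Stage s pos x r c a b e) (hP : Par r c a b) (he : 2 ≤ e)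
    (hec : e ≤ c) : s.PathVars (fun k => pos (pathPos r c a b e k)) (pathLen r c a b e)
      (pathI pos r c a b e) (pathZ pos a b e)
      fun k => stageVar x r c a b (e - 1) (pathPos r c a b e (k + 1)) := by
  have hm := pathLen_pos (r := r) (c := c) (a := a) (b := b) hP he
  constructor
  · have := stageVar_path (x := x) hP he hec hm
    rw [if_pos rfl] at this
    rw [hS.prod_pathI hP he hec hm, hS.var _ (act_pathPos hP he hec (Nat.zero_le _)),
      hS.var _ (act_pathPos hP he hec hm), this]
    congr 2
    unfold pathZ
    split_ifs with h
    · simp only [eq_true h, true_and]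
      rw [← hS.var _ (act_pathStart hP), Finset.prod_eq_single (pos (1, b + 1))]
      · simp
      · intro u _ hu
        rw [if_neg hu]; simp
      · intro h'
        refine absurd (Finset.mem_filter.2 ⟨hS.mem _ (act_pathStart hP), fun k hk hk' => ?_⟩) h'
        exact firstRow_off_path hP h hk (hS.inj _ _ (act_pathStart hP)
          (act_pathPos hP he hec hk) hk')
    · simp [h]
  · intro k hk
    have := stageVar_path (x := x) hP he hec hk
    rw [if_neg (Nat.succ_ne_zero k)] at this
    rw [hS.prod_pathI hP he hec hk, hS.var _ (act_pathPos hP he hec hk.le),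
      hS.var _ (act_pathPos hP he hec hk), this]

/-- Processing the path that starts at `(r, e)`. -/
theorem Stage.step {pos : ℕ × ℕ → ℕ × ℕ} {s : Seed (ℕ × ℕ) K} (hS : Stage s pos x r c a b e)
    (hP : Par r c a b) (he : 2 ≤ e) (hec : e ≤ c) {l : List (ℕ × ℕ)}
    (hl : l = (List.range (pathLen r c a b e + 1)).map (pathPos r c a b e)) :
    (∀ v ∈ l.dropLast.map pos, v ∈ s.exchangeable) ∧
    Stage (s.mutateList (l.dropLast.map pos)) (shift pos l) x r c a b (e - 1) := by
  have hm := pathLen_pos (r := r) (c := c) (a := a) (b := b) hP he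
  have hd : l.dropLast.map pos =
      (List.range (pathLen r c a b e)).map fun k => pos (pathPos r c a b e k) := by
    rw [hl, List.range_succ, List.map_append, List.map_singleton, List.dropLast_concat,
      List.map_map]
    rfl
  have hex : ∀ v ∈ l.dropLast.map pos, v ∈ s.exchangeable := by
    intro v hv
    rw [hd] at hv
    obtain ⟨k, hk, rfl⟩ := List.mem_map.1 hv
    have hk := List.mem_range.1 hk
    exact hS.exch _ (act_pathPos hP he hec hk.le) (not_isStable_pathPos hP he hec hk)
  refine ⟨hex, ?_⟩
  have hpath := hS.isPath hP he hec
  obtain ⟨n, hn⟩ : ∃ n, pathLen r c a b e = n + 1 := ⟨_, (Nat.sub_add_cancel hm).symm⟩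
  obtain ⟨hA, hv1, hv2⟩ := Seed.afterPath_mutateList hpath hS.skew (hS.pathVars hP he hec)
    (fun k hk => hS.nz [] (by simp) _ (hpath.mem k hk.le)) (j := n) (by omega)
  rw [← hn, ← hd] at hA hv1 hv2
  have p1 : ∀ k < pathLen r c a b e,
      shift pos l (pathPos r c a b e (k + 1)) = pos (pathPos r c a b e k) := fun k hk => by
    rw [hl]
    exact shift_map_range (fun k hk l hl h => pathPos_inj hP he hec hk hl h) hk
  have p2 : ∀ q, (∀ k ≤ pathLen r c a b e, q ≠ pathPos r c a b e k) → shift pos l q = pos q :=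
    fun q hq => shift_eq_of_notMem fun h => by
      have := List.mem_of_mem_tail h
      rw [hl] at this
      obtain ⟨k, hk, rfl⟩ := List.mem_map.1 this
      exact hq k (by have := List.mem_range.1 hk; omega) rfl
  have cases : ∀ q, Act r c (e - 1) q → (∃ k < pathLen r c a b e, q = pathPos r c a b e (k + 1)) ∨
      ∀ k ≤ pathLen r c a b e, q ≠ pathPos r c a b e k := by
    intro q hq
    by_cases h : ∃ k ≤ pathLen r c a b e, q = pathPos r c a b e k
    · left
      obtain ⟨k, hk, rfl⟩ := h
      cases k with
      | zero =>
        rw [pathPos_zero he] at hq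
        unfold Act at hq
        dsimp only at hq
        omega
      | succ k => exact ⟨k, hk, rfl⟩
    · right
      intro k hk h'
      exact h ⟨k, hk, h'⟩
  have act : ∀ q, Act r c (e - 1) q → Act r c e q := fun q hq => by
    unfold Act at hq ⊢; omega
  have actP : ∀ k ≤ pathLen r c a b e, Act r c e (pathPos r c a b e k) := fun k hk =>
    act_pathPos hP he hec hk
  have nst : ∀ k < pathLen r c a b e, ¬ IsStable a b (pathPos r c a b e k) := fun k hk =>
    not_isStable_pathPos hP he hec hk
  have last := isStable_pathPos_last (r := r) (c := c) (a := a) (b := b) hP he hec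
  have memoff : ∀ q, Act r c e q → (∀ k ≤ pathLen r c a b e, q ≠ pathPos r c a b e k) →
      pos q ∈ s.offPath (fun k => pos (pathPos r c a b e k)) (pathLen r c a b e) :=
    fun q hq hoff => Finset.mem_filter.2 ⟨hS.mem q hq, fun k hk h =>
      hoff k hk (hS.inj _ _ hq (actP k hk) h)⟩
  have hskew := hS.skew.mutateList (l.dropLast.map pos)
  have I0 : ∀ k ≤ pathLen r c a b e, cnt (pathIn r c a b e 0) (pathPos r c a b e k) = 0 := by
    intro k hk
    rw [cnt_eq_count, List.count_eq_zero_of_not_mem, Nat.cast_zero]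
    exact fun h => ne_pathPos_of_mem_pathIn hP he hec hm hk h rfl
  have i1 : ∀ k < pathLen r c a b e, e = a + 1 →
      ind (r - 1, a) (pathPos r c a b e (k + 1)) = if k = 0 then 1 else 0 := by
    intro k hk h
    have e1 : pathPos r c a b e 1 = (r - 1, a) := by
      rw [pathPos_seg1 (by omega), h]; rfl
    rw [← e1]
    unfold ind
    split_ifs with h1 h2 h2
    · rfl
    · exact absurd (pathPos_inj hP he hec hk hm h1) (by omega)
    · exact absurd (by rw [h2]) h1
    · rfl
  have i1' : ∀ q, e = a + 1 → (∀ k ≤ pathLen r c a b e, q ≠ pathPos r c a b e k) →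
      ind (r - 1, a) q = 0 := by
    intro q h hoff
    have e1 : pathPos r c a b e 1 = (r - 1, a) := by
      rw [pathPos_seg1 (by omega), h]; rfl
    exact ind_of_ne (e1 ▸ hoff 1 hm)
  have i2 : ∀ k ≤ pathLen r c a b e, e = a + 1 → ind (1, b + 1) (pathPos r c a b e k) = 0 :=
    fun k hk h => ind_of_ne (firstRow_off_path hP h hk).symm
  -- the arrows between a vertex of the path and a vertex off the path
  have mixed : ∀ k < pathLen r c a b e, ∀ q, Act r c (e - 1) q →
      (∀ k ≤ pathLen r c a b e, q ≠ pathPos r c a b e k) →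
      (¬ IsStable a b (pathPos r c a b e (k + 1)) ∨ ¬ IsStable a b q) →
      (s.mutateList (l.dropLast.map pos)).b (pos (pathPos r c a b e k)) (pos q) =
        arrB r c a b (e - 1) (pathPos r c a b e (k + 1)) q := by
    intro k hk q hq hoff hst
    have hq' := act q hq
    have hz := hS.pathZ_pos hP hq'
    rw [arrB_pred hP he (act_pathPos_succ hP he hec (by omega) hk) hq, I0 _ hk]
    -- The change of the additional arrows at `(1, b + 1)` for `e = a + 1` is exactly the effect of
    -- the outgoing arrow of the first vertex, described by `pathZ`.
    have corr : (if e = a + 1 then (0 - ind (r - 1, a) (pathPos r c a b e (k + 1))) *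
        ind (1, b + 1) q - ind (1, b + 1) (pathPos r c a b e (k + 1)) *
          (cnt (pathIn r c a b e 0) q - ind (r - 1, a) q) else 0) =
        -(if k = 0 then pathZ pos a b e (pos q) else 0) := by
      rw [hz]
      by_cases h : e = a + 1
      · rw [if_pos h, if_pos h, i1 k hk h, i2 _ hk h]
        split_ifs <;> ring
      · rw [if_neg h, if_neg h]; simp
    rw [corr]
    -- The last mutated vertex moves to a frozen position, so its arrows have to be correct only
    -- with respect to mutable positions. There they agree with those of the frozen vertex which
    -- stood on that position before.
    by_cases hkn : k = n
    · subst hkn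
      have h1 : ¬ IsStable a b q := by
        rw [← hn] at hst
        exact hst.resolve_left fun h => h last
      have hL := arrB_path_last hP he hec hq h1 hoff
      rw [hn, Nat.add_sub_cancel] at hL
      rw [hA.last _ (memoff q hq' hoff), hS.pathI_pos hP he hec hk hq', hL]
      ring
    · rw [hA.lt k (by omega) _ (memoff q hq' hoff), hS.pathI_pos hP he hec hk hq',
        hS.pathI_pos hP he hec (by omega) hq', cnt_pathIn_succ hP he hec (by omega) hq' hoff]
      ring
  have onpath : ∀ k l', k < l' → l' < pathLen r c a b e →
      (s.mutateList (l.dropLast.map pos)).b (pos (pathPos r c a b e k))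
        (pos (pathPos r c a b e l')) =
        arrB r c a b (e - 1) (pathPos r c a b e (k + 1)) (pathPos r c a b e (l' + 1)) := by
    intro k l' hkl hl'
    rw [arrB_pred hP he (act_pathPos_succ (k := k + 1) hP he hec (by omega) (by omega))
      (act_pathPos_succ (k := l' + 1) hP he hec (by omega) hl'), hA.on k l' hkl hl'.le,
      if_neg (show ¬ k = n by omega), arrB_path hP he hec (by omega) hl']
    by_cases h : e = a + 1
    · rw [if_pos h, i2 _ hl' h, i2 _ (by omega) h]
      simp
    · rw [if_neg h]
      simp
  refine ⟨hskew, hS.nz.mutateList hex, ?_, ?_, ?_, ?_, ?_, ?_⟩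
  · intro q hq
    rw [Seed.mutateList_verts]
    rcases cases q hq with ⟨k, hk, rfl⟩ | h
    · rw [p1 k hk]; exact hS.mem _ (actP k hk.le)
    · rw [p2 q h]; exact hS.mem _ (act q hq)
  · intro q hq hst
    simp only [Seed.exchangeable, Seed.mutateList_verts, Seed.mutateList_frozen]
    rcases cases q hq with ⟨k, hk, rfl⟩ | h
    · rw [p1 k hk]; exact hS.exch _ (actP k hk.le) (nst k hk)
    · rw [p2 q h]; exact hS.exch _ (act q hq) hst
  · intro q q' hq hq' h
    rcases cases q hq with ⟨k, hk, rfl⟩ | h1 <;> rcases cases q' hq' with ⟨k', hk', rfl⟩ | h2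
    · rw [p1 k hk, p1 k' hk'] at h
      rw [pathPos_inj hP he hec hk.le hk'.le (hS.inj _ _ (actP k hk.le) (actP k' hk'.le) h)]
    · rw [p1 k hk, p2 q' h2] at h
      exact absurd (hS.inj _ _ (actP k hk.le) (act q' hq') h).symm (h2 k hk.le)
    · rw [p2 q h1, p1 k' hk'] at h
      exact absurd (hS.inj _ _ (act q hq) (actP k' hk'.le) h) (h1 k' hk'.le)
    · rw [p2 q h1, p2 q' h2] at h
      exact hS.inj _ _ (act q hq) (act q' hq') h
  · intro q hq
    rcases cases q hq with ⟨k, hk, rfl⟩ | h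
    · rw [p1 k hk]
      exact hv2 k (by omega)
    · rw [p2 q h, stageVar_pred hP he hec hq h, ← hS.var q (act q hq)]
      exact hv1 _ fun k hk => Seed.offPath_ne (memoff q (act q hq) h) (by omega)
  · intro q q' hq hq' hst
    rcases cases q hq with ⟨k, hk, rfl⟩ | h1 <;> rcases cases q' hq' with ⟨k', hk', rfl⟩ | h2
    · rw [p1 k hk, p1 k' hk']
      rcases lt_trichotomy k k' with h | rfl | h
      · exact onpath k k' h hk'
      · rw [hskew.self, arrB, sub_self]
      · rw [hskew, arrB_skew, onpath k' k h hk]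
    · rw [p1 k hk, p2 q' h2]
      exact mixed k hk q' hq' h2 (.inl hst)
    · rw [p2 q h1, p1 k' hk', hskew, arrB_skew, mixed k' hk' q hq h1 (.inr hst)]
    · rw [p2 q h1, p2 q' h2, hA.off _ (memoff q (act q hq) h1) _ (memoff q' (act q' hq') h2),
        arrB_pred hP he hq hq', hS.arr q q' (act q hq) (act q' hq') hst,
        hS.pathI_pos hP he hec hm (act q hq), hS.pathI_pos hP he hec hm (act q' hq'),
        hS.pathZ_pos hP (act q hq), hS.pathZ_pos hP (act q' hq')]
      by_cases h : e = a + 1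
      · rw [if_pos h, if_pos h, if_pos h, i1' q h h1, i1' q' h h2]
        ring
      · rw [if_neg h, if_neg h, if_neg h]
        ring
  · intro u hu hout q hq hst
    rw [Seed.mutateList_verts] at hu
    -- The frozen vertex that stood on the last position is dropped. The arrows created by the last
    -- mutation cancel its arrows to all the mutable positions in use.
    by_cases hum : u = pos (pathPos r c a b e (pathLen r c a b e))
    · subst hum
      rcases cases q hq with ⟨k, hk, rfl⟩ | h
      · rw [p1 k hk]
        have hkn : k ≠ n := by
          rintro rfl
          rw [← hn] at hst
          exact hst last
        rw [hskew, hA.on k _ hk le_rfl]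
        rw [if_neg (by omega), neg_zero]
      · rw [p2 q h]
        have := hA.cur _ (memoff q (act q hq) h)
        rw [← hn] at this
        rw [this, hS.arr' _ _ (actP _ le_rfl) (act q hq) hst, arrB_path_last hP he hec hq hst h,
          hn, Nat.add_sub_cancel, hS.pathI_pos hP he hec (by omega) (act q hq), sub_self]
    · have hu' : ∀ q, Act r c e q → u ≠ pos q := by
        intro q' hq' h
        by_cases h1 : ∃ k ≤ pathLen r c a b e, q' = pathPos r c a b e k
        · obtain ⟨k, hk, rfl⟩ := h1
          rcases hk.lt_or_eq with hk | rfl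
          · exact hout _ (act_pathPos_succ hP he hec (by omega) hk) (by rw [p1 k hk, h])
          · exact hum h
        · have h2 : ∀ k ≤ pathLen r c a b e, q' ≠ pathPos r c a b e k :=
            fun k hk h' => h1 ⟨k, hk, h'⟩
          refine hout q' ?_ (by rw [p2 q' h2, h])
          have h0 := h2 0 (Nat.zero_le _)
          rw [pathPos_zero he, Ne, Prod.ext_iff] at h0
          unfold Act at hq' ⊢
          dsimp only at h0
          omega
      have hoff : u ∈ s.offPath (fun k => pos (pathPos r c a b e k)) (pathLen r c a b e) :=
        Finset.mem_filter.2 ⟨hu, fun k hk => hu' _ (actP k hk)⟩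
      have hI := fun k hk => Stage.pathI_out (pos := pos) hP he hec (k := k) hk hu'
      have hZ := Stage.pathZ_out (pos := pos) hP hu'
      rcases cases q hq with ⟨k, hk, rfl⟩ | h
      · rw [p1 k hk, hskew]
        by_cases hkn : k = n
        · subst hkn
          rw [hA.last u hoff, hI k hk, hZ]
          simp
        · rw [hA.lt k (by omega) u hoff, hI k hk, hI (k + 1) (by omega), hZ]
          simp
      · rw [p2 q h, hA.off u hoff _ (memoff q (act q hq) h), hI 0 hm, hZ,
          hS.out u hu hu' q (act q hq) hst]
        simp

end

theorem mutations_append (pos : ℕ × ℕ → ℕ × ℕ) (ps ps' : List (List (ℕ × ℕ))) :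
    mutations pos (ps ++ ps') = mutations pos ps ++ mutations (ps.foldl shift pos) ps' := by
  induction ps generalizing pos with
  | nil => rfl
  | cons p ps ih => simp [mutations, ih]

/-! ### Removal of a whole row, transposition, and the sequence `S` -/

section

variable {K : Type*} [Field K] {s : Seed (ℕ × ℕ) K} {pos : ℕ × ℕ → ℕ × ℕ} {x : ℕ → ℕ → K}
  {r c a b e N : ℕ}

/-- The paths that start in row `r`, from the last position to the second one. -/
def rowPaths (r c a b N m : ℕ) : List (List (ℕ × ℕ)) :=
  (List.range m).map fun k => path a b c c N (r, c - k)

/-- The path that starts at `(r, 1)` consists of a single frozen position, or is already absent from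
the sequence. So the description ends with one entry of the last row left after `c - 1` paths. -/
theorem Stage.rowRemoval (hS : Stage s pos x r c a b c) (hP : Par r c a b) (hN : c + b + a ≤ N)
    {m : ℕ} (hm : m + 1 ≤ c) :
    (∀ v ∈ mutations pos (rowPaths r c a b N m), v ∈ s.exchangeable) ∧
    Stage (s.mutateList (mutations pos (rowPaths r c a b N m)))
      ((rowPaths r c a b N m).foldl shift pos) x r c a b (c - m) := by
  induction m with
  | zero => exact ⟨by simp [rowPaths, mutations], hS⟩
  | succ m ih =>
    obtain ⟨h1, h2⟩ := ih (by omega)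
    have e : rowPaths r c a b N (m + 1) = rowPaths r c a b N m ++ [path a b c c N (r, c - m)] := by
      unfold rowPaths
      rw [List.range_succ, List.map_append]
      rfl
    obtain ⟨h3, h4⟩ := h2.step hP (by omega) (by omega)
      (path_eq_pathPos (N := N) hP (e := c - m) (by omega) (by omega) (by omega))
    rw [e, mutations_append, List.foldl_append, Seed.mutateList_append]
    simp only [mutations, List.append_nil, List.foldl_cons, List.foldl_nil]
    refine ⟨fun v hv => ?_, h4⟩
    rcases List.mem_append.1 hv with hv | hv
    · exact h1 v hv
    · have := h3 v hv
      simpa only [Seed.exchangeable, Seed.mutateList_verts, Seed.mutateList_frozen] using this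

/-! ### Transposition -/

/-- For `e = 1` there are no unprocessed diagonals among the rows above the last one. The
transposition interchanges the remaining two regions of `stageVar`: the shortened diagonals become
those that end in the last column, and the latter become unprocessed ones of the transposed matrix.
-/
theorem stageVar_transpose (hP : Par r c a b) {i j : ℕ} (hi : i < r) (hj : 1 ≤ j) :
    stageVar (fun i j => x j i) c (r - 1) b a (r - 1) (j, i) = stageVar x r c a b 1 (i, j) := by
  obtain ⟨ha, hb, har, hac, hbc, hh⟩ := hP
  have h1 : effRow c b (r - 1) = c := by have := effRow_spec c b (r - 1); omega
  have h2 : effRow r a 1 = r - 1 := by have := effRow_spec r a 1; omega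
  unfold stageVar
  dsimp only
  rw [h1, h2, ycol_transpose x c (r - 1) b a, zrow_transpose x c (r - 1) b a,
    if_neg (by omega : ¬ j + r ≤ 1 + i)]
  by_cases h : j + r ≤ c + i
  · rw [if_pos h, if_neg (by omega), if_neg (by omega), show r - 1 + 1 - i = r - i by omega]
    by_cases h3 : j + r = a + 1 + i
    · rw [if_pos h3, if_pos (by omega)]
      exact mn_transpose (updC x a _) _ _ _
    · rw [if_neg h3, if_neg (by omega)]
      exact mn_transpose x _ _ _
  · rw [if_neg h, if_pos (by omega)]
    by_cases h3 : j + b = c + i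
    · rw [if_pos h3, if_pos (by omega)]
      exact mn_transpose (updR x b _) _ _ _
    · rw [if_neg h3, if_neg (by omega)]
      exact mn_transpose x _ _ _

theorem arr_transpose (hP : Par r c a b) (p q : ℕ × ℕ) :
    Arr c (r - 1) b a (r - 1) p.swap q.swap ↔ Arr r c a b 1 p q := by
  obtain ⟨ha, hb, har, hac, hbc, hh⟩ := hP
  have h1 : lastRow c b (r - 1) = c := by have := lastRow_spec c b (r - 1); omega
  have h2 : lastRow r a 1 = r - 1 := by have := lastRow_spec r a 1; omega
  unfold Arr
  rw [h1, h2]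
  simp only [Prod.fst_swap, Prod.snd_swap]
  constructor
  · rintro (⟨h, h'⟩ | h | h | h | h | h | h)
    · refine .inl ⟨fun h'' => h ⟨h''.1.symm, h''.2.symm⟩, ?_⟩
      omega
    · right; right; left; omega
    · right; left; omega
    · right; right; right; right; right; left; omega
    · right; right; right; right; right; right; omega
    · right; right; right; left; omega
    · right; right; right; right; left; omega
  · rintro (⟨h, h'⟩ | h | h | h | h | h | h)
    · refine .inl ⟨fun h'' => h ⟨h''.1.symm, h''.2.symm⟩, ?_⟩
      omega
    · right; right; left; omega
    · right; left; omega
    · right; right; right; right; right; left; omega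
    · right; right; right; right; right; right; omega
    · right; right; right; left; omega
    · right; right; right; right; left; omega

theorem arrB_transpose (hP : Par r c a b) (p q : ℕ × ℕ) :
    arrB c (r - 1) b a (r - 1) p.swap q.swap = arrB r c a b 1 p q := by
  unfold arrB
  simp only [arr_transpose hP]

theorem isStable_swap (p : ℕ × ℕ) : IsStable b a p.swap ↔ IsStable a b p := by
  obtain ⟨i, j⟩ := p
  unfold IsStable
  simp only [Prod.swap_prod_mk, Ne, Prod.mk.injEq]
  tauto

theorem arrB_last_eq_zero (hP : Par r c a b) {q : ℕ × ℕ} (hq : q.1 < r) (hq2 : 1 ≤ q.2) (hst : ¬ IsStable a b q) :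
    arrB r c a b 1 (r, 1) q = 0 := by
  obtain ⟨q1, q2⟩ := q
  have h2 : lastRow r a 1 = r - 1 := by have := lastRow_spec r a 1; have := hP.ha; omega
  obtain ⟨ha, hb, har, hac, hbc, hh⟩ := hP
  unfold IsStable at hst
  simp only [Ne, Prod.mk.injEq] at hst
  dsimp only at hq hq2 hst
  unfold arrB
  rw [if_neg, if_neg, sub_self]
  all_goals
    unfold Arr
    rw [h2]
    dsimp only
    rintro (⟨_, h⟩ | h | h | h | h | h | h) <;> omega

/-- When the last row is removed, one obtains, after transposition, the situation in which the
removal of the next row begins. -/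
theorem Stage.transpose (hS : Stage s pos x r c a b 1) (hP : Par r c a b) :
    Stage s (pos ∘ Prod.swap) (fun i j => x j i) c (r - 1) b a (r - 1) := by
  have act : ∀ q, Act c (r - 1) (r - 1) q → Act r c 1 q.swap ∧ q.2 < r := by
    intro q hq
    have := hP.har
    unfold Act at hq ⊢
    simp only [Prod.fst_swap, Prod.snd_swap]
    omega
  have st : ∀ q, ¬ IsStable b a q → ¬ IsStable a b q.swap := fun q h => by
    rwa [isStable_swap]
  refine ⟨hS.skew, hS.nz, fun q hq => hS.mem _ (act q hq).1,
    fun q hq h => hS.exch _ (act q hq).1 (st q h),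
    fun q q' hq hq' h => Prod.swap_injective (hS.inj _ _ (act q hq).1 (act q' hq').1 h), ?_, ?_, ?_⟩
  · intro q hq
    rw [Function.comp_apply, hS.var _ (act q hq).1]
    exact (stageVar_transpose hP (act q hq).2 hq.1).symm
  · intro q q' hq hq' h
    rw [Function.comp_apply, Function.comp_apply, hS.arr _ _ (act q hq).1 (act q' hq').1 (st q h),
      ← arrB_transpose hP, Prod.swap_swap, Prod.swap_swap]
  · intro u hu hout q hq h
    rw [Function.comp_apply]
    by_cases h1 : ∃ p, Act r c 1 p ∧ u = pos p
    · obtain ⟨p, hp, rfl⟩ := h1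
      have hp1 : p = (r, 1) := by
        by_contra hne
        refine hout p.swap ?_ (by simp)
        rw [Prod.ext_iff] at hne
        unfold Act at hp ⊢
        simp only [Prod.fst_swap, Prod.snd_swap]
        dsimp only at hne
        omega
      rw [hS.arr' _ _ hp (act q hq).1 (st q h), hp1, arrB_last_eq_zero hP (act q hq).2 hq.1 (st q h)]
    · exact hS.out u hu (fun p hp hpu => h1 ⟨p, hp, hpu⟩) _ (act q hq).1 (st q h)

theorem next_swap (ha : 1 ≤ a) (p : ℕ × ℕ) : next b a c c p.swap = (next a b c c p).swap := by
  obtain ⟨i, j⟩ := p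
  unfold next
  simp only [Prod.swap_prod_mk, Prod.mk.injEq]
  split_ifs <;> simp <;> omega

theorem path_swap (ha : 1 ≤ a) (N : ℕ) (p : ℕ × ℕ) :
    path b a c c N p.swap = (path a b c c N p).map Prod.swap := by
  induction N generalizing p with
  | zero => rfl
  | succ N ih =>
    rw [path, path]
    simp only [isStable_swap, next_swap ha, ih]
    split_ifs <;> rfl

theorem shift_swap (pos : ℕ × ℕ → ℕ × ℕ) (l : List (ℕ × ℕ)) :
    shift pos (l.map Prod.swap) = shift (pos ∘ Prod.swap) l ∘ Prod.swap := by
  funext y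
  induction l with
  | nil => simp [shift]
  | cons p l ih =>
    cases l with
    | nil => simp [shift]
    | cons q l =>
      simp only [List.map_cons, shift, Function.comp_apply] at ih ⊢
      rw [ih]
      have : y = q.swap ↔ y.swap = q := by
        rw [← Prod.swap_inj, Prod.swap_swap]
      simp only [this]

theorem foldl_shift_swap (pos : ℕ × ℕ → ℕ × ℕ) (ps : List (List (ℕ × ℕ))) :
    (ps.map (List.map Prod.swap)).foldl shift pos =
      ps.foldl shift (pos ∘ Prod.swap) ∘ Prod.swap := by
  induction ps generalizing pos with
  | nil => funext y; simp
  | cons p ps ih =>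
    rw [List.map_cons, List.foldl_cons, List.foldl_cons, ih, shift_swap]
    congr 2

theorem mutations_swap (pos : ℕ × ℕ → ℕ × ℕ) (ps : List (List (ℕ × ℕ))) :
    mutations pos (ps.map (List.map Prod.swap)) = mutations (pos ∘ Prod.swap) ps := by
  induction ps generalizing pos with
  | nil => rfl
  | cons p ps ih =>
    rw [List.map_cons, mutations, mutations, ih, shift_swap, ← List.map_dropLast, List.map_map]
    congr 2

theorem hPaths_eq (n α β : ℕ) : hPaths n α β = rowPaths n n α β (n * n) (n - 1) := rfl

theorem vPaths_eq {n α β : ℕ} (hβ : 1 ≤ β) : vPaths n α β =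
    (rowPaths n (n - 1) β α (n * n) (n - 2)).map (List.map Prod.swap) := by
  unfold vPaths rowPaths
  rw [List.map_map]
  refine List.map_congr_left fun k _ => ?_
  rw [Function.comp_apply, ← path_swap hβ]
  rfl

/-- The positions of the vertices after the mutation sequence `S`. -/
def finalPos (n α β : ℕ) : ℕ × ℕ → ℕ × ℕ :=
  (vPaths n α β).foldl shift ((hPaths n α β).foldl shift id)

/-- The effect of the mutation sequence `S`. -/
theorem Stage.apply_S {n α β : ℕ} (hα : 1 ≤ α) (hαβ : α < β) (hβ : β + 2 ≤ n)
    (hS : Stage s id x n n α β n) :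
    (∀ v ∈ S n α β, v ∈ s.exchangeable) ∧
    Stage (s.mutateList (S n α β)) (finalPos n α β) x (n - 1) (n - 1) α β (n - 1) := by
  -- `S_h` removes a row with the parameters `(n, n, α, β)`. After transposition `S_v` does so with
  -- `(n, n - 1, β, α)`, and a second transposition restores the original orientation.
  have hP1 : Par n n α β := ⟨hα, by omega, by omega, by omega, by omega, .inl ⟨rfl, hαβ⟩⟩
  have hP2 : Par n (n - 1) β α := ⟨by omega, hα, by omega, by omega, by omega,
    .inr ⟨by omega, hαβ⟩⟩
  have hN : n + β + α ≤ n * n := by nlinarith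
  obtain ⟨h1, h2⟩ := hS.rowRemoval hP1 hN (m := n - 1) (by omega)
  rw [show n - (n - 1) = 1 by omega] at h2
  obtain ⟨h3, h4⟩ := (h2.transpose hP1).rowRemoval hP2 (N := n * n) (by omega) (m := n - 2)
    (by omega)
  rw [show n - 1 - (n - 2) = 1 by omega] at h4
  have h5 := h4.transpose hP2
  rw [← mutations_swap, ← vPaths_eq (by omega), ← hPaths_eq] at h3 h5
  rw [← foldl_shift_swap, ← vPaths_eq (by omega)] at h5
  have e1 : S n α β = mutations id (hPaths n α β) ++
      mutations ((hPaths n α β).foldl shift id) (vPaths n α β) := rfl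
  rw [e1, Seed.mutateList_append]
  refine ⟨fun v hv => ?_, h5⟩
  rcases List.mem_append.1 hv with hv | hv
  · exact h1 v hv
  · have := h3 v hv
    simpa only [Seed.exchangeable, Seed.mutateList_verts, Seed.mutateList_frozen] using this

end

/-! ### The functions of the initial seed as minors with a replaced row or column -/

section

variable {K : Type*} [Field K]

theorem mn_eq_mul_of_zero_lower (x : ℕ → ℕ → K) {i j k m : ℕ}
    (h : ∀ u < m, ∀ v < k, x (i + (k + u)) (j + v) = 0) :
    mn x i j (k + m) = mn x i j k * mn x (i + k) (j + k) m := by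
  unfold mn
  rw [← Matrix.det_fromBlocks_zero₂₁ _ (Matrix.of fun (u : Fin k) (v : Fin m) =>
    x (i + u) (j + (k + v))), ← Matrix.det_submatrix_equiv_self finSumFinEquiv]
  congr 1
  ext u v
  rcases u with u | u <;> rcases v with v | v
  · simp
  · simp
  · simpa using h u u.2 v v.2
  · simp [add_assoc]

theorem mn_eq_mul_of_zero_upper (x : ℕ → ℕ → K) {i j k m : ℕ}
    (h : ∀ u < k, ∀ v < m, x (i + u) (j + (k + v)) = 0) :
    mn x i j (k + m) = mn x i j k * mn x (i + k) (j + k) m := by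
  rw [← mn_transpose x, mn_eq_mul_of_zero_lower _ fun u hu v hv => h v hv u hu, mn_transpose,
    mn_transpose x]

/-- The determinant of a matrix that is glued from two blocks overlapping in two columns. -/
theorem mn_glue_cols (x : ℕ → ℕ → K) {i j k m : ℕ}
    (h1 : ∀ u < k + 1, ∀ v, k + 1 < v → x (i + u) (j + v) = 0)
    (h2 : ∀ u < m, ∀ v < k, x (i + (k + 1 + u)) (j + v) = 0) (hm : 1 ≤ m) :
    mn x i j (k + 1 + m) = mn x i j (k + 1) * mn x (i + (k + 1)) (j + (k + 1)) m -
      mn (updC x (j + k) fun u => x u (j + (k + 1))) i j (k + 1) *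
        mn (updC x (j + (k + 1)) fun u => x u (j + k)) (i + (k + 1)) (j + (k + 1)) m := by
  set t : ℕ → K := fun u => if u < i + (k + 1) then x u (j + k) else 0 with ht
  set s : ℕ → K := fun u => if u < i + (k + 1) then 0 else x u (j + k) with hs
  -- The first of the two overlapping columns is split into its upper part `t` and its lower part
  -- `s`. With `t` the matrix is block triangular; with `s` it becomes so after the two overlapping
  -- columns are interchanged, which gives the negative term.
  have e1 : x = updC x (j + k) fun u => 1 * t u - (-1) * s u := by
    conv_lhs => rw [← updC_eq_self x (j + k)]
    congr 1
    funext u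
    simp only [ht, hs]
    split_ifs <;> ring
  have e2 : mn x i j (k + 1 + m) = mn (updC x (j + k) t) i j (k + 1 + m) +
      mn (updC x (j + k) s) i j (k + 1 + m) := by
    conv_lhs => rw [e1, mn_updC_linear x (by omega)]
    ring
  rw [e2, mn_eq_mul_of_zero_lower (updC x (j + k) t) (k := k + 1),
    ← neg_neg (mn (updC x (j + k) s) i j (k + 1 + m)),
    ← mn_swap_cols_self (updC x (j + k) s) (a := j + k) (c := j + (k + 1)) (by omega) (by omega)
      (by omega), mn_eq_mul_of_zero_upper _ (k := k + 1) (m := m), sub_eq_add_neg]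
  · congr 1
    · congr 1
      · refine mn_congr fun u hu v hv => ?_
        simp only [updC, ht]
        split_ifs with h h'
        · rw [h]
        · omega
        · rfl
      · exact mn_updC_of_notMem x _ (by omega)
    · congr 2
      · refine mn_congr fun u hu v hv => ?_
        simp only [updC]
        rw [if_neg (by omega)]
        split_ifs <;> first | rfl | omega
      · refine mn_congr fun u hu v hv => ?_
        simp only [updC, hs]
        split_ifs <;> first | rfl | omega
  · intro u hu v hv
    simp only [updC, hs]
    by_cases h0 : v = 0
    · rw [if_pos (by omega), if_pos trivial, if_pos (by omega)]
    · rw [if_neg (by omega), if_neg (by omega), if_neg (by omega)]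
      exact h1 u hu _ (by omega)
  · intro u hu v hv
    simp only [updC, ht]
    by_cases h0 : v = k
    · rw [if_pos (by omega), if_neg (by omega)]
    · rw [if_neg (by omega)]
      exact h2 u hu v (by omega)

/-- The determinant of a matrix that is glued from two blocks overlapping in two rows. -/
theorem mn_glue_rows (x : ℕ → ℕ → K) {i j k m : ℕ}
    (h1 : ∀ u, k + 1 < u → ∀ v < k + 1, x (i + u) (j + v) = 0)
    (h2 : ∀ u < k, ∀ v < m, x (i + u) (j + (k + 1 + v)) = 0) (hm : 1 ≤ m) :
    mn x i j (k + 1 + m) = mn x i j (k + 1) * mn x (i + (k + 1)) (j + (k + 1)) m -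
      mn (updR x (i + k) (x (i + (k + 1)))) i j (k + 1) *
        mn (updR x (i + (k + 1)) (x (i + k))) (i + (k + 1)) (j + (k + 1)) m := by
  have := mn_glue_cols (fun i j => x j i) (i := j) (j := i) (k := k) (m := m)
    (fun u hu v hv => h1 v hv u hu) (fun u hu v hv => h2 v hv u hu) hm
  simp only [mn_updC, mn_transpose] at this
  exact this

/-- The entries of a block, see `block`. -/
def blk (x : ℕ → ℕ → K) (i₁ i₂ j₁ j₂ r₀ c₀ u v : ℕ) : K :=
  if (r₀ ≤ u ∧ i₁ + (u - r₀) ≤ i₂) ∧ (c₀ ≤ v ∧ j₁ + (v - c₀) ≤ j₂) then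
    x (i₁ + (u - r₀)) (j₁ + (v - c₀)) else 0

theorem blk_eq {x : ℕ → ℕ → K} {i₁ i₂ j₁ j₂ r₀ c₀ u v p q : ℕ}
    (hu : r₀ ≤ u ∧ i₁ + (u - r₀) = p ∧ p ≤ i₂) (hv : c₀ ≤ v ∧ j₁ + (v - c₀) = q ∧ q ≤ j₂) :
    blk x i₁ i₂ j₁ j₂ r₀ c₀ u v = x p q := by
  obtain ⟨h1, rfl, h2⟩ := hu
  obtain ⟨h3, rfl, h4⟩ := hv
  exact if_pos ⟨⟨h1, h2⟩, h3, h4⟩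

theorem blk_eq_zero {x : ℕ → ℕ → K} {i₁ i₂ j₁ j₂ r₀ c₀ u v : ℕ}
    (h : (u < r₀ ∨ i₂ < i₁ + (u - r₀)) ∨ (v < c₀ ∨ j₂ < j₁ + (v - c₀))) :
    blk x i₁ i₂ j₁ j₂ r₀ c₀ u v = 0 := if_neg (by omega)

/-- Everything behind the first block enters only through the two minors `p` and `q`. By linearity
their effect can be moved into the column `a` of the first block. -/
theorem mn_glue_first (M x : ℕ → ℕ → K) {i j k m a : ℕ} (ha : j + k = a) (hm : 1 ≤ m)
    (h0 : ∀ u ≤ k, ∀ v ≤ k + 1, M u v = x (i + u) (j + v))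
    (h1 : ∀ u ≤ k, ∀ v, k + 1 < v → M u v = 0)
    (h2 : ∀ u, k < u → ∀ v < k, M u v = 0) {y : ℕ → K} {p q : K}
    (hp : mn M (k + 1) (k + 1) m = p)
    (hq : mn (updC M (k + 1) fun u => M u k) (k + 1) (k + 1) m = q)
    (hy : y = fun u => p * x u a - q * x u (a + 1)) :
    mn M 0 0 (k + 1 + m) = mn (updC x a y) i j (k + 1) := by
  subst ha hp hq hy
  rw [mn_glue_cols M (i := 0) (j := 0)
    (fun u hu v hv => h1 _ (by omega) _ (by omega))
    (fun u hu v hv => h2 _ (by omega) _ (by omega)) hm,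
    mn_updC_linear x (by omega), updC_eq_self, mul_comm, zero_add, zero_add]
  congr 1
  · congr 1
    exact mn_congr fun u hu v hv => by
      rw [zero_add, zero_add]
      exact h0 u (by omega) v (by omega)
  · rw [mul_comm]
    congr 1
    refine mn_congr fun u hu v hv => ?_
    simp only [updC, zero_add]
    by_cases h : v = k
    · rw [if_pos h, if_pos (by omega), h0 u (by omega) _ le_rfl]
      rfl
    · rw [if_neg h, if_neg (by omega), h0 u (by omega) v (by omega)]

/-- Used in the presence of three blocks, for both coefficients of the first gluing. For the second
coefficient `x'` is the matrix in which a column is replaced by the preceding one, whereas the third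
block still comes from `x`. -/
theorem mn_glue_second (M x x' : ℕ → ℕ → K) {o k m a b c : ℕ}
    (h0 : ∀ u ≤ k + 1, ∀ v ≤ k, M (o + u) (o + v) = x' (1 + u) (c + v)) (hb : k + 1 = b)
    (h1 : ∀ u, k + 1 < u → ∀ v ≤ k, M (o + u) (o + v) = 0) (hm : 1 ≤ m)
    (h2 : ∀ u ≤ m, ∀ v < m, M (o + (k + u)) (o + (k + 1 + v)) = x (a + u) (1 + v))
    (h3 : ∀ u < k, ∀ v < m, M (o + u) (o + (k + 1 + v)) = 0) :
    mn M o o (k + 1 + m) =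
      mn (updR x' b fun j => mn x (a + 1) 1 m * x' b j -
        mn (updR x (a + 1) (x a)) (a + 1) 1 m * x' (b + 1) j) 1 c (k + 1) := by
  subst hb
  rw [mn_glue_rows M (fun u hu v hv => h1 u hu v (by omega)) (fun u hu v hv => h3 u hu v hv) hm,
    mn_updR_linear_sub x' (by omega), updR_eq_self, mul_comm]
  congr 1
  · congr 1
    · refine mn_congr fun u hu v hv => ?_
      rw [show o + (k + 1) + u = o + (k + (u + 1)) by ring, add_assoc o, h2 (u + 1) (by omega) v hv]
      congr 1
      ring
    · exact mn_congr fun u hu v hv => h0 u (by omega) v (by omega)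
  · rw [mul_comm]
    congr 1
    · refine mn_congr fun u hu v hv => ?_
      simp only [updR]
      by_cases h : u = 0
      · rw [if_pos (by omega), if_pos (by omega), add_assoc o]
        exact h2 0 (by omega) v hv
      · rw [if_neg (by omega), if_neg (by omega), show o + (k + 1) + u = o + (k + (u + 1)) by ring,
          add_assoc o, h2 (u + 1) (by omega) v hv]
        congr 1
        ring
    · refine mn_congr fun u hu v hv => ?_
      simp only [updR]
      by_cases h : u = k
      · rw [if_pos (by omega), if_pos (by omega), h0 _ le_rfl v (by omega)]
        congr 1
        ring
      · rw [if_neg (by omega), if_neg (by omega), h0 u (by omega) v (by omega)]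

variable {n : ℕ} (X : Matrix (Fin n) (Fin n) K)

theorem f_eq_mn (i j : ℕ) : f X i j = mn (entry X) i j (n + 1 - max i j) := by
  unfold f mn
  congr 1
  ext u v
  have := u.2
  have := v.2
  simp only [block, Matrix.of_apply]
  rw [if_pos (by omega)]
  simp

/-- The Laplace expansion of the glued matrix along the overlap. If there is a third block, the
coefficients are themselves glued determinants and are expanded in the same way, along two
overlapping rows; this is the role of `colBase`. -/
theorem fCol_eq_mn {α β i j : ℕ} (hα : 1 ≤ α) (hα2 : α + 1 ≤ n) (hβ : 1 ≤ β) (hβ2 : β + 1 ≤ n)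
    (hj : 1 ≤ j) (hi : i ≤ n) (hij : i + α = n + j) : fCol α β X i j =
      mn (updC (entry X) α (ycol (entry X) n n α β)) i j (n + 1 - i) := by
  set x := entry X with hx
  obtain ⟨k, hk⟩ : ∃ k, n = i + k := ⟨n - i, by omega⟩
  have hk' : n + 1 - i = k + 1 := by omega
  unfold fCol
  rw [hk', show n - i + 1 = k + 1 by omega, show n - i = k by omega]
  split_ifs with h
  · have e1 : (block (k + 1 + (n - β) + (n - α)) X i n j (α + 1) 0 0 +
        block (k + 1 + (n - β) + (n - α)) X 1 (β + 1) β n (k + 1) k +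
        block (k + 1 + (n - β) + (n - α)) X α n 1 (n - α) (k + β) (k + 1 + (n - β))).det =
        mn (fun u v => blk x i n j (α + 1) 0 0 u v + blk x 1 (β + 1) β n (k + 1) k u v +
          blk x α n 1 (n - α) (k + β) (k + 1 + (n - β)) u v) 0 0
          (k + 1 + (β - 1 + 1 + (n - α))) := by
      rw [show k + 1 + (β - 1 + 1 + (n - α)) = k + 1 + (n - β) + (n - α) by omega]
      unfold mn
      congr 1
      ext u v
      simp [block, blk, hx]
    simp only
    rw [e1]
    set M : ℕ → ℕ → K := fun u v => blk x i n j (α + 1) 0 0 u v +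
      blk x 1 (β + 1) β n (k + 1) k u v +
      blk x α n 1 (n - α) (k + β) (k + 1 + (n - β)) u v with hM
    have s0 : ∀ u ≤ k, ∀ v ≤ k + 1, M u v = x (i + u) (j + v) := fun u hu v hv => by
      simp only [hM]
      rw [blk_eq (p := i + u) (q := j + v) (by omega) (by omega), blk_eq_zero (by omega),
        blk_eq_zero (by omega), add_zero, add_zero]
    have s1 : ∀ u ≤ k, ∀ v, k + 1 < v → M u v = 0 := fun u hu v hv => by
      simp only [hM]
      rw [blk_eq_zero (by omega), blk_eq_zero (by omega),
        blk_eq_zero (by omega), add_zero, add_zero]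
    have s2 : ∀ u, k < u → ∀ v < k, M u v = 0 := fun u hu v hv => by
      simp only [hM]
      rw [blk_eq_zero (by omega), blk_eq_zero (by omega),
        blk_eq_zero (by omega), add_zero, add_zero]
    have t0 : ∀ u ≤ β, ∀ v ≤ β, M (k + 1 + u) (k + v) = x (1 + u) (β + v) := fun u hu v hv => by
      simp only [hM]
      rw [blk_eq_zero (by omega), blk_eq (p := 1 + u) (q := β + v) (by omega) (by omega),
        blk_eq_zero (by omega), add_zero, zero_add]
    have t1 : ∀ u, β < u → ∀ v ≤ β, M (k + 1 + u) (k + v) = 0 := fun u hu v hv => by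
      simp only [hM]
      rw [blk_eq_zero (by omega), blk_eq_zero (by omega),
        blk_eq_zero (by omega), add_zero, add_zero]
    have t2 : ∀ u ≤ n - α, ∀ v < n - α, M (k + β + u) (k + 1 + β + v) = x (α + u) (1 + v) :=
      fun u hu v hv => by
      simp only [hM]
      rw [blk_eq_zero (by omega), blk_eq_zero (by omega),
        blk_eq (p := α + u) (q := 1 + v) (by omega) (by omega), add_zero, zero_add]
    have t3 : ∀ u < β - 1, ∀ v, M (k + 1 + u) (k + 1 + β + v) = 0 := fun u hu v => by
      simp only [hM]
      rw [blk_eq_zero (by omega), blk_eq_zero (by omega),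
        blk_eq_zero (by omega), add_zero, add_zero]
    have hcb : n - β = β - 1 + 1 := by omega
    refine mn_glue_first M x (by omega) (by omega) s0 s1 s2 rfl rfl ?_
    unfold ycol vcol colBase
    rw [if_pos h]
    funext u
    congr 2
    · rw [mn_glue_second M x x (c := β + 1) (b := β) (a := α) _ (by omega) _ (by omega)]
      · unfold colCoeff vrow rowCoeff rowCoeff'
        rw [hcb]
      · intro u hu v hv
        rw [show k + 1 + (β - 1 + u) = k + β + u by omega,
          show k + 1 + (β - 1 + 1 + v) = k + 1 + β + v by omega, t2 u hu v hv]
      · intro u hu v hv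
        rw [show k + 1 + (β - 1 + 1 + v) = k + 1 + β + v by omega, t3 u hu v]
      · intro u hu v hv
        rw [show k + 1 + v = k + (1 + v) by ring, t0 u (by omega) _ (by omega), add_assoc β]
      · intro u hu v hv
        rw [show k + 1 + v = k + (1 + v) by ring, t1 u (by omega) _ (by omega)]
    · rw [mn_glue_second _ x (updC x (β + 1) fun u => x u β) (c := β + 1) (b := β) (a := α) _
        (by omega) _ (by omega)]
      · unfold colCoeff' vrow rowCoeff rowCoeff'
        rw [hcb]
        refine mn_congr fun u hu v hv => ?_
        simp only [updC, updR]
        split_ifs <;> rfl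
      · intro u hu v hv
        rw [updC_of_ne _ _ _ (by omega), show k + 1 + (β - 1 + u) = k + β + u by omega,
          show k + 1 + (β - 1 + 1 + v) = k + 1 + β + v by omega, t2 u hu v hv]
      · intro u hu v hv
        rw [updC_of_ne _ _ _ (by omega), show k + 1 + (β - 1 + 1 + v) = k + 1 + β + v by omega,
          t3 u hu v]
      · intro u hu v hv
        by_cases h0 : v = 0
        · subst h0
          rw [add_zero, add_zero, updC_self, updC_self]
          exact t0 u (by omega) 0 (by omega)
        · rw [updC_of_ne _ _ _ (by omega), updC_of_ne _ _ _ (by omega),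
            show k + 1 + v = k + (1 + v) by ring, t0 u (by omega) _ (by omega), add_assoc β]
      · intro u hu v hv
        by_cases h0 : v = 0
        · subst h0
          rw [add_zero, updC_self]
          exact t1 u (by omega) 0 (by omega)
        · rw [updC_of_ne _ _ _ (by omega), show k + 1 + v = k + (1 + v) by ring,
            t1 u (by omega) _ (by omega)]
  · have e1 : (block (k + 1 + (n - β)) X i n j (α + 1) 0 0 +
        block (k + 1 + (n - β)) X 1 (n - β) β n (k + 1) k).det =
        mn (fun u v => blk x i n j (α + 1) 0 0 u v + blk x 1 (n - β) β n (k + 1) k u v) 0 0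
          (k + 1 + (n - β)) := by
      unfold mn
      congr 1
      ext u v
      simp [block, blk, hx]
    simp only
    rw [e1]
    set M : ℕ → ℕ → K := fun u v => blk x i n j (α + 1) 0 0 u v +
      blk x 1 (n - β) β n (k + 1) k u v with hM
    have t0 : ∀ u < n - β, ∀ v ≤ n - β, M (k + 1 + u) (k + v) = x (1 + u) (β + v) :=
      fun u hu v hv => by
      simp only [hM]
      rw [blk_eq_zero (by omega), blk_eq (p := 1 + u) (q := β + v) (by omega) (by omega),
        zero_add]
    refine mn_glue_first M x (by omega) (by omega) ?_ ?_ ?_ rfl rfl ?_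
    · intro u hu v hv
      simp only [hM]
      rw [blk_eq (p := i + u) (q := j + v) (by omega) (by omega), blk_eq_zero (by omega),
        add_zero]
    · intro u hu v hv
      simp only [hM]
      rw [blk_eq_zero (by omega), blk_eq_zero (by omega), add_zero]
    · intro u hu v hv
      simp only [hM]
      rw [blk_eq_zero (by omega), blk_eq_zero (by omega), add_zero]
    · unfold ycol vcol colBase
      rw [if_neg h]
      funext u
      congr 2
      · refine mn_congr fun u hu v hv => ?_
        rw [show k + 1 + v = k + (1 + v) by ring, t0 u (by omega) _ (by omega), add_assoc β]
      · refine mn_congr fun u hu v hv => ?_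
        by_cases h0 : v = 0
        · subst h0
          rw [add_zero, add_zero, updC_self, updC_self]
          exact (t0 u (by omega) 0 (by omega)).symm
        · rw [updC_of_ne _ _ _ (by omega), updC_of_ne _ _ _ (by omega),
            show k + 1 + v = k + (1 + v) by ring, t0 u (by omega) _ (by omega), add_assoc β]

end

section

variable {K : Type*} [Field K] {n : ℕ} {X : Matrix (Fin n) (Fin n) K} {α β : ℕ}

theorem entry_transpose (X : Matrix (Fin n) (Fin n) K) (i j : ℕ) :
    entry X.transpose i j = entry X j i := by
  unfold entry
  split_ifs <;> first | rfl | omega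

theorem block_transpose (N : ℕ) (X : Matrix (Fin n) (Fin n) K) (i₁ i₂ j₁ j₂ r₀ c₀ : ℕ) :
    block N X.transpose i₁ i₂ j₁ j₂ r₀ c₀ = (block N X j₁ j₂ i₁ i₂ c₀ r₀).transpose := by
  ext u v
  simp only [block, Matrix.of_apply, Matrix.transpose_apply, entry_transpose]
  exact if_congr and_comm rfl rfl

theorem fRow_eq_fCol (X : Matrix (Fin n) (Fin n) K) (i j : ℕ) :
    fRow α β X i j = fCol β α X.transpose j i := by
  unfold fRow fCol
  simp only [block_transpose, ← Matrix.transpose_add, Matrix.det_transpose]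

theorem ycol_entry_transpose (X : Matrix (Fin n) (Fin n) K) (r c a b : ℕ) :
    ycol (entry X.transpose) r c a b = zrow (entry X) c r b a := by
  have : entry X.transpose = fun i j => entry X j i := by
    funext i j
    exact entry_transpose X i j
  rw [this, ycol_transpose (entry X)]

/-- The functions of the initial seed are the variables with which the removal of a row begins. -/
theorem phi_eq_stageVar (X : Matrix (Fin n) (Fin n) K) (hα : 1 ≤ α) (hαβ : α < β) (hβ : β + 1 ≤ n)
    {i j : ℕ} (hi : 1 ≤ i) (hi2 : i ≤ n) (hj : 1 ≤ j) (hj2 : j ≤ n) :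
    phi α β X i j = stageVar (entry X) n n α β n (i, j) := by
  have heff : effRow n α n = n := by have := effRow_spec n α n; omega
  unfold phi stageVar
  dsimp only
  by_cases h1 : i + α = n + j
  · rw [if_pos h1, if_pos (by omega), if_pos (by omega), heff,
      fCol_eq_mn X hα (by omega) (by omega) hβ hj hi2 h1]
  rw [if_neg h1]
  by_cases h2 : j + β = n + i
  · rw [if_pos h2, if_neg (by omega), if_neg (by omega), if_pos (by omega), heff, fRow_eq_fCol,
      fCol_eq_mn X.transpose (by omega) hβ hα (by omega) hi hj2 h2, mn_updC, ycol_entry_transpose]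
    simp only [entry_transpose]
  · rw [if_neg h2, f_eq_mn]
    by_cases h3 : j ≤ i
    · rw [if_pos (by omega), if_neg (by omega), max_eq_left h3]
    · rw [if_neg (by omega), if_neg (by omega), if_neg (by omega), max_eq_right (by omega)]

/-- A standard arrow is never one of the added ones, so the sum of the two indicator functions is
again an indicator function. -/
theorem arrows_eq (hα : 1 ≤ α) (hαβ : α < β) (hβ : β + 1 ≤ n) {p q : ℕ × ℕ} (hp : p ∈ grid n)
    (hq : q ∈ grid n) : arrows n α β p q = if Arr n n α β n p q then 1 else 0 := by
  have hl : lastRow n α n = n := by have := lastRow_spec n α n; omega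
  obtain ⟨p1, p2⟩ := p
  obtain ⟨q1, q2⟩ := q
  have hp' := hp
  have hq' := hq
  simp only [grid, Finset.mem_product, Finset.mem_Icc] at hp' hq'
  have h1 : StdArrow n (p1, p2) (q1, q2) ↔ (¬((p1 = 1 ∨ p2 = 1) ∧ (q1 = 1 ∨ q2 = 1)) ∧
    ((q1 = p1 + 1 ∧ q2 = p2) ∨ (q1 = p1 ∧ q2 = p2 + 1) ∨
      (p1 = q1 + 1 ∧ p2 = q2 + 1))) := by
    unfold StdArrow
    simp only [hp, hq, true_and, Prod.mk.injEq]
  have h2 : ((p1, p2), (q1, q2)) ∈ addedArrows n α β ↔ (p1 = α ∧ p2 = 1 ∧ q1 = α + 1 ∧ q2 = 1) ∨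
      (p1 = 1 ∧ p2 = β ∧ q1 = 1 ∧ q2 = β + 1) ∨
      (p1 = n ∧ p2 = α + 1 ∧ q1 = 1 ∧ q2 = β + 1) ∨
      (p1 = 1 ∧ p2 = β + 1 ∧ q1 = n ∧ q2 = α) ∨
      (p1 = β + 1 ∧ p2 = n ∧ q1 = α + 1 ∧ q2 = 1) ∨
      (p1 = α + 1 ∧ p2 = 1 ∧ q1 = β ∧ q2 = n) := by
    simp only [addedArrows, List.mem_cons, List.not_mem_nil, or_false, Prod.mk.injEq, and_assoc]
  have h3 : Arr n n α β n (p1, p2) (q1, q2) ↔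
      StdArrow n (p1, p2) (q1, q2) ∨ ((p1, p2), (q1, q2)) ∈ addedArrows n α β := by
    rw [h1, h2]
    unfold Arr
    rw [hl]
  unfold arrows
  simp only [h3, h1, h2]
  by_cases hs : (¬((p1 = 1 ∨ p2 = 1) ∧ (q1 = 1 ∨ q2 = 1)) ∧
    ((q1 = p1 + 1 ∧ q2 = p2) ∨ (q1 = p1 ∧ q2 = p2 + 1) ∨
      (p1 = q1 + 1 ∧ p2 = q2 + 1)))
  · rw [if_pos hs, if_neg, if_pos (.inl hs), add_zero]
    rintro (h | h | h | h | h | h) <;> omega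
  · rw [if_neg hs, zero_add]
    simp only [hs, false_or]

theorem matrixSeed_b (X : Matrix (Fin n) (Fin n) K) (hα : 1 ≤ α) (hαβ : α < β) (hβ : β + 1 ≤ n)
    {p q : ℕ × ℕ} (hp : p ∈ grid n) (hq : q ∈ grid n) :
    (matrixSeed α β X).b p q = arrB n n α β n p q := by
  simp only [matrixSeed, arrows_eq hα hαβ hβ hp hq, arrows_eq hα hαβ hβ hq hp]
  rfl

theorem act_iff_mem_grid (m : ℕ) (q : ℕ × ℕ) : Act m m m q ↔ q ∈ grid m := by
  simp only [Act, grid, Finset.mem_product, Finset.mem_Icc]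
  omega

theorem mem_matrixSeed_frozen (X : Matrix (Fin n) (Fin n) K) (q : ℕ × ℕ) :
    q ∈ (matrixSeed α β X).frozen ↔ q ∈ grid n ∧ IsStable α β q := Finset.mem_filter

theorem mem_matrixSeed_exchangeable (X : Matrix (Fin n) (Fin n) K) (q : ℕ × ℕ) :
    q ∈ (matrixSeed α β X).exchangeable ↔ q ∈ grid n ∧ ¬ IsStable α β q := by
  rw [Seed.exchangeable, Finset.mem_sdiff, mem_matrixSeed_frozen]
  change q ∈ grid n ∧ _ ↔ _
  tauto

theorem matrixSeed_skew (X : Matrix (Fin n) (Fin n) K) : (matrixSeed α β X).Skew := by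
  intro p q
  simp only [matrixSeed]
  ring

theorem stage_matrixSeed (X : Matrix (Fin n) (Fin n) K) (hα : 1 ≤ α) (hαβ : α < β)
    (hβ : β + 1 ≤ n) (hnz : (matrixSeed α β X).NonVanishing) :
    Stage (matrixSeed α β X) id (entry X) n n α β n := by
  refine ⟨matrixSeed_skew X, hnz, fun q hq => (act_iff_mem_grid n q).1 hq, fun q hq h => ?_,
    fun _ _ _ _ h => h, fun q hq => ?_, fun q q' hq hq' _ => ?_, fun u hu h => ?_⟩
  · exact (mem_matrixSeed_exchangeable X q).2 ⟨(act_iff_mem_grid n q).1 hq, h⟩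
  · exact phi_eq_stageVar X hα hαβ hβ hq.1 hq.2.1 hq.2.2.1 hq.2.2.2.1
  · exact matrixSeed_b X hα hαβ hβ ((act_iff_mem_grid n q).1 hq) ((act_iff_mem_grid n q').1 hq')
  · exact absurd rfl (h u ((act_iff_mem_grid n u).2 hu))

end

/-! ### Restriction of the matrix -/

section Agree

variable {K : Type*} [CommRing K]

/-- The matrices `x` and `x'` have the same entries in the first `m` rows and columns. -/
def Agree (m : ℕ) (x x' : ℕ → ℕ → K) : Prop :=
  ∀ i j, 1 ≤ i → i ≤ m → 1 ≤ j → j ≤ m → x i j = x' i j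

variable {m : ℕ} {x x' X X' : ℕ → ℕ → K} {i j k r c a b : ℕ}

theorem Agree.mn (h : Agree m x x') (hi : 1 ≤ i) (hj : 1 ≤ j) (hi' : i + k ≤ m + 1)
    (hj' : j + k ≤ m + 1) : mn x i j k = mn x' i j k :=
  mn_congr fun u _ v _ => h _ _ (by omega) (by omega) (by omega) (by omega)

theorem Agree.updC (h : Agree m x x') {y y' : ℕ → K} (hy : ∀ i, 1 ≤ i → i ≤ m → y i = y' i) :
    Agree m (updC x a y) (updC x' a y') := fun i j h1 h2 h3 h4 => by
  unfold ExoticCluster.updC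
  split_ifs
  · exact hy i h1 h2
  · exact h i j h1 h2 h3 h4

theorem Agree.updR (h : Agree m x x') {z z' : ℕ → K} (hz : ∀ j, 1 ≤ j → j ≤ m → z j = z' j) :
    Agree m (updR x a z) (updR x' a z') := fun i j h1 h2 h3 h4 => by
  unfold ExoticCluster.updR
  split_ifs
  · exact hz j h3 h4
  · exact h i j h1 h2 h3 h4

theorem Agree.vcol (h : Agree m x x') (hX : Agree m X X') (ha : 1 ≤ a) (ham : a + 1 ≤ m)
    (hb : 1 ≤ b) (hc : c ≤ m) (hbm : b + 1 ≤ m) (hi : 1 ≤ i) (him : i ≤ m) :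
    vcol x X c a b i = vcol x' X' c a b i := by
  unfold ExoticCluster.vcol colCoeff colCoeff'
  rw [hX.mn le_rfl (by omega) (by omega) (by omega),
    (hX.updC fun i h1 h2 => hX i b h1 h2 hb (by omega)).mn le_rfl (by omega) (by omega) (by omega),
    h i a hi him ha (by omega), h i (a + 1) hi him (by omega) ham]

theorem Agree.vrow (h : Agree m x x') (hX : Agree m X X') (hb : 1 ≤ b) (hbm : b + 1 ≤ m)
    (ha : 1 ≤ a) (hr : r ≤ m) (ham : a + 1 ≤ m) (hj : 1 ≤ j) (hjm : j ≤ m) :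
    vrow x X r a b j = vrow x' X' r a b j := by
  unfold ExoticCluster.vrow rowCoeff rowCoeff'
  rw [hX.mn (by omega) le_rfl (by omega) (by omega),
    (hX.updR fun i h1 h2 => hX a i ha (by omega) h1 h2).mn (by omega) le_rfl (by omega) (by omega),
    h b j hb (by omega) hj hjm, h (b + 1) j (by omega) hbm hj hjm]

/-- After `S` the variables are given by the entries of the full matrix, but with size parameters
`m` they only involve its leading submatrix. -/
theorem Agree.stageVar (h : Agree m x x') (ha : 1 ≤ a) (ham : a + 1 ≤ m) (hb : 1 ≤ b)
    (hbm : b + 1 ≤ m) (hi : 1 ≤ i) (him : i ≤ m) (hj : 1 ≤ j) (hjm : j ≤ m) :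
    stageVar x m m a b m (i, j) = stageVar x' m m a b m (i, j) := by
  have heff : effRow m a m = m := by have := effRow_spec m a m; omega
  have hC : Agree m (colBase x m m a b) (colBase x' m m a b) := by
    unfold colBase
    split_ifs
    · exact h.updR fun j h1 h2 => h.vrow h hb hbm ha le_rfl ham h1 h2
    · exact h
  have hR : Agree m (rowBase x m m a b) (rowBase x' m m a b) := by
    unfold rowBase
    split_ifs
    · exact h.updC fun j h1 h2 => h.vcol h ha ham hb le_rfl hbm h1 h2
    · exact h
  have hy := h.updC (a := a) fun i h1 h2 => h.vcol hC ha ham hb (c := m) le_rfl hbm h1 h2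
  have hz := h.updR (a := b) fun i h1 h2 => h.vrow hR hb hbm ha (r := m) le_rfl ham h1 h2
  unfold ExoticCluster.stageVar
  dsimp only
  rw [heff]
  by_cases h1 : j + m ≤ m + i
  · rw [if_pos h1, if_pos h1]
    split_ifs
    · exact hy.mn hi hj (by omega) (by omega)
    · exact h.mn hi hj (by omega) (by omega)
  · rw [if_neg h1, if_neg h1, if_neg h1, if_neg h1]
    split_ifs
    · exact hz.mn hi hj (by omega) (by omega)
    · exact h.mn hi hj (by omega) (by omega)

end Agree

theorem agree_leading {K : Type*} [Field K] {n : ℕ} (X : Matrix (Fin n) (Fin n) K) :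
    Agree (n - 1) (entry X) (entry (leading X)) := by
  intro i j h1 h2 h3 h4
  unfold entry
  rw [dif_pos (by omega), dif_pos (by omega)]
  rfl

/-! ### Freezing and removing vertices: the seed of the leading submatrix -/

namespace Seed

variable {V K : Type*} [DecidableEq V] [Field K]

theorem removeIsolated_eq_keep (s : Seed V K) : s.removeIsolated = s.keep fun v =>
    ∃ w ∈ s.verts, s.b v w ≠ 0 ∧ ¬(v ∈ s.frozen ∧ w ∈ s.frozen) := rfl

/-- The second hypothesis excludes that a mutable vertex is removed. The frozen vertices which are
removed have no arrows to mutable ones, so that `keep_upper_le` applies. -/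
theorem removeIsolated_upper_le (R : Type*) [CommRing R] [Algebra R K] {s : Seed V K}
    (hs : s.Skew)
    (h : ∀ v ∈ s.exchangeable, ∃ w ∈ s.verts, s.b v w ≠ 0) :
    s.removeIsolated.upper R ≤ s.upper R := by
  rw [removeIsolated_eq_keep]
  refine keep_upper_le R s _ fun v hv hiso => ?_
  push Not at hiso
  have hvf : v ∈ s.frozen := by
    by_contra hvf
    obtain ⟨w, hw, hb⟩ := h v (Finset.mem_sdiff.2 ⟨hv, hvf⟩)
    exact hvf (hiso w hw hb).1
  refine ⟨hvf, fun k hk => ?_⟩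
  by_contra hb
  have := (hiso k (s.exchangeable_subset hk) (by rw [hs]; exact neg_ne_zero.2 hb)).2
  exact (Finset.mem_sdiff.1 hk).2 this

end Seed

section

variable {V K : Type*} [DecidableEq V] [Field K] {s : Seed V K} {pos : ℕ × ℕ → V}
  {x : ℕ → ℕ → K} {r c a b e m α β : ℕ}

theorem Stage.keep (hS : Stage s pos x r c a b e) (p : V → Prop) [DecidablePred p]
    (hp : ∀ q, Act r c e q → p (pos q)) (h1 : ∀ v ∈ s.verts, ¬ p v → s.var v = 1) :
    Stage (s.keep p) pos x r c a b e := by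
  refine ⟨hS.skew, fun l hl v hv => ?_, fun q hq => Finset.mem_filter.2 ⟨hS.mem q hq, hp q hq⟩,
    fun q hq h => ?_, hS.inj, hS.var, hS.arr, fun u hu hout q hq h => ?_⟩
  · have hl' : ∀ k ∈ l, k ∈ s.exchangeable ∧ p k := fun k hk => by
      have := hl k hk
      simp only [Seed.exchangeable, Seed.keep, Finset.mem_sdiff, Finset.mem_filter] at this ⊢
      tauto
    rw [Seed.keep_mutateList s p (fun k hk => (hl' k hk).2) h1]
    exact hS.nz l (fun k hk => (hl' k hk).1) v (Finset.mem_filter.1 hv).1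
  · have := hS.exch q hq h
    have := hp q hq
    simp only [Seed.exchangeable, Seed.keep, Finset.mem_sdiff, Finset.mem_filter] at *
    tauto
  · exact hS.out u (Finset.mem_filter.1 hu).1 hout q hq h

/-- Every position has a neighbour such that not both of them are frozen. -/
theorem exists_neighbour (hα : 1 ≤ α) (hαβ : α < β) (hβ : β + 1 ≤ m) {q : ℕ × ℕ}
    (hq : q ∈ grid m) : ∃ q' ∈ grid m, arrB m m α β m q q' ≠ 0 ∧
      ¬(IsStable α β q ∧ IsStable α β q') := by
  obtain ⟨i, j⟩ := q
  simp only [grid, Finset.mem_product, Finset.mem_Icc] at hq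
  have hl : lastRow m α m = m := by have := lastRow_spec m α m; omega
  have key : ∀ q' ∈ grid m, Arr m m α β m (i, j) q' → ¬ Arr m m α β m q' (i, j) →
      arrB m m α β m (i, j) q' ≠ 0 := fun q' _ h h' => by
    rw [arrB, if_pos h, if_neg h']; norm_num
  have key' : ∀ q' ∈ grid m, Arr m m α β m q' (i, j) → ¬ Arr m m α β m (i, j) q' →
      arrB m m α β m (i, j) q' ≠ 0 := fun q' _ h h' => by
    rw [arrB, if_neg h', if_pos h]; norm_num
  by_cases hi : i = 1
  · by_cases hj : j = 1
    · have hg : (2, 2) ∈ grid m := by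
        simp only [grid, Finset.mem_product, Finset.mem_Icc]; omega
      refine ⟨(2, 2), hg, key' _ hg ?_ ?_, ?_⟩
      · unfold Arr; dsimp only; left; omega
      · unfold Arr; rw [hl]; dsimp only
        rintro (⟨_, h⟩ | h | h | h | h | h | h) <;> omega
      · unfold IsStable; dsimp only; omega
    · have hg : (2, j) ∈ grid m := by
        simp only [grid, Finset.mem_product, Finset.mem_Icc]; omega
      refine ⟨(2, j), hg, key _ hg ?_ ?_, ?_⟩
      · unfold Arr; dsimp only; left; omega
      · unfold Arr; rw [hl]; dsimp only
        rintro (⟨_, h⟩ | h | h | h | h | h | h) <;> omega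
      · unfold IsStable; dsimp only; omega
  · by_cases hj : j = 1
    · have hg : (i, 2) ∈ grid m := by
        simp only [grid, Finset.mem_product, Finset.mem_Icc]; omega
      refine ⟨(i, 2), hg, key _ hg ?_ ?_, ?_⟩
      · unfold Arr; dsimp only; left; omega
      · unfold Arr; rw [hl]; dsimp only
        rintro (⟨_, h⟩ | h | h | h | h | h | h) <;> omega
      · unfold IsStable; dsimp only; omega
    · have hg : (i - 1, j - 1) ∈ grid m := by
        simp only [grid, Finset.mem_product, Finset.mem_Icc]; omega
      refine ⟨(i - 1, j - 1), hg, key _ hg ?_ ?_, ?_⟩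
      · unfold Arr; dsimp only; left; omega
      · unfold Arr; rw [hl]; dsimp only
        rintro (⟨_, h⟩ | h | h | h | h | h | h) <;> omega
      · unfold IsStable; dsimp only; omega

/-- The mutable vertices that do not stand on a mutable position of the `m × m` grid. -/
def freezeSet (s : Seed V K) (pos : ℕ × ℕ → V) (m α β : ℕ) : Finset V :=
  s.exchangeable \ ((grid m).filter fun q => ¬ IsStable α β q).image pos

theorem mem_frozen_freezeSet (hS : Stage s pos x m m α β m) {q : ℕ × ℕ} (hq : q ∈ grid m) :
    pos q ∈ (s.freeze (freezeSet s pos m α β)).frozen ↔ IsStable α β q := by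
  have hq' := (act_iff_mem_grid m q).2 hq
  rw [Seed.freeze, Finset.mem_union]
  constructor
  · intro h
    by_contra hst
    have hex := hS.exch q hq' hst
    rcases h with h | h
    · exact (Finset.mem_sdiff.1 hex).2 h
    · exact (Finset.mem_sdiff.1 h).2 (Finset.mem_image_of_mem _ (Finset.mem_filter.2 ⟨hq, hst⟩))
  · intro hst
    by_cases hf : pos q ∈ s.frozen
    · exact .inl hf
    · refine .inr (Finset.mem_sdiff.2 ⟨Finset.mem_sdiff.2 ⟨hS.mem q hq', hf⟩, fun h => ?_⟩)
      obtain ⟨p, hp, hpq⟩ := Finset.mem_image.1 h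
      obtain ⟨hp1, hp2⟩ := Finset.mem_filter.1 hp
      rw [hS.inj p q ((act_iff_mem_grid m p).2 hp1) hq' hpq] at hp2
      exact hp2 hst

theorem exists_pos_of_notMem_frozen {v : V}
    (hv : v ∈ s.verts) (h : v ∉ (s.freeze (freezeSet s pos m α β)).frozen) :
    ∃ q ∈ grid m, ¬ IsStable α β q ∧ pos q = v := by
  rw [Seed.freeze, Finset.mem_union, not_or] at h
  have h2 := h.2
  rw [freezeSet, Finset.mem_sdiff, not_and, not_not] at h2
  obtain ⟨q, hq, hqv⟩ := Finset.mem_image.1 (h2 (Finset.mem_sdiff.2 ⟨hv, h.1⟩))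
  obtain ⟨hq1, hq2⟩ := Finset.mem_filter.1 hq
  exact ⟨q, hq1, hq2, hqv⟩

theorem Stage.exists_arrow (hS : Stage s pos x m m α β m) (hα : 1 ≤ α) (hαβ : α < β)
    (hβ : β + 1 ≤ m) {q : ℕ × ℕ} (hq : q ∈ grid m) : ∃ q' ∈ grid m,
      s.b (pos q) (pos q') ≠ 0 ∧ ¬(IsStable α β q ∧ IsStable α β q') := by
  obtain ⟨q', hq', hb, hst⟩ := exists_neighbour hα hαβ hβ hq
  refine ⟨q', hq', ?_, hst⟩
  have h1 := (act_iff_mem_grid m q).2 hq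
  have h2 := (act_iff_mem_grid m q').2 hq'
  by_cases h : IsStable α β q
  · rw [hS.arr' q q' h1 h2 fun h' => hst ⟨h, h'⟩]
    exact hb
  · rw [hS.arr q q' h1 h2 h]
    exact hb

theorem Stage.removeIsolated_upper_le (R : Type*) [CommRing R] [Algebra R K]
    (hS : Stage s pos x m m α β m) (hα : 1 ≤ α) (hαβ : α < β)
    (hβ : β + 1 ≤ m) : (s.freeze (freezeSet s pos m α β)).removeIsolated.upper R ≤
      (s.freeze (freezeSet s pos m α β)).upper R := by
  refine Seed.removeIsolated_upper_le R hS.skew fun v hv => ?_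
  obtain ⟨hv, hvf⟩ := Finset.mem_sdiff.1 hv
  obtain ⟨q, hq, -, rfl⟩ := exists_pos_of_notMem_frozen (s := s) hv hvf
  obtain ⟨q', hq', hb, -⟩ := hS.exists_arrow hα hαβ hβ hq
  exact ⟨_, hS.mem q' ((act_iff_mem_grid m q').2 hq'), hb⟩

/-- The placement of the vertices on positions is itself the isomorphism. Positions of the grid are
kept because each of them has a neighbour such that not both are frozen. Any other vertex has been
frozen and has no arrow to a vertex that is still mutable, so it is isolated. -/
theorem Stage.isIso {X : Matrix (Fin m) (Fin m) K} (hS : Stage s pos x m m α β m)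
    (hX : Agree m x (entry X)) (hα : 1 ≤ α) (hαβ : α < β) (hβ : β + 1 ≤ m) :
    Seed.IsIso pos (matrixSeed α β X) (s.freeze (freezeSet s pos m α β)).removeIsolated := by
  have act := fun q => act_iff_mem_grid m q
  have mem : ∀ q ∈ grid m, pos q ∈
      s.verts.filter fun v => ∃ w ∈ s.verts, s.b v w ≠ 0 ∧
        ¬(v ∈ (s.freeze (freezeSet s pos m α β)).frozen ∧
          w ∈ (s.freeze (freezeSet s pos m α β)).frozen) := by
    intro q hq
    obtain ⟨q', hq', hb, hst⟩ := hS.exists_arrow hα hαβ (by omega) hq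
    refine Finset.mem_filter.2 ⟨hS.mem q ((act q).2 hq), pos q', hS.mem q' ((act q').2 hq'), hb, ?_⟩
    rwa [mem_frozen_freezeSet hS hq, mem_frozen_freezeSet hS hq']
  constructor
  · refine ⟨fun q hq => mem q hq, fun q hq q' hq' h =>
      hS.inj q q' ((act q).2 hq) ((act q').2 hq') h, fun v hv => ?_⟩
    obtain ⟨hv, w, hw, hb, hf⟩ := Finset.mem_filter.1 hv
    by_contra hout
    have hout' : ∀ q, Act m m m q → v ≠ pos q := fun q hq h => hout ⟨q, (act q).1 hq, h.symm⟩
    have hvf : v ∈ (s.freeze (freezeSet s pos m α β)).frozen := by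
      by_contra hvf
      obtain ⟨q, hq, -, h⟩ := exists_pos_of_notMem_frozen (s := s) hv hvf
      exact hout ⟨q, hq, h⟩
    obtain ⟨q, hq, hst, rfl⟩ := exists_pos_of_notMem_frozen (s := s) hw fun h => hf ⟨hvf, h⟩
    exact hb (hS.out v hv hout' q ((act q).2 hq) hst)
  · intro q hq
    have h1 := mem_frozen_freezeSet hS hq
    rw [mem_matrixSeed_frozen]
    have h2 := (Finset.mem_filter.1 (mem q hq)).2
    constructor
    · intro h
      exact ⟨hq, h1.1 (Finset.mem_filter.1 h).1⟩
    · intro h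
      exact Finset.mem_filter.2 ⟨h1.2 h.2, h2⟩
  · rintro ⟨i, j⟩ hq
    have hA := (act _).2 hq
    change s.var (pos (i, j)) = phi α β X i j
    rw [hS.var _ hA, phi_eq_stageVar X hα hαβ hβ hA.1 hA.2.1 hA.2.2.1 hA.2.2.2.1]
    exact hX.stageVar hα (by omega) (by omega) (by omega) hA.1 hA.2.1 hA.2.2.1 hA.2.2.2.1
  · intro q hq q' hq' hst
    rw [mem_matrixSeed_frozen, mem_matrixSeed_frozen] at hst
    change s.b (pos q) (pos q') = _
    rw [matrixSeed_b X hα hαβ hβ hq hq']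
    by_cases h : IsStable α β q
    · exact hS.arr' q q' ((act q).2 hq) ((act q').2 hq') fun h' => hst ⟨⟨hq, h⟩, hq', h'⟩
    · exact hS.arr q q' ((act q).2 hq) ((act q').2 hq') h

end

/-! ### Full rank of the initial exchange matrix -/

/-- The mixed difference of a function on the grid. -/
def mixedDiff (l : ℕ → ℕ → ℤ) (i j : ℕ) : ℤ := l (i + 1) (j + 1) - l i (j + 1) - l (i + 1) j + l i j

/-- The equations which say that `l` is in the kernel of the exchange matrix. -/
structure KernelEq (n α β : ℕ) (l : ℕ → ℕ → ℤ) (s t : ℤ) : Prop where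
  row_out : ∀ j, l (n + 1) j = 0
  col_out : ∀ i, l i (n + 1) = 0
  row_one : ∀ j, l 1 j = if j = β + 1 then t else 0
  col_one : ∀ i, l i 1 = if i = α + 1 then s else 0
  interior : ∀ i j, 1 ≤ i → i < n → 1 ≤ j → j < n → mixedDiff l (i + 1) (j + 1) = mixedDiff l i j +
    (if i + 1 = n ∧ j = α then t else 0) - (if i + 1 = n ∧ j + 1 = α then t else 0) +
    (if j + 1 = n ∧ i = β then s else 0) - (if j + 1 = n ∧ i + 1 = β then s else 0)
  row : ∀ j, 2 ≤ j → j ≤ n → j ≠ β + 1 → mixedDiff l 1 j = -if β = 1 ∧ j = n then s else 0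
  col : ∀ i, 2 ≤ i → i ≤ n → i ≠ α + 1 → mixedDiff l i 1 = -if α = 1 ∧ i = n then t else 0
  row_special : mixedDiff l 1 (β + 1) = l n α - l n (α + 1) + t
  col_special : mixedDiff l (α + 1) 1 = l β n - l (β + 1) n + s

namespace KernelEq

variable {n α β : ℕ} {l : ℕ → ℕ → ℤ} {s t : ℤ}

theorem mixedDiff_transpose (l : ℕ → ℕ → ℤ) (i j : ℕ) :
    mixedDiff (fun i j => l j i) i j = mixedDiff l j i := by
  unfold mixedDiff
  ring

theorem transpose (h : KernelEq n α β l s t) : KernelEq n β α (fun i j => l j i) t s := by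
  refine ⟨h.col_out, h.row_out, h.col_one, h.row_one, fun i j h1 h2 h3 h4 => ?_, fun j h1 h2 h3 => ?_,
    fun j h1 h2 h3 => ?_, ?_, ?_⟩
  · rw [mixedDiff_transpose l, mixedDiff_transpose l, h.interior j i h3 h4 h1 h2]
    ring
  · rw [mixedDiff_transpose l, h.col j h1 h2 h3]
  · rw [mixedDiff_transpose l, h.row j h1 h2 h3]
  · rw [mixedDiff_transpose l, h.col_special]
  · rw [mixedDiff_transpose l, h.row_special]

theorem diag (h : KernelEq n α β l s t) {i j : ℕ} (hi : 1 ≤ i) (hj : 1 ≤ j) (k : ℕ)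
    (hik : i + k < n) (hjk : j + k < n) : mixedDiff l (i + k) (j + k) = mixedDiff l i j := by
  induction k with
  | zero => rfl
  | succ k ih =>
    rw [← add_assoc, ← add_assoc, h.interior (i + k) (j + k) (by omega) (by omega) (by omega)
      (by omega), ih (by omega) (by omega), if_neg (by omega), if_neg (by omega),
      if_neg (by omega), if_neg (by omega)]
    ring

theorem mixedDiff_last (h : KernelEq n α β l s t) (j : ℕ) :
    mixedDiff l n j = l n j - l n (j + 1) := by
  rw [mixedDiff, h.row_out, h.row_out]
  ring

/-- The equation at `(1, β + 1)` expresses the mixed difference by values in the last row. Following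
the diagonal from `(n, α)` upwards one arrives at `(n - α + 1, 1)`, where the mixed difference
vanishes by the equation of a frozen vertex, unless this is the mutable position `(α + 1, 1)`. The
latter happens for `n = 2 * α` only. -/
theorem special_cases (h : KernelEq n α β l s t) (hα : 1 ≤ α) (hα2 : α + 2 ≤ n) :
    mixedDiff l 1 (β + 1) = 0 ∨
      (n = 2 * α ∧ mixedDiff l 1 (β + 1) = mixedDiff l (α + 1) 1) := by
  have h1 := h.row_special
  have h2 := h.mixedDiff_last α
  rcases hα.lt_or_eq with hα1 | rfl
  · have h3 := h.interior (n - 1) (α - 1) (by omega) (by omega) (by omega) (by omega)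
    have h4 := h.diag (i := n - α + 1) (j := 1) (by omega) le_rfl (α - 2) (by omega) (by omega)
    rw [show n - 1 + 1 = n by omega, show α - 1 + 1 = α by omega, if_neg (by omega),
      if_pos ⟨rfl, rfl⟩, if_neg (by omega), if_neg (by omega)] at h3
    rw [show n - α + 1 + (α - 2) = n - 1 by omega, show 1 + (α - 2) = α - 1 by omega] at h4
    by_cases h5 : n = 2 * α
    · right
      rw [show n - α + 1 = α + 1 by omega] at h4
      exact ⟨h5, by omega⟩
    · left
      have h6 := h.col (n - α + 1) (by omega) (by omega) (by omega)
      rw [if_neg (by omega)] at h6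
      omega
  · left
    have h3 := h.col n (by omega) le_rfl (by omega)
    rw [if_pos ⟨rfl, rfl⟩] at h3
    omega

/-- For `α ≠ β` the exceptional cases of `special_cases` and of its transpose exclude each other, so
one of the two mixed differences is zero, and then both are. -/
theorem special (h : KernelEq n α β l s t) (hα : 1 ≤ α) (hα2 : α + 2 ≤ n) (hβ : 1 ≤ β)
    (hβ2 : β + 2 ≤ n) (hne : α ≠ β) : mixedDiff l 1 (β + 1) = 0 := by
  have h1 := h.special_cases hα hα2
  have h2 := h.transpose.special_cases hβ hβ2
  rw [mixedDiff_transpose l, mixedDiff_transpose l] at h2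
  omega

theorem mixedDiff_eq_zero_of_lt (h : KernelEq n α β l s t) (hα : 1 ≤ α) (hα2 : α + 2 ≤ n)
    (hβ : 1 ≤ β) (hβ2 : β + 2 ≤ n) (hne : α ≠ β) {i j : ℕ} (hi : 1 ≤ i) (hij : i < j)
    (hj : j < n) : mixedDiff l i j = 0 := by
  have h1 := h.diag (i := 1) (j := j - i + 1) le_rfl (by omega) (i - 1) (by omega) (by omega)
  rw [show 1 + (i - 1) = i by omega, show j - i + 1 + (i - 1) = j by omega] at h1
  rw [h1]
  by_cases h2 : j - i + 1 = β + 1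
  · rw [h2, h.special hα hα2 hβ hβ2 hne]
  · rw [h.row _ (by omega) (by omega) h2, if_neg (by omega), neg_zero]

theorem mixedDiff_eq_zero_of_ne (h : KernelEq n α β l s t) (hα : 1 ≤ α) (hα2 : α + 2 ≤ n)
    (hβ : 1 ≤ β) (hβ2 : β + 2 ≤ n) (hne : α ≠ β) {i j : ℕ} (hi : 1 ≤ i) (hin : i < n)
    (hj : 1 ≤ j) (hjn : j < n) (hij : i ≠ j) : mixedDiff l i j = 0 := by
  rcases lt_or_gt_of_ne hij with h1 | h1
  · exact h.mixedDiff_eq_zero_of_lt hα hα2 hβ hβ2 hne hi h1 hjn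
  · rw [← mixedDiff_transpose l]
    exact h.transpose.mixedDiff_eq_zero_of_lt hβ hβ2 hα hα2 hne.symm hj h1 hin

/-- In the last row a mixed difference is a difference of neighbouring values, because `l` vanishes
outside of the grid. Its value is known from the preceding diagonal entry, so the row can be summed
up from the right. -/
theorem last_row (h : KernelEq n α β l s t) (hα : 1 ≤ α) (hα2 : α + 2 ≤ n)
    (hβ : 1 ≤ β) (hβ2 : β + 2 ≤ n) (hne : α ≠ β) {k : ℕ} (hk : k + 2 ≤ n) :
    l n (n - k) = mixedDiff l 1 1 + if n - k = α + 1 then t else 0 := by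
  have step : ∀ j, 2 ≤ j → j ≤ n → l n j = l n (j + 1) + (if j = α + 1 then t else 0) -
      (if j = α then t else 0) + if j = n then mixedDiff l 1 1 else 0 := by
    intro j hj hjn
    have h2 := h.mixedDiff_last j
    have h3 := h.interior (n - 1) (j - 1) (by omega) (by omega) (by omega) (by omega)
    rw [show n - 1 + 1 = n by omega, show j - 1 + 1 = j by omega,
      if_neg (show ¬ (j = n ∧ n - 1 = β) by omega),
      if_neg (show ¬ (j = n ∧ n = β) by omega)] at h3
    simp only [true_and] at h3
    have e : (j - 1 = α) ↔ (j = α + 1) := by omega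
    simp only [e] at h3
    by_cases h4 : j = n
    · have h5 := h.diag (i := 1) (j := 1) le_rfl le_rfl (n - 2) (by omega) (by omega)
      rw [show 1 + (n - 2) = n - 1 by omega] at h5
      rw [if_pos h4]
      rw [show j - 1 = n - 1 by omega, h5] at h3
      linarith
    · rw [if_neg h4]
      rw [h.mixedDiff_eq_zero_of_ne hα hα2 hβ hβ2 hne (i := n - 1) (j := j - 1) (by omega)
        (by omega) (by omega) (by omega) (by omega)] at h3
      linarith
  induction k with
  | zero =>
    rw [Nat.sub_zero, step n (by omega) le_rfl, h.col_out, if_pos rfl, if_neg (by omega),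
      if_neg (by omega)]
    ring
  | succ k ih =>
    rw [step (n - (k + 1)) (by omega) (by omega), show n - (k + 1) + 1 = n - k by omega,
      ih (by omega), if_neg (by omega : ¬ n - (k + 1) = n)]
    have e : (n - k = α + 1) ↔ (n - (k + 1) = α) := by omega
    simp only [e]
    ring

theorem diag_eq_zero (h : KernelEq n α β l s t) (hα : 1 ≤ α) (hα2 : α + 2 ≤ n)
    (hβ : 1 ≤ β) (hβ2 : β + 2 ≤ n) (hne : α ≠ β) : mixedDiff l 1 1 = 0 := by
  have h1 := h.last_row hα hα2 hβ hβ2 hne (k := n - 2) (by omega)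
  have h2 := h.col n (by omega) le_rfl (by omega)
  have h3 := h.mixedDiff_last 1
  rw [h.col_one, if_neg (by omega)] at h3
  rw [show n - (n - 2) = 2 by omega] at h1
  have e : (2 = α + 1) ↔ α = 1 := by omega
  simp only [e] at h1
  simp only [and_true] at h2
  linarith

/-- All mixed differences inside the grid vanish, so the function is a sum of a function of the row
and one of the column. Both are determined by the first row and column. -/
theorem eq_add (h : KernelEq n α β l s t) (hα : 1 ≤ α) (hα2 : α + 2 ≤ n)
    (hβ : 1 ≤ β) (hβ2 : β + 2 ≤ n) (hne : α ≠ β) {i j : ℕ} (hi : 1 ≤ i) (hin : i ≤ n)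
    (hj : 1 ≤ j) (hjn : j ≤ n) :
    l i j = (if i = α + 1 then s else 0) + if j = β + 1 then t else 0 := by
  have hC : ∀ i j, 1 ≤ i → i < n → 1 ≤ j → j < n → mixedDiff l i j = 0 := by
    intro i j h1 h2 h3 h4
    by_cases hij : i = j
    · subst hij
      have h5 := h.diag (i := 1) (j := 1) le_rfl le_rfl (i - 1) (by omega) (by omega)
      rw [show 1 + (i - 1) = i by omega] at h5
      rw [h5, h.diag_eq_zero hα hα2 hβ hβ2 hne]
    · exact h.mixedDiff_eq_zero_of_ne hα hα2 hβ hβ2 hne h1 h2 h3 h4 hij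
  induction i, hi using Nat.le_induction generalizing j with
  | base => rw [h.row_one, if_neg (show ¬ 1 = α + 1 by omega), zero_add]
  | succ i hi ih =>
    induction j, hj using Nat.le_induction with
    | base => rw [h.col_one, if_neg (by omega : ¬ 1 = β + 1), add_zero]
    | succ j hj ihj =>
      have h1 := hC i j hi (by omega) hj (by omega)
      have h2 := ihj (by omega)
      have h3 := ih (by omega) hj (by omega)
      have h4 := ih (by omega) (j := j + 1) (by omega) hjn
      unfold mixedDiff at h1
      linarith

/-- The value at `(n, α + 1)` is `t` by the formula for the last row and `0` by the formula for the
whole grid. -/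
theorem t_eq_zero (h : KernelEq n α β l s t) (hα : 1 ≤ α) (hα2 : α + 2 ≤ n)
    (hβ : 1 ≤ β) (hβ2 : β + 2 ≤ n) (hne : α ≠ β) : t = 0 := by
  have h1 := h.last_row hα hα2 hβ hβ2 hne (k := n - (α + 1)) (by omega)
  have h2 := h.eq_add hα hα2 hβ hβ2 hne (i := n) (j := α + 1) (by omega) le_rfl (by omega)
    (by omega)
  rw [show n - (n - (α + 1)) = α + 1 by omega, h.diag_eq_zero hα hα2 hβ hβ2 hne,
    if_pos rfl] at h1
  rw [if_neg (by omega), if_neg (by omega)] at h2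
  linarith

theorem eq_zero (h : KernelEq n α β l s t) (hα : 1 ≤ α) (hα2 : α + 2 ≤ n)
    (hβ : 1 ≤ β) (hβ2 : β + 2 ≤ n) (hne : α ≠ β) {i j : ℕ} (hi : 1 ≤ i) (hin : i ≤ n)
    (hj : 1 ≤ j) (hjn : j ≤ n) : l i j = 0 := by
  rw [h.eq_add hα hα2 hβ hβ2 hne hi hin hj hjn, h.t_eq_zero hα hα2 hβ hβ2 hne,
    h.transpose.t_eq_zero hβ hβ2 hα hα2 hne.symm]
  simp

end KernelEq

section

variable {K : Type*} [Field K] {n α β : ℕ}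

theorem ite_mem_eq_count {A : Type*} [DecidableEq A] {L : List A} (hL : L.Nodup) (a : A)
    [Decidable (a ∈ L)] :
    (if a ∈ L then 1 else 0 : ℤ) = (L.map fun x => if a = x then 1 else 0).sum := by
  have h := List.count_eq_one_of_mem hL (a := a)
  rw [show (L.map fun x => if a = x then (1 : ℤ) else 0).sum = L.count a from ?_]
  · split_ifs with ha
    · rw [h ha, Nat.cast_one]
    · rw [List.count_eq_zero_of_not_mem ha, Nat.cast_zero]
  · clear hL h
    induction L with
    | nil => simp
    | cons x L ih =>
      rw [List.map_cons, List.sum_cons, ih, List.count_cons]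
      by_cases h : a = x
      · subst h; simp [add_comm]
      · simp [h, Ne.symm h]

theorem addedArrows_nodup (hα : 1 ≤ α) (hα2 : α + 2 ≤ n) (hβ : 1 ≤ β) (hβ2 : β + 2 ≤ n) :
    (addedArrows n α β).Nodup := by
  unfold addedArrows
  simp only [List.nodup_cons, List.mem_cons, List.not_mem_nil, Prod.mk.injEq, or_false,
    not_false_eq_true, List.nodup_nil, and_true]
  omega

theorem ind_mul_ind (x y p q : ℕ × ℕ) : ind x p * ind y q = if (p, q) = (x, y) then 1 else 0 := by
  unfold ind
  simp only [Prod.mk.injEq]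
  by_cases h1 : p = x <;> by_cases h2 : q = y <;> simp [h1, h2]

theorem added_eq (hα : 1 ≤ α) (hα2 : α + 2 ≤ n) (hβ : 1 ≤ β) (hβ2 : β + 2 ≤ n) (p q : ℕ × ℕ) :
    (if (p, q) ∈ addedArrows n α β then 1 else 0 : ℤ) = ind (α, 1) p * ind (α + 1, 1) q +
      (ind (1, β) p * ind (1, β + 1) q + (ind (n, α + 1) p * ind (1, β + 1) q +
      (ind (1, β + 1) p * ind (n, α) q + (ind (β + 1, n) p * ind (α + 1, 1) q +
      ind (α + 1, 1) p * ind (β, n) q)))) := by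
  rw [ite_mem_eq_count (addedArrows_nodup hα hα2 hβ hβ2)]
  simp only [addedArrows, List.map_cons, List.map_nil, List.sum_cons, List.sum_nil, add_zero,
    ind_mul_ind]

/-- Extend a function on the mutable vertices by zero. -/
def extendZero (E : Finset (ℕ × ℕ)) (c : ℕ × ℕ → ℤ) (q : ℕ × ℕ) : ℤ := if q ∈ E then c q else 0

theorem sum_ind_mul (E : Finset (ℕ × ℕ)) (c : ℕ × ℕ → ℤ) (p : ℕ × ℕ) :
    ∑ v ∈ E, ind p v * extendZero E c v = extendZero E c p := by
  unfold ind
  simp only [ite_mul, one_mul, zero_mul]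
  rw [Finset.sum_ite_eq']
  unfold extendZero
  split_ifs <;> rfl

variable {E : Finset (ℕ × ℕ)} {c : ℕ × ℕ → ℤ}

theorem sum_added_out (hα : 1 ≤ α) (hα2 : α + 2 ≤ n) (hβ : 1 ≤ β) (hβ2 : β + 2 ≤ n)
    (w : ℕ × ℕ) : ∑ v ∈ E, (if (w, v) ∈ addedArrows n α β then 1 else 0) * extendZero E c v =
      ind (α, 1) w * extendZero E c (α + 1, 1) + ind (1, β) w * extendZero E c (1, β + 1) +
      ind (n, α + 1) w * extendZero E c (1, β + 1) + ind (1, β + 1) w * extendZero E c (n, α) +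
      ind (β + 1, n) w * extendZero E c (α + 1, 1) +
      ind (α + 1, 1) w * extendZero E c (β, n) := by
  simp only [added_eq hα hα2 hβ hβ2, add_mul, Finset.sum_add_distrib, mul_assoc,
    ← Finset.mul_sum, sum_ind_mul]
  ring

theorem sum_added_in (hα : 1 ≤ α) (hα2 : α + 2 ≤ n) (hβ : 1 ≤ β) (hβ2 : β + 2 ≤ n)
    (w : ℕ × ℕ) : ∑ v ∈ E, (if (v, w) ∈ addedArrows n α β then 1 else 0) * extendZero E c v =
      ind (α + 1, 1) w * extendZero E c (α, 1) + ind (1, β + 1) w * extendZero E c (1, β) +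
      ind (1, β + 1) w * extendZero E c (n, α + 1) + ind (n, α) w * extendZero E c (1, β + 1) +
      ind (α + 1, 1) w * extendZero E c (β + 1, n) +
      ind (β, n) w * extendZero E c (α + 1, 1) := by
  have e : ∀ x y v : ℕ × ℕ, ind x v * ind y w * extendZero E c v =
      ind y w * (ind x v * extendZero E c v) := fun x y v => by ring
  simp only [added_eq hα hα2 hβ hβ2, add_mul, Finset.sum_add_distrib, e,
    ← Finset.mul_sum, sum_ind_mul]
  ring

theorem sum_std_interior (hE : ∀ v ∈ E, v ∈ grid n) {i j : ℕ} (hi : 1 ≤ i) (hin : i < n)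
    (hj : 1 ≤ j) (hjn : j < n) :
    ∑ v ∈ E, (if StdArrow n (i + 1, j + 1) v then 1 else 0) * extendZero E c v =
      extendZero E c (i + 2, j + 1) + extendZero E c (i + 1, j + 2) + extendZero E c (i, j) ∧
    ∑ v ∈ E, (if StdArrow n v (i + 1, j + 1) then 1 else 0) * extendZero E c v =
      extendZero E c (i, j + 1) + extendZero E c (i + 1, j) +
        extendZero E c (i + 2, j + 2) := by
  have hw : (i + 1, j + 1) ∈ grid n := by
    simp only [grid, Finset.mem_product, Finset.mem_Icc]; omega
  constructor
  · rw [Finset.sum_congr rfl fun v hv => by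
      rw [ind_three (x := (i + 2, j + 1)) (y := (i + 1, j + 2)) (z := (i, j)) (q := v) (by simp) (by simp) (by simp) (by
        simp only [StdArrow, hw, hE v hv, true_and, Prod.ext_iff]
        omega)]]
    simp only [add_mul, Finset.sum_add_distrib, sum_ind_mul]
  · rw [Finset.sum_congr rfl fun v hv => by
      rw [ind_three (x := (i, j + 1)) (y := (i + 1, j)) (z := (i + 2, j + 2)) (q := v) (by simp) (by simp) (by simp) (by
        simp only [StdArrow, hw, hE v hv, true_and, Prod.ext_iff]
        omega)]]
    simp only [add_mul, Finset.sum_add_distrib, sum_ind_mul]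

theorem sum_std_row (hE : ∀ v ∈ E, v ∈ grid n) {j : ℕ} (hj : 2 ≤ j) (hjn : j ≤ n) :
    ∑ v ∈ E, (if StdArrow n (1, j) v then 1 else 0) * extendZero E c v =
      extendZero E c (2, j) ∧
    ∑ v ∈ E, (if StdArrow n v (1, j) then 1 else 0) * extendZero E c v =
      extendZero E c (2, j + 1) := by
  have hw : (1, j) ∈ grid n := by
    simp only [grid, Finset.mem_product, Finset.mem_Icc]; omega
  have hg : ∀ v ∈ E, 1 ≤ v.1 ∧ 1 ≤ v.2 := fun v hv => by
    have := hE v hv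
    simp only [grid, Finset.mem_product, Finset.mem_Icc] at this
    omega
  constructor
  · rw [Finset.sum_congr rfl fun v hv => by
      rw [ind_one (x := (2, j)) (q := v) (by
        have := hg v hv
        simp only [StdArrow, hw, hE v hv, true_and, true_or,
          Prod.ext_iff]
        omega)]]
    rw [sum_ind_mul]
  · rw [Finset.sum_congr rfl fun v hv => by
      rw [ind_one (x := (2, j + 1)) (q := v) (by
        have := hg v hv
        simp only [StdArrow, hw, hE v hv, true_and, and_true, true_or,
          Prod.ext_iff]
        omega)]]
    rw [sum_ind_mul]

theorem sum_std_col (hE : ∀ v ∈ E, v ∈ grid n) {i : ℕ} (hi : 2 ≤ i) (hin : i ≤ n) :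
    ∑ v ∈ E, (if StdArrow n (i, 1) v then 1 else 0) * extendZero E c v =
      extendZero E c (i, 2) ∧
    ∑ v ∈ E, (if StdArrow n v (i, 1) then 1 else 0) * extendZero E c v =
      extendZero E c (i + 1, 2) := by
  have hw : (i, 1) ∈ grid n := by
    simp only [grid, Finset.mem_product, Finset.mem_Icc]; omega
  have hg : ∀ v ∈ E, 1 ≤ v.1 ∧ 1 ≤ v.2 := fun v hv => by
    have := hE v hv
    simp only [grid, Finset.mem_product, Finset.mem_Icc] at this
    omega
  constructor
  · rw [Finset.sum_congr rfl fun v hv => by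
      rw [ind_one (x := (i, 2)) (q := v) (by
        have := hg v hv
        simp only [StdArrow, hw, hE v hv, true_and, or_true,
          Prod.ext_iff]
        omega)]]
    rw [sum_ind_mul]
  · rw [Finset.sum_congr rfl fun v hv => by
      rw [ind_one (x := (i + 1, 2)) (q := v) (by
        have := hg v hv
        simp only [StdArrow, hw, hE v hv, true_and, and_true, or_true,
          Prod.ext_iff]
        omega)]]
    rw [sum_ind_mul]

/-- The equation at the frozen vertex `(1, 1)` is not used. Hence the same computation serves the
seed on `Mat_n` and the one on `SL_n`, from which this vertex is removed. -/
theorem kernelEq_of_sum (hα : 1 ≤ α) (hα2 : α + 2 ≤ n) (hβ : 1 ≤ β) (hβ2 : β + 2 ≤ n)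
    (hE : ∀ v, v ∈ E ↔ v ∈ grid n ∧ ¬ IsStable α β v)
    (h : ∀ w ∈ grid n, w ≠ (1, 1) →
      ∑ v ∈ E, (arrows n α β w v - arrows n α β v w) * c v = 0) :
    KernelEq n α β (fun i j => extendZero E c (i, j)) (extendZero E c (α + 1, 1))
      (extendZero E c (1, β + 1)) := by
  have hEg : ∀ v ∈ E, v ∈ grid n := fun v hv => ((hE v).1 hv).1
  have hz : ∀ q, q ∉ E → extendZero E c q = 0 := fun q hq => if_neg hq
  have hmem : ∀ i j, (i, j) ∈ E ↔ (1 ≤ i ∧ i ≤ n) ∧ (1 ≤ j ∧ j ≤ n) ∧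
      ¬ ((i = 1 ∨ j = 1) ∧ ¬ (i = α + 1 ∧ j = 1) ∧ ¬ (i = 1 ∧ j = β + 1)) := fun i j => by
    rw [hE, IsStable, grid, Finset.mem_product, Finset.mem_Icc, Finset.mem_Icc, Ne, Ne,
      Prod.mk.injEq, Prod.mk.injEq, and_assoc]
  have key : ∀ w ∈ grid n, w ≠ (1, 1) →
      ∑ v ∈ E, (if StdArrow n w v then 1 else 0) * extendZero E c v -
      ∑ v ∈ E, (if StdArrow n v w then 1 else 0) * extendZero E c v +
      (ind (α, 1) w * extendZero E c (α + 1, 1) + ind (1, β) w * extendZero E c (1, β + 1) +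
      ind (n, α + 1) w * extendZero E c (1, β + 1) + ind (1, β + 1) w * extendZero E c (n, α) +
      ind (β + 1, n) w * extendZero E c (α + 1, 1) +
      ind (α + 1, 1) w * extendZero E c (β, n)) -
      (ind (α + 1, 1) w * extendZero E c (α, 1) + ind (1, β + 1) w * extendZero E c (1, β) +
      ind (1, β + 1) w * extendZero E c (n, α + 1) + ind (n, α) w * extendZero E c (1, β + 1) +
      ind (α + 1, 1) w * extendZero E c (β + 1, n) +
      ind (β, n) w * extendZero E c (α + 1, 1)) = 0 := fun w hw hw1 => by
    refine Eq.trans ?_ (h w hw hw1)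
    rw [← sum_added_out hα hα2 hβ hβ2, ← sum_added_in hα hα2 hβ hβ2, ← Finset.sum_sub_distrib, ← Finset.sum_add_distrib, ← Finset.sum_sub_distrib]
    refine Finset.sum_congr rfl fun v hv => ?_
    rw [extendZero, if_pos hv, arrows, arrows]
    ring
  have hg : ∀ i j, 1 ≤ i → i ≤ n → 1 ≤ j → j ≤ n → (i, j) ∈ grid n := fun i j _ _ _ _ => by
    simp only [grid, Finset.mem_product, Finset.mem_Icc]; omega
  have i0 : ∀ {x q : ℕ × ℕ}, q.1 ≠ x.1 ∨ q.2 ≠ x.2 → ind x q = 0 := fun hxq =>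
    if_neg fun e => by rw [e] at hxq; simp at hxq
  have i1 : ∀ {x y i j : ℕ} {A : Prop} [Decidable A], (A ↔ i = x ∧ j = y) → ∀ z : ℤ,
      ind (x, y) (i, j) * z = if A then z else 0 := fun hA z => by
    simp only [ind, Prod.mk.injEq, hA, ite_mul, one_mul, zero_mul]
  have zα : extendZero E c (α, 1) = 0 := hz _ (by rw [hmem]; omega)
  have zβ : extendZero E c (1, β) = 0 := hz _ (by rw [hmem]; omega)
  have hrow1 : ∀ j, j ≠ β + 1 → extendZero E c (1, j) = 0 := fun j hj => hz _ (by rw [hmem]; omega)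
  have hcol1 : ∀ i, i ≠ α + 1 → extendZero E c (i, 1) = 0 := fun j hj => hz _ (by rw [hmem]; omega)
  refine ⟨fun j => hz _ (by rw [hmem]; omega), fun i => hz _ (by rw [hmem]; omega), fun j => ?_,
    fun i => ?_, fun i j hi hin hj hjn => ?_, fun j hj hjn hjβ => ?_, fun i hi hin hiα => ?_, ?_, ?_⟩
  · split_ifs with hj
    · rw [hj]
    · exact hrow1 j hj
  · split_ifs with hj
    · rw [hj]
    · exact hcol1 i hj
  · have k := key (i + 1, j + 1) (hg _ _ (by omega) (by omega) (by omega) (by omega)) (by simp; omega)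
    rw [(sum_std_interior hEg hi hin hj hjn).1, (sum_std_interior hEg hi hin hj hjn).2] at k
    rw [i0 (x := (α, 1)) (by dsimp only; omega), i0 (x := (1, β)) (by dsimp only; omega),
      i0 (x := (1, β + 1)) (by dsimp only; omega), i0 (x := (α + 1, 1)) (by dsimp only; omega),
      i1 (A := i + 1 = n ∧ j = α) (by omega), i1 (A := j + 1 = n ∧ i = β) (by omega),
      i1 (A := i + 1 = n ∧ j + 1 = α) (by omega), i1 (A := j + 1 = n ∧ i + 1 = β) (by omega)] at k
    unfold mixedDiff
    linarith
  · have k := key (1, j) (hg _ _ (by omega) (by omega) (by omega) (by omega)) (by simp; omega)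
    rw [(sum_std_row hEg hj hjn).1, (sum_std_row hEg hj hjn).2,
      i0 (x := (α, 1)) (by dsimp only; omega), i0 (x := (n, α + 1)) (by dsimp only; omega),
      i0 (x := (1, β + 1)) (by dsimp only; omega), i0 (x := (α + 1, 1)) (by dsimp only; omega),
      i0 (x := (n, α)) (by dsimp only; omega), i0 (x := (β + 1, n)) (by dsimp only; omega),
      i1 (A := j = β) (by omega), i1 (A := β = 1 ∧ j = n) (by omega)] at k
    rw [mixedDiff, hrow1 j hjβ]
    rw [show extendZero E c (1, j + 1) = if j = β then extendZero E c (1, β + 1) else 0 by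
      split_ifs with e
      · rw [e]
      · exact hrow1 _ (by omega)]
    linarith
  · have k := key (i, 1) (hg _ _ (by omega) (by omega) (by omega) (by omega)) (by simp; omega)
    rw [(sum_std_col hEg hi hin).1, (sum_std_col hEg hi hin).2,
      i0 (x := (1, β)) (by dsimp only; omega), i0 (x := (n, α + 1)) (by dsimp only; omega),
      i0 (x := (1, β + 1)) (by dsimp only; omega), i0 (x := (α + 1, 1)) (by dsimp only; omega),
      i0 (x := (β, n)) (by dsimp only; omega), i0 (x := (β + 1, n)) (by dsimp only; omega),
      i1 (A := i = α) (by omega), i1 (A := α = 1 ∧ i = n) (by omega)] at k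
    rw [mixedDiff, hcol1 i hiα]
    rw [show extendZero E c (i + 1, 1) = if i = α then extendZero E c (α + 1, 1) else 0 by
      split_ifs with e
      · rw [e]
      · exact hcol1 _ (by omega)]
    linarith
  · have k := key (1, β + 1) (hg _ _ (by omega) (by omega) (by omega) (by omega)) (by simp; omega)
    rw [(sum_std_row hEg (j := β + 1) (by omega) (by omega)).1,
      (sum_std_row hEg (j := β + 1) (by omega) (by omega)).2,
      i0 (x := (α, 1)) (by dsimp only; omega), i0 (x := (n, α + 1)) (by dsimp only; omega),
      i0 (x := (1, β)) (by dsimp only; omega), i0 (x := (α + 1, 1)) (by dsimp only; omega),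
      i0 (x := (β, n)) (by dsimp only; omega), i0 (x := (β + 1, n)) (by dsimp only; omega),
      i0 (x := (n, α)) (by dsimp only; omega), zβ, ind, if_pos rfl] at k
    rw [mixedDiff, hrow1 (β + 1 + 1) (by omega)]
    linarith
  · have k := key (α + 1, 1) (hg _ _ (by omega) (by omega) (by omega) (by omega)) (by simp; omega)
    rw [(sum_std_col hEg (i := α + 1) (by omega) (by omega)).1,
      (sum_std_col hEg (i := α + 1) (by omega) (by omega)).2,
      i0 (x := (α, 1)) (by dsimp only; omega), i0 (x := (n, α + 1)) (by dsimp only; omega),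
      i0 (x := (1, β)) (by dsimp only; omega), i0 (x := (1, β + 1)) (by dsimp only; omega),
      i0 (x := (β, n)) (by dsimp only; omega), i0 (x := (β + 1, n)) (by dsimp only; omega),
      i0 (x := (n, α)) (by dsimp only; omega), zα, ind, if_pos rfl] at k
    rw [mixedDiff, hcol1 (α + 1 + 1) (by omega)]
    linarith

theorem matrixSeed_eq_zero_of_sum (X : Matrix (Fin n) (Fin n) K) (hα : 1 ≤ α) (hαβ : α < β)
    (hβ : β + 2 ≤ n) (c : ℕ × ℕ → ℤ) (h : ∀ w ∈ grid n, w ≠ (1, 1) →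
      ∑ v ∈ (matrixSeed α β X).exchangeable, (matrixSeed α β X).b w v * c v = 0)
    (v : ℕ × ℕ) (hv : v ∈ (matrixSeed α β X).exchangeable) : c v = 0 := by
  have hk := kernelEq_of_sum hα (by omega) (by omega) hβ (mem_matrixSeed_exchangeable X) h
  have hg := ((mem_matrixSeed_exchangeable X v).1 hv).1
  simp only [grid, Finset.mem_product, Finset.mem_Icc] at hg
  have := hk.eq_zero hα (by omega) (by omega) hβ hαβ.ne hg.1.1 hg.1.2 hg.2.1 hg.2.2
  rwa [extendZero, if_pos hv] at this

theorem matrixSeed_fullRank (X : Matrix (Fin n) (Fin n) K) (hα : 1 ≤ α) (hαβ : α < β)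
    (hβ : β + 2 ≤ n) : (matrixSeed α β X).FullRank := fun c hc =>
  matrixSeed_eq_zero_of_sum X hα hαβ hβ c fun w hw _ => hc w hw

theorem matrixSeed_remove_fullRank (X : Matrix (Fin n) (Fin n) K) (hα : 1 ≤ α) (hαβ : α < β)
    (hβ : β + 2 ≤ n) : ((matrixSeed α β X).remove (1, 1)).FullRank := by
  have hE : ((matrixSeed α β X).remove (1, 1)).exchangeable = (matrixSeed α β X).exchangeable := by
    ext q
    have h1 : (1, 1) ∈ (matrixSeed α β X).frozen := by
      rw [mem_matrixSeed_frozen]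
      refine ⟨by simp only [grid, Finset.mem_product, Finset.mem_Icc]; omega, ?_⟩
      simp only [IsStable, true_or, Ne, Prod.mk.injEq, true_and, and_true]
      omega
    simp only [Seed.exchangeable, Seed.remove, Finset.mem_sdiff, Finset.mem_erase]
    by_cases hq : q = (1, 1)
    · subst hq; simp [h1]
    · simp [hq]
  intro c hc
  rw [hE] at hc ⊢
  exact matrixSeed_eq_zero_of_sum X hα hαβ hβ c fun w hw hw1 =>
    hc w (Finset.mem_erase.2 ⟨hw1, hw⟩)

end

end ExoticCluster

namespace ExoticCluster

/-! ### Leading monomials with respect to a weight -/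

open Finsupp MvPolynomial

section Lead

variable {σ R : Type*} [CommRing R] {w : σ → ℕ} {p q : MvPolynomial σ R} {m m' : σ →₀ ℕ} {d : ℕ}

/-- The monomial `m` occurs in `p` with coefficient `1`, and all other monomials of `p` have
smaller weight. -/
structure Lead (w : σ → ℕ) (p : MvPolynomial σ R) (m : σ →₀ ℕ) : Prop where
  coeff_eq : p.coeff m = 1
  lt : ∀ a, p.coeff a ≠ 0 → a ≠ m → weight w a < weight w m

/-- All monomials of `p` have weight less than `d`. -/
def Below (w : σ → ℕ) (p : MvPolynomial σ R) (d : ℕ) : Prop :=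
  ∀ a, p.coeff a ≠ 0 → weight w a < d

theorem Lead.le (h : Lead w p m) {a : σ →₀ ℕ} (ha : p.coeff a ≠ 0) :
    weight w a ≤ weight w m := by
  by_cases e : a = m
  · rw [e]
  · exact (h.lt a ha e).le

theorem Lead.below (h : Lead w p m) (hd : weight w m < d) : Below w p d := fun _ ha =>
  (h.le ha).trans_lt hd

theorem Below.sum {ι : Type*} {s : Finset ι} {f : ι → MvPolynomial σ R}
    (h : ∀ i ∈ s, Below w (f i) d) : Below w (∑ i ∈ s, f i) d := by
  intro a ha
  rw [coeff_sum] at ha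
  obtain ⟨i, hi, hia⟩ := Finset.exists_ne_zero_of_sum_ne_zero ha
  exact h i hi a hia

theorem Lead.add_below (h : Lead w p m) (hq : Below w q (weight w m)) : Lead w (p + q) m := by
  refine ⟨?_, fun a ha hne => ?_⟩
  · have : q.coeff m = 0 := by_contra fun h0 => lt_irrefl _ (hq m h0)
    rw [coeff_add, this, add_zero, h.coeff_eq]
  · by_cases h0 : q.coeff a = 0
    · rw [coeff_add, h0, add_zero] at ha
      exact h.lt a ha hne
    · exact hq a h0

theorem Lead.sub (h : Lead w p m) (hq : Lead w q m') (hlt : weight w m' < weight w m) :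
    Lead w (p - q) m := by
  rw [sub_eq_add_neg]
  refine h.add_below fun a ha => ?_
  rw [coeff_neg, neg_ne_zero] at ha
  exact hq.below hlt a ha

theorem lead_one : Lead w (1 : MvPolynomial σ R) 0 := by
  classical
  refine ⟨coeff_zero_one, fun a ha hne => ?_⟩
  rw [coeff_one, if_neg (Ne.symm hne)] at ha
  exact absurd rfl ha

theorem lead_X (s : σ) : Lead w (X s : MvPolynomial σ R) (single s 1) := by
  classical
  refine ⟨by rw [coeff_X, if_pos rfl], fun a ha hne => ?_⟩
  rw [coeff_X, if_neg (Ne.symm hne)] at ha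
  exact absurd rfl ha

theorem Lead.coeff_mul (h : Lead w p m) (hq : ∀ y, q.coeff y ≠ 0 → weight w y ≤ weight w m') :
    (p * q).coeff (m + m') = q.coeff m' := by
  classical
  rw [MvPolynomial.coeff_mul, Finset.sum_eq_single (m, m'), h.coeff_eq, one_mul]
  · rintro ⟨x, y⟩ hxy hne
    rw [Finset.HasAntidiagonal.mem_antidiagonal] at hxy
    dsimp only at hxy ⊢
    by_contra h0
    have e := congrArg (weight w) hxy
    rw [map_add, map_add] at e
    by_cases hx : x = m
    · subst hx
      exact hne (by rw [add_left_cancel hxy])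
    · have := h.lt x (left_ne_zero_of_mul h0) hx
      have := hq y (right_ne_zero_of_mul h0)
      omega
  · intro h0
    rw [Finset.HasAntidiagonal.mem_antidiagonal] at h0
    exact absurd rfl h0

theorem Lead.mul (h : Lead w p m) (hq : Lead w q m') : Lead w (p * q) (m + m') := by
  classical
  refine ⟨by rw [h.coeff_mul fun y hy => hq.le hy, hq.coeff_eq], fun a ha hne => ?_⟩
  · rw [MvPolynomial.coeff_mul] at ha
    obtain ⟨⟨x, y⟩, hxy, h0⟩ := Finset.exists_ne_zero_of_sum_ne_zero ha
    rw [Finset.HasAntidiagonal.mem_antidiagonal] at hxy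
    dsimp only at hxy h0
    have h1 := left_ne_zero_of_mul h0
    have h2 := right_ne_zero_of_mul h0
    rw [← hxy, map_add, map_add]
    by_cases hx : x = m
    · subst hx
      have := hq.lt y h2 fun e => hne (by rw [← hxy, e])
      omega
    · have := h.lt x h1 hx
      have := hq.le h2
      omega

theorem Lead.pow (h : Lead w p m) (k : ℕ) : Lead w (p ^ k) (k • m) := by
  induction k with
  | zero => rw [pow_zero, zero_smul]; exact lead_one
  | succ k ih => rw [pow_succ, succ_nsmul]; exact ih.mul h

theorem Lead.prod {ι : Type*} {s : Finset ι} {f : ι → MvPolynomial σ R} {m : ι → σ →₀ ℕ}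
    (h : ∀ i ∈ s, Lead w (f i) (m i)) : Lead w (∏ i ∈ s, f i) (∑ i ∈ s, m i) := by
  classical
  induction s using Finset.induction_on with
  | empty => rw [Finset.prod_empty, Finset.sum_empty]; exact lead_one
  | insert a s ha ih =>
    rw [Finset.prod_insert ha, Finset.sum_insert ha]
    exact (h a (Finset.mem_insert_self a s)).mul
      (ih fun i hi => h i (Finset.mem_insert_of_mem hi))

theorem perm_eq_one_of_monovary {k : ℕ} {f g : Fin k → ℕ} (hf : StrictMono f) (hg : StrictMono g)
    {τ : Equiv.Perm (Fin k)} (h : Monovary (f ∘ τ) g) : τ = 1 := by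
  have hm : StrictMono τ := by
    refine (Monotone.strictMono_of_injective (fun i j hij => ?_) τ.injective)
    rcases hij.lt_or_eq with hlt | rfl
    · exact hf.le_iff_le.1 (h (hg hlt))
    · exact le_rfl
  ext i
  have := Subsingleton.elim (hm.orderIsoOfSurjective τ τ.surjective) (OrderIso.refl _)
  exact congrArg Fin.val (congrArg (fun e : Fin k ≃o Fin k => e i) this)

/-- The leading monomial of a minor is the product of the diagonal entries, if the weights are
supermodular. -/
theorem lead_det {k : ℕ} (s : Fin k → Fin k → σ) {f g A B : Fin k → ℕ} (hf : StrictMono f)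
    (hg : StrictMono g) (hw : ∀ u v, w (s u v) = f u * g v + A u + B v) :
    Lead w (Matrix.of fun u v => (X (s u v) : MvPolynomial σ R)).det
      (∑ u, single (s u u) 1) := by
  classical
  rw [Matrix.det_apply, ← Finset.add_sum_erase _ _ (Finset.mem_univ 1)]
  have hW : ∀ τ : Equiv.Perm (Fin k), weight w (∑ u, single (s (τ u) u) 1) =
      ∑ u, f (τ u) * g u + (∑ u, A u + ∑ u, B u) := fun τ => by
    rw [map_sum, ← Equiv.sum_comp τ A, ← Finset.sum_add_distrib, ← Finset.sum_add_distrib]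
    refine Finset.sum_congr rfl fun u _ => ?_
    rw [weight_single, hw, one_smul, add_assoc]
  refine Lead.add_below ?_ (Below.sum fun τ hτ => ?_)
  · rw [Equiv.Perm.sign_one, one_smul]
    exact Lead.prod fun u _ => lead_X _
  · have h1 : Lead w (∏ u, Matrix.of (fun u v => (X (s u v) : MvPolynomial σ R)) (τ u) u)
        (∑ u, single (s (τ u) u) 1) := Lead.prod fun u _ => lead_X _
    have h2 := h1.below (d := weight w (∑ u, single (s u u) 1)) (by
      rw [hW τ]
      have := hW 1
      simp only [Equiv.Perm.one_apply] at this
      rw [this]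
      refine Nat.add_lt_add_right ?_ _
      -- The strict rearrangement inequality: among all permutations only the identity maximises the
      -- sum of the products; the terms `A` and `B` contribute equally to all of them.
      refine Monovary.sum_comp_perm_mul_lt_sum_mul_iff (fun i j hij => ?_) |>.2 fun hm => ?_
      · exact (hf (hg.lt_iff_lt.1 hij)).le
      · exact (Finset.mem_erase.1 hτ).1 (perm_eq_one_of_monovary hf hg hm))
    intro a ha
    refine h2 a fun h0 => ha ?_
    rw [Units.smul_def, coeff_smul, h0, smul_zero]

/-! ### Algebraic independence -/

variable {ι : Type*} {F : ι → MvPolynomial σ R} {μ : ι → σ →₀ ℕ}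

/-- Different monomials in the `F i` have different leading monomials, so those of maximal weight
cannot cancel. -/
theorem Lead.aeval (h : ∀ i, Lead w (F i) (μ i))
    (hμ : Function.Injective fun a : ι →₀ ℕ => a.sum fun i e => e • μ i) {P : MvPolynomial ι R}
    (hP : P ≠ 0) : ∃ a ∈ P.support, (MvPolynomial.aeval F P).coeff (a.sum fun i e => e • μ i) ≠ 0 ∧
      ∀ b, (MvPolynomial.aeval F P).coeff b ≠ 0 →
        weight w b ≤ weight w (a.sum fun i e => e • μ i) := by
  classical
  set M : (ι →₀ ℕ) → σ →₀ ℕ := fun a => a.sum fun i e => e • μ i with hM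
  have hl : ∀ a : ι →₀ ℕ, Lead w (a.prod fun i e => F i ^ e) (M a) := fun a =>
    Lead.prod fun i _ => (h i).pow _
  have hc : ∀ b, (MvPolynomial.aeval F P).coeff b =
      ∑ a ∈ P.support, P.coeff a * (a.prod fun i e => F i ^ e).coeff b := fun b => by
    rw [aeval_def, eval₂_eq, coeff_sum]
    refine Finset.sum_congr rfl fun a _ => ?_
    rw [algebraMap_eq, coeff_C_mul]
    rfl
  obtain ⟨a, ha, hmax⟩ := Finset.exists_max_image P.support (fun a => weight w (M a))
    (MvPolynomial.support_nonempty.2 hP)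
  refine ⟨a, ha, ?_, fun b hb => ?_⟩
  · change coeff (M a) _ ≠ 0
    rw [hc, Finset.sum_eq_single a, (hl a).coeff_eq, mul_one]
    · exact MvPolynomial.mem_support_iff.1 ha
    · intro b hb hne
      by_contra h0
      have h1 := (hl b).lt (M a) (right_ne_zero_of_mul h0) fun e => hne (hμ e).symm
      exact absurd (hmax b hb) (not_le.2 h1)
    · exact fun h => absurd ha h
  · rw [hc] at hb
    obtain ⟨c, hc1, hc2⟩ := Finset.exists_ne_zero_of_sum_ne_zero hb
    exact ((hl c).le (right_ne_zero_of_mul hc2)).trans (hmax c hc1)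

theorem Lead.algebraicIndependent (h : ∀ i, Lead w (F i) (μ i))
    (hμ : Function.Injective fun a : ι →₀ ℕ => a.sum fun i e => e • μ i) :
    AlgebraicIndependent R F := by
  rw [algebraicIndependent_iff]
  intro P hP
  by_contra h0
  obtain ⟨a, -, h1, -⟩ := Lead.aeval h hμ h0
  rw [hP, coeff_zero] at h1
  exact h1 rfl

/-- A polynomial in the `F i` is not divisible by `G - 1`, if a variable occurs in the leading
monomial of `G`, but not in those of the `F i`. -/
theorem Lead.eq_zero_of_dvd (h : ∀ i, Lead w (F i) (μ i))
    (hμ : Function.Injective fun a : ι →₀ ℕ => a.sum fun i e => e • μ i) {G : MvPolynomial σ R}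
    (hG : Lead w G m) {s : σ} (hs : m s ≠ 0) (hws : 0 < w s) (hμs : ∀ i, μ i s = 0)
    {P : MvPolynomial ι R} (hd : G - 1 ∣ MvPolynomial.aeval F P) : P = 0 := by
  classical
  by_contra h0
  obtain ⟨a, -, h1, h2⟩ := Lead.aeval h hμ h0
  set b := a.sum fun i e => e • μ i with hb
  have hbs : b s = 0 := by
    rw [hb, Finsupp.sum, Finsupp.finsetSum_apply]
    exact Finset.sum_eq_zero fun i _ => by rw [Finsupp.smul_apply, hμs, smul_zero]
  have hm : weight w (0 : σ →₀ ℕ) < weight w m := by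
    rw [map_zero]
    exact hws.trans_le (le_weight_of_ne_zero' (w := w) hs)
  have hG1 : Lead w (G - 1) m := hG.sub lead_one hm
  obtain ⟨Q, hQ⟩ := hd
  have hQ0 : Q ≠ 0 := by
    rintro rfl
    rw [hQ, mul_zero, coeff_zero] at h1
    exact h1 rfl
  -- If `c` has maximal weight in the quotient, then `m + c` survives in the product. It is heavier
  -- than `b`: since `b` does not contain `s`, it cannot arise from the leading monomial `m` of `G -
  -- 1`.
  obtain ⟨c, hc, hmax⟩ := Finset.exists_max_image Q.support (weight w) (MvPolynomial.support_nonempty.2 hQ0)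
  have h3 : weight w b < weight w (m + c) := by
    rw [hQ, MvPolynomial.coeff_mul] at h1
    obtain ⟨⟨x, y⟩, hxy, h4⟩ := Finset.exists_ne_zero_of_sum_ne_zero h1
    rw [Finset.HasAntidiagonal.mem_antidiagonal] at hxy
    dsimp only at hxy h4
    have hx : x ≠ m := by
      rintro rfl
      have := DFunLike.congr_fun hxy s
      rw [hbs, Finsupp.add_apply] at this
      omega
    have := hG1.lt x (left_ne_zero_of_mul h4) hx
    have := hmax y (MvPolynomial.mem_support_iff.2 (right_ne_zero_of_mul h4))
    rw [← hxy, map_add, map_add]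
    omega
  refine absurd (h2 (m + c) ?_) (not_le.2 h3)
  rw [hQ, hG1.coeff_mul fun y hy => hmax y (MvPolynomial.mem_support_iff.2 hy)]
  exact MvPolynomial.mem_support_iff.1 hc

end Lead

end ExoticCluster

namespace ExoticCluster

/-! ### The leading monomials of the initial variables -/

open Finsupp MvPolynomial

section

variable {σ R : Type*} [CommRing R]

/-- The product of the entries on the diagonal of the `k × k` submatrix with upper left entry
`(i, j)`. -/
noncomputable def diagMon (pos : ℕ → ℕ → σ) (i j k : ℕ) : σ →₀ ℕ :=
  ∑ u ∈ Finset.range k, single (pos (i + u) (j + u)) 1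

theorem diagMon_zero (pos : ℕ → ℕ → σ) (i j : ℕ) : diagMon pos i j 0 = 0 := rfl

theorem diagMon_succ (pos : ℕ → ℕ → σ) (i j k : ℕ) :
    diagMon pos i j (k + 1) = single (pos i j) 1 + diagMon pos (i + 1) (j + 1) k := by
  unfold diagMon
  rw [Finset.sum_range_succ', add_comm]
  congr 1
  exact Finset.sum_congr rfl fun u _ => by
    rw [show i + (u + 1) = i + 1 + u by omega, show j + (u + 1) = j + 1 + u by omega]

/-- The weight of the position `(i, j)`, for which the initial variables have monomials as
leading terms. -/
def wt (n a b i j : ℕ) : ℕ :=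
  i * j + (if a + 1 ≤ i then n else 0) + (if b + 1 ≤ j then n else 0)

theorem wt_transpose (n a b i j : ℕ) : wt n a b i j = wt n b a j i := by
  unfold wt
  ring

variable {w : σ → ℕ} {pos : ℕ → ℕ → σ} {n a b : ℕ}

theorem lead_mn (hw : ∀ i j, w (pos i j) = wt n a b i j) {y : ℕ → ℕ → MvPolynomial σ R}
    {i j k : ℕ} {ρ κ : ℕ → ℕ} (hρ : ∀ u v, u < v → v < k → ρ u < ρ v)
    (hκ : ∀ u v, u < v → v < k → κ u < κ v)
    (hy : ∀ u < k, ∀ v < k, y (i + u) (j + v) = X (pos (ρ u) (κ v))) :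
    Lead w (mn y i j k) (∑ u ∈ Finset.range k, single (pos (ρ u) (κ u)) 1) := by
  have h := lead_det (R := R) (w := w) (fun u v : Fin k => pos (ρ u) (κ v))
    (f := fun u => ρ u) (g := fun v => κ v) (A := fun u => if a + 1 ≤ ρ u then n else 0)
    (B := fun v => if b + 1 ≤ κ v then n else 0) (fun u v huv => hρ u v huv v.2)
    (fun u v huv => hκ u v huv v.2) (fun u v => hw _ _)
  rw [Finset.sum_range (fun u => single (pos (ρ u) (κ u)) 1), mn]
  rwa [show (Matrix.of fun u v : Fin k => y (i + u) (j + v)) =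
    Matrix.of fun u v : Fin k => X (pos (ρ u) (κ v)) from
      Matrix.ext fun u v => hy u u.2 v v.2]

theorem lead_mn_X (hw : ∀ i j, w (pos i j) = wt n a b i j) (i j k : ℕ) :
    Lead w (mn (fun i j => (X (pos i j) : MvPolynomial σ R)) i j k) (diagMon pos i j k) :=
  lead_mn (ρ := fun u => i + u) (κ := fun u => j + u) hw (fun _ _ _ _ => by omega)
    (fun _ _ _ _ => by omega) fun _ _ _ _ => rfl

/-- Replacing row `b` by row `b + 1` raises the weight of the second minor by the column number `κ k
≤ n`. The jump of the weight by `n` between the rows `a` and `a + 1`, or the corresponding jump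
between columns, makes the first coefficient heavier by more than that, which is the hypothesis
`hPQ`. -/
theorem lead_updR_sub (hw : ∀ i j, w (pos i j) = wt n a b i j) (hab : a ≠ b)
    {y : ℕ → ℕ → MvPolynomial σ R} {i j k : ℕ} {κ : ℕ → ℕ} (hκ : ∀ u v, u < v → v ≤ k → κ u < κ v)
    (hy : ∀ u ≤ k + 1, ∀ v ≤ k, y (i + u) (j + v) = X (pos (i + u) (κ v))) (hb : i + k = b)
    (hn : κ k ≤ n) {p q : MvPolynomial σ R} {P Q : σ →₀ ℕ} (hp : Lead w p P) (hq : Lead w q Q)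
    (hPQ : weight w Q + n < weight w P) :
    Lead w (mn (updR y b fun j => p * y b j - q * y (b + 1) j) i j (k + 1))
      (P + ∑ u ∈ Finset.range (k + 1), single (pos (i + u) (κ u)) 1) := by
  rw [mn_updR_linear_sub y (by omega), updR_eq_self]
  have h1 := lead_mn (y := y) (i := i) (j := j) (k := k + 1) (ρ := fun u => i + u) (κ := κ) hw
    (fun u v _ _ => by omega) (fun u v h1 h2 => hκ u v h1 (by omega))
    (fun u hu v hv => hy u (by omega) v (by omega))
  have h2 := lead_mn (y := updR y b (y (b + 1))) (i := i) (j := j) (k := k + 1)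
    (ρ := fun u => if u = k then b + 1 else i + u) (κ := κ) hw
    (fun u v _ _ => by split_ifs <;> omega) (fun u v h1 h2 => hκ u v h1 (by omega))
    (fun u hu v hv => by
      unfold updR
      split_ifs with e1 e2 e2
      · rw [← hb, add_assoc, hy (k + 1) le_rfl v (by omega)]
      · omega
      · omega
      · exact hy u (by omega) v (by omega))
  refine (hp.mul h1).sub (hq.mul h2) ?_
  rw [map_add, map_add, Finset.sum_range_succ, Finset.sum_range_succ, map_add, map_add,
    weight_single, weight_single, if_pos rfl, hw, hw, one_smul, one_smul, hb,
    Finset.sum_congr rfl fun u hu => by rw [if_neg (Finset.mem_range.1 hu).ne]]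
  -- This uses `a ≠ b`: the jump of the weight between the rows `a` and `a + 1` is not met between
  -- the rows `b` and `b + 1`.
  have : wt n a b (b + 1) (κ k) = wt n a b b (κ k) + κ k := by
    unfold wt
    rw [if_congr (show a + 1 ≤ b + 1 ↔ a + 1 ≤ b by omega) rfl rfl]
    ring
  omega

theorem lead_updC_sub (hw : ∀ i j, w (pos i j) = wt n a b i j) (hab : a ≠ b)
    {y : ℕ → ℕ → MvPolynomial σ R} {i j k : ℕ} {ρ : ℕ → ℕ} (hρ : ∀ u v, u < v → v ≤ k → ρ u < ρ v)
    (hy : ∀ u ≤ k, ∀ v ≤ k + 1, y (i + u) (j + v) = X (pos (ρ u) (j + v))) (ha : j + k = a)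
    (hn : ρ k ≤ n) {p q : MvPolynomial σ R} {P Q : σ →₀ ℕ} (hp : Lead w p P) (hq : Lead w q Q)
    (hPQ : weight w Q + n < weight w P) :
    Lead w (mn (updC y a fun i => p * y i a - q * y i (a + 1)) i j (k + 1))
      (P + ∑ u ∈ Finset.range (k + 1), single (pos (ρ u) (j + u)) 1) := by
  rw [mn_updC]
  exact lead_updR_sub (pos := fun i j => pos j i) (a := b) (b := a) (i := j) (j := i)
    (y := fun i j => y j i) (fun i j => by rw [hw, wt_transpose]) hab.symm hρ
    (fun u hu v hv => hy v hv u hu) ha hn hp hq hPQ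

/-- The leading monomial of `rowCoeff'` is obtained from that of `rowCoeff` by replacing the first
entry. -/
theorem weight_diagMon_row (hw : ∀ i j, w (pos i j) = wt n a b i j) {m : ℕ} (hm : 1 ≤ m) :
    weight w (∑ u ∈ Finset.range m, single (pos (if u = 0 then a else a + 1 + u) (1 + u)) 1) + n <
      weight w (diagMon pos (a + 1) 1 m) := by
  obtain ⟨m, rfl⟩ : ∃ l, m = l + 1 := ⟨m - 1, by omega⟩
  rw [diagMon, Finset.sum_range_succ', Finset.sum_range_succ', map_add, map_add, weight_single,
    weight_single, if_pos rfl, hw, hw]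
  simp only [Nat.succ_ne_zero, if_false, one_smul, wt]
  split_ifs <;> omega

theorem lead_rowCoeff' (hw : ∀ i j, w (pos i j) = wt n a b i j) (r : ℕ) :
    Lead w (rowCoeff' (fun i j => (X (pos i j) : MvPolynomial σ R)) r a)
      (∑ u ∈ Finset.range (r - a), single (pos (if u = 0 then a else a + 1 + u) (1 + u)) 1) := by
  refine lead_mn (ρ := fun u => if u = 0 then a else a + 1 + u) (κ := fun u => 1 + u) hw
    (fun u v _ _ => by split_ifs <;> omega) (fun _ _ _ _ => by omega)
    fun u hu v hv => ?_
  unfold updR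
  dsimp only
  split_ifs <;> first | rfl | omega

theorem lead_colCoeff' (hw : ∀ i j, w (pos i j) = wt n a b i j) (c : ℕ) :
    Lead w (colCoeff' (fun i j => (X (pos i j) : MvPolynomial σ R)) c b)
      (∑ u ∈ Finset.range (c - b), single (pos (1 + u) (if u = 0 then b else b + 1 + u)) 1) := by
  rw [colCoeff', mn_updC]
  exact lead_rowCoeff' (pos := fun i j => pos j i) (a := b) (b := a)
    (fun i j => by rw [hw, wt_transpose]) c

theorem weight_diagMon_col (hw : ∀ i j, w (pos i j) = wt n a b i j) {m : ℕ} (hm : 1 ≤ m) :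
    weight w (∑ u ∈ Finset.range m, single (pos (1 + u) (if u = 0 then b else b + 1 + u)) 1) + n <
      weight w (diagMon pos 1 (b + 1) m) :=
  weight_diagMon_row (pos := fun i j => pos j i) (a := b) (b := a)
    (fun i j => by rw [hw, wt_transpose]) hm

/-- The leading monomial of the variables on the diagonal that ends in `(b, n)`. -/
theorem lead_zrow (hw : ∀ i j, w (pos i j) = wt n a b i j) (hab : a ≠ b) (ha : 1 ≤ a)
    (han : a + 1 ≤ n) (hbn : b + 1 ≤ n) {i j k : ℕ} (hi : i + k = b) (hj : j + k = n) :
    Lead w (mn (updR (fun i j => (X (pos i j) : MvPolynomial σ R)) b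
        (zrow (fun i j => X (pos i j)) n n a b)) i j (k + 1))
      (diagMon pos (a + 1) 1 (n - a) + (if n = 2 * a then diagMon pos 1 (b + 1) (n - b) else 0) +
        diagMon pos i j (k + 1)) := by
  set x : ℕ → ℕ → MvPolynomial σ R := fun i j => X (pos i j) with hx
  have main : ∀ {p q : MvPolynomial σ R} {P Q : σ →₀ ℕ}, Lead w p P → Lead w q Q →
      weight w Q + n < weight w P → Lead w (mn (updR x b fun j => p * x b j - q * x (b + 1) j)
        i j (k + 1)) (P + diagMon pos i j (k + 1)) := fun hp hq hPQ =>
    lead_updR_sub (κ := fun v => j + v) hw hab (fun _ _ _ _ => by omega)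
      (fun _ _ _ _ => rfl) hi (by omega) hp hq hPQ
  unfold zrow rowBase
  split_ifs with h
  -- With a third block the coefficients are themselves minors with a replaced column. The same
  -- estimate is applied to them first, and their common factor does not affect the comparison of
  -- weights.
  · have e : ∀ {y : ℕ → ℕ → MvPolynomial σ R} {ρ : ℕ → ℕ},
        (∀ u v, u < v → v ≤ a - 1 → ρ u < ρ v) → ρ (a - 1) ≤ n →
        (∀ u ≤ a - 1, ∀ v ≤ a - 1 + 1, y (a + 1 + u) (1 + v) = X (pos (ρ u) (1 + v))) →
        Lead w (mn (updC y a fun i => colCoeff x n b * y i a - colCoeff' x n b * y i (a + 1))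
          (a + 1) 1 (n - a)) (diagMon pos 1 (b + 1) (n - b) +
            ∑ u ∈ Finset.range (n - a), single (pos (ρ u) (1 + u)) 1) := fun hρ hn hy => by
      rw [show n - a = a - 1 + 1 by omega]
      exact lead_updC_sub hw hab hρ hy (by omega) hn (lead_mn_X hw _ _ _) (lead_colCoeff' hw n)
        (weight_diagMon_col hw (by omega))
    rw [add_comm (diagMon pos (a + 1) 1 (n - a))]
    refine main (Q := diagMon pos 1 (b + 1) (n - b) + ∑ u ∈ Finset.range (n - a),
      single (pos (if u = 0 then a else a + 1 + u) (1 + u)) 1) ?_ ?_ ?_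
    · exact e (y := x) (ρ := fun u => a + 1 + u) (fun _ _ _ _ => by omega)
        (by omega) (fun _ _ _ _ => rfl)
    · have := e (y := updR x (a + 1) (x a)) (ρ := fun u => if u = 0 then a else a + 1 + u)
        (fun _ _ _ _ => by split_ifs <;> omega)
        (by split_ifs <;> omega) (fun u _ v _ => by
          unfold updR
          split_ifs <;> first | rfl | omega)
      convert this using 1
      unfold rowCoeff'
      congr 1
      funext u v
      unfold updR updC vcol
      by_cases h1 : u = a + 1 <;> by_cases h2 : v = a <;> simp only [h1, h2, if_true, if_false]
    · rw [map_add, map_add, add_assoc]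
      exact Nat.add_lt_add_left (weight_diagMon_row hw (by omega)) _
  · rw [add_zero]
    exact main (lead_mn_X hw _ _ _) (lead_rowCoeff' hw n) (weight_diagMon_row hw (by omega))

/-- The leading monomial of the variables on the diagonal that ends in `(n, a)`. -/
theorem lead_ycol (hw : ∀ i j, w (pos i j) = wt n a b i j) (hab : a ≠ b) (hb : 1 ≤ b)
    (han : a + 1 ≤ n) (hbn : b + 1 ≤ n) {i j k : ℕ} (hi : i + k = n) (hj : j + k = a) :
    Lead w (mn (updC (fun i j => (X (pos i j) : MvPolynomial σ R)) a
        (ycol (fun i j => X (pos i j)) n n a b)) i j (k + 1))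
      (diagMon pos 1 (b + 1) (n - b) + (if n = 2 * b then diagMon pos (a + 1) 1 (n - a) else 0) +
        diagMon pos i j (k + 1)) := by
  rw [mn_updC]
  have := lead_zrow (R := R) (w := w) (pos := fun i j => pos j i) (a := b) (b := a) (i := j) (j := i)
    (fun i j => by rw [hw, wt_transpose]) hab.symm hb hbn han hj hi
  rwa [← ycol_transpose (fun i j => (X (pos j i) : MvPolynomial σ R))] at this

/-- The leading monomial of the variable at `(i, j)`. -/
noncomputable def leadMon (pos : ℕ → ℕ → σ) (n a b i j : ℕ) : σ →₀ ℕ :=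
  (if i + a = n + j then
    diagMon pos 1 (b + 1) (n - b) + (if n = 2 * b then diagMon pos (a + 1) 1 (n - a) else 0)
  else if j + b = n + i then
    diagMon pos (a + 1) 1 (n - a) + (if n = 2 * a then diagMon pos 1 (b + 1) (n - b) else 0)
  else 0) + diagMon pos i j (n + 1 - max i j)

theorem lead_stageVar (hw : ∀ i j, w (pos i j) = wt n a b i j) (hab : a ≠ b) (ha : 1 ≤ a)
    (hb : 1 ≤ b) (han : a + 1 ≤ n) (hbn : b + 1 ≤ n) {i j : ℕ} (hin : i ≤ n) (hjn : j ≤ n) :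
    Lead w (stageVar (fun i j => (X (pos i j) : MvPolynomial σ R)) n n a b n (i, j))
      (leadMon pos n a b i j) := by
  have heff : effRow n a n = n := by have := effRow_spec n a n; omega
  unfold stageVar leadMon
  dsimp only
  rw [heff]
  by_cases h1 : i + a = n + j
  · rw [if_pos h1, if_pos (by omega), if_pos (by omega), max_eq_left (by omega),
      show n + 1 - i = n - i + 1 by omega]
    exact lead_ycol hw hab hb han hbn (by omega) (by omega)
  rw [if_neg h1]
  by_cases h2 : j + b = n + i
  · rw [if_pos h2, if_neg (by omega), if_neg (by omega), if_pos (by omega),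
      max_eq_right (by omega), show n + 1 - j = n - j + 1 by omega]
    exact lead_zrow hw hab ha han hbn (by omega) (by omega)
  · simp only [h2, if_false, zero_add]
    by_cases h3 : j ≤ i
    · rw [if_pos (by omega), if_neg (by omega), max_eq_left h3]
      exact lead_mn_X hw _ _ _
    · rw [if_neg (by omega), if_neg (by omega), max_eq_right (by omega)]
      exact lead_mn_X hw _ _ _

/-- Every variable is a quotient of two leading monomials, or a leading monomial itself. -/
theorem leadMon_succ (hab : a ≠ b) (han : a + 1 ≤ n) (hbn : b + 1 ≤ n) {i j : ℕ} (hi : 1 ≤ i)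
    (hj : 1 ≤ j) (hin : i ≤ n) (hjn : j ≤ n) :
    leadMon pos n a b i j = single (pos i j) 1 ∨ ∃ i' j', 1 ≤ i' ∧ i' ≤ n ∧ 1 ≤ j' ∧ j' ≤ n ∧
      leadMon pos n a b i j = single (pos i j) 1 + leadMon pos n a b i' j' := by
  by_cases h : i < n ∧ j < n
  · refine .inr ⟨i + 1, j + 1, by omega, by omega, by omega, by omega, ?_⟩
    unfold leadMon
    rw [show n + 1 - max i j = n + 1 - max (i + 1) (j + 1) + 1 by omega, diagMon_succ,
      if_congr (show i + 1 + a = n + (j + 1) ↔ i + a = n + j by omega) rfl rfl,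
      if_congr (show j + 1 + b = n + (i + 1) ↔ j + b = n + i by omega) rfl rfl]
    abel
  -- Where a special diagonal leaves the grid, the monomial continues along the diagonal of the next
  -- block, which starts at `(1, b + 1)` or at `(a + 1, 1)`. This again is the leading monomial of a
  -- variable, also if there is a third block.
  by_cases h1 : i = n ∧ j = a
  · refine .inr ⟨1, b + 1, le_rfl, by omega, by omega, hbn, ?_⟩
    obtain ⟨rfl, rfl⟩ := h1
    unfold leadMon
    rw [if_pos rfl, if_neg (show ¬ 1 + j = i + (b + 1) by omega), max_eq_left hjn,
      max_eq_right (by omega),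
      show i + 1 - i = 0 + 1 by omega, diagMon_succ, diagMon_zero, add_zero,
      show i + 1 - (b + 1) = i - b by omega]
    by_cases h2 : i = 2 * b
    · rw [if_pos h2, if_pos (by omega), if_neg (show ¬ i = 2 * j by omega)]
      abel
    · rw [if_neg h2, if_neg (by omega)]
      abel
  by_cases h2 : i = b ∧ j = n
  · refine .inr ⟨a + 1, 1, by omega, han, le_rfl, by omega, ?_⟩
    obtain ⟨rfl, rfl⟩ := h2
    unfold leadMon
    rw [if_neg (show ¬ i + a = j + j by omega), if_pos (show j + i = j + i from rfl),
      max_eq_right hin, max_eq_left (by omega),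
      show j + 1 - j = 0 + 1 by omega, diagMon_succ, diagMon_zero, add_zero,
      show j + 1 - (a + 1) = j - a by omega]
    by_cases h3 : j = 2 * a
    · rw [if_pos h3, if_pos (show a + 1 + a = j + 1 by omega), if_neg (show ¬ j = 2 * i by omega)]
      abel
    · rw [if_neg h3, if_neg (show ¬ a + 1 + a = j + 1 by omega),
        if_neg (show ¬ 1 + i = j + (a + 1) by omega)]
      abel
  · left
    unfold leadMon
    rw [if_neg (by omega), if_neg (by omega), show n + 1 - max i j = 0 + 1 by omega, diagMon_succ,
      diagMon_zero, zero_add, add_zero]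

end

end ExoticCluster

namespace ExoticCluster

open Finsupp MvPolynomial

/-! ### Linear independence of the leading monomials -/

section

/-- By hypothesis every unit vector is one of the exponent vectors, restricted to the positions `s`,
or a difference of two of them. So these vectors span, and they are linearly independent because
their number equals the dimension. No ordering of the indices is needed. -/
theorem sum_nsmul_injective {ι σ : Type*} [Fintype ι] [DecidableEq ι] {s : ι → σ}
    (hs : Function.Injective s) {μ : ι → σ →₀ ℕ}
    (h : ∀ i, μ i = single (s i) 1 ∨ ∃ j, μ i = single (s i) 1 + μ j) :
    Function.Injective fun a : ι →₀ ℕ => a.sum fun i e => e • μ i := by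
  classical
  set v : ι → ι → ℚ := fun i j => μ i (s j) with hv
  have hsp : ⊤ ≤ Submodule.span ℚ (Set.range v) := by
    rw [← (Pi.basisFun ℚ ι).span_eq, Submodule.span_le]
    rintro _ ⟨i, rfl⟩
    have hi : ∀ j, Pi.basisFun ℚ ι i j = ((single (s i) 1 : σ →₀ ℕ) (s j) : ℚ) := fun j => by
      rw [Pi.basisFun_apply, Pi.single_apply, single_apply]
      by_cases e : i = j
      · subst e; simp
      · rw [if_neg (Ne.symm e), if_neg (fun e' => e (hs e'))]; simp
    rcases h i with h | ⟨j, h⟩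
    · refine Submodule.subset_span ⟨i, funext fun j => ?_⟩
      rw [hi, ← h]
    · have : Pi.basisFun ℚ ι i = v i - v j := funext fun k => by
        rw [hi, Pi.sub_apply, hv]
        dsimp only
        rw [h, Finsupp.add_apply]
        push_cast
        ring
      rw [this]
      exact Submodule.sub_mem _ (Submodule.subset_span ⟨i, rfl⟩) (Submodule.subset_span ⟨j, rfl⟩)
  have hli := linearIndependent_of_top_le_span_of_card_eq_finrank hsp
    (by rw [Module.finrank_fintype_fun_eq_card])
  rw [Fintype.linearIndependent_iff] at hli
  intro a b hab
  ext i
  have := hli (fun i => (a i : ℚ) - b i) (funext fun j => ?_) i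
  · exact_mod_cast sub_eq_zero.1 this
  · have hsum : ∀ c : ι →₀ ℕ, (c.sum fun i e => e • μ i) (s j) = ∑ i, c i * μ i (s j) := fun c => by
      rw [Finsupp.sum_fintype c (fun i e => e • μ i) fun _ => zero_smul ℕ _, Finsupp.finsetSum_apply]
      rfl
    have e := congrArg (Nat.cast : ℕ → ℚ) (DFunLike.congr_fun hab (s j))
    rw [hsum, hsum] at e
    push_cast at e
    simp only [Finset.sum_apply, Pi.smul_apply, smul_eq_mul, sub_mul, Finset.sum_sub_distrib, hv,
      Pi.zero_apply]
    exact sub_eq_zero.2 e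

variable {n a b : ℕ}

theorem leadMon_injective {ι : Type*} {s : ι → ℕ × ℕ} (hs : Function.Injective s)
    (hg : ∀ i, s i ∈ grid n) (hab : a ≠ b) (han : a + 1 ≤ n) (hbn : b + 1 ≤ n) :
    Function.Injective fun c : ι →₀ ℕ => c.sum fun i e => e • leadMon Prod.mk n a b (s i).1 (s i).2 := by
  have key : Function.Injective fun c : grid n →₀ ℕ =>
      c.sum fun i e => e • leadMon Prod.mk n a b i.1.1 i.1.2 := by
    refine sum_nsmul_injective (s := Subtype.val) Subtype.val_injective fun ⟨⟨i, j⟩, hij⟩ => ?_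
    have hij' := hij
    simp only [grid, Finset.mem_product, Finset.mem_Icc] at hij'
    rcases leadMon_succ (pos := Prod.mk) hab han hbn hij'.1.1 hij'.2.1 hij'.1.2 hij'.2.2 with
      h | ⟨i', j', h1, h2, h3, h4, h⟩
    · exact .inl h
    · refine .inr ⟨⟨(i', j'), ?_⟩, h⟩
      simp only [grid, Finset.mem_product, Finset.mem_Icc]
      omega
  intro c c' h
  have hinj : Function.Injective fun i => (⟨s i, hg i⟩ : grid n) := fun i j e =>
    hs (congrArg Subtype.val e)
  refine mapDomain_injective hinj (key ?_)
  dsimp only at h ⊢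
  rw [sum_mapDomain_index (h := fun (i : grid n) e => e • leadMon Prod.mk n a b i.1.1 i.1.2)
      (fun _ => zero_smul ℕ _) fun _ _ _ => add_smul _ _ _,
    sum_mapDomain_index (h := fun (i : grid n) e => e • leadMon Prod.mk n a b i.1.1 i.1.2)
      (fun _ => zero_smul ℕ _) fun _ _ _ => add_smul _ _ _]
  exact h

/-! ### Base change -/

variable {A B : Type*} [CommRing A] [CommRing B] (ψ : A →+* B) (x : ℕ → ℕ → A)

theorem map_mn (i j k : ℕ) : mn (fun i j => ψ (x i j)) i j k = ψ (mn x i j k) := by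
  unfold mn
  rw [RingHom.map_det]
  rfl

theorem map_updC (a : ℕ) (y : ℕ → A) :
    updC (fun i j => ψ (x i j)) a (fun i => ψ (y i)) = fun i j => ψ (updC x a y i j) := by
  funext i j
  unfold updC
  split_ifs <;> rfl

theorem map_updR (a : ℕ) (y : ℕ → A) :
    updR (fun i j => ψ (x i j)) a (fun i => ψ (y i)) = fun i j => ψ (updR x a y i j) := by
  funext i j
  unfold updR
  split_ifs <;> rfl

theorem map_vrow (X : ℕ → ℕ → A) (r a b : ℕ) :
    vrow (fun i j => ψ (x i j)) (fun i j => ψ (X i j)) r a b = fun j => ψ (vrow x X r a b j) := by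
  funext j
  unfold vrow rowCoeff rowCoeff'
  rw [map_updR, map_mn, map_mn, map_sub, map_mul, map_mul]

theorem map_vcol (X : ℕ → ℕ → A) (c a b : ℕ) :
    vcol (fun i j => ψ (x i j)) (fun i j => ψ (X i j)) c a b = fun i => ψ (vcol x X c a b i) := by
  funext j
  unfold vcol colCoeff colCoeff'
  rw [map_updC ψ X (b + 1) fun u => X u b, map_mn, map_mn, map_sub, map_mul, map_mul]

theorem map_zrow (r c a b : ℕ) :
    zrow (fun i j => ψ (x i j)) r c a b = fun j => ψ (zrow x r c a b j) := by
  have : rowBase (fun i j => ψ (x i j)) r c a b = fun i j => ψ (rowBase x r c a b i j) := by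
    unfold rowBase
    split_ifs
    · rw [map_vcol, map_updC]
    · rfl
  unfold zrow
  rw [this, map_vrow]

theorem map_ycol (r c a b : ℕ) :
    ycol (fun i j => ψ (x i j)) r c a b = fun j => ψ (ycol x r c a b j) := by
  have : colBase (fun i j => ψ (x i j)) r c a b = fun i j => ψ (colBase x r c a b i j) := by
    unfold colBase
    split_ifs
    · rw [map_vrow, map_updR]
    · rfl
  unfold ycol
  rw [this, map_vcol]

theorem map_stageVar (r c a b e : ℕ) (p : ℕ × ℕ) :
    stageVar (fun i j => ψ (x i j)) r c a b e p = ψ (stageVar x r c a b e p) := by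
  unfold stageVar
  rw [map_ycol, map_zrow, map_updC, map_updR]
  split_ifs <;> rw [← map_mn]

end

end ExoticCluster

namespace ExoticCluster

open MvPolynomial

/-! ### The variables as polynomials -/

section

variable {n α β : ℕ}

/-- The coordinate functions, as elements of the coordinate ring of `Mat_n`. -/
noncomputable def entryRing (n i j : ℕ) : MatRing n :=
  if h : (1 ≤ i ∧ i ≤ n) ∧ (1 ≤ j ∧ j ≤ n) then X (⟨i - 1, by omega⟩, ⟨j - 1, by omega⟩) else 0

/-- The matrix of the images of the coordinate functions under a ring homomorphism. -/
noncomputable def imageMat {K : Type*} [Field K] (ψ : MatRing n →+* K) : Matrix (Fin n) (Fin n) K :=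
  (Matrix.mvPolynomialX (Fin n) (Fin n) ℂ).map ψ

theorem entry_imageMat {K : Type*} [Field K] (ψ : MatRing n →+* K) :
    entry (imageMat ψ) = fun i j => ψ (entryRing n i j) := by
  funext i j
  unfold entry entryRing imageMat
  split_ifs with h
  · rfl
  · rw [map_zero]

/-- The functions `φ_ij` as elements of the coordinate ring of `Mat_n`. -/
noncomputable def phiRing (n α β : ℕ) (p : ℕ × ℕ) : MatRing n :=
  stageVar (entryRing n) n n α β n p

theorem phi_imageMat {K : Type*} [Field K] (ψ : MatRing n →+* K) (hα : 1 ≤ α) (hαβ : α < β)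
    (hβ : β + 1 ≤ n) {p : ℕ × ℕ} (hp : p ∈ grid n) :
    phi α β (imageMat ψ) p.1 p.2 = ψ (phiRing n α β p) := by
  simp only [grid, Finset.mem_product, Finset.mem_Icc] at hp
  rw [phi_eq_stageVar _ hα hαβ hβ hp.1.1 hp.1.2 hp.2.1 hp.2.2, entry_imageMat, map_stageVar]
  rfl

/-- Embed the coordinate ring of `Mat_n` in the polynomial ring in the `x_ij` for all `i`, `j`. -/
noncomputable def shiftHom (n : ℕ) : MatRing n →ₐ[ℂ] MvPolynomial (ℕ × ℕ) ℂ :=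
  rename fun p => (p.1 + 1, p.2 + 1)

theorem shiftHom_phiRing (hα : 1 ≤ α) (hα2 : α + 1 ≤ n) (hβ : 1 ≤ β) (hβ2 : β + 1 ≤ n)
    {p : ℕ × ℕ} (hp : p ∈ grid n) : shiftHom n (phiRing n α β p) =
      stageVar (fun i j => X (i, j)) n n α β n p := by
  simp only [grid, Finset.mem_product, Finset.mem_Icc] at hp
  have h : Agree n (fun i j => shiftHom n (entryRing n i j)) fun i j => X (i, j) := by
    intro i j h1 h2 h3 h4
    dsimp only
    rw [entryRing, dif_pos ⟨⟨h1, h2⟩, h3, h4⟩, shiftHom, rename_X]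
    simp only [Nat.sub_add_cancel h1, Nat.sub_add_cancel h3]
  exact (map_stageVar (shiftHom n).toRingHom _ _ _ _ _ _ _).symm.trans
    (h.stageVar hα hα2 hβ hβ2 hp.1.1 hp.1.2 hp.2.1 hp.2.2)

/-- The weights of the coordinate functions. -/
def wtPair (n α β : ℕ) (p : ℕ × ℕ) : ℕ := wt n α β p.1 p.2

theorem lead_phi (hα : 1 ≤ α) (hαβ : α < β) (hβ : β + 1 ≤ n) {p : ℕ × ℕ} (hp : p ∈ grid n) :
    Lead (wtPair n α β) (shiftHom n (phiRing n α β p)) (leadMon Prod.mk n α β p.1 p.2) := by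
  rw [shiftHom_phiRing hα (by omega) (by omega) hβ hp]
  simp only [grid, Finset.mem_product, Finset.mem_Icc] at hp
  exact lead_stageVar (R := ℂ) (pos := Prod.mk) (fun _ _ => rfl) hαβ.ne hα (by omega) (by omega) hβ
    hp.1.2 hp.2.2

theorem phiRing_algebraicIndependent (hα : 1 ≤ α) (hαβ : α < β) (hβ : β + 1 ≤ n) :
    AlgebraicIndependent ℂ fun p : grid n => phiRing n α β p := by
  refine AlgebraicIndependent.of_comp (shiftHom n) ?_
  exact Lead.algebraicIndependent (fun p : grid n => lead_phi hα hαβ hβ p.2)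
    (leadMon_injective Subtype.val_injective (fun p => p.2) hαβ.ne (by omega) hβ)

theorem diagMon_apply_one_one {i j k : ℕ} (hi : 1 ≤ i) (h : ¬(i = 1 ∧ j = 1)) :
    diagMon Prod.mk i j k (1, 1) = 0 := by
  rw [diagMon, Finsupp.finsetSum_apply]
  refine Finset.sum_eq_zero fun u _ => ?_
  rw [Finsupp.single_apply, if_neg]
  rw [Prod.mk.injEq]
  omega

theorem leadMon_apply_one_one (hα : 1 ≤ α) (hβ : 1 ≤ β) {i j : ℕ} (hi : 1 ≤ i)
    (h : ¬(i = 1 ∧ j = 1)) : leadMon Prod.mk n α β i j (1, 1) = 0 := by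
  have h1 : ∀ k, diagMon Prod.mk 1 (β + 1) k (1, 1) = 0 := fun k =>
    diagMon_apply_one_one le_rfl (by omega)
  have h2 : ∀ k, diagMon Prod.mk (α + 1) 1 k (1, 1) = 0 := fun k =>
    diagMon_apply_one_one (by omega) (by omega)
  unfold leadMon
  rw [Finsupp.add_apply, diagMon_apply_one_one hi h, add_zero]
  split_ifs <;> simp only [Finsupp.add_apply, h1, h2, Finsupp.coe_zero, Pi.zero_apply, add_zero]

theorem phiRing_one_one (hα2 : α + 1 ≤ n) :
    phiRing n α β (1, 1) = (Matrix.mvPolynomialX (Fin n) (Fin n) ℂ).det := by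
  rw [phiRing, stageVar, if_pos (by dsimp only; omega), if_neg (by dsimp only; omega),
    Nat.add_sub_cancel, mn]
  congr 1
  ext u v : 2
  have := u.2
  have := v.2
  rw [Matrix.of_apply, entryRing, dif_pos (by omega), Matrix.mvPolynomialX_apply]
  simp

/-- The ideal is generated by `φ₁₁ - 1`, and `x₁₁` occurs in the leading monomial of `φ₁₁` but in
none of the others. -/
theorem eq_zero_of_aeval_phiRing_mem_slIdeal (hα : 1 ≤ α) (hαβ : α < β) (hβ : β + 1 ≤ n)
    {P : MvPolynomial ((grid n).erase (1, 1)) ℂ}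
    (hP : aeval (fun p : (grid n).erase (1, 1) => phiRing n α β p) P ∈ slIdeal n) : P = 0 := by
  have h11 : (1, 1) ∈ grid n := by simp only [grid, Finset.mem_product, Finset.mem_Icc]; omega
  rw [slIdeal, Ideal.mem_span_singleton, ← phiRing_one_one (α := α) (β := β) (by omega)] at hP
  have h : shiftHom n (phiRing n α β (1, 1)) - 1 ∣
      aeval (fun p : (grid n).erase (1, 1) => shiftHom n (phiRing n α β p)) P := by
    have h1 := map_dvd (shiftHom n) hP
    have h2 := DFunLike.congr_fun (comp_aeval (R := ℂ)
      (fun p : (grid n).erase (1, 1) => phiRing n α β p) (shiftHom n)) P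
    rw [map_sub, map_one] at h1
    exact h1.trans (dvd_of_eq h2)
  have hg : ∀ p : (grid n).erase (1, 1), (p : ℕ × ℕ) ∈ grid n := fun p =>
    Finset.mem_of_mem_erase p.2
  refine Lead.eq_zero_of_dvd (s := (1, 1)) (w := wtPair n α β)
    (F := fun p : (grid n).erase (1, 1) => shiftHom n (phiRing n α β p))
    (μ := fun p => leadMon Prod.mk n α β p.1.1 p.1.2) (fun p => lead_phi hα hαβ hβ (hg p))
    (leadMon_injective Subtype.val_injective hg hαβ.ne (by omega) hβ) (lead_phi hα hαβ hβ h11)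
    ?_ ?_ (fun p => ?_) h
  · rcases leadMon_succ (pos := Prod.mk) hαβ.ne (by omega) hβ le_rfl le_rfl (by omega : 1 ≤ n)
      (by omega : 1 ≤ n) with e | ⟨i', j', -, -, -, -, e⟩
    · rw [e, Finsupp.single_eq_same]
      exact one_ne_zero
    · rw [e, Finsupp.add_apply, Finsupp.single_eq_same]
      omega
  · simp only [wtPair, wt]
    omega
  · have h1 := hg p
    simp only [grid, Finset.mem_product, Finset.mem_Icc] at h1
    refine leadMon_apply_one_one hα (by omega) h1.1.1 fun e => ?_
    exact Finset.ne_of_mem_erase p.2 (Prod.ext e.1 e.2)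

/-! ### The seeds on `Mat_n` and on `SL_n` -/

theorem phi_genericMat (hα : 1 ≤ α) (hαβ : α < β) (hβ : β + 1 ≤ n) {p : ℕ × ℕ} (hp : p ∈ grid n) :
    phi α β (genericMat n) p.1 p.2 = algebraMap (MatRing n) (MatField n) (phiRing n α β p) :=
  phi_imageMat _ hα hαβ hβ hp

theorem phi_genericSL (hα : 1 ≤ α) (hαβ : α < β) (hβ : β + 1 ≤ n) {p : ℕ × ℕ} (hp : p ∈ grid n) :
    phi α β (genericSL n) p.1 p.2 =
      algebraMap (SLRing n) (SLField n) (Ideal.Quotient.mk (slIdeal n) (phiRing n α β p)) :=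
  phi_imageMat ((algebraMap (SLRing n) (SLField n)).comp (Ideal.Quotient.mk (slIdeal n)))
    hα hαβ hβ hp

theorem matrixSeed_genericMat_indep (hα : 1 ≤ α) (hαβ : α < β) (hβ : β + 1 ≤ n) :
    (matrixSeed α β (genericMat n)).Indep ℂ := by
  have h := (phiRing_algebraicIndependent hα hαβ hβ).map'
    (f := IsScalarTower.toAlgHom ℂ (MatRing n) (MatField n))
    (IsFractionRing.injective (MatRing n) (MatField n))
  change AlgebraicIndependent ℂ fun p : grid n => phi α β (genericMat n) p.1.1 p.1.2
  rw [funext fun p : grid n => phi_genericMat hα hαβ hβ p.2]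
  exact h

theorem initialSeed_indep (hα : 1 ≤ α) (hαβ : α < β) (hβ : β + 1 ≤ n) :
    (initialSeed n α β).Indep ℂ := by
  have h : AlgebraicIndependent ℂ fun p : (grid n).erase (1, 1) =>
      Ideal.Quotient.mkₐ ℂ (slIdeal n) (phiRing n α β p) := by
    rw [algebraicIndependent_iff]
    intro P hP
    refine eq_zero_of_aeval_phiRing_mem_slIdeal hα hαβ hβ ?_
    rw [← Ideal.Quotient.eq_zero_iff_mem]
    have := comp_aeval (R := ℂ) (fun p : (grid n).erase (1, 1) => phiRing n α β p)
      (Ideal.Quotient.mkₐ ℂ (slIdeal n))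
    rw [← hP]
    exact DFunLike.congr_fun this P
  have h2 := h.map' (f := IsScalarTower.toAlgHom ℂ (SLRing n) (SLField n))
    (IsFractionRing.injective (SLRing n) (SLField n))
  change AlgebraicIndependent ℂ fun p : (grid n).erase (1, 1) =>
    phi α β (genericSL n) p.1.1 p.1.2
  rw [funext fun p : (grid n).erase (1, 1) =>
    phi_genericSL hα hαβ hβ (Finset.mem_of_mem_erase p.2)]
  exact h2

theorem Seed.Indep.int {V K : Type*} [DecidableEq V] [Field K] [Algebra ℂ K] {s : Seed V K}
    (h : s.Indep ℂ) : s.Indep ℤ :=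
  AlgebraicIndependent.restrictScalars (FaithfulSMul.algebraMap_injective ℤ ℂ) h

theorem matrixSeed_genericMat_good (hα : 1 ≤ α) (hαβ : α < β) (hβ : β + 2 ≤ n) :
    (matrixSeed α β (genericMat n)).Good ℂ :=
  ⟨matrixSeed_skew _, matrixSeed_genericMat_indep hα hαβ (by omega), matrixSeed_fullRank _ hα hαβ hβ⟩

theorem initialSeed_good (hα : 1 ≤ α) (hαβ : α < β) (hβ : β + 2 ≤ n) :
    (initialSeed n α β).Good ℂ :=
  ⟨matrixSeed_skew (α := α) (β := β) (genericSL n), initialSeed_indep hα hαβ (by omega),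
    matrixSeed_remove_fullRank _ hα hαβ hβ⟩

theorem Seed.Good.int {V K : Type*} [DecidableEq V] [Field K] [Algebra ℂ K] {s : Seed V K}
    (h : s.Good ℂ) : s.Good ℤ := ⟨h.skew, h.indep.int, h.rank⟩

end

end ExoticCluster

namespace ExoticCluster

open MvPolynomial

/-! ### The embeddings of fields -/

section

variable {K L : Type*} [Field K] [Field L] {n α β : ℕ}

theorem entry_map (θ : K →+* L) (X : Matrix (Fin n) (Fin n) K) (i j : ℕ) :
    entry (X.map θ) i j = θ (entry X i j) := by
  unfold entry
  split_ifs
  · rfl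
  · rw [map_zero]

theorem block_map (θ : K →+* L) (N : ℕ) (X : Matrix (Fin n) (Fin n) K) (i₁ i₂ j₁ j₂ r₀ c₀ : ℕ) :
    block N (X.map θ) i₁ i₂ j₁ j₂ r₀ c₀ = θ.mapMatrix (block N X i₁ i₂ j₁ j₂ r₀ c₀) := by
  ext u v
  simp only [block, Matrix.of_apply, RingHom.mapMatrix_apply, Matrix.map_apply, entry_map]
  split_ifs
  · rfl
  · rw [map_zero]

theorem phi_map (θ : K →+* L) (X : Matrix (Fin n) (Fin n) K) (i j : ℕ) :
    phi α β (X.map θ) i j = θ (phi α β X i j) := by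
  unfold phi fCol fRow f
  simp only [block_map, ← map_add, ← RingHom.map_det]
  split_ifs <;> rfl

theorem matrixSeed_map (θ : K →+* L) (X : Matrix (Fin n) (Fin n) K) :
    (matrixSeed α β X).map θ = matrixSeed α β (X.map θ) := by
  unfold matrixSeed Seed.map
  simp only [phi_map]

/-- The inclusion of the coordinate ring of `Mat_{n-1}` in that of `Mat_n`. -/
noncomputable def leadingHom (n : ℕ) : MatRing (n - 1) →ₐ[ℂ] MatRing n :=
  rename (Prod.map (Fin.castLE (Nat.sub_le n 1)) (Fin.castLE (Nat.sub_le n 1)))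

theorem leadingHom_injective (n : ℕ) : Function.Injective (leadingHom n) :=
  rename_injective _ ((Fin.castLE_injective _).prodMap (Fin.castLE_injective _))

theorem mn_entry (X : Matrix (Fin n) (Fin n) K) : mn (entry X) 1 1 n = X.det := by
  rw [mn]
  congr 1
  ext u v : 2
  have := u.2
  have := v.2
  rw [Matrix.of_apply, entry, dif_pos (by omega)]
  congr <;> omega

/-- The entries of the matrix of determinant `1` with the blocks `Y` and `1 / det Y`. -/
noncomputable def extendEntry (n i j : ℕ) : MatField (n - 1) :=
  if i = n ∧ j = n then (genericMat (n - 1)).det⁻¹ else entry (genericMat (n - 1)) i j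

theorem mn_extendEntry (hn : 1 ≤ n) : mn (extendEntry n) 1 1 n = 1 := by
  have h := mn_eq_mul_of_zero_lower (extendEntry n) (i := 1) (j := 1) (k := n - 1) (m := 1)
    fun u hu v hv => by
      rw [extendEntry, if_neg (by omega), entry, dif_neg (by omega)]
  rw [Nat.sub_add_cancel hn] at h
  rw [h, show mn (extendEntry n) 1 1 (n - 1) = (genericMat (n - 1)).det by
    rw [← mn_entry]
    exact mn_congr fun u _ v _ => if_neg (by omega), mn, Matrix.det_fin_one, Matrix.of_apply,
    extendEntry, if_pos (by simp only [Fin.val_zero]; omega)]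
  exact mul_inv_cancel₀ (genericMat_det_ne_zero _)

/-- Evaluation at the matrix with the blocks `Y` and `1 / det Y`. -/
noncomputable def extendHom (n : ℕ) : MatRing n →ₐ[ℂ] MatField (n - 1) :=
  aeval fun p => extendEntry n (1 + p.1) (1 + p.2)

/-- Every invertible matrix of size `n - 1` is the leading submatrix of one of determinant `1`. So
no nonzero polynomial in the leading entries vanishes on `SL_n`. -/
theorem extendHom_leadingHom (p : MatRing (n - 1)) :
    extendHom n (leadingHom n p) = algebraMap (MatRing (n - 1)) (MatField (n - 1)) p := by
  have h : (extendHom n).comp (leadingHom n) =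
      IsScalarTower.toAlgHom ℂ (MatRing (n - 1)) (MatField (n - 1)) := by
    ext ⟨i, j⟩
    have := i.2
    have := j.2
    rw [AlgHom.comp_apply, leadingHom, rename_X, extendHom, aeval_X, extendEntry]
    simp only [Prod.map_apply, Fin.val_castLE]
    rw [if_neg (by omega), entry, dif_pos (by omega)]
    simp [genericMat]
  exact DFunLike.congr_fun h p

theorem slIdeal_le_ker_extendHom (hn : 1 ≤ n) {p : MatRing n} (hp : p ∈ slIdeal n) :
    extendHom n p = 0 := by
  rw [slIdeal, Ideal.mem_span_singleton] at hp
  obtain ⟨q, rfl⟩ := hp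
  have : extendHom n (Matrix.mvPolynomialX (Fin n) (Fin n) ℂ).det = 1 := by
    rw [AlgHom.map_det, ← mn_extendEntry hn, mn]
    congr 1
    ext i j
    simp [extendHom]
  rw [map_mul, map_sub, map_one, this, sub_self, zero_mul]

theorem exists_algHom_of_injective {K : Type*} [Field K] [Algebra ℂ K] {n : ℕ}
    (g : MatRing n →ₐ[ℂ] K) (hg : Function.Injective g) :
    ∃ θ : MatField n →ₐ[ℂ] K, ∀ p, θ (algebraMap (MatRing n) (MatField n) p) = g p :=
  ⟨IsFractionRing.liftAlgHom (K := MatField n) hg, fun p => IsFractionRing.lift_algebraMap hg p⟩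

/-- The composite with the evaluation `extendHom` is the inclusion into the field of fractions.
Hence the map from the polynomial ring is injective and extends to the field of fractions. -/
theorem exists_algHom_SLField (hn : 1 ≤ n) : ∃ θ : MatField (n - 1) →ₐ[ℂ] SLField n,
    ∀ i j, θ (genericMat (n - 1) i j) = leading (genericSL n) i j := by
  obtain ⟨θ, hθ⟩ := exists_algHom_of_injective
    (((IsScalarTower.toAlgHom ℂ (SLRing n) (SLField n)).comp
      (Ideal.Quotient.mkₐ ℂ (slIdeal n))).comp (leadingHom n)) (by
    rw [injective_iff_map_eq_zero]
    intro p hp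
    have h1 : Ideal.Quotient.mk (slIdeal n) (leadingHom n p) = 0 :=
      IsFractionRing.injective (SLRing n) (SLField n) (hp.trans (map_zero _).symm)
    have h2 := slIdeal_le_ker_extendHom hn (Ideal.Quotient.eq_zero_iff_mem.1 h1)
    rw [extendHom_leadingHom] at h2
    exact IsFractionRing.injective (MatRing (n - 1)) (MatField (n - 1)) (h2.trans (map_zero _).symm))
  refine ⟨θ, fun i j => (hθ (X (i, j))).trans ?_⟩
  change algebraMap (SLRing n) (SLField n) (Ideal.Quotient.mk (slIdeal n) (leadingHom n (X (i, j)))) = _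
  rw [leadingHom, rename_X]
  rfl

theorem exists_algHom_MatField (n : ℕ) : ∃ θ : MatField (n - 1) →ₐ[ℂ] MatField n,
    ∀ i j, θ (genericMat (n - 1) i j) = leading (genericMat n) i j := by
  obtain ⟨θ, hθ⟩ := exists_algHom_of_injective
    ((IsScalarTower.toAlgHom ℂ (MatRing n) (MatField n)).comp (leadingHom n))
    ((IsFractionRing.injective (MatRing n) (MatField n)).comp (leadingHom_injective n))
  refine ⟨θ, fun i j => (hθ (X (i, j))).trans ?_⟩
  change algebraMap (MatRing n) (MatField n) (leadingHom n (X (i, j))) = _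
  rw [leadingHom, rename_X]
  rfl

end

end ExoticCluster

namespace ExoticCluster

/-! ### Removing the last row and column from the initial seed -/

section

variable {V K : Type*} [DecidableEq V] [Field K]

theorem Seed.mutateList_var_of_notMem (s : Seed V K) {l : List V} {v : V} (hv : v ∉ l) :
    (s.mutateList l).var v = s.var v := by
  induction l generalizing s with
  | nil => rfl
  | cons k l ih =>
    rw [List.mem_cons, not_or] at hv
    exact (ih (s.mutate k) hv.2).trans (s.mutate_var_of_ne hv.1)

theorem Seed.Good.nonVanishing {R : Type*} [CommRing R] [IsDomain R] [CharZero R] [Algebra R K]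
    [FaithfulSMul R K] {s : Seed V K} (h : s.Good R) : s.NonVanishing := fun l hl v hv =>
  ((s.mutEquiv_mutateList hl).good h).indep.var_ne_zero (by rwa [Seed.mutateList_verts])

/-- Restoring a removed frozen vertex with the variable `1`. -/
theorem Seed.NonVanishing.of_remove {s : Seed V K} {v₀ : V} (h : (s.remove v₀).NonVanishing)
    (h1 : s.var v₀ = 1) (hf : v₀ ∈ s.frozen) : s.NonVanishing := by
  rw [Seed.remove_eq_keep] at h
  intro l hl v hv
  have hl' : ∀ k ∈ l, k ≠ v₀ := fun k hk e => by
    have := hl k hk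
    rw [e, Seed.exchangeable, Finset.mem_sdiff] at this
    exact this.2 hf
  by_cases e : v = v₀
  · rw [e, s.mutateList_var_of_notMem fun hm => hl' _ hm rfl, h1]
    exact one_ne_zero
  · have := h l (fun k hk => by
      have h2 := hl k hk
      simp only [Seed.exchangeable, Seed.keep, Finset.mem_sdiff, Finset.mem_filter] at h2 ⊢
      exact ⟨⟨h2.1, hl' k hk⟩, fun h3 => h2.2 h3.1⟩) v (Finset.mem_filter.2 ⟨hv, e⟩)
    rwa [Seed.keep_mutateList s _ hl' fun w _ hw => by rw [not_not.1 hw, h1]] at this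

end

section

variable {K : Type*} [Field K] {n α β : ℕ}

theorem one_one_mem_frozen (X : Matrix (Fin n) (Fin n) K) (hα : 1 ≤ α) (hβ : 1 ≤ β) (hn : 1 ≤ n) :
    (1, 1) ∈ (matrixSeed α β X).frozen := by
  rw [mem_matrixSeed_frozen]
  refine ⟨by simp only [grid, Finset.mem_product, Finset.mem_Icc]; omega, ?_⟩
  simp only [IsStable, true_or, Ne, Prod.mk.injEq, true_and, and_true]
  omega

theorem initialSeed_var_one_one (hα : 1 ≤ α) (hαβ : α < β) (hβ : β + 1 ≤ n) :
    (matrixSeed α β (genericSL n)).var (1, 1) = 1 := by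
  change phi α β (genericSL n) 1 1 = 1
  have h := phi_genericSL (n := n) hα hαβ hβ (p := (1, 1))
    (by simp only [grid, Finset.mem_product, Finset.mem_Icc]; omega)
  rw [phiRing_one_one (by omega), (Ideal.Quotient.eq (I := slIdeal n)).2
    (Ideal.subset_span (Set.mem_singleton _)), map_one, map_one] at h
  exact h

/-- A seed from which the seed for the leading submatrix arises has the larger upper cluster
algebra. -/
theorem upper_leading_le (R : Type*) [CommRing R] [IsDomain R] [CharZero R]
    [UniqueFactorizationMonoid R] [Algebra R K] [FaithfulSMul R K] {s : Seed (ℕ × ℕ) K}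
    (hs : s.Good R) {l : List (ℕ × ℕ)} (hl : ∀ v ∈ l, v ∈ s.exchangeable) {pos : ℕ × ℕ → ℕ × ℕ}
    {X : Matrix (Fin n) (Fin n) K} (hα : 1 ≤ α) (hαβ : α < β) (hβ : β + 2 ≤ n)
    (hS : Stage (s.mutateList l) pos (entry X) (n - 1) (n - 1) α β (n - 1)) :
    (matrixSeed α β (leading X)).upper R ≤ s.upper R := by
  have hm := s.mutEquiv_mutateList hl
  exact ((Seed.IsIso.upper_le R (hS.isIso (agree_leading X) hα hαβ (by omega))).trans
    (hS.removeIsolated_upper_le R hα hαβ (by omega))).trans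
      ((Seed.upper_freeze_le (hm.good hs) _).trans (hm.upper_le hs))

/-- The structure of a `ℤ`-algebra is left arbitrary and then identified with the canonical one,
because it may be found in several ways for the fields in question. -/
theorem upper_leading_le_int [Algebra ℂ K] [Algebra ℤ K] {s : Seed (ℕ × ℕ) K} (hs : s.Good ℂ)
    {l : List (ℕ × ℕ)} (hl : ∀ v ∈ l, v ∈ s.exchangeable) {pos : ℕ × ℕ → ℕ × ℕ}
    {X : Matrix (Fin n) (Fin n) K} (hα : 1 ≤ α) (hαβ : α < β) (hβ : β + 2 ≤ n)
    (hS : Stage (s.mutateList l) pos (entry X) (n - 1) (n - 1) α β (n - 1)) :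
    (matrixSeed α β (leading X)).upper ℤ ≤ s.upper ℤ := by
  obtain rfl : ‹Algebra ℤ K› = Ring.toIntAlgebra K := Subsingleton.elim _ _
  have : CharZero K := charZero_of_injective_algebraMap (algebraMap ℂ K).injective
  exact upper_leading_le ℤ hs.int hl hα hαβ hβ hS

theorem map_mem_upper_of_le {R M : Type*} [CommRing R] [Field M] [Algebra R K] [Algebra R M]
    (θ : M →ₐ[R] K) {Y : Matrix (Fin n) (Fin n) M} {X : Matrix (Fin n) (Fin n) K}
    (hθ : ∀ i j, θ (Y i j) = X i j) {s : Seed (ℕ × ℕ) K}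
    (h : (matrixSeed α β X).upper R ≤ s.upper R) :
    ∀ g ∈ (matrixSeed α β Y).upper R, θ g ∈ s.upper R := by
  intro g hg
  have h1 := Seed.map_mem_upper θ _ hg
  rw [matrixSeed_map, show Y.map (θ : M →+* K) = X from Matrix.ext hθ] at h1
  exact h h1

theorem map_mem_upper_int_of_le {M : Type*} [Field M] [Algebra ℤ K] [Algebra ℤ M]
    (θ : M →+* K) {Y : Matrix (Fin n) (Fin n) M} {X : Matrix (Fin n) (Fin n) K}
    (hθ : ∀ i j, θ (Y i j) = X i j) {s : Seed (ℕ × ℕ) K}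
    (h : (matrixSeed α β X).upper ℤ ≤ s.upper ℤ) :
    ∀ g ∈ (matrixSeed α β Y).upper ℤ, θ g ∈ s.upper ℤ :=
  map_mem_upper_of_le (AlgHom.mk θ fun r => by simp : M →ₐ[ℤ] K) hθ h

/-- The functions for size `n - 1` are transcendental over `ℂ`. It follows that the vertex `(1, 1)`,
which carries `1` on `SL_n`, does not stand on a position in use after `S`. -/
theorem phi_leading_ne_one [Algebra ℂ K] {X : Matrix (Fin n) (Fin n) K}
    (θ : MatField (n - 1) →ₐ[ℂ] K) (hθ : ∀ i j, θ (genericMat (n - 1) i j) = leading X i j)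
    (hα : 1 ≤ α) (hαβ : α < β) (hβ : β + 2 ≤ n) {q : ℕ × ℕ} (hq : q ∈ grid (n - 1)) :
    phi α β (leading X) q.1 q.2 ≠ 1 := by
  have h := (matrixSeed_genericMat_indep (n := n - 1) hα hαβ (by omega)).transcendental ⟨q, hq⟩
  rw [show leading X = (genericMat (n - 1)).map ((θ : MatField (n - 1) →+* K)) from
    Matrix.ext fun i j => (hθ i j).symm, phi_map]
  intro e
  have e' : phi α β (genericMat (n - 1)) q.1 q.2 = 1 :=
    (θ : MatField (n - 1) →+* K).injective (e.trans (map_one _).symm)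
  refine h ?_
  change IsAlgebraic ℂ (phi α β (genericMat (n - 1)) q.1 q.2)
  rw [e']
  exact isAlgebraic_one

/-- The mutation sequence, applied to the initial seed on `SL_n`. -/
theorem initialSeed_apply_S (hα : 1 ≤ α) (hαβ : α < β) (hβ : β + 2 ≤ n) :
    (∀ v ∈ S n α β, v ∈ (initialSeed n α β).exchangeable) ∧
    Stage ((initialSeed n α β).mutateList (S n α β)) (finalPos n α β) (entry (genericSL n))
      (n - 1) (n - 1) α β (n - 1) := by
  have h1 := initialSeed_var_one_one (n := n) hα hαβ (by omega)
  have hf := one_one_mem_frozen (genericSL n) hα (by omega : 1 ≤ β) (by omega)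
  obtain ⟨hS1, hS2⟩ := Stage.apply_S hα hαβ hβ (stage_matrixSeed (genericSL n) hα hαβ (by omega)
    ((initialSeed_good hα hαβ hβ).nonVanishing.of_remove h1 hf))
  have hne : ∀ v ∈ S n α β, v ≠ (1, 1) := fun v hv e => by
    have := hS1 v hv
    rw [e, Seed.exchangeable, Finset.mem_sdiff] at this
    exact this.2 hf
  obtain ⟨θ, hθ⟩ := exists_algHom_SLField (n := n) (by omega)
  have hvar := (matrixSeed α β (genericSL n)).mutateList_var_of_notMem (l := S n α β)
    fun hm => hne (1, 1) hm rfl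
  have e : initialSeed n α β = (matrixSeed α β (genericSL n)).keep (· ≠ (1, 1)) :=
    Seed.remove_eq_keep _ _
  refine ⟨fun v hv => ?_, ?_⟩
  · have h2 := hS1 v hv
    rw [e]
    simp only [Seed.exchangeable, Seed.keep, Finset.mem_sdiff, Finset.mem_filter] at h2 ⊢
    exact ⟨⟨h2.1, hne v hv⟩, fun h3 => h2.2 h3.1⟩
  · rw [e, Seed.keep_mutateList _ _ hne fun w _ hw => by rw [not_not.1 hw, h1]]
    -- No mutation takes place at `(1, 1)`, so it still carries `1`. If it stood on the position
    -- `q`, then `φ` at `q` for the leading submatrix would be `1`.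
    refine hS2.keep _ (fun q hq hq1 => ?_) fun w _ hw => by rw [not_not.1 hw, hvar, h1]
    have hq' := (act_iff_mem_grid (n - 1) q).1 hq
    refine phi_leading_ne_one θ hθ hα hαβ hβ hq' ?_
    rw [phi_eq_stageVar _ hα hαβ (by omega) hq.1 hq.2.1 hq.2.2.1 hq.2.2.2.1,
      ← (agree_leading (genericSL n)).stageVar hα (by omega) (by omega) (by omega) hq.1 hq.2.1
        hq.2.2.1 hq.2.2.2.1]
    exact (hS2.var q hq).symm.trans (by rw [hq1, hvar, h1])

end

end ExoticCluster

theorem mainTheorem3 (n α β : ℕ) (hα : 1 ≤ α) (hαβ : α < β) (hβ : β ≤ n - 1) (hβn : β ≠ n - 1) :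
    -- `S` consists of mutations at mutable vertices
    (∀ v ∈ ExoticCluster.S n α β, v ∈ (ExoticCluster.initialSeed n α β).exchangeable) ∧
    -- after freezing and removing isolated vertices, `S` leads to the seed for `n - 1`
    (∃ F ⊆ (ExoticCluster.initialSeed n α β).exchangeable, ∃ ι : ℕ × ℕ → ℕ × ℕ,
      ExoticCluster.Seed.IsIso ι
        (ExoticCluster.matrixSeed α β (ExoticCluster.leading (ExoticCluster.genericSL n)))
        ((((ExoticCluster.initialSeed n α β).mutateList
          (ExoticCluster.S n α β)).freeze F).removeIsolated)) ∧
    -- the upper cluster algebra for `n - 1` embeds in the one for `n`, on `SL_n`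
    (∃ θ : ExoticCluster.MatField (n - 1) →ₐ[ℂ] ExoticCluster.SLField n,
      (∀ i j, θ (ExoticCluster.genericMat (n - 1) i j) =
        ExoticCluster.leading (ExoticCluster.genericSL n) i j) ∧
      (∀ g ∈ (ExoticCluster.matrixSeed α β (ExoticCluster.genericMat (n - 1))).upper ℂ,
        θ g ∈ (ExoticCluster.initialSeed n α β).upper ℂ) ∧
      (∀ g ∈ (ExoticCluster.matrixSeed α β (ExoticCluster.genericMat (n - 1))).upper ℤ,
        θ g ∈ (ExoticCluster.initialSeed n α β).upper ℤ)) ∧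
    -- the same with the determinants as stable variables, on `Mat_n`
    (∃ θ : ExoticCluster.MatField (n - 1) →ₐ[ℂ] ExoticCluster.MatField n,
      (∀ i j, θ (ExoticCluster.genericMat (n - 1) i j) =
        ExoticCluster.leading (ExoticCluster.genericMat n) i j) ∧
      (∀ g ∈ (ExoticCluster.matrixSeed α β (ExoticCluster.genericMat (n - 1))).upper ℂ,
        θ g ∈ (ExoticCluster.matrixSeed α β (ExoticCluster.genericMat n)).upper ℂ) ∧
      (∀ g ∈ (ExoticCluster.matrixSeed α β (ExoticCluster.genericMat (n - 1))).upper ℤ,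
        θ g ∈ (ExoticCluster.matrixSeed α β (ExoticCluster.genericMat n)).upper ℤ)) := by
  have hβ2 : β + 2 ≤ n := by omega
  obtain ⟨hS, hstage⟩ := ExoticCluster.initialSeed_apply_S hα hαβ hβ2
  have hgood := ExoticCluster.initialSeed_good (n := n) hα hαβ hβ2
  refine ⟨hS, ⟨ExoticCluster.freezeSet ((ExoticCluster.initialSeed n α β).mutateList
    (ExoticCluster.S n α β)) (ExoticCluster.finalPos n α β) (n - 1) α β, ?_,
    ExoticCluster.finalPos n α β, ?_⟩, ?_, ?_⟩
  · refine Finset.sdiff_subset.trans_eq ?_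
    rw [ExoticCluster.Seed.exchangeable, ExoticCluster.Seed.mutateList_verts,
      ExoticCluster.Seed.mutateList_frozen, ExoticCluster.Seed.exchangeable]
  · exact hstage.isIso (ExoticCluster.agree_leading _) hα hαβ (by omega)
  · obtain ⟨θ, hθ⟩ := ExoticCluster.exists_algHom_SLField (n := n) (by omega)
    refine ⟨θ, hθ, ?_, ?_⟩
    · exact ExoticCluster.map_mem_upper_of_le θ hθ
        (ExoticCluster.upper_leading_le ℂ hgood hS hα hαβ hβ2 hstage)
    · exact ExoticCluster.map_mem_upper_int_of_le θ.toRingHom hθ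
        (ExoticCluster.upper_leading_le_int hgood hS hα hαβ hβ2 hstage)
  · obtain ⟨θ, hθ⟩ := ExoticCluster.exists_algHom_MatField n
    have hgood := ExoticCluster.matrixSeed_genericMat_good (n := n) hα hαβ hβ2
    obtain ⟨hS, hstage⟩ := ExoticCluster.Stage.apply_S hα hαβ hβ2 (ExoticCluster.stage_matrixSeed
      (ExoticCluster.genericMat n) hα hαβ (by omega) hgood.nonVanishing)
    refine ⟨θ, hθ, ?_, ?_⟩
    · exact ExoticCluster.map_mem_upper_of_le θ hθ
        (ExoticCluster.upper_leading_le ℂ hgood hS hα hαβ hβ2 hstage)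
    · exact ExoticCluster.map_mem_upper_int_of_le θ.toRingHom hθ
        (ExoticCluster.upper_leading_le_int hgood hS hα hαβ hβ2 hstage)
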